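/- **Notation.** For a partition $\lambda$ let $l(\lambda)$ be its number of parts and $|\lambda|$ its sum. Write uniquely $\lambda=(\lambda_e,\lambda_{o,o},\lambda_{o,o},\lambda_o)$, where $\lambda_e$ consists of the even parts, all parts of $\lambda_{o,o}$ and $\lambda_o$ are odd, and $\lambda_o$ has no repeated entries. For $g\ge 0$ and partitions $\lambda,\mu$ of $n\ge1$ put $r=l(\lambda)+l(\mu)+2g-2$. A *factorization* of type $(g,\lambda,\mu)$ is a tuple $(\sigma_1,\tau_1,\dots,\tau_r,\sigma_2)$ in $S_n$ with $\sigma_2\tau_r\cdots\tau_1\sigma_1=\mathrm{id}$, where $\sigma_1,\sigma_2$ have cycle types $\lambda,\mu$, the $\tau_i$ are transpositions, and $\sigma_1,\sigma_2,\tau_1,\dots,\tau_r$ generate a transitive subgroup. Their number is the complex double Hurwitz number $H^{\mathbb C}_g(\lambda,\mu)$ (covers with labelled sheets). For signs $S=(s_1,\dots,s_r)\in\{\pm1\}^r$, put $P_i=\tau_i\cdots\tau_1\sigma_1$, $s_0=+1$; a *real factorization* of type $(g,\lambda,\mu;S)$ is a factorization with a $\gamma\in S_n$ such that $\gamma^2=\mathrm{id}$,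 $\gamma\sigma_1\gamma=\sigma_1^{-1}$ and $\gamma_iP_i\gamma_i=P_i^{-1}$ for $1\le i\le r$, where $\gamma_0=\gamma$ and $\gamma_{j+1}=\gamma_j$ if $s_{j+1}=s_j$, $\gamma_{j+1}=\gamma_jP_j$ otherwise. Write $\tau_i=(a_i,b_i)$, $a_i<b_i$; the real factorization is *$k$-mixed* if $b_i\le b_{i+1}$ for $1\le i\le k-1$. Let $\vec H^{\mathbb R}_g(\lambda,\mu;S,k)$ be the number of real $k$-mixed factorizations and $\vec{\mathcal H}^{\mathbb R}_g(\lambda,\mu;k)=\min_S\vec H^{\mathbb R}_g(\lambda,\mu;S,k)$ the *real $k$-mixed double Hurwitz number*. **Tropical covers.** Fix $\underline x=\{x_1<\dots<x_r\}\subset\mathbb R$. A tropical cover $\varphi:C\to T\mathbb P^1=\mathbb R\cup\{\pm\infty\}$ of type $(g,\lambda,\mu,\underline x)$ is a connected graph $C$ of genus $g$ with one 3-valent inner vertex over each $x_i$, whose edges map homeomorphically onto intervals and carry positive integer weights, balanced at every inner vertex, the ends over $-\infty$ (in-ends) having weights $\lambda$ and those over $+\infty$ (out-ends) weights $\mu$;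 covers are taken up to isomorphism. A symmetric cycle (fork) is a pair of inner edges (ends) of equal weight with the same inner vertices. A *colouring* is a choice of a set $I$ of symmetric cycles and forks (dotted) and a colour red or blue for each component of the subgraph of even edges not in $I$. A vertex is positive if the edges at it are, on one side and on the other (up to reflection): odd / odd, blue; blue / blue, blue; red / odd, odd; or blue / two dotted; negative: the same with red and blue exchanged. A real factorization of type $(g,\lambda,\mu;S)$ produces a coloured tropical cover: the edges are the cycles of $P_0=\sigma_1,P_1,\dots,P_r$, weighted by their lengths, cut and joined at $x_i$ by $\tau_i$; cycles of $P_i$ exchanged by $\gamma_i$ are dotted; an inverted even cycle is red if ($\gamma_i$ has a fixed point on it and $s_i=+1$) or (it has none and $s_i=-1$), and blue otherwise. **Zigzag covers.** A string is a connected subgraph that is a closed 1-dimensional submanifold away from the leaves. A zigzag cover with string $S$ is a tropical cover such that $S$ consists of odd edges, contains no edge of a symmetric cycle or fork, and each component of $C\setminus S$ (a *tail*) is a chain starting at a vertex of $S$ with edges of one even weight $w$ (the weight of the tail) alternating with symmetric cycles (possibly none) of odd weight $w/2$, and ending either in an end of weight $w$ or in a symmetric fork of odd weight $w/2$. It is an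 in-tail or out-tail according to its end. For each $S\in\{\pm1\}^r$ a zigzag cover has a unique colouring whose positive vertices are those over the $x_i$ with $s_i=+1$. Let the string have two ends, list its pieces between bent vertices (where it turns) in order from one of its ends; pieces number $1,3,\dots$ are in-pieces and the others out-pieces if the first piece contains an in-end of the string, and conversely if it contains an out-end. An in-component is an in-piece (including its bent vertices) with all tails attached to it; an out-component is an out-piece without its bent vertices, with the tails attached to its unbent vertices. The cover is *universally monotone* if, for some such string and listing: (1) tails at unbent vertices of in-pieces are out-tails, and of out-pieces in-tails; such tails contain no symmetric cycle, and such out-tails no symmetric fork; (2) a tail at a bent vertex that contains a symmetric cycle or fork has weight 2; (3) the smallest intervals containing the images of the inner vertices (including the vertex of attachment) of two different tails are disjoint, and likewise for two different components; (4) at most one out-tail is attached to the unbent vertices of each in-piece. A zigzag cover with string $S$ is *$k$-mixed* if the smallest subgraph $C'$ with the inner vertices over $x_1,\dots,x_k$ has no other inner vertices, the restriction of $\varphi$ to $C'$ (edges leaving $C'$ being made ends) is a universally monotone zigzag cover, and $S\setminus C'$ is connected or empty. The *$k$-mixed zigzag number* is $$\vec{\mathcal Z}_g(\lambda,\mu;k)=\sum_{\varphi}\min_{S}\vec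 N_k(\varphi,S),$$ summed over the $k$-mixed zigzag covers of type $(g,\lambda,\mu,\underline x)$, where $\vec N_k(\varphi,S)$ is the number of real $k$-mixed factorizations of type $(g,\lambda,\mu;S,k)$ that produce $\varphi$ with its colouring determined by $S$. **Statement.** Let $g\ge0$, let $\lambda,\mu$ be partitions of $d$ with $l(\lambda_o)=l(\mu_o)=1$, and suppose that there are partitions $\lambda',\mu'$ with $|\lambda'|=|\mu'|\le d$ such that * $\lambda'_o=\lambda_o$, $\lambda'\setminus\lambda'_o\subset\lambda_e$ and $\mu'\setminus\mu'_o\subset\mu_e$; * $\lambda'_{o,o}=\mu'_{o,o}=\emptyset$, $l(\lambda'_o)=l(\mu'_o)=1$ and $l(\lambda')+l(\mu')=k+2$; * $\mu'_i+\mu'_j>\max(\lambda_o,\lambda'_{\max})$ for any two entries ($i\neq j$) of $\mu'_e$, and $\lambda'_{\max}>\mu'_o$, where $\lambda'_{\max}$ is the maximal entry of $\lambda'_e$. Then, as $m\to\infty$, $$\log\vec{\mathcal Z}_g\big((\lambda,1^{2m}),(\mu,1^{2m});k\big)\sim 6m\log m\sim\log H^{\mathbb C}_g\big((\lambda,1^{2m}),(\mu,1^{2m})\big).$$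 Hence the real $k$-mixed double Hurwitz numbers are logarithmically equivalent to the complex double Hurwitz numbers: $$\log\vec{\mathcal H}^{\mathbb R}_g\big((\lambda,1^{2m}),(\mu,1^{2m});k\big)\sim\log H^{\mathbb C}_g\big((\lambda,1^{2m}),(\mu,1^{2m})\big),$$ and likewise $\log\vec H^{\mathbb R}_g\big((\lambda,1^{2m}),(\mu,1^{2m});S_m,k\big)\sim\log H^{\mathbb C}_g\big((\lambda,1^{2m}),(\mu,1^{2m})\big)$ for every choice of sign sequences $S_m$. -/

import Mathlib

open Equiv

namespace MixedHurwitz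

/-! ### Partitions -/

/-- The even parts `lam_e` of a partition (a partition is given by the multiset of its parts). -/
def evenPart (a : Multiset ℕ) : Multiset ℕ := a.filter fun x => Even x

/-- The part `lam_o` of the tail decomposition `lam = (lam_e, lam_{o,o}, lam_{o,o}, lam_o)`: every odd
integer that occurs an odd number of times, taken once. -/
def oddPart (a : Multiset ℕ) : Multiset ℕ :=
  (a.toFinset.filter fun x => Odd x ∧ Odd (a.count x)).val

/-- The part `lam_{o,o}` of the tail decomposition: an odd integer that occurs `c` times in the
partition occurs `⌊c / 2⌋` times here. -/
def pairPart (a : Multiset ℕ) : Multiset ℕ :=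
  ∑ x ∈ a.toFinset.filter (fun x => Odd x), Multiset.replicate (a.count x / 2) x

/-- The partition `(lam, 1^j)`. -/
def addOnes {d : ℕ} (lam : d.Partition) (j : ℕ) : (d + j).Partition where
  parts := lam.parts + Multiset.replicate j 1
  parts_pos := by
    intro i hi
    rcases Multiset.mem_add.1 hi with h | h
    · exact lam.parts_pos h
    · rw [Multiset.eq_of_mem_replicate h]; exact Nat.one_pos
  parts_sum := by simp [lam.parts_sum]

/-- The number `r = l(lam) + l(mu) + 2 g - 2` of simple branch points. -/
def numBranch (g : ℕ) {n : ℕ} (lam mu : n.Partition) : ℕ :=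
  lam.parts.card + mu.parts.card + 2 * g - 2

/-! ### Factorizations in the symmetric group -/

/-- A tuple `(σ₁, τ₁, …, τ_r, σ₂)`; the transposition `τ_i` is `τ ⟨i - 1, _⟩`. -/
structure PermTuple (n r : ℕ) where
  σ₁ : Perm (Fin n)
  τ : Fin r → Perm (Fin n)
  σ₂ : Perm (Fin n)

/-- A tuple `(γ, σ₁, τ₁, …, τ_r, σ₂)`. -/
structure RealTuple (n r : ℕ) extends PermTuple n r where
  γ : Perm (Fin n)

/-- `partialProd T i = τ_i ∘ ⋯ ∘ τ_1 ∘ σ₁` for `0 ≤ i ≤ r`. -/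
def PermTuple.partialProd {n r : ℕ} (T : PermTuple n r) : ℕ → Perm (Fin n)
  | 0 => T.σ₁
  | i + 1 => if h : i < r then T.τ ⟨i, h⟩ * T.partialProd i else T.partialProd i

/-- Factorizations of type `(g, lam, mu)`. -/
structure IsFactorization (g : ℕ) {n : ℕ} (lam mu : n.Partition)
    (T : PermTuple n (numBranch g lam mu)) : Prop where
  prod_eq_one : T.σ₂ * T.partialProd (numBranch g lam mu) = 1
  cycleType_left : T.σ₁.partition.parts = lam.parts
  cycleType_right : T.σ₂.partition.parts = mu.parts
  isSwap : ∀ i, (T.τ i).IsSwap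
  transitive : MulAction.IsPretransitive
    (Subgroup.closure (insert T.σ₁ (insert T.σ₂ (Set.range T.τ)))) (Fin n)

/-- The complex double Hurwitz number `H^ℂ_g(lam, mu)` with labelled sheets: the number of
factorizations of type `(g, lam, mu)`. -/
noncomputable def complexHurwitz (g : ℕ) {n : ℕ} (lam mu : n.Partition) : ℕ :=
  Nat.card {T : PermTuple n (numBranch g lam mu) // IsFactorization g lam mu T}

/-- The sign of the `i`-th branch point, `1 ≤ i ≤ r`, with the convention that the sign with
index `0` is `+1`. -/
def signAt {r : ℕ} (s : Fin r → ℤˣ) : ℕ → ℤˣ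
  | 0 => 1
  | i + 1 => if h : i < r then s ⟨i, h⟩ else 1

/-- The involutions `γ_0 = γ, γ_1, …, γ_r`: one has `γ_{j+1} = γ_j` if the signs with indices `j` and
`j + 1` agree, and `γ_{j+1} = γ_j ∘ τ_j ∘ ⋯ ∘ τ_1 ∘ σ₁` otherwise. -/
def RealTuple.involution {n r : ℕ} (T : RealTuple n r) (s : Fin r → ℤˣ) : ℕ → Perm (Fin n)
  | 0 => T.γ
  | j + 1 =>
    if signAt s (j + 1) = signAt s j then T.involution s j
    else T.involution s j * T.partialProd j

/-- Real factorizations of type `(g, lam, mu; s)`, for a sequence of signs `s`. -/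
structure IsRealFactorization (g : ℕ) {n : ℕ} (lam mu : n.Partition)
    (s : Fin (numBranch g lam mu) → ℤˣ) (T : RealTuple n (numBranch g lam mu)) : Prop where
  factorization : IsFactorization g lam mu T.toPermTuple
  involutive : T.γ * T.γ = 1
  conj_zero : T.γ * T.σ₁ * T.γ = T.σ₁⁻¹
  conj : ∀ i, 1 ≤ i → i ≤ numBranch g lam mu →
    T.involution s i * T.partialProd i * T.involution s i = (T.partialProd i)⁻¹

/-- The condition `b_i ≤ b_{i+1}` for `1 ≤ i ≤ k - 1`, where `τ_i = (a_i, b_i)` with `a_i < b_i`. -/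
def IsMonotoneUpTo {n r : ℕ} (k : ℕ) (T : PermTuple n r) : Prop :=
  ∀ i (h : i + 1 < r), i + 1 < k → ∀ a b a' b' : Fin n, a < b → a' < b' →
    T.τ ⟨i, (Nat.lt_succ_self i).trans h⟩ = swap a b → T.τ ⟨i + 1, h⟩ = swap a' b' → b ≤ b'

/-- Real `k`-mixed factorizations of type `(g, lam, mu; s, k)`. -/
def IsRealMixedFactorization (g : ℕ) {n : ℕ} (lam mu : n.Partition) (k : ℕ)
    (s : Fin (numBranch g lam mu) → ℤˣ) (T : RealTuple n (numBranch g lam mu)) : Prop :=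
  IsRealFactorization g lam mu s T ∧ IsMonotoneUpTo k T.toPermTuple

/-- The real `k`-mixed double Hurwitz number under the sequence of signs `s`. -/
noncomputable def realMixedHurwitzAt (g : ℕ) {n : ℕ} (lam mu : n.Partition) (k : ℕ)
    (s : Fin (numBranch g lam mu) → ℤˣ) : ℕ :=
  Nat.card {T : RealTuple n (numBranch g lam mu) // IsRealMixedFactorization g lam mu k s T}

/-- The real `k`-mixed double Hurwitz number: the minimum over all sequences of signs. -/
noncomputable def realMixedHurwitz (g : ℕ) {n : ℕ} (lam mu : n.Partition) (k : ℕ) : ℕ :=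
  ⨅ s : Fin (numBranch g lam mu) → ℤˣ, realMixedHurwitzAt g lam mu k s

/-! ### Tropical covers

A simply branched tropical cover `φ : C → Tℙ¹` of type `(g, lam, mu, {x_1 < ⋯ < x_r})` has exactly one
inner vertex over each `x_i`, and this vertex is 3-valent. The vertex over `x_i` is called `i`; the
numbers `0` and `r + 1` stand for `-∞` and `+∞`. An edge is mapped homeomorphically onto an interval, so
it is given by the two endpoints of this interval and by its weight (its length is determined by
these). Hence an isomorphism class of tropical covers over the points `x_i` is a multiset of edges. -/

/-- An edge of weight `weight` over the interval from `left` to `right`. -/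
@[ext] structure Edge where
  left : ℕ
  right : ℕ
  weight : ℕ
  deriving DecidableEq

/-- The edge of weight `w` between the points `u` and `v`, in whichever order they lie. -/
def seg (u v w : ℕ) : Edge := ⟨min u v, max u v, w⟩

def Incident (v : ℕ) (e : Edge) : Prop := e.left = v ∨ e.right = v

instance (v : ℕ) (e : Edge) : Decidable (Incident v e) := inferInstanceAs (Decidable (_ ∨ _))

/-- Any two edges in `S` are linked by a chain of edges in `S`, consecutive ones sharing a vertex that
belongs to `V`. -/
def EdgesConnected (V : Set ℕ) (S : Multiset Edge) : Prop :=
  ∀ e ∈ S, ∀ e' ∈ S, Relation.ReflTransGen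
    (fun a b => a ∈ S ∧ b ∈ S ∧ ∃ v ∈ V, Incident v a ∧ Incident v b) e e'

/-- (Isomorphism classes of) connected tropical covers with exactly one inner vertex, which is
3-valent, over each of `r` points. -/
structure IsTropicalCover (r : ℕ) (M : Multiset Edge) : Prop where
  pos : 0 < r
  edge : ∀ e ∈ M, e.left < e.right ∧ e.right ≤ r + 1 ∧ 0 < e.weight
  inner : ∀ e ∈ M, ¬(e.left = 0 ∧ e.right = r + 1)
  trivalent : ∀ v, 1 ≤ v → v ≤ r → (M.filter fun e => Incident v e).card = 3
  balanced : ∀ v, 1 ≤ v → v ≤ r →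
    ((M.filter fun e => e.right = v).map Edge.weight).sum =
      ((M.filter fun e => e.left = v).map Edge.weight).sum
  connected : EdgesConnected (Set.Icc 1 r) M

/-- Tropical covers of type `(g, lam, mu, x)`. There are `r` inner vertices and `l(lam) + l(mu)` leaves,
so the first Betti number of the graph is `|edges| - (r + l(lam) + l(mu)) + 1`. -/
structure IsCoverOfType (g : ℕ) {n : ℕ} (lam mu : n.Partition) (M : Multiset Edge) : Prop where
  cover : IsTropicalCover (numBranch g lam mu) M
  left_ends : (M.filter fun e => e.left = 0).map Edge.weight = lam.parts
  right_ends : (M.filter fun e => e.right = numBranch g lam mu + 1).map Edge.weight = mu.parts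
  genus : M.card + 1 = g + (numBranch g lam mu + lam.parts.card + mu.parts.card)

/-! ### Colourings and the real tropical cover of a real factorization -/

/-- Dotted edges are those in the chosen symmetric cycles and forks. Of the other edges, the even
ones are red or blue, and the odd ones are `normal`. -/
inductive Colour
  | normal
  | red
  | blue
  | dotted
  deriving DecidableEq

/-- `R` is a colouring of the cover `M`. A symmetric cycle or fork is a pair of edges with the same
weight and the same endpoints, at least one of which is an inner vertex. Every component of the
subgraph of even edges that are not dotted has only one colour. -/
structure IsColouring (r : ℕ) (M : Multiset Edge) (R : Multiset (Edge × Colour)) : Prop where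
  forget : R.map Prod.fst = M
  dotted : ∀ e, (e, Colour.dotted) ∈ R →
    R.count (e, Colour.dotted) = 2 ∧ ¬(e.left = 0 ∧ e.right = r + 1)
  normal : ∀ e, (e, Colour.normal) ∈ R → Odd e.weight
  red : ∀ e, (e, Colour.red) ∈ R → Even e.weight
  blue : ∀ e, (e, Colour.blue) ∈ R → Even e.weight
  component : ∀ e e', (e, Colour.red) ∈ R → (e', Colour.blue) ∈ R →
    ∀ v, 1 ≤ v → v ≤ r → ¬(Incident v e ∧ Incident v e')

/-- At the vertex `v` there is an edge of colour `a` on one side (left or right), and there are two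
edges of colours `b` and `c` on the other side. -/
def HasVertex (R : Multiset (Edge × Colour)) (v : ℕ) (a b c : Colour) : Prop :=
  ((R.filter fun e => e.1.right = v).map Prod.snd = {a} ∧
    (R.filter fun e => e.1.left = v).map Prod.snd = {b, c}) ∨
  ((R.filter fun e => e.1.left = v).map Prod.snd = {a} ∧
    (R.filter fun e => e.1.right = v).map Prod.snd = {b, c})

def IsPositiveVertex (R : Multiset (Edge × Colour)) (v : ℕ) : Prop :=
  HasVertex R v .normal .normal .blue ∨ HasVertex R v .blue .blue .blue ∨
    HasVertex R v .red .normal .normal ∨ HasVertex R v .blue .dotted .dotted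

def IsNegativeVertex (R : Multiset (Edge × Colour)) (v : ℕ) : Prop :=
  HasVertex R v .normal .normal .red ∨ HasVertex R v .red .red .red ∨
    HasVertex R v .blue .normal .normal ∨ HasVertex R v .red .dotted .dotted

/-- The splitting into positive and negative branch points induced by the colouring is the one
given by the signs `s`. -/
def HasSplitting {r : ℕ} (R : Multiset (Edge × Colour)) (s : Fin r → ℤˣ) : Prop :=
  ∀ i : Fin r, (s i = 1 → IsPositiveVertex R (i + 1)) ∧ (s i = -1 → IsNegativeVertex R (i + 1))

/-- `B` is the set of elements of a cycle of `σ` (fixed points are cycles of length one). -/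
def IsCycleSet {n : ℕ} (σ : Perm (Fin n)) (B : Finset (Fin n)) : Prop :=
  ∃ x, ∀ y, y ∈ B ↔ σ.SameCycle x y

/-- The set `B` carries an edge from `a` to `b`: it is a cycle of `τ_i ∘ ⋯ ∘ τ_1 ∘ σ₁` for exactly the
indices `i` with `a ≤ i < b` in a maximal interval of indices. (A transposition changes the sets of
the cycles that it cuts or joins and leaves the other cycles as they are.) -/
def PermTuple.IsCycleEdge {n r : ℕ} (T : PermTuple n r) (a b : ℕ) (B : Finset (Fin n)) : Prop :=
  a < b ∧ b ≤ r + 1 ∧ (∀ i, a ≤ i → i < b → IsCycleSet (T.partialProd i) B) ∧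
    (0 < a → ¬ IsCycleSet (T.partialProd (a - 1)) B) ∧
    (b ≤ r → ¬ IsCycleSet (T.partialProd b) B)

open Classical in
/-- The colour of an edge that starts at `a`: dotted if `γ_a` exchanges the cycle with another one; an
inverted even cycle is red if it has a point fixed by `γ_a` and the sign is `+1`, or has no such point
and the sign is `-1`, and blue otherwise. -/
noncomputable def RealTuple.colour {n r : ℕ} (T : RealTuple n r) (s : Fin r → ℤˣ) (a : ℕ)
    (B : Finset (Fin n)) : Colour :=
  if ∃ x ∈ B, T.involution s a x ∉ B then .dotted
  else if Odd B.card then .normal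
  else if (∃ x ∈ B, T.involution s a x = x) ↔ signAt s a = 1 then .red
  else .blue

open Classical in
/-- The real tropical cover that a real factorization produces. -/
noncomputable def RealTuple.realCover {n r : ℕ} (T : RealTuple n r) (s : Fin r → ℤˣ) :
    Multiset (Edge × Colour) :=
  ((Finset.univ : Finset (Fin (r + 1) × Fin (r + 2) × Finset (Fin n))).filter
      fun t => T.IsCycleEdge t.1 t.2.1 t.2.2).val.map
    fun t => (⟨t.1, t.2.1, t.2.2.card⟩, T.colour s t.1 t.2.2)

/-! ### Zigzag covers -/

/-- A tail: it is attached at the vertex `attach` of the string, the edge adjacent to the string has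
weight `weight`, its other vertices are listed in `inner`, starting next to the string, and it ends at
`far`, which is `0` (in-tail) or `r + 1` (out-tail). -/
structure Tail where
  attach : ℕ
  far : ℕ
  weight : ℕ
  inner : List ℕ

/-- The edges of the part of a tail of weight `w` that starts at `u` and has the further vertices
`l`: symmetric cycles alternate with edges of weight `w`; if the number of vertices in `l` is even, then
the last edge is an end of weight `w`, and if it is odd, then there is a symmetric fork at the last
vertex. -/
def tailEdges (far w : ℕ) : ℕ → List ℕ → Multiset Edge
  | u, [] => {seg u far w}
  | u, [v] => {seg u v w, seg v far (w / 2), seg v far (w / 2)}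
  | u, v :: v' :: l => {seg u v w, seg v v' (w / 2), seg v v' (w / 2)} + tailEdges far w v' l

def Tail.edges (t : Tail) : Multiset Edge := tailEdges t.far t.weight t.attach t.inner

/-- The inner vertices in the (closed) tail. -/
def Tail.vertices (t : Tail) : Set ℕ := {v | v = t.attach ∨ v ∈ t.inner}

/-- The tails of zigzag covers: the weight is even, and all symmetric cycles and forks have odd
weight. -/
structure IsTail (r : ℕ) (t : Tail) : Prop where
  far : t.far = 0 ∨ t.far = r + 1
  even : Even t.weight
  odd : t.inner ≠ [] → Odd (t.weight / 2)
  mem : ∀ v ∈ t.inner, 1 ≤ v ∧ v ≤ r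

/-- A string: a connected subgraph that is a closed submanifold away from the leaves. -/
structure IsString (r : ℕ) (S : Multiset Edge) : Prop where
  nonempty : S ≠ 0
  manifold : ∀ v, 1 ≤ v → v ≤ r →
    (S.filter fun e => Incident v e).card = 0 ∨ (S.filter fun e => Incident v e).card = 2
  connected : EdgesConnected (Set.Icc 1 r) S

/-- The cover `M` is a zigzag cover with the string `S`, which consists of odd edges outside the
symmetric cycles and forks, and the components of the complement of `S` are the given tails. -/
structure IsZigzagWith (r : ℕ) (M S : Multiset Edge) (tails : Multiset Tail) : Prop where
  string : IsString r S
  odd : ∀ e ∈ S, Odd e.weight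
  notSymmetric : ∀ e ∈ S, M.count e = 1
  decomposition : M = S + (tails.map Tail.edges).sum
  tail : ∀ t ∈ tails, IsTail r t ∧ 1 ≤ t.attach ∧ t.attach ≤ r ∧ ∃ e ∈ S, Incident t.attach e

/-! ### Universally monotone zigzag covers -/

/-- The string `S` with two ends runs through the points `p 0, p 1, …, p (n + 1)`, of which the first
and the last are `±∞` and the others are inner vertices. -/
structure IsRun (r : ℕ) (S : Multiset Edge) (n : ℕ) (p w : ℕ → ℕ) : Prop where
  first : p 0 = 0 ∨ p 0 = r + 1
  last : p (n + 1) = 0 ∨ p (n + 1) = r + 1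
  inner : ∀ i, 1 ≤ i → i ≤ n → 1 ≤ p i ∧ p i ≤ r
  inj : Set.InjOn p (Set.Icc 1 n)
  edges : S = (Multiset.range (n + 1)).map fun i => seg (p i) (p (i + 1)) (w i)

/-- The string bends at its vertex `p i`. -/
def IsBent (p : ℕ → ℕ) (i : ℕ) : Prop :=
  (p (i - 1) < p i ∧ p (i + 1) < p i) ∨ (p i < p (i - 1) ∧ p i < p (i + 1))

open Classical in
/-- The number of bent vertices among `p 1, …, p i`, which is the index (counted from `0`) of the piece
that contains the edge of the string between `p i` and `p (i + 1)`. As the pieces alternate, the pieces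
of the same kind as a first piece with an in-end, the in-pieces, are those that run from left to right,
and the out-pieces are those that run from right to left. -/
noncomputable def pieceIndex (p : ℕ → ℕ) (i : ℕ) : ℕ :=
  ((Finset.Icc 1 i).filter fun j => IsBent p j).card

/-- The index of the component (an in-piece or an out-piece together with tails) to which the vertex
`p i` and the tail attached to it belong: bent vertices belong to in-components. -/
noncomputable def componentIndex (p : ℕ → ℕ) (i : ℕ) : ℕ :=
  if p i < p (i + 1) then pieceIndex p i else pieceIndex p (i - 1)

/-- The inner vertices in the component with index `c`. -/
def componentVertices (tails : Multiset Tail) (n : ℕ) (p : ℕ → ℕ) (c : ℕ) : Set ℕ :=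
  {v | ∃ i, 1 ≤ i ∧ i ≤ n ∧ componentIndex p i = c ∧
    (v = p i ∨ ∃ t ∈ tails, t.attach = p i ∧ v ∈ t.vertices)}

/-- The smallest closed intervals containing `A` and `B` are disjoint. -/
def Separated (A B : Set ℕ) : Prop :=
  (∀ a ∈ A, ∀ b ∈ B, a < b) ∨ (∀ a ∈ A, ∀ b ∈ B, b < a)

/-- Universally monotone zigzag covers. Unbent tails have no symmetric cycles (at most one vertex in
`inner`), and unbent out-tails have no symmetric forks either (no vertex in `inner`). -/
def IsUniversallyMonotone (r : ℕ) (M : Multiset Edge) : Prop :=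
  IsTropicalCover r M ∧
  ∃ (S : Multiset Edge) (tails : Multiset Tail) (n : ℕ) (p w : ℕ → ℕ),
    IsZigzagWith r M S tails ∧ IsRun r S n p w ∧
    -- unbent tails attached to in-pieces are out-tails
    (∀ t ∈ tails, ∀ i, 1 ≤ i → i ≤ n → t.attach = p i → ¬ IsBent p i → p i < p (i + 1) →
      t.far = r + 1 ∧ t.inner = []) ∧
    -- unbent tails attached to out-pieces are in-tails
    (∀ t ∈ tails, ∀ i, 1 ≤ i → i ≤ n → t.attach = p i → ¬ IsBent p i → p (i + 1) < p i →
      t.far = 0 ∧ t.inner.length ≤ 1) ∧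
    -- bent tails with a symmetric cycle or fork have weight two
    (∀ t ∈ tails, ∀ i, 1 ≤ i → i ≤ n → t.attach = p i → IsBent p i → t.inner ≠ [] →
      t.weight = 2) ∧
    -- different tails, and different components, lie over disjoint intervals
    (∀ t ∈ tails, ∀ t' ∈ tails, t ≠ t' → Separated t.vertices t'.vertices) ∧
    (∀ c c', c ≠ c' →
      Separated (componentVertices tails n p c) (componentVertices tails n p c')) ∧
    -- at most one unbent out-tail is attached to each in-piece
    (∀ i j, 1 ≤ i → i ≤ n → 1 ≤ j → j ≤ n → ¬ IsBent p i → ¬ IsBent p j →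
      p i < p (i + 1) → p j < p (j + 1) → pieceIndex p i = pieceIndex p j →
      (∃ t ∈ tails, t.attach = p i ∧ t.far = r + 1) →
      (∃ t ∈ tails, t.attach = p j ∧ t.far = r + 1) → i = j)

/-! ### `k`-mixed zigzag covers and the `k`-mixed zigzag number -/

/-- The edge `e` is adjacent to one of the vertices `1, …, k`. -/
def Touches (k : ℕ) (e : Edge) : Prop := (1 ≤ e.left ∧ e.left ≤ k) ∨ (1 ≤ e.right ∧ e.right ≤ k)

instance (k : ℕ) (e : Edge) : Decidable (Touches k e) := inferInstanceAs (Decidable (_ ∨ _))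

/-- The restriction of the cover to the minimal subgraph with the inner vertices `1, …, k`; the edges
that leave this subgraph become ends. -/
def restrictTo (k : ℕ) (M : Multiset Edge) : Multiset Edge :=
  (M.filter fun e => Touches k e).map fun e => ⟨e.left, min e.right (k + 1), e.weight⟩

/-- `k`-mixed zigzag covers with `r` inner vertices. The third condition says that the minimal
subgraph `C'` containing the vertices `1, …, k` has no other inner vertices: each further vertex on it is
a leaf of `C'`. The last one says that the part of the string outside `C'` is connected (or empty). -/
def IsMixedZigzag (r k : ℕ) (M : Multiset Edge) : Prop :=
  k ≤ r ∧ ∃ (S : Multiset Edge) (tails : Multiset Tail),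
    IsZigzagWith r M S tails ∧
    (∀ v, k < v → v ≤ r → (M.filter fun e => Touches k e ∧ e.right = v).card ≤ 1) ∧
    IsUniversallyMonotone k (restrictTo k M) ∧
    EdgesConnected {v | k < v ∧ v ≤ r ∧ ∀ e ∈ M, Touches k e → ¬ Incident v e}
      (S.filter fun e => ¬ Touches k e)

/-- The number of real `k`-mixed factorizations associated to `(M, R)`, where `R` is the (unique)
colouring of the zigzag cover `M` with the splitting given by `s`. -/
noncomputable def mixedMultiplicityAt (g : ℕ) {n : ℕ} (lam mu : n.Partition) (k : ℕ)
    (M : Multiset Edge) (s : Fin (numBranch g lam mu) → ℤˣ) : ℕ :=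
  Nat.card {T : RealTuple n (numBranch g lam mu) //
    IsRealMixedFactorization g lam mu k s T ∧
      ∃ R, IsColouring (numBranch g lam mu) M R ∧ HasSplitting R s ∧ T.realCover s = R}

/-- The minimum of these numbers over all sequences of signs. -/
noncomputable def mixedMultiplicity (g : ℕ) {n : ℕ} (lam mu : n.Partition) (k : ℕ)
    (M : Multiset Edge) : ℕ :=
  ⨅ s : Fin (numBranch g lam mu) → ℤˣ, mixedMultiplicityAt g lam mu k M s

/-- The `k`-mixed zigzag number: the sum of these minima over all `k`-mixed zigzag covers of type
`(g, lam, mu, x)`. -/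
noncomputable def mixedZigzagNumber (g : ℕ) {n : ℕ} (lam mu : n.Partition) (k : ℕ) : ℕ :=
  ∑ᶠ M : {M : Multiset Edge // IsCoverOfType g lam mu M ∧
    IsMixedZigzag (numBranch g lam mu) k M}, mixedMultiplicity g lam mu k M.1

end MixedHurwitz

/-! Write n = d + 2m for the degree. All numbers in question have logarithm asymptotic to 6 m log m,
because they lie between two bounds with this rate. A transitive factorization carries at most n
real structures: two of them differ by a permutation that commutes with a transitive group, so it is
determined by one value (`realMixedHurwitzAt_le`). The zigzag number is at most the number of real
k-mixed factorizations for every choice of signs (`mixedZigzagNumber_le`). Hence an upper bound for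
the complex number and a lower bound for the zigzag number suffice; factors n are invisible to the
logarithm.

Upper bound. The outer permutations move at most d points each, so they are products of d swaps or
identities, and a factorization becomes a transitive sequence of ρ, about 4m, swaps with product one
(`complexHurwitz_le`). Read the sequence from its start. The swaps that join two cycles of the
product of the earlier joining swaps number n - 1 and build a full cycle ζ; the others can be moved
past them by conjugation. So, up to 2^ρ choices of positions, one factors the inverse of ζ into n -
1 swaps and ζ itself into ρ + 1 - n swaps, about 2m (`treeWalks_le`). Summed over ζ the first factor
is n^(2(n-1)), of rate 4. The second factor has rate 2: such a factorization is nearly as short as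
possible, so almost every swap cuts a cycle, and for permutations weighted by the product of the
inverse squares of the cycle lengths, all cuts together multiply the weight by at most a constant
times the number of steps left (`walks_le`). This gives a constant to the power 2m, times (2m)!, up
to a power of n.

Lower bound. There are (m!)^4 covers, each with at least (n - 2k)!/n factorizations for every sign
sequence. Three ingredients enter.

(1) Coloured covers are realizable. On a cycle of P that is inverted by γ, both γ and Pγ are
reflections. A swap turns P into a permutation still inverted by γ when it commutes with Pγ
(`Inverts.swap_mul`), and the colours record which reflection of an even cycle has fixed points. At
each vertex of a zigzag cover this is enough to find a suitable swap (`ColouredGraph.IsState.step`);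
the cover and its colouring are then recovered from the factorization
(`ColouredGraph.Realizes.realCover_eq`).

(2) Monotonicity is a matter of renaming the sheets. It is enough to choose an element of each of
the first k transpositions such that an element chosen later has not been moved earlier, unless it
was chosen all the time in between (`ColouredGraph.Realizes.exists_choice`); sorting by the first
time of choice makes the chosen elements the larger ones. Edges at which such a choice is safe are
called active. Renamings that fix the at most 2k elements of these transpositions keep the
condition, whence (n - 2k)!/n.

(3) The required covers exist. The parts of λ' and μ' are arranged greedily along a string that
descends like a staircase (`exists_fullStair`): the inequality on pairs of parts of μ' ensures that
at most one cut precedes each turn to the left, and the largest part of λ' is saved for the last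
bend. Behind it the other parts are attached as tails, the whole genus g sits in one tail of weight
two with g symmetric cycles, and a string of weight one bends 2m times with a fork of two ends of
weight one at each bend. The m out-bends, their forks, the m in-bends and their forks occupy four
zones of vertices, each of which can be permuted freely. This yields (m!)^4 different covers
(`FullStair.cover_injective`), of rate 4, and (n - 2k)! adds 2. -/

namespace MixedHurwitz

/-! ### Cycles of a permutation that is multiplied by a transposition: cuts and joins. -/

section Cycles

variable {α : Type*} [Fintype α] [DecidableEq α]

/-- The set of elements of the cycle of `σ` through `x`. -/
def cyc (σ : Perm α) (x : α) : Finset α := Finset.univ.filter fun y => σ.SameCycle x y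

/-- The sets of elements of the cycles of `σ`, including the fixed points. -/
def cycles (σ : Perm α) : Finset (Finset α) := Finset.univ.image (cyc σ)

@[simp] theorem mem_cyc {σ : Perm α} {x y : α} : y ∈ cyc σ x ↔ σ.SameCycle x y := by simp [cyc]

theorem self_mem_cyc (σ : Perm α) (x : α) : x ∈ cyc σ x := mem_cyc.2 (Perm.SameCycle.refl _ _)

theorem cyc_eq_cyc {σ : Perm α} {x y : α} : cyc σ x = cyc σ y ↔ σ.SameCycle x y := by
  constructor
  · intro h
    have : y ∈ cyc σ x := h ▸ self_mem_cyc σ y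
    simpa using this
  · intro h
    ext z
    simp only [mem_cyc]
    exact ⟨fun h' => h.symm.trans h', fun h' => h.trans h'⟩

theorem cyc_mem_cycles (σ : Perm α) (x : α) : cyc σ x ∈ cycles σ := by simp [cycles]

theorem mem_cycles {σ : Perm α} {B : Finset α} : B ∈ cycles σ ↔ ∃ x, cyc σ x = B := by
  simp [cycles]

theorem isCycleOn_cyc (σ : Perm α) (x : α) : σ.IsCycleOn (cyc σ x : Set α) := by
  refine ⟨σ.bijOn fun y => by simp, fun y hy z hz => ?_⟩
  simp only [Finset.mem_coe, mem_cyc] at hy hz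
  exact hy.symm.trans hz

theorem card_cyc_pos (σ : Perm α) (x : α) : 0 < (cyc σ x).card :=
  Finset.card_pos.2 ⟨x, self_mem_cyc σ x⟩

theorem pow_apply_eq_self_iff (σ : Perm α) (x : α) (n : ℕ) :
    (σ ^ n) x = x ↔ (cyc σ x).card ∣ n :=
  (isCycleOn_cyc σ x).pow_apply_eq (self_mem_cyc σ x)

theorem zpow_apply_eq_self_iff (σ : Perm α) (x : α) (n : ℤ) :
    (σ ^ n) x = x ↔ ((cyc σ x).card : ℤ) ∣ n :=
  (isCycleOn_cyc σ x).zpow_apply_eq (self_mem_cyc σ x)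

theorem exists_pow_of_sameCycle {σ : Perm α} {x y : α} (h : σ.SameCycle x y) :
    ∃ i < (cyc σ x).card, (σ ^ i) x = y :=
  (isCycleOn_cyc σ x).exists_pow_eq (self_mem_cyc σ x) (by simpa using h)

theorem pow_injOn (σ : Perm α) (x : α) :
    Set.InjOn (fun i : ℕ => (σ ^ i) x) (Set.Iio (cyc σ x).card) := by
  intro i hi j hj h
  have := ((isCycleOn_cyc σ x).pow_apply_eq_pow_apply (self_mem_cyc σ x)).1 h
  exact Nat.ModEq.eq_of_lt_of_lt this hi hj

theorem sameCycle_iff_of_pow_eq {f : Perm α} {x w : α} {m : ℕ} (hm : 0 < m) (h : (f ^ m) x = x) :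
    f.SameCycle x w ↔ ∃ i < m, (f ^ i) x = w := by
  constructor
  · intro hw
    obtain ⟨i, hi, rfl⟩ := exists_pow_of_sameCycle hw
    exact ⟨i, hi.trans_le (Nat.le_of_dvd hm ((pow_apply_eq_self_iff f x m).1 h)), rfl⟩
  · rintro ⟨i, -, rfl⟩
    exact ⟨i, by simp⟩

-- Until the orbit of `z` first hits `a` or `b`, the swap is invisible. All statements about cuts
-- and joins come from locating this first hit.
omit [Fintype α] in
theorem swap_mul_pow_apply {P : Perm α} {a b z : α} {i : ℕ}
    (h : ∀ j, 0 < j → j ≤ i → (P ^ j) z ≠ a ∧ (P ^ j) z ≠ b) :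
    ((swap a b * P) ^ i) z = (P ^ i) z := by
  induction i with
  | zero => simp
  | succ i ih =>
    rw [pow_succ', Perm.mul_apply, ih fun j hj hji => h j hj (hji.trans i.le_succ), Perm.mul_apply,
      ← Perm.mul_apply P, ← pow_succ']
    exact swap_apply_of_ne_of_ne (h _ i.succ_pos le_rfl).1 (h _ i.succ_pos le_rfl).2

theorem sameCycle_swap_mul_of_not {P : Perm α} {a b z w : α} (ha : ¬ P.SameCycle z a)
    (hb : ¬ P.SameCycle z b) : (swap a b * P).SameCycle z w ↔ P.SameCycle z w := by
  have key : ∀ i : ℕ, ((swap a b * P) ^ i) z = (P ^ i) z := fun i =>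
    swap_mul_pow_apply fun j _ _ => ⟨fun h => ha ⟨j, by simpa using h⟩, fun h => hb ⟨j, by simpa using h⟩⟩
  constructor
  · intro h
    obtain ⟨i, rfl⟩ := h.exists_nat_pow_eq
    rw [key]; exact ⟨i, by simp⟩
  · intro h
    obtain ⟨i, rfl⟩ := h.exists_nat_pow_eq
    rw [← key]; exact ⟨i, by simp⟩

section Cut

variable {P : Perm α} {x : α} {k : ℕ} (hk : 0 < k) (hkl : k < (cyc P x).card)
include hk hkl

omit hk in
theorem cut_pow_left {i : ℕ} (hi : i < k) : ((swap x ((P ^ k) x) * P) ^ i) x = (P ^ i) x := by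
  refine swap_mul_pow_apply fun j hj hji => ⟨fun h => ?_, fun h => ?_⟩
  · have := Nat.le_of_dvd hj ((pow_apply_eq_self_iff P x j).1 h)
    omega
  · have := pow_injOn P x (show j < _ by omega) hkl h
    omega

theorem sameCycle_cut_left (w : α) :
    (swap x ((P ^ k) x) * P).SameCycle x w ↔ ∃ i < k, (P ^ i) x = w := by
  -- The orbit agrees with that of `P` until the `k`-th step, which would reach the second point of
  -- the swap and is sent back to `x`.
  have hper : ((swap x ((P ^ k) x) * P) ^ k) x = x := by
    obtain ⟨j, rfl⟩ : ∃ j, k = j + 1 := ⟨k - 1, by omega⟩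
    rw [pow_succ', Perm.mul_apply, cut_pow_left hkl j.lt_succ_self, Perm.mul_apply,
      ← Perm.mul_apply P, ← pow_succ', swap_apply_right]
  rw [sameCycle_iff_of_pow_eq hk hper]
  exact ⟨fun ⟨i, hi, h⟩ => ⟨i, hi, (cut_pow_left hkl hi).symm.trans h⟩,
    fun ⟨i, hi, h⟩ => ⟨i, hi, (cut_pow_left hkl hi).trans h⟩⟩

theorem cut_pow_right {i : ℕ} (hi : i < (cyc P x).card - k) :
    ((swap x ((P ^ k) x) * P) ^ i) ((P ^ k) x) = (P ^ (k + i)) x := by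
  rw [swap_mul_pow_apply, ← Perm.mul_apply, ← pow_add, add_comm]
  intro j hj hji
  rw [← Perm.mul_apply, ← pow_add]
  refine ⟨fun h => ?_, fun h => ?_⟩
  · have := Nat.le_of_dvd (by omega) ((pow_apply_eq_self_iff P x _).1 h)
    omega
  · have := pow_injOn P x (show j + k < _ by omega) hkl h
    omega

theorem sameCycle_cut_right (w : α) :
    (swap x ((P ^ k) x) * P).SameCycle ((P ^ k) x) w ↔
      ∃ i, k ≤ i ∧ i < (cyc P x).card ∧ (P ^ i) x = w := by
  have hper : ((swap x ((P ^ k) x) * P) ^ ((cyc P x).card - k)) ((P ^ k) x) = (P ^ k) x := by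
    obtain ⟨j, hj⟩ : ∃ j, (cyc P x).card - k = j + 1 := ⟨(cyc P x).card - k - 1, by omega⟩
    have h1 : (P ^ (j + 1 + k)) x = x := by
      rw [← hj, Nat.sub_add_cancel hkl.le, pow_apply_eq_self_iff]
    rw [hj, pow_succ', Perm.mul_apply, cut_pow_right hk hkl (by omega), Perm.mul_apply,
      ← Perm.mul_apply P, ← pow_succ', show k + j + 1 = j + 1 + k by omega, h1, swap_apply_left]
  rw [sameCycle_iff_of_pow_eq (by omega) hper]
  constructor
  · rintro ⟨i, hi, h⟩
    exact ⟨k + i, by omega, by omega, (cut_pow_right hk hkl hi).symm.trans h⟩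
  · rintro ⟨i, h1, h2, h⟩
    refine ⟨i - k, by omega, ?_⟩
    rw [cut_pow_right hk hkl (by omega), show k + (i - k) = i by omega, h]

theorem card_cut_left : (cyc (swap x ((P ^ k) x) * P) x).card = k := by
  have : cyc (swap x ((P ^ k) x) * P) x = (Finset.range k).image fun i => (P ^ i) x := by
    ext w; simp [sameCycle_cut_left hk hkl]
  rw [this, Finset.card_image_of_injOn, Finset.card_range]
  intro i hi j hj h
  simp only [Finset.coe_range, Set.mem_Iio] at hi hj
  exact pow_injOn P x (show i < _ by omega) (show j < _ by omega) h

theorem card_cut_right :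
    (cyc (swap x ((P ^ k) x) * P) ((P ^ k) x)).card = (cyc P x).card - k := by
  have : cyc (swap x ((P ^ k) x) * P) ((P ^ k) x) =
      (Finset.Ico k (cyc P x).card).image fun i => (P ^ i) x := by
    ext w; simp [sameCycle_cut_right hk hkl, and_assoc]
  rw [this, Finset.card_image_of_injOn, Nat.card_Ico]
  intro i hi j hj h
  simp only [Finset.coe_Ico, Set.mem_Ico] at hi hj
  exact pow_injOn P x (show i < _ by omega) (show j < _ by omega) h

theorem not_sameCycle_cut : ¬ (swap x ((P ^ k) x) * P).SameCycle x ((P ^ k) x) := by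
  rw [sameCycle_cut_left hk hkl]
  rintro ⟨i, hi, h⟩
  have := pow_injOn P x (show i < _ by omega) hkl h
  omega

end Cut

section Join

variable {P : Perm α} {x y : α} (hxy : ¬ P.SameCycle x y)
include hxy

theorem sameCycle_join_aux (w : α) (hw : P.SameCycle x w) : (swap x y * P).SameCycle x w := by
  obtain ⟨i, hi, rfl⟩ := exists_pow_of_sameCycle hw
  refine ⟨i, ?_⟩
  rw [zpow_natCast, swap_mul_pow_apply]
  intro j hj hji
  refine ⟨fun h => ?_, fun h => hxy ⟨j, by simpa using h⟩⟩
  have := Nat.le_of_dvd hj ((pow_apply_eq_self_iff P x j).1 h)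
  omega

/-- The `P`-predecessor of `x` stays on the cycle of `x`, and the new permutation sends it to `y`.
-/
theorem sameCycle_join_pair : (swap x y * P).SameCycle x y := by
  have h1 : (swap x y * P).SameCycle x (P⁻¹ x) :=
    sameCycle_join_aux hxy _ ⟨-1, by simp⟩
  refine h1.trans ⟨1, ?_⟩
  simp

theorem sameCycle_join (w : α) :
    (swap x y * P).SameCycle x w ↔ P.SameCycle x w ∨ P.SameCycle y w := by
  constructor
  · intro h
    obtain ⟨i, rfl⟩ := h.exists_nat_pow_eq
    clear h
    induction i with
    | zero => left; exact Perm.SameCycle.refl _ _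
    | succ i ih =>
      rw [pow_succ', Perm.mul_apply, Perm.mul_apply]
      set z := ((swap x y * P) ^ i) x
      by_cases h1 : P z = x
      · rw [h1, swap_apply_left]; right; exact Perm.SameCycle.refl _ _
      by_cases h2 : P z = y
      · rw [h2, swap_apply_right]; left; exact Perm.SameCycle.refl _ _
      rw [swap_apply_of_ne_of_ne h1 h2]
      simpa only [Perm.sameCycle_apply_right] using ih
  · rintro (h | h)
    · exact sameCycle_join_aux hxy w h
    · refine (sameCycle_join_pair hxy).trans ?_
      rw [swap_comm]
      exact sameCycle_join_aux (fun h => hxy h.symm) w h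

theorem cyc_join : cyc (swap x y * P) x = cyc P x ∪ cyc P y := by
  ext w; simp [sameCycle_join hxy]

theorem disjoint_cyc : Disjoint (cyc P x) (cyc P y) := by
  rw [Finset.disjoint_left]
  intro z hz hz'
  simp only [mem_cyc] at hz hz'
  exact hxy (hz.trans hz'.symm)

theorem card_join : (cyc (swap x y * P) x).card = (cyc P x).card + (cyc P y).card := by
  rw [cyc_join hxy, Finset.card_union_of_disjoint (disjoint_cyc hxy)]

omit hxy in
theorem cyc_join_of_not {z : α} (hx : ¬ P.SameCycle z x) (hy : ¬ P.SameCycle z y) :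
    cyc (swap x y * P) z = cyc P z := by
  ext w; simp [sameCycle_swap_mul_of_not hx hy]

theorem cycles_join : cycles (swap x y * P) =
    insert (cyc P x ∪ cyc P y) (((cycles P).erase (cyc P x)).erase (cyc P y)) := by
  ext B
  simp only [mem_cycles, Finset.mem_insert, Finset.mem_erase]
  constructor
  · rintro ⟨z, rfl⟩
    by_cases h : (swap x y * P).SameCycle x z
    · left
      rw [← cyc_join hxy, cyc_eq_cyc.2 h]
    · rw [sameCycle_join hxy, not_or] at h
      right
      rw [cyc_join_of_not (fun h' => h.1 h'.symm) (fun h' => h.2 h'.symm)]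
      exact ⟨fun h' => h.2 (cyc_eq_cyc.1 h').symm, fun h' => h.1 (cyc_eq_cyc.1 h').symm, z, rfl⟩
  · rintro (rfl | ⟨h1, h2, z, rfl⟩)
    · exact ⟨x, cyc_join hxy⟩
    · rw [Ne, cyc_eq_cyc] at h1 h2
      exact ⟨z, cyc_join_of_not h2 h1⟩

/-- Two factors are replaced by one. Written without division it holds in every commutative monoid:
`Multiplicative ℕ` yields the number of cycles, inverse squares yield `cycleWeight`. -/
theorem prod_cycles_join {M : Type*} [CommMonoid M] (f : ℕ → M) :
    (∏ B ∈ cycles (swap x y * P), f B.card) * f (cyc P x).card * f (cyc P y).card =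
      (∏ B ∈ cycles P, f B.card) * f ((cyc P x).card + (cyc P y).card) := by
  have hne : cyc P y ≠ cyc P x := fun h => hxy (cyc_eq_cyc.1 h).symm
  rw [cycles_join hxy, Finset.prod_insert,
    Finset.card_union_of_disjoint (disjoint_cyc hxy),
    ← Finset.mul_prod_erase (cycles P) _ (cyc_mem_cycles P x),
    ← Finset.mul_prod_erase ((cycles P).erase (cyc P x)) _
      (Finset.mem_erase.2 ⟨hne, cyc_mem_cycles P y⟩)]
  · ac_rfl
  · simp only [Finset.mem_erase, not_and, mem_cycles, not_exists]
    intro _ _ z hz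
    have hx : P.SameCycle z x := by
      rw [← mem_cyc, hz]; simp [Perm.SameCycle.refl]
    have hy : P.SameCycle z y := by
      rw [← mem_cyc, hz]; simp [Perm.SameCycle.refl]
    exact hxy (hx.symm.trans hy)

theorem card_cycles_join : (cycles (swap x y * P)).card + 1 = (cycles P).card := by
  have := prod_cycles_join hxy (M := Multiplicative ℕ) (fun _ => Multiplicative.ofAdd 1)
  have := congrArg Multiplicative.toAdd this
  simp only [Finset.prod_const, toAdd_mul, toAdd_pow, toAdd_ofAdd, smul_eq_mul, mul_one] at this
  omega

end Join

omit [Fintype α] in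
theorem swap_mul_swap_mul_self (x y : α) (P : Perm α) : swap x y * (swap x y * P) = P := by
  rw [← mul_assoc, swap_mul_self, one_mul]

/-- A cut is undone by the same swap, so this is the formula for a join read backwards. -/
theorem prod_cycles_cut {M : Type*} [CommMonoid M] (f : ℕ → M) {P : Perm α} {x : α} {k : ℕ}
    (hk : 0 < k) (hkl : k < (cyc P x).card) :
    (∏ B ∈ cycles P, f B.card) * f k * f ((cyc P x).card - k) =
      (∏ B ∈ cycles (swap x ((P ^ k) x) * P), f B.card) * f (cyc P x).card := by
  have := prod_cycles_join (not_sameCycle_cut hk hkl) f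
  rwa [swap_mul_swap_mul_self, card_cut_left hk hkl, card_cut_right hk hkl,
    Nat.add_sub_cancel' hkl.le] at this

theorem card_cycles_cut {P : Perm α} {x : α} {k : ℕ} (hk : 0 < k) (hkl : k < (cyc P x).card) :
    (cycles (swap x ((P ^ k) x) * P)).card = (cycles P).card + 1 := by
  have := card_cycles_join (not_sameCycle_cut hk hkl)
  rw [swap_mul_swap_mul_self] at this
  omega

theorem cyc_of_fixed {σ : Perm α} {x : α} (h : σ x = x) : cyc σ x = {x} := by
  ext y
  simp only [mem_cyc, Finset.mem_singleton]
  exact ⟨fun h' => (h'.eq_of_left h).symm, fun h' => h' ▸ Perm.SameCycle.refl _ _⟩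

/-- The parts of the partition of a permutation are the sizes of its cycles. -/
theorem partition_parts_eq (σ : Perm α) :
    σ.partition.parts = (cycles σ).val.map Finset.card := by
  have h1 : cycles σ = σ.cycleFactorsFinset.image Perm.support ∪
      (σ.support)ᶜ.image (fun x => {x}) := by
    ext B
    simp only [mem_cycles, Finset.mem_union, Finset.mem_image, Finset.mem_compl,
      Perm.mem_support, not_not]
    constructor
    · rintro ⟨x, rfl⟩
      by_cases hx : σ x = x
      · exact Or.inr ⟨x, hx, (cyc_of_fixed hx).symm⟩
      · left
        refine ⟨σ.cycleOf x, Perm.cycleOf_mem_cycleFactorsFinset_iff.2 (Perm.mem_support.2 hx), ?_⟩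
        ext y
        rw [Perm.mem_support_cycleOf_iff' hx, mem_cyc]
    · rintro (⟨c, hc, rfl⟩ | ⟨x, hx, rfl⟩)
      · obtain ⟨x, hx⟩ := (Perm.mem_cycleFactorsFinset_iff.1 hc).1.nonempty_support
        refine ⟨x, ?_⟩
        rw [Perm.cycle_is_cycleOf hx hc]
        have hx' : σ x ≠ x := by
          have := Perm.mem_cycleFactorsFinset_support_le hc hx
          simpa using this
        ext y
        rw [Perm.mem_support_cycleOf_iff' hx', mem_cyc]
      · exact ⟨x, cyc_of_fixed hx⟩
  have h2 : Disjoint (σ.cycleFactorsFinset.image Perm.support)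
      ((σ.support)ᶜ.image (fun x => ({x} : Finset α))) := by
    rw [Finset.disjoint_left]
    intro B hB hB'
    simp only [Finset.mem_image, Finset.mem_compl] at hB hB'
    obtain ⟨c, hc, rfl⟩ := hB
    obtain ⟨x, hx, h⟩ := hB'
    exact hx (Perm.mem_cycleFactorsFinset_support_le hc (by rw [← h]; simp))
  have h3 : Set.InjOn Perm.support (σ.cycleFactorsFinset : Set (Perm α)) := by
    intro c hc c' hc' h
    obtain ⟨x, hx⟩ := (Perm.mem_cycleFactorsFinset_iff.1 hc).1.nonempty_support
    have hx2 : x ∈ c'.support := by rw [← h]; exact hx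
    rw [Perm.cycle_is_cycleOf hx hc, Perm.cycle_is_cycleOf hx2 hc']
  rw [Perm.parts_partition, h1, ← Finset.disjUnion_eq_union _ _ h2, Finset.disjUnion_val,
    Multiset.map_add, Finset.image_val_of_injOn h3, Finset.image_val_of_injOn
      (fun a _ b _ h => Finset.singleton_injective h), Multiset.map_map, Multiset.map_map,
    Perm.cycleType_def]
  congr 1
  simp only [Function.comp_def, Finset.card_singleton, Multiset.map_const', Finset.card_val,
    Finset.card_compl]

end Cycles


/-! ### Factorizations of a permutation into a given number of swaps. -/

section Walks

variable {α : Type*} [Fintype α] [DecidableEq α]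

/-- The number of sequences of `k` pairs such that the product of the corresponding swaps,
composed with `σ`, is the identity. -/
def walks : ℕ → Perm α → ℕ
  | 0, σ => if σ = 1 then 1 else 0
  | k + 1, σ => ∑ p : α × α, walks k (swap p.1 p.2 * σ)

theorem cycles_one : (cycles (1 : Perm α)).card = Fintype.card α := by
  have : cycles (1 : Perm α) = Finset.univ.image (fun x => {x}) := by
    unfold cycles
    congr 1
    ext1 x
    exact cyc_of_fixed rfl
  rw [this, Finset.card_image_of_injective _ Finset.singleton_injective, Finset.card_univ]

omit [Fintype α] in
theorem swap_self_mul (a : α) (σ : Perm α) : swap a a * σ = σ := by ext; simp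

theorem card_cycles_swap_mul_le (σ : Perm α) (a b : α) :
    (cycles (swap a b * σ)).card ≤ (cycles σ).card + 1 := by
  by_cases h : σ.SameCycle a b
  · obtain ⟨k, hk, rfl⟩ := exists_pow_of_sameCycle h
    rcases Nat.eq_zero_or_pos k with rfl | hk0
    · rw [pow_zero, Perm.one_apply, swap_self_mul]
      exact Nat.le_succ _
    · exact (card_cycles_cut hk0 hk).le
  · have := card_cycles_join h
    omega

/-- The identity has the maximal number of cycles, and one swap creates at most one new cycle. -/
theorem card_le_of_walks_ne_zero {k : ℕ} {σ : Perm α} (h : walks k σ ≠ 0) :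
    Fintype.card α ≤ k + (cycles σ).card := by
  induction k generalizing σ with
  | zero =>
    have : σ = 1 := by by_contra h'; simp [walks, h'] at h
    rw [this, cycles_one, zero_add]
  | succ k ih =>
    obtain ⟨p, -, hp⟩ := Finset.exists_ne_zero_of_sum_ne_zero h
    have := ih hp
    have := card_cycles_swap_mul_le σ p.1 p.2
    omega

theorem card_support_le_of_walks_ne_zero {k : ℕ} {σ : Perm α} (h : walks k σ ≠ 0) :
    σ.support.card ≤ 2 * k := by
  induction k generalizing σ with
  | zero =>
    have : σ = 1 := by by_contra h'; simp [walks, h'] at h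
    simp [this]
  | succ k ih =>
    obtain ⟨p, -, hp⟩ := Finset.exists_ne_zero_of_sum_ne_zero h
    have h1 := ih hp
    have h2 : σ.support ⊆ {p.1, p.2} ∪ (swap p.1 p.2 * σ).support := by
      intro x hx
      by_contra hx'
      simp only [Finset.mem_union, Finset.mem_insert, Finset.mem_singleton, Perm.mem_support,
        Perm.mul_apply, not_or, not_not] at hx' hx
      obtain ⟨⟨h3, h4⟩, h5⟩ := hx'
      have := congrArg (swap p.1 p.2) h5
      rw [swap_apply_self, swap_apply_of_ne_of_ne h3 h4] at this
      exact hx this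
    have h3 := (Finset.card_le_card h2).trans (Finset.card_union_le _ _)
    have h4 := Finset.card_le_two (a := p.1) (b := p.2)
    omega

/-- A weight on permutations: the product of the inverse squares of the lengths of the cycles. -/
noncomputable def cycleWeight (σ : Perm α) : ℝ := ∏ B ∈ cycles σ, ((B.card : ℝ) ^ 2)⁻¹

theorem cycleWeight_pos (σ : Perm α) : 0 < cycleWeight σ := by
  refine Finset.prod_pos fun B hB => ?_
  obtain ⟨x, rfl⟩ := mem_cycles.1 hB
  have := card_cyc_pos σ x
  positivity

theorem cycleWeight_le_one (σ : Perm α) : cycleWeight σ ≤ 1 := by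
  refine Finset.prod_le_one (fun B _ => by positivity) fun B hB => ?_
  obtain ⟨x, rfl⟩ := mem_cycles.1 hB
  have : (1 : ℝ) ≤ (cyc σ x).card := by exact_mod_cast card_cyc_pos σ x
  exact inv_le_one_of_one_le₀ (one_le_pow₀ this)

theorem cycleWeight_cut {P : Perm α} {x : α} {k : ℕ} (hk : 0 < k) (hkl : k < (cyc P x).card) :
    cycleWeight (swap x ((P ^ k) x) * P) = cycleWeight P *
      (((cyc P x).card : ℝ) ^ 2 / ((k : ℝ) ^ 2 * (((cyc P x).card - k : ℕ) : ℝ) ^ 2)) := by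
  have h := prod_cycles_cut (fun l : ℕ => ((l : ℝ) ^ 2)⁻¹) hk hkl
  have h1 : (0 : ℝ) < (cyc P x).card := by exact_mod_cast card_cyc_pos P x
  have h2 : (0 : ℝ) < k := by exact_mod_cast hk
  have h3 : (0 : ℝ) < ((cyc P x).card - k : ℕ) := by exact_mod_cast Nat.sub_pos_of_lt hkl
  simp only [cycleWeight]
  generalize (∏ B ∈ cycles P, ((B.card : ℝ) ^ 2)⁻¹) = u at *
  generalize (∏ B ∈ cycles (swap x ((P ^ k) x) * P), ((B.card : ℝ) ^ 2)⁻¹) = v at *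
  field_simp at h ⊢
  linarith

theorem cycleWeight_join {P : Perm α} {x y : α} (h : ¬ P.SameCycle x y) :
    cycleWeight (swap x y * P) ≤ (Fintype.card α : ℝ) ^ 2 * cycleWeight P := by
  have h' := prod_cycles_join h (fun l : ℕ => ((l : ℝ) ^ 2)⁻¹)
  have h1 : (1 : ℝ) ≤ (cyc P x).card := by exact_mod_cast card_cyc_pos P x
  have h2 : (1 : ℝ) ≤ (cyc P y).card := by exact_mod_cast card_cyc_pos P y
  have h3 : ((cyc P x).card : ℝ) ≤ Fintype.card α := by exact_mod_cast Finset.card_le_univ _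
  have h4 := cycleWeight_pos P
  push_cast at h'
  change cycleWeight _ * _ * _ = cycleWeight _ * _ at h'
  have h5 : cycleWeight (swap x y * P) = cycleWeight P *
      ((cyc P x).card * (cyc P y).card / ((cyc P x).card + (cyc P y).card)) ^ 2 := by
    field_simp at h' ⊢
    linarith
  rw [h5, mul_comm]
  gcongr
  rw [div_le_iff₀ (by positivity)]
  nlinarith

/-- The summand is (1/j + 1/(l-j))², the factor by which the weight changes when a cycle of length l
is cut into j and l - j. Its sum is bounded independently of l because 1/j² is summable; this is the
reason for the exponent in `cycleWeight`. -/
theorem sum_inv_sq_mul_inv_sq_le (l : ℕ) :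
    ∑ j ∈ Finset.Ico 1 l, (l : ℝ) ^ 2 / ((j : ℝ) ^ 2 * ((l - j : ℕ) : ℝ) ^ 2) ≤ 16 := by
  have h1 : ∀ j ∈ Finset.Ico 1 l, (l : ℝ) ^ 2 / ((j : ℝ) ^ 2 * ((l - j : ℕ) : ℝ) ^ 2) ≤
      4 * ((j : ℝ) ^ 2)⁻¹ + 4 * (((l - j : ℕ) : ℝ) ^ 2)⁻¹ := by
    intro j hj
    rw [Finset.mem_Ico] at hj
    have hj1 : (0 : ℝ) < j := by exact_mod_cast hj.1
    have hj2 : (0 : ℝ) < (l - j : ℕ) := by exact_mod_cast Nat.sub_pos_of_lt hj.2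
    have hl : (l : ℝ) = j + (l - j : ℕ) := by rw [Nat.cast_sub hj.2.le]; ring
    rw [hl]
    generalize ((l - j : ℕ) : ℝ) = b at *
    rw [div_le_iff₀ (by positivity)]
    have : (4 * ((j : ℝ) ^ 2)⁻¹ + 4 * (b ^ 2)⁻¹) * ((j : ℝ) ^ 2 * b ^ 2) = 4 * b ^ 2 + 4 * j ^ 2 := by
      field_simp
    rw [this]
    nlinarith [sq_nonneg ((j : ℝ) - b)]
  have h2 : ∀ n : ℕ, ∑ j ∈ Finset.Ico 1 n, ((j : ℝ) ^ 2)⁻¹ ≤ 2 := by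
    intro n
    have h := sum_Ioo_inv_sq_le (α := ℝ) 0 n
    have h' : Finset.Ico 1 n = Finset.Ioo 0 n := by ext; simp; omega
    rw [h']
    simpa using h
  have h3 : ∑ j ∈ Finset.Ico 1 l, (((l - j : ℕ) : ℝ) ^ 2)⁻¹ = ∑ j ∈ Finset.Ico 1 l, ((j : ℝ) ^ 2)⁻¹ := by
    refine Finset.sum_nbij' (fun j => l - j) (fun j => l - j) ?_ ?_ ?_ ?_ ?_ <;>
      simp only [Finset.mem_Ico] <;> intros <;> first | omega | trivial
  calc _ ≤ ∑ j ∈ Finset.Ico 1 l, (4 * ((j : ℝ) ^ 2)⁻¹ + 4 * (((l - j : ℕ) : ℝ) ^ 2)⁻¹) :=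
        Finset.sum_le_sum h1
    _ = 8 * ∑ j ∈ Finset.Ico 1 l, ((j : ℝ) ^ 2)⁻¹ := by
        rw [Finset.sum_add_distrib, ← Finset.mul_sum, ← Finset.mul_sum, h3]; ring
    _ ≤ 16 := by linarith [h2 l]

/-- For a fixed first point the second one runs through the other positions on its cycle, which
costs a factor 16. Fixed points allow no cut, so only the support counts. -/
theorem sum_cut_cycleWeight_le (P : Perm α) :
    ∑ p : α × α with P.SameCycle p.1 p.2 ∧ p.1 ≠ p.2, cycleWeight (swap p.1 p.2 * P) ≤
      16 * P.support.card * cycleWeight P := by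
  have hx : ∀ x : α, ∑ y ∈ (cyc P x).erase x, cycleWeight (swap x y * P) ≤
      if x ∈ P.support then 16 * cycleWeight P else 0 := by
    intro x
    split_ifs with hxs
    · have : (cyc P x).erase x =
          (Finset.Ico 1 (cyc P x).card).image fun j => (P ^ j) x := by
        ext w
        simp only [Finset.mem_erase, mem_cyc, Finset.mem_image, Finset.mem_Ico]
        constructor
        · rintro ⟨hw, h⟩
          obtain ⟨i, hi, rfl⟩ := exists_pow_of_sameCycle h
          refine ⟨i, ⟨Nat.one_le_iff_ne_zero.2 ?_, hi⟩, rfl⟩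
          rintro rfl
          simp at hw
        · rintro ⟨i, ⟨h1, h2⟩, rfl⟩
          refine ⟨fun h => ?_, by simp [Perm.SameCycle.refl]⟩
          have := Nat.le_of_dvd h1 ((pow_apply_eq_self_iff P x i).1 h)
          omega
      rw [this, Finset.sum_image]
      · rw [Finset.sum_congr rfl fun j hj => cycleWeight_cut (Finset.mem_Ico.1 hj).1
          (Finset.mem_Ico.1 hj).2, ← Finset.mul_sum, mul_comm]
        exact mul_le_mul_of_nonneg_right (sum_inv_sq_mul_inv_sq_le _) (cycleWeight_pos P).le
      · intro i hi j hj h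
        simp only [Finset.coe_Ico, Set.mem_Ico] at hi hj
        exact pow_injOn P x (show i < _ by omega) (show j < _ by omega) h
    · rw [Perm.notMem_support] at hxs
      rw [cyc_of_fixed hxs]
      simp
  have h1 : ∑ p : α × α with P.SameCycle p.1 p.2 ∧ p.1 ≠ p.2, cycleWeight (swap p.1 p.2 * P) =
      ∑ x, ∑ y ∈ (cyc P x).erase x, cycleWeight (swap x y * P) := by
    rw [Finset.sum_filter, Fintype.sum_prod_type]
    refine Finset.sum_congr rfl fun x _ => ?_
    rw [← Finset.sum_filter]
    refine Finset.sum_congr ?_ fun _ _ => rfl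
    ext y
    simp [and_comm, eq_comm]
  rw [h1]
  refine (Finset.sum_le_sum fun x _ => hx x).trans ?_
  rw [← Finset.sum_filter, Finset.sum_const]
  simp only [Finset.filter_univ_mem, nsmul_eq_mul]
  exact le_of_eq (by ring)

/-- `G` bounds the excess of the number of steps over the minimal number. A cut leaves the excess
unchanged, a diagonal pair lowers it by one, a join by two; the powers of the degree n in the bound
pay for the latter two kinds, so that each contributes at most the weight itself. The cuts
contribute 16 times the size of the support, which is at most 2(k + 1) if the remaining steps reach
the identity. Thus one step costs at most 32(k + 1) + 1 + 1 ≤ 34(k + 1), and the product over all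
steps is 34^k k!. -/
theorem walks_le [Nonempty α] {k G : ℕ} {σ : Perm α}
    (hkG : k + (cycles σ).card ≤ Fintype.card α + G) :
    (walks k σ : ℝ) ≤ 34 ^ k * k.factorial * (Fintype.card α : ℝ) ^ (2 * G) * cycleWeight σ := by
  have hn : (1 : ℝ) ≤ Fintype.card α := by exact_mod_cast Fintype.card_pos
  induction k generalizing σ G with
  | zero =>
    have h0 := cycleWeight_pos σ
    rcases eq_or_ne (walks 0 σ) 0 with h | h
    · rw [h]; push_cast; positivity
    have h1 : σ = 1 := by by_contra h'; simp [walks, h'] at h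
    subst h1
    have h2 : cycleWeight (1 : Perm α) = 1 := by
      refine Finset.prod_eq_one fun B hB => ?_
      obtain ⟨x, rfl⟩ := mem_cycles.1 hB
      rw [cyc_of_fixed (by simp)]; simp
    simp only [walks, h2, if_pos, Nat.cast_one, pow_zero, Nat.factorial_zero, one_mul, mul_one]
    exact one_le_pow₀ hn
  | succ k ih =>
    have h0 := cycleWeight_pos σ
    rcases eq_or_ne (walks (k + 1) σ) 0 with h | h
    · rw [h]; push_cast; positivity
    have hsupp := card_support_le_of_walks_ne_zero h
    set n : ℝ := (Fintype.card α : ℝ) with hn_def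
    set A : ℝ := 34 ^ k * k.factorial * n ^ (2 * G) with hA
    have hA0 : 0 ≤ A := by positivity
    have hmono : ∀ {G' : ℕ} {b : ℝ} {j : ℕ}, b ≤ n ^ j → j + 2 * G' = 2 * G →
        b * (34 ^ k * k.factorial * n ^ (2 * G')) ≤ A := by
      intro G' b j hb hj
      rw [hA, ← hj, pow_add]
      calc b * (34 ^ k * k.factorial * n ^ (2 * G'))
          ≤ n ^ j * (34 ^ k * k.factorial * n ^ (2 * G')) := by gcongr
        _ = _ := by ring
    have hdiag : ∑ p : α × α with p.1 = p.2, (walks k (swap p.1 p.2 * σ) : ℝ) ≤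
        A * cycleWeight σ := by
      have : ∀ p ∈ Finset.univ.filter (fun p : α × α => p.1 = p.2),
          (walks k (swap p.1 p.2 * σ) : ℝ) = walks k σ := by
        intro p hp
        rw [(Finset.mem_filter.1 hp).2, swap_self_mul]
      rw [Finset.sum_congr rfl this, Finset.sum_const, nsmul_eq_mul]
      have hcard : (Finset.univ.filter (fun p : α × α => p.1 = p.2)).card = Fintype.card α := by
        have : Finset.univ.filter (fun p : α × α => p.1 = p.2) = (Finset.univ : Finset α).diag := by
          ext p; simp
        rw [this, Finset.diag_card, Finset.card_univ]
      rw [hcard]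
      rcases eq_or_ne (walks k σ) 0 with h1 | h1
      · rw [h1]; push_cast; rw [mul_zero]; positivity
      have h2 := card_le_of_walks_ne_zero h1
      -- With excess zero a wasted step leaves too few swaps to reach the identity. The n diagonal
      -- pairs are paid by the factor n² that is set free.
      obtain ⟨G', rfl⟩ : ∃ G', G = G' + 1 := ⟨G - 1, by omega⟩
      have h3 := ih (σ := σ) (G := G') (by omega)
      calc n * walks k σ ≤ n * (34 ^ k * k.factorial * n ^ (2 * G') * cycleWeight σ) := by gcongr
        _ = n * (34 ^ k * k.factorial * n ^ (2 * G')) * cycleWeight σ := by ring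
        _ ≤ _ := by
          refine mul_le_mul_of_nonneg_right (hmono (j := 2) ?_ (by omega)) h0.le
          nlinarith
    have hcut : ∑ p : α × α with σ.SameCycle p.1 p.2 ∧ p.1 ≠ p.2,
        (walks k (swap p.1 p.2 * σ) : ℝ) ≤ A * (32 * (k + 1)) * cycleWeight σ := by
      calc _ ≤ ∑ p : α × α with σ.SameCycle p.1 p.2 ∧ p.1 ≠ p.2,
              A * cycleWeight (swap p.1 p.2 * σ) := by
            refine Finset.sum_le_sum fun p hp => ?_
            obtain ⟨x, y⟩ := p
            obtain ⟨-, h1, h2⟩ := Finset.mem_filter.1 hp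
            dsimp only at h1 h2 ⊢
            obtain ⟨j, hj, rfl⟩ := exists_pow_of_sameCycle h1
            have hj0 : 0 < j := Nat.pos_of_ne_zero fun h => h2 (by simp [h])
            refine ih ?_
            have := card_cycles_cut hj0 hj
            omega
        _ ≤ A * (16 * σ.support.card * cycleWeight σ) := by
            rw [← Finset.mul_sum]
            exact mul_le_mul_of_nonneg_left (sum_cut_cycleWeight_le σ) hA0
        _ ≤ A * (16 * (2 * (k + 1)) * cycleWeight σ) := by
            have : (σ.support.card : ℝ) ≤ 2 * (k + 1) := by exact_mod_cast hsupp
            gcongr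
        _ = _ := by ring
    have hjoin : ∑ p : α × α with ¬ σ.SameCycle p.1 p.2,
        (walks k (swap p.1 p.2 * σ) : ℝ) ≤ A * cycleWeight σ := by
      have hterm : ∀ p ∈ Finset.univ.filter (fun p : α × α => ¬ σ.SameCycle p.1 p.2),
          n ^ 2 * (walks k (swap p.1 p.2 * σ) : ℝ) ≤ A * cycleWeight σ := by
        intro p hp
        have hp' := (Finset.mem_filter.1 hp).2
        rcases eq_or_ne (walks k (swap p.1 p.2 * σ)) 0 with h1 | h1
        · rw [h1]; push_cast; rw [mul_zero]; positivity
        have h2 := card_le_of_walks_ne_zero h1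
        have h3 := card_cycles_join hp'
        -- The excess falls by two, which frees n⁴: one n² for the number of pairs, the other for
        -- the growth of the weight under a join.
        obtain ⟨G', rfl⟩ : ∃ G', G = G' + 2 := ⟨G - 2, by omega⟩
        have h4 := ih (σ := swap p.1 p.2 * σ) (G := G') (by omega)
        calc n ^ 2 * (walks k (swap p.1 p.2 * σ) : ℝ)
            ≤ n ^ 2 * (34 ^ k * k.factorial * n ^ (2 * G') * (n ^ 2 * cycleWeight σ)) := by
              refine mul_le_mul_of_nonneg_left (h4.trans ?_) (by positivity)
              exact mul_le_mul_of_nonneg_left (cycleWeight_join hp') (by positivity)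
          _ = n ^ 4 * (34 ^ k * k.factorial * n ^ (2 * G')) * cycleWeight σ := by ring
          _ ≤ _ := mul_le_mul_of_nonneg_right (hmono le_rfl (by omega)) h0.le
      have h5 := Finset.sum_le_sum hterm
      rw [← Finset.mul_sum, Finset.sum_const, nsmul_eq_mul] at h5
      have h6 : ((Finset.univ.filter (fun p : α × α => ¬ σ.SameCycle p.1 p.2)).card : ℝ) ≤ n ^ 2 := by
        rw [hn_def, sq]
        exact_mod_cast (Finset.card_filter_le _ _).trans (by simp [Finset.card_univ])
      have h7 : n ^ 2 * ∑ p : α × α with ¬ σ.SameCycle p.1 p.2,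
          (walks k (swap p.1 p.2 * σ) : ℝ) ≤ n ^ 2 * (A * cycleWeight σ) :=
        h5.trans (mul_le_mul_of_nonneg_right h6 (by positivity))
      exact le_of_mul_le_mul_left h7 (by positivity)
    have hsplit : (walks (k + 1) σ : ℝ) =
        ∑ p : α × α with p.1 = p.2, (walks k (swap p.1 p.2 * σ) : ℝ) +
        ∑ p : α × α with σ.SameCycle p.1 p.2 ∧ p.1 ≠ p.2, (walks k (swap p.1 p.2 * σ) : ℝ) +
        ∑ p : α × α with ¬ σ.SameCycle p.1 p.2, (walks k (swap p.1 p.2 * σ) : ℝ) := by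
      simp only [walks, Nat.cast_sum]
      rw [← Finset.sum_filter_add_sum_filter_not _ (fun p : α × α => σ.SameCycle p.1 p.2),
        ← Finset.sum_filter_add_sum_filter_not
          (Finset.univ.filter fun p : α × α => σ.SameCycle p.1 p.2) (fun p => p.1 = p.2),
        Finset.filter_filter, Finset.filter_filter]
      congr 3
      ext p
      simp only [Finset.mem_filter, Finset.mem_univ, true_and, and_iff_right_iff_imp]
      rintro h
      rw [h]
    rw [hsplit]
    calc _ ≤ A * cycleWeight σ + A * (32 * (k + 1)) * cycleWeight σ + A * cycleWeight σ := by
          gcongr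
      _ = A * cycleWeight σ * (32 * k + 34) := by ring
      _ ≤ A * cycleWeight σ * (34 * (k + 1)) := by
          have : (0 : ℝ) ≤ k := k.cast_nonneg
          gcongr
          linarith
      _ = _ := by
          rw [hA, Nat.factorial_succ, pow_succ]
          push_cast
          ring

end Walks


/-! ### Transitive factorizations of the identity: joining swaps and the other swaps. -/

section TreeWalks

variable {α : Type*} [Fintype α] [DecidableEq α]

/-- The count of sequences of `ρ` swaps, where each swap either joins two cycles of `Q` or is moved
past `Q` to the factor `D`, such that `Q` ends as a single cycle with inverse `D`. -/
def treeWalks : ℕ → Perm α → Perm α → ℕ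
  | 0, Q, D => if (cycles Q).card = 1 ∧ Q * D = 1 then 1 else 0
  | ρ + 1, Q, D => ∑ p : α × α,
      if Q.SameCycle p.1 p.2 then treeWalks ρ Q (Q⁻¹ * swap p.1 p.2 * Q * D)
      else treeWalks ρ (swap p.1 p.2 * Q) D

theorem card_cycles_pos [Nonempty α] (Q : Perm α) : 0 < (cycles Q).card :=
  Finset.card_pos.2 ⟨_, cyc_mem_cycles Q (Classical.arbitrary α)⟩

theorem treeWalks_le [Nonempty α] (ρ : ℕ) (Q D : Perm α) :
    treeWalks ρ Q D ≤ ∑ ζ : Perm α with (cycles ζ).card = 1,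
      ρ.choose ((cycles Q).card - 1) * walks ((cycles Q).card - 1) (Q * ζ⁻¹) *
        walks (ρ - ((cycles Q).card - 1)) (D * ζ) := by
  induction ρ generalizing Q D with
  | zero =>
    simp only [treeWalks]
    split_ifs with h
    · have hDQ : D * Q = 1 := mul_eq_one_comm.1 h.2
      refine le_trans ?_ (Finset.single_le_sum (fun _ _ => Nat.zero_le _)
        (Finset.mem_filter.2 ⟨Finset.mem_univ Q, h.1⟩))
      simp [h.1, walks, hDQ]
    · exact Nat.zero_le _
  | succ ρ ih =>
    set l := (cycles Q).card - 1 with hl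
    have hc := card_cycles_pos Q
    have h1 : ∑ p : α × α with Q.SameCycle p.1 p.2,
        treeWalks ρ Q (Q⁻¹ * swap p.1 p.2 * Q * D) ≤
        ∑ ζ : Perm α with (cycles ζ).card = 1,
          ρ.choose l * walks l (Q * ζ⁻¹) * walks (ρ + 1 - l) (D * ζ) := by
      calc _ ≤ ∑ p : α × α, treeWalks ρ Q (Q⁻¹ * swap p.1 p.2 * Q * D) :=
            Finset.sum_le_sum_of_subset (Finset.filter_subset _ _)
        _ = ∑ p : α × α, treeWalks ρ Q (swap p.1 p.2 * D) := by
            -- Conjugation by `Q` only permutes the pairs, so the conjugated swap may be replaced by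
            -- an arbitrary one.
            rw [← (Equiv.prodCongr (Q⁻¹ : Perm α) (Q⁻¹ : Perm α)).sum_comp
              (fun p => treeWalks ρ Q (swap p.1 p.2 * D))]
            refine Finset.sum_congr rfl fun p _ => ?_
            simp only [Equiv.prodCongr_apply, Prod.map_fst, Prod.map_snd]
            rw [Equiv.swap_apply_apply, inv_inv]
        _ ≤ ∑ p : α × α, ∑ ζ : Perm α with (cycles ζ).card = 1,
              ρ.choose l * walks l (Q * ζ⁻¹) * walks (ρ - l) (swap p.1 p.2 * D * ζ) :=
            Finset.sum_le_sum fun p _ => ih Q _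
        _ = _ := by
            rw [Finset.sum_comm]
            refine Finset.sum_congr rfl fun ζ _ => ?_
            rw [← Finset.mul_sum]
            by_cases hlρ : l ≤ ρ
            · rw [show ρ + 1 - l = (ρ - l) + 1 by omega, walks]
              simp only [mul_assoc]
            · rw [Nat.choose_eq_zero_of_lt (by omega)]; simp
    have h2 : ∑ p : α × α with ¬ Q.SameCycle p.1 p.2, treeWalks ρ (swap p.1 p.2 * Q) D ≤
        ∑ ζ : Perm α with (cycles ζ).card = 1,
          (if l = 0 then 0 else ρ.choose (l - 1)) * walks l (Q * ζ⁻¹) * walks (ρ + 1 - l) (D * ζ) := by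
      rcases Nat.eq_zero_or_pos l with hl0 | hl0
      · refine le_trans (le_of_eq ?_) (Nat.zero_le _)
        refine Finset.sum_eq_zero fun p hp => ?_
        have := card_cycles_join (Finset.mem_filter.1 hp).2
        have := card_cycles_pos (swap p.1 p.2 * Q)
        omega
      · rw [if_neg hl0.ne']
        obtain ⟨l', hl'⟩ : ∃ l', l = l' + 1 := ⟨l - 1, by omega⟩
        calc _ ≤ ∑ p : α × α with ¬ Q.SameCycle p.1 p.2,
              ∑ ζ : Perm α with (cycles ζ).card = 1,
              ρ.choose l' * walks l' (swap p.1 p.2 * Q * ζ⁻¹) * walks (ρ - l') (D * ζ) := by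
              refine Finset.sum_le_sum fun p hp => ?_
              have h3 := card_cycles_join (Finset.mem_filter.1 hp).2
              have h4 := ih (swap p.1 p.2 * Q) D
              rwa [show (cycles (swap p.1 p.2 * Q)).card - 1 = l' by omega] at h4
          _ ≤ ∑ p : α × α, ∑ ζ : Perm α with (cycles ζ).card = 1,
              ρ.choose l' * walks l' (swap p.1 p.2 * Q * ζ⁻¹) * walks (ρ - l') (D * ζ) :=
              Finset.sum_le_sum_of_subset (Finset.filter_subset _ _)
          _ = _ := by
              rw [Finset.sum_comm, hl']
              refine Finset.sum_congr rfl fun ζ _ => ?_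
              rw [← Finset.sum_mul, ← Finset.mul_sum, Nat.add_sub_cancel,
                show ρ + 1 - (l' + 1) = ρ - l' by omega, walks]
              simp only [mul_assoc]
    rw [treeWalks, Finset.sum_ite]
    refine (add_le_add h1 h2).trans (le_of_eq ?_)
    rw [← Finset.sum_add_distrib]
    refine Finset.sum_congr rfl fun ζ _ => ?_
    rw [← add_mul, ← add_mul]
    congr 2
    -- Pascal's rule: the first step is either moved aside or is one of the joins.
    rcases Nat.eq_zero_or_pos l with hl0 | hl0
    · simp [hl0]
    · rw [if_neg hl0.ne']
      obtain ⟨l', hl'⟩ : ∃ l', l = l' + 1 := ⟨l - 1, by omega⟩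
      rw [hl', Nat.add_sub_cancel, Nat.choose_succ_succ, add_comm]

/-- Every sequence of pairs is counted for exactly one ζ, namely the inverse of its product. -/
theorem sum_walks (l : ℕ) : ∑ ζ : Perm α, walks l ζ = (Fintype.card α ^ 2) ^ l := by
  induction l with
  | zero => simp [walks]
  | succ l ih =>
    simp only [walks]
    rw [Finset.sum_comm]
    have : ∀ p : α × α, ∑ ζ : Perm α, walks l (swap p.1 p.2 * ζ) = (Fintype.card α ^ 2) ^ l := by
      intro p
      rw [← ih]
      exact Equiv.sum_comp (Equiv.mulLeft (swap p.1 p.2)) (walks l)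
    rw [Finset.sum_congr rfl fun p _ => this p]
    simp [Finset.card_univ, pow_succ]
    ring

/-- The product of the swaps given by a sequence of pairs, the first one being applied first. -/
def seqProd : (ρ : ℕ) → (Fin ρ → α × α) → Perm α
  | 0, _ => 1
  | ρ + 1, p => seqProd ρ (Fin.tail p) * swap (p 0).1 (p 0).2

/-- Every set that is invariant under `Q` and the swaps is trivial. -/
def Connects (Q : Perm α) {ρ : ℕ} (p : Fin ρ → α × α) : Prop :=
  ∀ f : α → Prop, (∀ x, f (Q x) ↔ f x) → (∀ i, f (p i).1 ↔ f (p i).2) → ∀ x y, f x → f y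

omit [Fintype α] [DecidableEq α] in
theorem iff_of_sameCycle {Q : Perm α} {f : α → Prop} (hf : ∀ x, f (Q x) ↔ f x) {x y : α}
    (h : Q.SameCycle x y) : f x ↔ f y := by
  obtain ⟨i, rfl⟩ := h
  induction i with
  | zero => simp
  | succ i ih => rw [add_comm, zpow_add, Perm.mul_apply, zpow_one, hf]; exact ih
  | pred i ih =>
    rw [ih, ← hf ((Q ^ (-(i : ℤ) - 1)) x), ← Perm.mul_apply, ← zpow_one_add,
      show 1 + (-(i : ℤ) - 1) = -i by ring]

-- A swap inside a cycle of `Q` is moved past `Q` by conjugation, which keeps the total product; it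
-- links no new orbits, so it can be dropped from the connectivity condition. A swap between two
-- cycles is absorbed into `Q`. When no swap is left, connectivity says that `Q` has a single cycle.
open Classical in
theorem card_seq_le_treeWalks [Nonempty α] (ρ : ℕ) (Q D : Perm α) :
    (Finset.univ.filter fun p : Fin ρ → α × α => seqProd ρ p * Q * D = 1 ∧ Connects Q p).card ≤
      treeWalks ρ Q D := by
  induction ρ generalizing Q D with
  | zero =>
    simp only [treeWalks]
    split_ifs with h
    · exact (Finset.card_filter_le _ _).trans (by simp)
    · rw [Nat.le_zero, Finset.card_eq_zero, Finset.filter_eq_empty_iff]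
      rintro p - ⟨h1, h2⟩
      refine h ⟨?_, by simpa [seqProd] using h1⟩
      rw [Finset.card_eq_one]
      let x := Classical.arbitrary α
      refine ⟨cyc Q x, Finset.eq_singleton_iff_unique_mem.2 ⟨cyc_mem_cycles Q x, ?_⟩⟩
      intro B hB
      obtain ⟨y, rfl⟩ := mem_cycles.1 hB
      rw [cyc_eq_cyc]
      exact (h2 (Q.SameCycle x) (by simp) (fun i => i.elim0) x y (Perm.SameCycle.refl _ _)).symm
  | succ ρ ih =>
    rw [Finset.card_filter, ← (Fin.consEquiv (fun _ => α × α)).sum_comp, Fintype.sum_prod_type,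
      treeWalks]
    refine Finset.sum_le_sum fun b _ => ?_
    rw [← Finset.card_filter]
    split_ifs with h
    · refine le_trans (Finset.card_le_card ?_) (ih _ _)
      intro p hp
      replace hp := (Finset.mem_filter.1 hp).2
      refine Finset.mem_filter.2 ⟨Finset.mem_univ _, ?_⟩
      change seqProd ρ p * swap b.1 b.2 * Q * D = 1 ∧ Connects Q (Fin.cons b p : Fin (ρ + 1) → α × α) at hp
      refine ⟨by rw [← hp.1]; group, fun f hf hp' => hp.2 f hf fun i => ?_⟩
      refine Fin.cases ?_ (fun i => ?_) i
      · simpa using iff_of_sameCycle hf h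
      · simpa using hp' i
    · refine le_trans (Finset.card_le_card ?_) (ih _ _)
      intro p hp
      replace hp := (Finset.mem_filter.1 hp).2
      refine Finset.mem_filter.2 ⟨Finset.mem_univ _, ?_⟩
      change seqProd ρ p * swap b.1 b.2 * Q * D = 1 ∧ Connects Q (Fin.cons b p : Fin (ρ + 1) → α × α) at hp
      refine ⟨by rw [← hp.1]; group, fun f hf hp' => ?_⟩
      have hb : f b.1 ↔ f b.2 := iff_of_sameCycle hf (sameCycle_join_pair h)
      refine hp.2 f (fun x => ?_) fun i => ?_
      · rw [← hf x, Perm.mul_apply]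
        rcases eq_or_ne (Q x) b.1 with h1 | h1
        · rw [h1, swap_apply_left, hb]
        rcases eq_or_ne (Q x) b.2 with h2 | h2
        · rw [h2, swap_apply_right, hb]
        rw [swap_apply_of_ne_of_ne h1 h2]
      · refine Fin.cases ?_ (fun i => ?_) i
        · simpa using hb
        · simpa using hp' i

open Classical in
/-- An upper bound for the number of transitive factorizations of the identity into `ρ` swaps. -/
theorem card_seq_le [Nonempty α] {ρ G : ℕ} (hρ : ρ + 2 ≤ 2 * Fintype.card α + G) :
    ((Finset.univ.filter fun p : Fin ρ → α × α => seqProd ρ p = 1 ∧ Connects 1 p).card : ℝ) ≤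
      2 ^ ρ * (Fintype.card α : ℝ) ^ (2 * Fintype.card α) *
        (34 ^ ρ * (ρ + 1 - Fintype.card α).factorial * (Fintype.card α : ℝ) ^ (2 * G)) := by
  have h1 := card_seq_le_treeWalks (α := α) ρ 1 1
  have h2 := treeWalks_le (α := α) ρ 1 1
  simp only [mul_one, one_mul, cycles_one] at h1 h2
  have hn : 0 < Fintype.card α := Fintype.card_pos
  set n := Fintype.card α with hn_def
  have hn1 : (1 : ℝ) ≤ n := by exact_mod_cast hn
  set K : ℝ := 34 ^ ρ * (ρ + 1 - n).factorial * (n : ℝ) ^ (2 * G) with hK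
  -- Only the number of factorizations of ζ is bounded for each ζ separately. The other factor is
  -- kept, because its sum over all ζ is known exactly.
  have h3 : ∀ ζ ∈ Finset.univ.filter (fun ζ : Perm α => (cycles ζ).card = 1),
      ((ρ.choose (n - 1) * walks (n - 1) ζ⁻¹ * walks (ρ - (n - 1)) ζ : ℕ) : ℝ) ≤
        2 ^ ρ * K * walks (n - 1) ζ⁻¹ := by
    intro ζ hζ
    have hζ' := (Finset.mem_filter.1 hζ).2
    push_cast
    by_cases hnρ : n - 1 ≤ ρ
    · have h4 : (walks (ρ - (n - 1)) ζ : ℝ) ≤ K := by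
        refine (walks_le (G := G) (σ := ζ) (by omega)).trans ?_
        rw [← hn_def, hK, show ρ - (n - 1) = ρ + 1 - n by omega]
        calc _ ≤ 34 ^ (ρ + 1 - n) * ((ρ + 1 - n).factorial : ℝ) * (n : ℝ) ^ (2 * G) * 1 := by
              gcongr; exact cycleWeight_le_one ζ
          _ ≤ _ := by
              rw [mul_one]
              gcongr
              · norm_num
              · omega
      have h5 : (ρ.choose (n - 1) : ℝ) ≤ 2 ^ ρ := by exact_mod_cast Nat.choose_le_two_pow ρ (n - 1)
      calc _ ≤ 2 ^ ρ * (walks (n - 1) ζ⁻¹ : ℝ) * K := by gcongr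
        _ = _ := by ring
    · rw [Nat.choose_eq_zero_of_lt (by omega)]
      have : 0 ≤ K := by positivity
      push_cast
      rw [zero_mul, zero_mul]
      positivity
  have h6 : (∑ ζ : Perm α, (walks (n - 1) ζ⁻¹ : ℝ)) = ((n : ℝ) ^ 2) ^ (n - 1) := by
    have := sum_walks (α := α) (n - 1)
    rw [← Equiv.sum_comp (Equiv.inv (Perm α))] at this
    exact_mod_cast this
  calc _ ≤ ((∑ ζ : Perm α with (cycles ζ).card = 1,
          ρ.choose (n - 1) * walks (n - 1) ζ⁻¹ * walks (ρ - (n - 1)) ζ : ℕ) : ℝ) := by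
        exact_mod_cast h1.trans h2
    _ ≤ ∑ ζ : Perm α with (cycles ζ).card = 1, 2 ^ ρ * K * walks (n - 1) ζ⁻¹ := by
        rw [Nat.cast_sum]; exact Finset.sum_le_sum h3
    _ ≤ ∑ ζ : Perm α, 2 ^ ρ * K * walks (n - 1) ζ⁻¹ :=
        Finset.sum_le_sum_of_subset_of_nonneg (Finset.filter_subset _ _)
          fun _ _ _ => by positivity
    _ = 2 ^ ρ * K * ((n : ℝ) ^ 2) ^ (n - 1) := by rw [← Finset.mul_sum, h6]
    _ ≤ 2 ^ ρ * K * (n : ℝ) ^ (2 * n) := by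
        rw [← pow_mul]
        exact mul_le_mul_of_nonneg_left (pow_le_pow_right₀ hn1 (by omega)) (by positivity)
    _ = _ := by ring

/-- Every permutation moving at most `d` points is a product of `d` swaps or identities. -/
theorem exists_seqProd_eq [Nonempty α] (d : ℕ) (σ : Perm α) (h : σ.support.card ≤ d) :
    ∃ p : Fin d → α × α, seqProd d p = σ := by
  induction d generalizing σ with
  | zero =>
    have : σ = 1 := by simpa using h
    exact ⟨fun i => i.elim0, by rw [this]; rfl⟩
  | succ d ih =>
    by_cases hσ : σ = 1
    · obtain ⟨p, hp⟩ := ih 1 (by simp)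
      let x := Classical.arbitrary α
      refine ⟨Fin.cons (x, x) p, ?_⟩
      rw [seqProd, Fin.tail_cons, hp, Fin.cons_zero, hσ]
      ext; simp
    · obtain ⟨x, hx⟩ : ∃ x, σ x ≠ x := by
        by_contra h'
        push Not at h'
        exact hσ (Equiv.ext h')
      -- The swap makes `x` a fixed point and moves no point that was fixed. If σ is already
      -- trivial, diagonal pairs fill up the sequence.
      have h1 : (σ * swap x (σ⁻¹ x)).support.card < σ.support.card := by
        refine Finset.card_lt_card ⟨?_, fun h' => ?_⟩
        · intro y hy
          rw [Perm.mem_support] at hy ⊢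
          intro hy'
          rw [Perm.mul_apply] at hy
          rcases eq_or_ne y x with rfl | h2
          · exact hx hy'
          rcases eq_or_ne y (σ⁻¹ x) with h3 | h3
          · rw [h3] at hy'
            rw [← Perm.mul_apply, mul_inv_cancel, Perm.one_apply] at hy'
            exact h2 (h3.trans hy'.symm)
          rw [swap_apply_of_ne_of_ne h2 h3] at hy
          exact hy hy'
        · have := h' (Perm.mem_support.2 hx)
          simp at this
      obtain ⟨p, hp⟩ := ih (σ * swap x (σ⁻¹ x)) (by omega)
      refine ⟨Fin.cons (x, σ⁻¹ x) p, ?_⟩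
      rw [seqProd, Fin.tail_cons, hp, Fin.cons_zero, mul_assoc, swap_mul_self, mul_one]

end TreeWalks


/-! ### Complex factorizations as transitive sequences of swaps. -/

section ComplexBound

theorem seqProd_eq_prod {α : Type*} [DecidableEq α] {ρ : ℕ} (p : Fin ρ → α × α) :
    seqProd ρ p = (((List.ofFn p).map fun q => swap q.1 q.2).reverse).prod := by
  induction ρ with
  | zero => simp [seqProd]
  | succ ρ ih =>
    rw [seqProd, ih, List.ofFn_succ, List.map_cons, List.reverse_cons, List.prod_append]
    simp [Fin.tail_def]

theorem seqProd_append {α : Type*} [DecidableEq α] {a b : ℕ} (p : Fin a → α × α)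
    (q : Fin b → α × α) : seqProd (a + b) (Fin.append p q) = seqProd b q * seqProd a p := by
  simp only [seqProd_eq_prod, List.ofFn_fin_append, List.map_append, List.reverse_append,
    List.prod_append]

theorem apply_seqProd_iff {α : Type*} [DecidableEq α] {ρ : ℕ} (p : Fin ρ → α × α) {f : α → Prop}
    (hf : ∀ i, f (p i).1 ↔ f (p i).2) (x : α) : f (seqProd ρ p x) ↔ f x := by
  induction ρ generalizing x with
  | zero => rfl
  | succ ρ ih =>
    rw [seqProd, Perm.mul_apply, ih (Fin.tail p) fun i => hf i.succ]
    rcases eq_or_ne x (p 0).1 with h | h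
    · rw [h, swap_apply_left, hf 0]
    rcases eq_or_ne x (p 0).2 with h' | h'
    · rw [h', swap_apply_right, hf 0]
    rw [swap_apply_of_ne_of_ne h h']

theorem partialProd_eq {n r : ℕ} (T : PermTuple n r) {i : ℕ} (hi : i ≤ r) :
    T.partialProd i = (((List.ofFn T.τ).take i).reverse).prod * T.σ₁ := by
  induction i with
  | zero => simp [PermTuple.partialProd]
  | succ i ih =>
    have h : i < r := hi
    rw [PermTuple.partialProd, dif_pos h, ih h.le, List.take_add_one, List.reverse_append,
      List.prod_append]
    simp [h, mul_assoc]

/-- The parts equal to one are the fixed points, since a cycle type has no part one, and there are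
at least `j` of them. -/
theorem support_card_le {d j : ℕ} {σ : Perm (Fin (d + j))} {lam : d.Partition}
    (h : σ.partition.parts = (addOnes lam j).parts) : σ.support.card ≤ d := by
  have h1 := congrArg (Multiset.count 1) h
  rw [Perm.parts_partition, addOnes, Multiset.count_add, Multiset.count_add,
    Multiset.count_replicate_self, Multiset.count_replicate_self, Fintype.card_fin,
    Multiset.count_eq_zero_of_notMem (fun h => (Perm.one_lt_of_mem_cycleType h).ne rfl)] at h1
  have h2 : σ.support.card ≤ d + j := by simpa using Finset.card_le_univ σ.support
  omega

/-- Each of the two outer permutations is written as `d` swaps or trivial swaps in one chosen way.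
The concatenated sequence determines the factorization, and a set invariant under all swaps is
invariant under the transitive group. -/
theorem complexHurwitz_le (g : ℕ) {d j : ℕ} (lam mu : d.Partition) [NeZero (d + j)] :
    complexHurwitz g (addOnes lam j) (addOnes mu j) ≤
      Nat.card {p : Fin (d + numBranch g (addOnes lam j) (addOnes mu j) + d) →
        Fin (d + j) × Fin (d + j) // seqProd _ p = 1 ∧ Connects 1 p} := by
  set r := numBranch g (addOnes lam j) (addOnes mu j) with hr
  have : Nonempty (Fin (d + j)) := ⟨0⟩
  have h1 : ∀ T : {T : PermTuple (d + j) r // IsFactorization g (addOnes lam j) (addOnes mu j) T},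
      ∃ p : Fin d → Fin (d + j) × Fin (d + j), seqProd d p = T.1.σ₁ :=
    fun T => exists_seqProd_eq d _ (support_card_le T.2.cycleType_left)
  have h2 : ∀ T : {T : PermTuple (d + j) r // IsFactorization g (addOnes lam j) (addOnes mu j) T},
      ∃ p : Fin d → Fin (d + j) × Fin (d + j), seqProd d p = T.1.σ₂ :=
    fun T => exists_seqProd_eq d _ (support_card_le T.2.cycleType_right)
  have h3 : ∀ (T : {T : PermTuple (d + j) r // IsFactorization g (addOnes lam j) (addOnes mu j) T})
      (i : Fin r), ∃ q : Fin (d + j) × Fin (d + j), T.1.τ i = swap q.1 q.2 := fun T i => by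
    obtain ⟨a, b, -, h⟩ := T.2.isSwap i
    exact ⟨(a, b), h⟩
  choose p1 hp1 using h1
  choose p2 hp2 using h2
  choose q hq using h3
  have hτ : ∀ T, seqProd r (q T) * T.1.σ₁ = T.1.partialProd r := by
    intro T
    rw [partialProd_eq T.1 le_rfl, seqProd_eq_prod, List.map_ofFn, List.take_of_length_le (by simp)]
    congr 4
    ext1 i
    exact (hq T i).symm
  have hprod : ∀ T, seqProd _ (Fin.append (Fin.append (p1 T) (q T)) (p2 T)) = 1 := by
    intro T
    rw [seqProd_append, seqProd_append, hp1, hp2, hτ]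
    exact T.2.prod_eq_one
  have hconn : ∀ T, Connects 1 (Fin.append (Fin.append (p1 T) (q T)) (p2 T)) := by
    intro T f _ hf
    have hf1 : ∀ i, f (p1 T i).1 ↔ f (p1 T i).2 := fun i => by
      simpa using hf (Fin.castAdd d (Fin.castAdd r i))
    have hf2 : ∀ i, f (q T i).1 ↔ f (q T i).2 := fun i => by
      simpa using hf (Fin.castAdd d (Fin.natAdd d i))
    have hf3 : ∀ i, f (p2 T i).1 ↔ f (p2 T i).2 := fun i => by
      simpa using hf (Fin.natAdd (d + r) i)
    have hg : ∀ σ ∈ Subgroup.closure (insert T.1.σ₁ (insert T.1.σ₂ (Set.range T.1.τ))),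
        ∀ x, f (σ x) ↔ f x := by
      intro σ hσ
      induction hσ using Subgroup.closure_induction with
      | mem σ h =>
        intro x
        rcases h with rfl | rfl | ⟨i, rfl⟩
        · rw [← hp1]; exact apply_seqProd_iff _ hf1 x
        · rw [← hp2]; exact apply_seqProd_iff _ hf3 x
        · have := apply_seqProd_iff (ρ := 1) (fun _ => q T i) (fun _ => hf2 i) x
          rw [hq]
          simpa [seqProd] using this
      | one => simp
      | mul a b _ _ ha hb => intro x; rw [Perm.mul_apply, ha, hb]
      | inv a _ ha => intro x; rw [← ha (a⁻¹ x), ← Perm.mul_apply, mul_inv_cancel, Perm.one_apply]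
    intro x y hx
    obtain ⟨⟨σ, hσ⟩, rfl⟩ := T.2.transitive.exists_smul_eq x y
    exact (hg σ hσ x).2 hx
  refine Nat.card_le_card_of_injective
    (fun T => ⟨Fin.append (Fin.append (p1 T) (q T)) (p2 T), hprod T, hconn T⟩) ?_
  intro T T' h
  have h := congrArg Subtype.val h
  dsimp only at h
  have e1 : p1 T = p1 T' := funext fun i => by
    simpa using congrFun h (Fin.castAdd d (Fin.castAdd r i))
  have e2 : q T = q T' := funext fun i => by
    simpa using congrFun h (Fin.castAdd d (Fin.natAdd d i))
  have e3 : p2 T = p2 T' := funext fun i => by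
    simpa using congrFun h (Fin.natAdd (d + r) i)
  have f1 : T.1.σ₁ = T'.1.σ₁ := by rw [← hp1, ← hp1, e1]
  have f2 : T.1.τ = T'.1.τ := funext fun i => by rw [hq, hq, e2]
  have f3 : T.1.σ₂ = T'.1.σ₂ := by rw [← hp2, ← hp2, e3]
  apply Subtype.ext
  cases hT : T.1
  cases hT' : T'.1
  rw [hT, hT'] at f1 f2 f3
  simp_all

end ComplexBound

/-! ### The number of real structures on a factorization. -/

section RealBound

theorem partialProd_mem_closure {n r : ℕ} (T : PermTuple n r) (H : Subgroup (Perm (Fin n)))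
    (h : ∀ i ≤ r, T.partialProd i ∈ H) (h2 : T.σ₂ * T.partialProd r = 1) :
    Subgroup.closure (insert T.σ₁ (insert T.σ₂ (Set.range T.τ))) ≤ H := by
  rw [Subgroup.closure_le]
  rintro σ (rfl | rfl | ⟨i, rfl⟩)
  · exact h 0 (Nat.zero_le _)
  · rw [eq_inv_of_mul_eq_one_left h2]
    exact H.inv_mem (h r le_rfl)
  · have h3 := h (i + 1) i.2
    rw [PermTuple.partialProd, dif_pos i.2] at h3
    exact (H.mul_mem_cancel_right (h i i.2.le)).1 h3

/-- The updates multiply from the right by partial products that do not involve γ, so the left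
quotient of two real structures is the same at every index. -/
theorem involution_mul {n r : ℕ} {T T' : RealTuple n r} (s : Fin r → ℤˣ)
    (hT : T.toPermTuple = T'.toPermTuple) (δ : Perm (Fin n)) (hδ : T'.γ = δ * T.γ) (i : ℕ) :
    T'.involution s i = δ * T.involution s i := by
  induction i with
  | zero => exact hδ
  | succ i ih =>
    simp only [RealTuple.involution]
    split_ifs
    · exact ih
    · rw [ih, hT, mul_assoc]

theorem IsRealFactorization.conj_all {g n : ℕ} {lam mu : n.Partition}
    {s : Fin (numBranch g lam mu) → ℤˣ} {T : RealTuple n (numBranch g lam mu)}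
    (h : IsRealFactorization g lam mu s T) {i : ℕ} (hi : i ≤ numBranch g lam mu) :
    T.involution s i * T.involution s i = 1 ∧
      T.involution s i * T.partialProd i * T.involution s i = (T.partialProd i)⁻¹ := by
  have h2 : ∀ i, i ≤ numBranch g lam mu →
      T.involution s i * T.partialProd i * T.involution s i = (T.partialProd i)⁻¹ := by
    intro i hi
    rcases Nat.eq_zero_or_pos i with rfl | hi0
    · exact h.conj_zero
    · exact h.conj i hi0 hi
  refine ⟨?_, h2 i hi⟩
  induction i with
  | zero => exact h.involutive
  | succ i ih =>
    simp only [RealTuple.involution]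
    split_ifs
    · exact ih (by omega)
    · have := h2 i (by omega)
      rw [← mul_assoc, this, inv_mul_cancel]

/-- A transitive factorization has at most `n` real structures. -/
theorem realMixedHurwitzAt_le (g : ℕ) {n : ℕ} [NeZero n] (lam mu : n.Partition) (k : ℕ)
    (s : Fin (numBranch g lam mu) → ℤˣ) :
    realMixedHurwitzAt g lam mu k s ≤ complexHurwitz g lam mu * n := by
  have : Finite (PermTuple n (numBranch g lam mu)) :=
    Finite.of_injective (fun T => (T.σ₁, T.τ, T.σ₂)) (by rintro ⟨⟩ ⟨⟩ h; simp_all)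
  have hcard : Nat.card ({T : PermTuple n (numBranch g lam mu) // IsFactorization g lam mu T} ×
      Fin n) = complexHurwitz g lam mu * n := by
    rw [Nat.card_prod, Nat.card_fin]; rfl
  rw [← hcard]
  refine Nat.card_le_card_of_injective
    (fun T => (⟨T.1.toPermTuple, T.2.1.factorization⟩, T.1.γ 0)) ?_
  rintro ⟨T, hT⟩ ⟨T', hT'⟩ h
  simp only [Prod.mk.injEq, Subtype.mk.injEq] at h
  obtain ⟨h1, h2⟩ := h
  -- Both involutions invert every partial product, so δ commutes with all of them and hence with
  -- the whole group. A permutation commuting with a transitive group is trivial as soon as it fixes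
  -- one point.
  set δ := T'.γ * T.γ⁻¹ with hδ
  have hinv := fun i => involution_mul s h1 δ (by rw [hδ]; group) i
  have hcomm : ∀ i ≤ numBranch g lam mu, T.partialProd i ∈ Subgroup.centralizer {δ} := by
    intro i hi
    rw [Subgroup.mem_centralizer_singleton_iff]
    obtain ⟨a1, a2⟩ := hT.1.conj_all hi
    obtain ⟨b1, b2⟩ := hT'.1.conj_all hi
    rw [hinv, ← h1] at b2
    rw [hinv] at b1
    set γ := T.involution s i
    set P := T.partialProd i
    have c1 : γ⁻¹ = γ := inv_eq_of_mul_eq_one_left a1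
    have c2 : γ * δ = δ⁻¹ * γ := by
      calc γ * δ = δ⁻¹ * (δ * γ * (δ * γ)) * γ⁻¹ := by group
        _ = δ⁻¹ * γ := by rw [b1, c1]; group
    have c3 : δ * P⁻¹ * δ⁻¹ = P⁻¹ := by
      calc δ * P⁻¹ * δ⁻¹ = δ * (γ * P * γ) * δ⁻¹ := by rw [a2]
        _ = δ * γ * P * (γ * δ⁻¹) := by group
        _ = δ * γ * P * (δ * γ) := by
          have : γ * δ⁻¹ = δ * γ := by
            calc γ * δ⁻¹ = δ * (δ⁻¹ * γ) * δ⁻¹ := by group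
              _ = δ * γ := by rw [← c2]; group
          rw [this]
        _ = P⁻¹ := b2
    have c4 : δ * P⁻¹ = P⁻¹ * δ := by rw [← mul_inv_eq_iff_eq_mul.1 c3]
    calc P * δ = P * (δ * P⁻¹) * P := by group
      _ = δ * P := by rw [c4]; group
  have hle := partialProd_mem_closure T.toPermTuple _ hcomm hT.1.factorization.prod_eq_one
  have hδ0 : δ (T.γ 0) = T.γ 0 := by
    rw [hδ, Perm.mul_apply, ← Perm.mul_apply T.γ⁻¹, inv_mul_cancel, Perm.one_apply, h2]
  have hδ1 : δ = 1 := by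
    ext1 x
    obtain ⟨⟨σ, hσ⟩, hx⟩ := hT.1.factorization.transitive.exists_smul_eq (T.γ 0) x
    have h3 := Subgroup.mem_centralizer_singleton_iff.1 (hle hσ)
    have h4 : σ (T.γ 0) = x := hx
    rw [← h4, ← Perm.mul_apply, ← h3, Perm.mul_apply, hδ0, Perm.one_apply]
  have hγ : T.γ = T'.γ := by
    rw [hδ, mul_inv_eq_one] at hδ1
    exact hδ1.symm
  apply Subtype.ext
  cases T
  cases T'
  simp_all

end RealBound


/-! ### Involutions that invert a permutation, and their fixed points on its cycles. -/

section Reflections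

variable {α : Type*} [Fintype α] [DecidableEq α]

/-- `γ` is an involution that conjugates `P` to its inverse. -/
def Inverts (γ P : Perm α) : Prop := γ * γ = 1 ∧ γ * P * γ = P⁻¹

variable {γ P : Perm α}

omit [Fintype α] [DecidableEq α] in
theorem Inverts.apply_apply (h : Inverts γ P) (x : α) : γ (γ x) = x := by
  rw [← Perm.mul_apply, h.1, Perm.one_apply]

omit [Fintype α] [DecidableEq α] in
theorem Inverts.mul_eq (h : Inverts γ P) : γ * P = P⁻¹ * γ := by
  rw [← h.2, mul_assoc, h.1, mul_one]

omit [Fintype α] [DecidableEq α] in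
theorem Inverts.mul_eq' (h : Inverts γ P) : P * γ = γ * P⁻¹ := by
  rw [← h.2, ← mul_assoc, ← mul_assoc, h.1, one_mul]

omit [Fintype α] [DecidableEq α] in
theorem Inverts.mul_right (h : Inverts γ P) : Inverts (γ * P) P := by
  have h1 : γ * P * (γ * P) = 1 := by rw [← mul_assoc, h.2, inv_mul_cancel]
  refine ⟨h1, ?_⟩
  calc γ * P * P * (γ * P) = γ * P * (P * γ) * P := by group
    _ = γ * P * (γ * P⁻¹) * P := by rw [h.mul_eq']
    _ = γ * P * γ := by group
    _ = P⁻¹ := h.2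

omit [Fintype α] [DecidableEq α] in
theorem Inverts.mul_left (h : Inverts γ P) : Inverts (P * γ) P := by
  have h1 : P * γ * (P * γ) = 1 := by
    rw [mul_assoc, ← mul_assoc γ, h.2, mul_inv_cancel]
  refine ⟨h1, ?_⟩
  calc P * γ * P * (P * γ) = P * (γ * P) * (P * γ) := by group
    _ = P * (P⁻¹ * γ) * (γ * P⁻¹) := by rw [h.mul_eq, h.mul_eq']
    _ = (γ * γ) * P⁻¹ := by group
    _ = P⁻¹ := by rw [h.1, one_mul]

omit [Fintype α] [DecidableEq α] in
theorem Inverts.apply_zpow (h : Inverts γ P) (i : ℤ) (x : α) :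
    γ ((P ^ i) x) = (P ^ (-i)) (γ x) := by
  have h1 : γ * P * γ⁻¹ = P⁻¹ := by
    rw [inv_eq_of_mul_eq_one_left h.1, h.2]
  have h2 : γ * P ^ i * γ⁻¹ = P ^ (-i) := by
    rw [← conj_zpow, h1, inv_zpow, zpow_neg]
  rw [← h2]
  simp

omit [Fintype α] [DecidableEq α] in
theorem Inverts.sameCycle (h : Inverts γ P) {x y : α} (hxy : P.SameCycle x y) :
    P.SameCycle (γ x) (γ y) := by
  obtain ⟨i, rfl⟩ := hxy
  exact ⟨-i, (h.apply_zpow i x).symm⟩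

-- The reflection `P * γ`, not `γ`, decides which swaps are allowed: their two elements are both
-- fixed by it or exchanged by it.
omit [Fintype α] [DecidableEq α] in
theorem Inverts.swap_mul [DecidableEq α] (h : Inverts γ P) {a b : α}
    (hab : P * γ * swap a b = swap a b * (P * γ)) : Inverts γ (swap a b * P) := by
  refine ⟨h.1, ?_⟩
  calc γ * (swap a b * P) * γ = γ * (swap a b * (P * γ)) := by group
    _ = γ * P * γ * swap a b := by rw [← hab]; group
    _ = (swap a b * P)⁻¹ := by rw [h.2, mul_inv_rev, swap_inv]

omit [Fintype α] in
theorem mul_swap_comm_of_fixed {ρ : Perm α} {a b : α} (ha : ρ a = a) (hb : ρ b = b) :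
    ρ * swap a b = swap a b * ρ := by
  rw [Equiv.mul_swap_eq_swap_mul, ha, hb]

omit [Fintype α] in
theorem mul_swap_comm_of_swapped {ρ : Perm α} {a b : α} (ha : ρ a = b) (hb : ρ b = a) :
    ρ * swap a b = swap a b * ρ := by
  rw [Equiv.mul_swap_eq_swap_mul, ha, hb, swap_comm]

/-- In the coordinate i of the point P^i x the involution is i ↦ t - i modulo the length. Everything
about fixed points is the solvability of 2i ≡ t: always and uniquely for odd length, according to
the parity of t for even length. -/
theorem Inverts.exists_fixed_iff (h : Inverts γ P) {x : α} {t : ℤ} (ht : γ x = (P ^ t) x) :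
    (∃ y, P.SameCycle x y ∧ γ y = y) ↔ ∃ i : ℤ, ((cyc P x).card : ℤ) ∣ t - 2 * i := by
  have key : ∀ i : ℤ, γ ((P ^ i) x) = (P ^ i) x ↔ ((cyc P x).card : ℤ) ∣ t - 2 * i := by
    intro i
    rw [h.apply_zpow, ht, ← Perm.mul_apply, ← zpow_add, ← zpow_apply_eq_self_iff,
      show t - 2 * i = -i + (-i + t) by ring, zpow_add P (-i) (-i + t), Perm.mul_apply, zpow_neg P i,
      Perm.inv_eq_iff_eq]
  constructor
  · rintro ⟨y, ⟨i, rfl⟩, hy⟩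
    exact ⟨i, (key i).1 hy⟩
  · rintro ⟨i, hi⟩
    exact ⟨_, ⟨i, rfl⟩, (key i).2 hi⟩

theorem Inverts.exists_fixed_iff_even (h : Inverts γ P) {x : α} {t : ℤ} (ht : γ x = (P ^ t) x)
    (hl : Even (cyc P x).card) : (∃ y, P.SameCycle x y ∧ γ y = y) ↔ Even t := by
  rw [h.exists_fixed_iff ht]
  obtain ⟨m, hm⟩ := hl
  constructor
  · rintro ⟨i, c, hc⟩
    rw [hm] at hc
    push_cast at hc
    exact ⟨m * c + i, by linarith⟩
  · rintro ⟨i, rfl⟩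
    exact ⟨i, by ring_nf; exact dvd_zero _⟩

theorem Inverts.exists_fixed_of_odd (h : Inverts γ P) {x : α} (hx : P.SameCycle x (γ x))
    (hl : Odd (cyc P x).card) : ∃ y, P.SameCycle x y ∧ γ y = y := by
  obtain ⟨t, ht⟩ := hx
  rw [h.exists_fixed_iff ht.symm]
  obtain ⟨m, hm⟩ := hl
  refine ⟨t * (m + 1), -t, ?_⟩
  rw [hm]; push_cast; ring

theorem Inverts.fixed_unique (h : Inverts γ P) {x y : α} (hxy : P.SameCycle x y) (hx : γ x = x)
    (hy : γ y = y) (hl : Odd (cyc P x).card) : x = y := by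
  obtain ⟨i, rfl⟩ := hxy
  rw [h.apply_zpow, hx] at hy
  have h1 : (P ^ (2 * i)) x = x := by
    rw [two_mul, zpow_add, Perm.mul_apply, ← hy, ← Perm.mul_apply, ← zpow_add]
    simp
  rw [zpow_apply_eq_self_iff] at h1
  have h2 : ((cyc P x).card : ℤ) ∣ i := by
    refine Int.dvd_of_dvd_mul_right_of_gcd_one h1 ?_
    rw [Int.gcd_eq_natAbs]
    simpa using hl.coprime_two_right
  exact ((zpow_apply_eq_self_iff P x i).2 h2).symm

/-- On an even cycle exactly one of the reflections `γ` and `P γ` has a fixed point. -/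
theorem Inverts.fixed_mul_left_iff (h : Inverts γ P) {x : α} (hx : P.SameCycle x (γ x))
    (hl : Even (cyc P x).card) :
    (∃ y, P.SameCycle x y ∧ (P * γ) y = y) ↔ ¬ ∃ y, P.SameCycle x y ∧ γ y = y := by
  obtain ⟨t, ht⟩ := hx
  rw [h.exists_fixed_iff_even ht.symm hl, h.mul_left.exists_fixed_iff_even (t := 1 + t) _ hl,
    add_comm, Int.even_add_one]
  rw [Perm.mul_apply, ← ht, zpow_one_add, Perm.mul_apply]

theorem Inverts.fixed_mul_right_iff (h : Inverts γ P) {x : α} (hx : P.SameCycle x (γ x))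
    (hl : Even (cyc P x).card) :
    (∃ y, P.SameCycle x y ∧ (γ * P) y = y) ↔ ¬ ∃ y, P.SameCycle x y ∧ γ y = y := by
  obtain ⟨t, ht⟩ := hx
  rw [h.exists_fixed_iff_even ht.symm hl, h.mul_right.exists_fixed_iff_even (t := t - 1) _ hl,
    Int.even_sub_one]
  have := h.apply_zpow 1 x
  rw [zpow_one] at this
  rw [Perm.mul_apply, this, ← ht, ← Perm.mul_apply, ← zpow_add]
  congr 2; ring

end Reflections

/-! ### Realizing a coloured graph vertex by vertex. -/

section States

variable {α ι : Type*} [Fintype α] [DecidableEq α] [Fintype ι] [DecidableEq ι]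

/-- A coloured graph over the line, given by an indexed family of coloured edges, and an involution
that exchanges the two edges in each dotted pair. -/
structure ColouredGraph (ι : Type*) where
  ed : ι → Edge
  col : ι → Colour
  bar : ι → ι
  lt : ∀ j, (ed j).left < (ed j).right
  pos : ∀ j, 0 < (ed j).weight
  odd : ∀ j, col j = .normal → Odd (ed j).weight
  even : ∀ j, col j = .red ∨ col j = .blue → Even (ed j).weight
  bar_bar : ∀ j, bar (bar j) = j
  ed_bar : ∀ j, ed (bar j) = ed j
  col_bar : ∀ j, col (bar j) = col j
  bar_eq : ∀ j, bar j = j ↔ col j ≠ .dotted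

/-- The possible colours of two edges `j₁`, `j₂` on one side of a vertex and the edge `j₃` on the
other side. -/
def ColouredGraph.VertexColours (G : ColouredGraph ι) (ε : ℤˣ) (j₁ j₂ j₃ : ι) : Prop :=
  (G.col j₁ = .normal ∧ (G.col j₂ = .red ∨ G.col j₂ = .blue) ∧ G.col j₃ = .normal ∧
    ¬ (G.col j₂ = .red ↔ ε = 1)) ∨
  (G.col j₁ = .normal ∧ G.col j₂ = .normal ∧ (G.col j₃ = .red ∨ G.col j₃ = .blue) ∧
    (G.col j₃ = .red ↔ ε = 1)) ∨
  (G.bar j₁ = j₂ ∧ (G.col j₃ = .red ∨ G.col j₃ = .blue) ∧ ¬ (G.col j₃ = .red ↔ ε = 1))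

/-- The vertex `v` joins or cuts edges as prescribed by the colours. -/
def ColouredGraph.IsVertex (G : ColouredGraph ι) (v : ℕ) (ε : ℤˣ) : Prop :=
  ∃ j₁ j₂ j₃, j₁ ≠ j₂ ∧ (G.ed j₃).weight = (G.ed j₁).weight + (G.ed j₂).weight ∧
    G.VertexColours ε j₁ j₂ j₃ ∧
    ((∀ j, (G.ed j).right = v ↔ j = j₁ ∨ j = j₂) ∧ (∀ j, (G.ed j).left = v ↔ j = j₃) ∨
      (∀ j, (G.ed j).right = v ↔ j = j₃) ∧ (∀ j, (G.ed j).left = v ↔ j = j₁ ∨ j = j₂))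

/-- The permutation `P` with the involution `γ` has cycles that correspond to the edges over the
open interval after the point `i`; `lab` sends an element to the edge that corresponds to its cycle. -/
structure ColouredGraph.IsState (G : ColouredGraph ι) (i : ℕ) (ε : ℤˣ) (P γ : Perm α)
    (lab : α → ι) : Prop where
  inverts : Inverts γ P
  same : ∀ x y, P.SameCycle x y ↔ lab x = lab y
  alive : ∀ x, (G.ed (lab x)).left ≤ i ∧ i < (G.ed (lab x)).right
  card : ∀ j, (G.ed j).left ≤ i → i < (G.ed j).right →
    (Finset.univ.filter fun x => lab x = j).card = (G.ed j).weight
  bar : ∀ x, lab (γ x) = G.bar (lab x)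
  fix : ∀ j, (G.ed j).left ≤ i → i < (G.ed j).right → (G.col j = .red ∨ G.col j = .blue) →
    ((∃ x, lab x = j ∧ γ x = x) ↔ (G.col j = .red ↔ ε = 1))

variable {G : ColouredGraph ι} {i : ℕ} {ε : ℤˣ} {P γ : Perm α} {lab : α → ι}

omit [DecidableEq α] [Fintype ι] in
theorem ColouredGraph.IsState.cyc_eq [DecidableEq α] (h : G.IsState i ε P γ lab) (x : α) :
    cyc P x = Finset.univ.filter fun y => lab y = lab x := by
  ext y; simp [h.same, eq_comm]

omit [Fintype ι] in
theorem ColouredGraph.IsState.card_cyc (h : G.IsState i ε P γ lab) (x : α) :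
    (cyc P x).card = (G.ed (lab x)).weight := by
  rw [h.cyc_eq, h.card _ (h.alive x).1 (h.alive x).2]

omit [DecidableEq α] [Fintype ι] in
theorem ColouredGraph.IsState.exists_lab (h : G.IsState i ε P γ lab) {j : ι}
    (h1 : (G.ed j).left ≤ i) (h2 : i < (G.ed j).right) : ∃ x, lab x = j := by
  have := G.pos j
  rw [← h.card j h1 h2, Finset.card_pos] at this
  obtain ⟨x, hx⟩ := this
  exact ⟨x, by simpa using hx⟩

omit [DecidableEq α] [Fintype ι] in
theorem ColouredGraph.IsState.sameCycle_gamma (h : G.IsState i ε P γ lab) {x : α}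
    (hx : G.col (lab x) ≠ .dotted) : P.SameCycle x (γ x) := by
  rw [h.same, h.bar, (G.bar_eq _).2 hx]

omit [DecidableEq α] [Fintype ι] in
theorem ColouredGraph.IsState.fix_iff (h : G.IsState i ε P γ lab) {x : α}
    (hx : G.col (lab x) = .red ∨ G.col (lab x) = .blue) :
    (∃ y, P.SameCycle x y ∧ γ y = y) ↔ (G.col (lab x) = .red ↔ ε = 1) := by
  rw [← h.fix _ (h.alive x).1 (h.alive x).2 hx]
  simp [h.same, eq_comm]

omit [DecidableEq α] [Fintype ι] in
theorem ColouredGraph.IsState.lab_apply (h : G.IsState i ε P γ lab) (x : α) :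
    lab (P x) = lab x := by
  rw [← h.same]; simp [Perm.SameCycle.refl]

-- When the sign changes, the involution is multiplied by `P`. On an even cycle this exchanges the
-- reflections with and without fixed points, so the colours keep their meaning.
omit [Fintype ι] in
theorem ColouredGraph.IsState.switch (h : G.IsState i ε P γ lab) :
    G.IsState i (-ε) P (γ * P) lab where
  inverts := h.inverts.mul_right
  same := h.same
  alive := h.alive
  card := h.card
  bar x := by rw [Perm.mul_apply, h.bar, h.lab_apply]
  fix j h1 h2 hj := by
    obtain ⟨x, rfl⟩ := h.exists_lab h1 h2
    have hnd : G.col (lab x) ≠ .dotted := by rcases hj with hj | hj <;> simp [hj]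
    have h3 := h.inverts.fixed_mul_right_iff (h.sameCycle_gamma hnd)
      (by rw [h.card_cyc]; exact G.even _ hj)
    rw [h.fix_iff hj] at h3
    simp only [h.same] at h3
    simp only [eq_comm] at h3 ⊢
    rw [h3]
    rcases Int.units_eq_one_or ε with rfl | rfl <;> simp

/-- The effect of the swap of `a` and `b` at the vertex `i + 1`. -/
structure ColouredGraph.IsStep (G : ColouredGraph ι) (i : ℕ) (P γ : Perm α) (lab lab' : α → ι)
    (a b : α) : Prop where
  ne : a ≠ b
  comm : P * γ * swap a b = swap a b * (P * γ)
  lab_eq : ∀ z, (G.ed (lab z)).right ≠ i + 1 → lab' z = lab z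
  new : ∀ z, (G.ed (lab z)).right = i + 1 → (G.ed (lab' z)).left = i + 1
  changed : ∀ z, (G.ed (lab z)).right = i + 1 → ∃ z', ¬ (lab' z' = lab' z ↔ lab z' = lab z)
  right_left : (G.ed (lab a)).right = i + 1
  right_right : (G.ed (lab b)).right = i + 1
  hit_old : ∀ j, (G.ed j).right = i + 1 → lab a = j ∨ lab b = j
  hit_new : ∀ j, (G.ed j).left = i + 1 → lab' a = j ∨ lab' b = j

omit [Fintype ι] in
theorem ColouredGraph.IsState.join (h : G.IsState i ε P γ lab) {j₁ j₂ j₃ : ι} (hne : j₁ ≠ j₂)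
    (hw : (G.ed j₃).weight = (G.ed j₁).weight + (G.ed j₂).weight)
    (hr : ∀ j, (G.ed j).right = i + 1 ↔ j = j₁ ∨ j = j₂) (hl : ∀ j, (G.ed j).left = i + 1 ↔ j = j₃)
    (h3 : G.col j₃ ≠ .dotted) (hbar : ∀ j, (j = j₁ ∨ j = j₂) → (G.bar j = j₁ ∨ G.bar j = j₂))
    {a b : α} (ha : lab a = j₁) (hb : lab b = j₂) (hcomm : P * γ * swap a b = swap a b * (P * γ))
    (hfix : (G.col j₃ = .red ∨ G.col j₃ = .blue) → Inverts γ (swap a b * P) →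
      (cyc (swap a b * P) a).card = (G.ed j₃).weight →
      ((∃ x, (swap a b * P).SameCycle a x ∧ γ x = x) ↔ (G.col j₃ = .red ↔ ε = 1))) :
    ∃ lab', G.IsState (i + 1) ε (swap a b * P) γ lab' ∧ G.IsStep i P γ lab lab' a b := by
  have hab : ¬ P.SameCycle a b := by rw [h.same, ha, hb]; exact hne
  set P' := swap a b * P with hP'
  set lab' : α → ι := fun z => if lab z = j₁ ∨ lab z = j₂ then j₃ else lab z with hlab'
  have hj3 : (G.ed j₃).left = i + 1 := (hl j₃).2 rfl
  have hne3 : ∀ x, lab x ≠ j₃ := by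
    intro x hx
    have := (h.alive x).1
    rw [hx] at this
    omega
  have hold : ∀ z, ¬ (lab z = j₁ ∨ lab z = j₂) → lab' z = lab z := fun z hz => if_neg hz
  have hnew : ∀ z, (lab z = j₁ ∨ lab z = j₂) → lab' z = j₃ := fun z hz => if_pos hz
  have hiff : ∀ z, lab' z = j₃ ↔ (lab z = j₁ ∨ lab z = j₂) := by
    intro z
    refine ⟨fun hz => ?_, hnew z⟩
    by_contra h'
    rw [hold z h'] at hz
    exact hne3 z hz
  have hsa : ∀ w, P'.SameCycle a w ↔ lab' w = j₃ := by
    intro w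
    rw [hiff, hP', sameCycle_join hab, h.same, h.same, ha, hb, eq_comm, @eq_comm _ j₂]
  have hsame : ∀ x y, P'.SameCycle x y ↔ lab' x = lab' y := by
    intro x y
    by_cases hx : lab' x = j₃
    · rw [hx, @eq_comm _ j₃, ← hsa]
      have := (hsa x).2 hx
      exact ⟨fun h' => this.trans h', fun h' => this.symm.trans h'⟩
    · have hx1 := mt (hiff x).2 hx
      rw [hP', sameCycle_swap_mul_of_not (by rw [h.same, ha]; tauto) (by rw [h.same, hb]; tauto),
        h.same, hold x hx1]
      by_cases hy : lab' y = j₃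
      · rw [hy]
        refine iff_of_false (fun h' => hx1 ?_) (hne3 x)
        rw [h']; exact (hiff y).1 hy
      · rw [hold y (mt (hiff y).2 hy)]
  have hinv : Inverts γ P' := h.inverts.swap_mul hcomm
  have hcard3 : (Finset.univ.filter fun x => lab' x = j₃).card = (G.ed j₃).weight := by
    have h4 : (Finset.univ.filter fun x => lab' x = j₃) = cyc P' a := by
      ext w; simp [hsa]
    rw [h4, hP', card_join hab, h.card_cyc, h.card_cyc, ha, hb, hw]
  have hout : ∀ j, j ≠ j₃ → (G.ed j).left ≤ i + 1 → i + 1 < (G.ed j).right →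
      (G.ed j).left ≤ i ∧ i < (G.ed j).right ∧ ∀ z, lab' z = j ↔ lab z = j := by
    intro j hj h1 h2
    have h5 := mt (hl j).1 hj
    have h6 := mt (hr j).2 (by omega)
    refine ⟨by omega, by omega, fun z => ⟨fun hz => ?_, fun hz => ?_⟩⟩
    · by_cases h7 : lab z = j₁ ∨ lab z = j₂
      · rw [hnew z h7] at hz; exact absurd hz.symm hj
      · rwa [hold z h7] at hz
    · rw [hold z (by rw [hz]; exact h6), hz]
  refine ⟨lab', ⟨hinv, hsame, fun x => ?_, fun j h1 h2 => ?_, fun x => ?_, fun j h1 h2 hj => ?_⟩,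
    ⟨fun h' => hab (h' ▸ Perm.SameCycle.refl _ _), hcomm, fun z hz => hold z (mt (hr _).2 hz),
      fun z hz => ?_, fun z hz => ?_, (hr _).2 (Or.inl ha), (hr _).2 (Or.inr hb), fun j hj => ?_,
      fun j hj => ?_⟩⟩
  · by_cases hx : lab x = j₁ ∨ lab x = j₂
    · rw [hnew x hx]
      have := G.lt j₃
      omega
    · rw [hold x hx]
      have := h.alive x
      have := mt (hr _).1 hx
      omega
  · by_cases hj : j = j₃
    · rw [hj, hcard3]
    · obtain ⟨h3, h4, h5⟩ := hout j hj h1 h2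
      simp only [h5]
      exact h.card j h3 h4
  · by_cases hx : lab x = j₁ ∨ lab x = j₂
    · rw [hnew x hx, (G.bar_eq _).2 h3]
      exact hnew _ (by rw [h.bar]; exact hbar _ hx)
    · rw [hold x hx, hold, h.bar]
      rw [h.bar]
      intro h'
      exact hx (by simpa [G.bar_bar] using hbar _ h')
  · by_cases hj' : j = j₃
    · subst hj'
      rw [← hfix hj hinv (by rw [← hcard3]; congr 1; ext w; simp [hsa])]
      simp only [hsa]
    · obtain ⟨h3, h4, h5⟩ := hout j hj' h1 h2
      simp only [h5]
      exact h.fix j h3 h4 hj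
  · rw [hnew z ((hr _).1 hz)]; exact hj3
  · have h4 := (hr _).1 hz
    rcases h4 with h4 | h4
    · refine ⟨b, fun h' => hne ?_⟩
      have := h'.1 (by rw [hnew z (Or.inl h4), hnew b (Or.inr hb)])
      rw [← h4, ← this, hb]
    · refine ⟨a, fun h' => hne ?_⟩
      have := h'.1 (by rw [hnew z (Or.inr h4), hnew a (Or.inl ha)])
      rw [← ha, this, h4]
  · rcases (hr j).1 hj with rfl | rfl
    · exact Or.inl ha
    · exact Or.inr hb
  · rw [(hl j).1 hj]
    exact Or.inl (hnew a (Or.inl ha))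

-- The cycle of `j₃` is cut so that `a` lies on the part of length `(G.ed j₁).weight`. If the
-- reflection `P * γ` exchanges the two points of the swap, γ preserves both parts; if it fixes
-- them, γ exchanges the parts. This is the alternative in `hbar`. The fixed points on an even part
-- are left to the caller in `hfix`.
omit [Fintype ι] in
theorem ColouredGraph.IsState.cut (h : G.IsState i ε P γ lab) {j₁ j₂ j₃ : ι} (hne : j₁ ≠ j₂)
    (hw : (G.ed j₃).weight = (G.ed j₁).weight + (G.ed j₂).weight)
    (hr : ∀ j, (G.ed j).right = i + 1 ↔ j = j₃) (hl : ∀ j, (G.ed j).left = i + 1 ↔ j = j₁ ∨ j = j₂)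
    (h3 : G.col j₃ ≠ .dotted)
    {a b : α} (ha : lab a = j₃) (hb : (P ^ (G.ed j₁).weight) a = b)
    (hcomm : P * γ * swap a b = swap a b * (P * γ))
    (hbar : ((P * γ) a = b ∧ (P * γ) b = a ∧ G.bar j₁ = j₁ ∧ G.bar j₂ = j₂) ∨
      ((P * γ) a = a ∧ (P * γ) b = b ∧ G.bar j₁ = j₂))
    (hfix1 : ¬ (G.col j₁ = .red ∨ G.col j₁ = .blue))
    (hfix : (G.col j₂ = .red ∨ G.col j₂ = .blue) → Inverts γ (swap a b * P) →
      (cyc (swap a b * P) b).card = (G.ed j₂).weight →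
      ((∃ x, (swap a b * P).SameCycle b x ∧ γ x = x) ↔ (G.col j₂ = .red ↔ ε = 1))) :
    ∃ lab', G.IsState (i + 1) ε (swap a b * P) γ lab' ∧ G.IsStep i P γ lab lab' a b := by
  have hk : 0 < (G.ed j₁).weight := G.pos _
  have hkl : (G.ed j₁).weight < (cyc P a).card := by
    have := G.pos j₂
    rw [h.card_cyc, ha, hw]; omega
  have hcard1 : (cyc (swap a b * P) a).card = (G.ed j₁).weight := by
    rw [← hb]; exact card_cut_left hk hkl
  have hcard2 : (cyc (swap a b * P) b).card = (G.ed j₂).weight := by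
    rw [← hb, card_cut_right hk hkl, h.card_cyc, ha, hw]; omega
  have hab' : ¬ (swap a b * P).SameCycle a b := by rw [← hb]; exact not_sameCycle_cut hk hkl
  have hPab : P.SameCycle a b := ⟨(G.ed j₁).weight, by simpa using hb⟩
  have hlb : lab b = j₃ := by rw [← ha]; exact ((h.same _ _).1 hPab).symm
  have hunion : ∀ w, lab w = j₃ ↔ (swap a b * P).SameCycle a w ∨ (swap a b * P).SameCycle b w := by
    intro w
    rw [← sameCycle_join hab', swap_mul_swap_mul_self, h.same, ha, eq_comm]
  set P' := swap a b * P with hP'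
  classical
  set lab' : α → ι := fun z => if P'.SameCycle a z then j₁ else if P'.SameCycle b z then j₂ else lab z
    with hlab'
  have h1a : (G.ed j₁).left = i + 1 := (hl j₁).2 (Or.inl rfl)
  have h2a : (G.ed j₂).left = i + 1 := (hl j₂).2 (Or.inr rfl)
  have hne1 : ∀ x, lab x ≠ j₁ := by
    intro x hx
    have := (h.alive x).1
    rw [hx] at this
    omega
  have hne2 : ∀ x, lab x ≠ j₂ := by
    intro x hx
    have := (h.alive x).1
    rw [hx] at this
    omega
  have hla : ∀ z, P'.SameCycle a z → lab' z = j₁ := fun z hz => if_pos hz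
  have hlb' : ∀ z, P'.SameCycle b z → lab' z = j₂ := fun z hz => by
    simp only [hlab']
    rw [if_neg, if_pos hz]
    exact fun h' => hab' (h'.trans hz.symm)
  have hold : ∀ z, lab z ≠ j₃ → lab' z = lab z := fun z hz => by
    rw [Ne, hunion, not_or] at hz
    simp only [hlab']
    rw [if_neg hz.1, if_neg hz.2]
  have hia : ∀ z, lab' z = j₁ ↔ P'.SameCycle a z := by
    refine fun z => ⟨fun hz => ?_, hla z⟩
    by_contra h'
    by_cases h'' : P'.SameCycle b z
    · rw [hlb' z h''] at hz; exact hne hz.symm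
    · rw [hold z (by rw [Ne, hunion]; tauto)] at hz; exact hne1 z hz
  have hib : ∀ z, lab' z = j₂ ↔ P'.SameCycle b z := by
    refine fun z => ⟨fun hz => ?_, hlb' z⟩
    by_contra h'
    by_cases h'' : P'.SameCycle a z
    · rw [hla z h''] at hz; exact hne hz
    · rw [hold z (by rw [Ne, hunion]; tauto)] at hz; exact hne2 z hz
  have hsame : ∀ x y, P'.SameCycle x y ↔ lab' x = lab' y := by
    intro x y
    by_cases hx : lab' x = j₁
    · rw [hx, @eq_comm _ j₁, hia]
      have := (hia x).1 hx
      exact ⟨fun h' => this.trans h', fun h' => this.symm.trans h'⟩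
    by_cases hx' : lab' x = j₂
    · rw [hx', @eq_comm _ j₂, hib]
      have := (hib x).1 hx'
      exact ⟨fun h' => this.trans h', fun h' => this.symm.trans h'⟩
    have hx3 : lab x ≠ j₃ := by rw [Ne, hunion, ← hia, ← hib]; tauto
    rw [hP', sameCycle_swap_mul_of_not (by rw [h.same, ha]; exact hx3)
      (by rw [h.same, hlb]; exact hx3), h.same, hold x hx3]
    by_cases hy : lab y = j₃
    · rw [hy]
      refine iff_of_false hx3 ?_
      rcases (hunion y).1 hy with h' | h'
      · rw [hla y h']; exact hne1 x
      · rw [hlb' y h']; exact hne2 x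
    · rw [hold y hy]
  have hinv : Inverts γ P' := h.inverts.swap_mul hcomm
  have hfib1 : (Finset.univ.filter fun x => lab' x = j₁) = cyc P' a := by ext w; simp [hia]
  have hfib2 : (Finset.univ.filter fun x => lab' x = j₂) = cyc P' b := by ext w; simp [hib]
  have hout : ∀ j, j ≠ j₁ → j ≠ j₂ → (G.ed j).left ≤ i + 1 → i + 1 < (G.ed j).right →
      (G.ed j).left ≤ i ∧ i < (G.ed j).right ∧ ∀ z, lab' z = j ↔ lab z = j := by
    intro j hj1 hj2 h1 h2
    have h5 := mt (hl j).1 (by tauto)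
    have h6 : j ≠ j₃ := mt (hr j).2 (by omega)
    refine ⟨by omega, by omega, fun z => ⟨fun hz => ?_, fun hz => ?_⟩⟩
    · by_cases h7 : lab z = j₃
      · rcases (hunion z).1 h7 with h' | h'
        · rw [hla z h'] at hz; exact absurd hz.symm hj1
        · rw [hlb' z h'] at hz; exact absurd hz.symm hj2
      · rwa [hold z h7] at hz
    · rw [hold z (by rw [hz]; exact h6), hz]
  have hγ : (P' * γ) = swap a b * (P * γ) := by rw [hP', mul_assoc]
  -- The image of a part under γ is found by following the single point `(P' * γ) a` or `(P' * γ)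
  -- b`, where the swap acts on a known value.
  have hP'γ : ∀ x, P'.SameCycle (γ x) ((P' * γ) x) := fun x => ⟨1, by simp⟩
  have hbar1 : ∀ x, P'.SameCycle a x → lab' (γ x) = G.bar j₁ := by
    intro x hx
    have h5 := hinv.sameCycle hx
    have h6 := hP'γ a
    rw [hγ, Perm.mul_apply] at h6
    rcases hbar with ⟨b1, b2, b3, b4⟩ | ⟨b1, b2, b3⟩
    · rw [b1, swap_apply_right] at h6
      rw [b3, hia]
      exact h6.symm.trans h5
    · rw [b1, swap_apply_left] at h6
      rw [b3, hib]
      exact h6.symm.trans h5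
  have hbar2 : ∀ x, P'.SameCycle b x → lab' (γ x) = G.bar j₂ := by
    intro x hx
    have h5 := hinv.sameCycle hx
    have h6 := hP'γ b
    rw [hγ, Perm.mul_apply] at h6
    rcases hbar with ⟨b1, b2, b3, b4⟩ | ⟨b1, b2, b3⟩
    · rw [b2, swap_apply_left] at h6
      rw [b4, hib]
      exact h6.symm.trans h5
    · rw [b2, swap_apply_right] at h6
      rw [← b3, G.bar_bar, hia]
      exact h6.symm.trans h5
  refine ⟨lab', ⟨hinv, hsame, fun x => ?_, fun j h1 h2 => ?_, fun x => ?_, fun j h1 h2 hj => ?_⟩,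
    ⟨fun h' => hab' (h' ▸ Perm.SameCycle.refl _ _), hcomm, fun z hz => hold z (mt (hr _).2 hz),
      fun z hz => ?_, fun z hz => ?_, (hr _).2 ha, (hr _).2 hlb, fun j hj => ?_,
      fun j hj => ?_⟩⟩
  · by_cases hx : lab x = j₃
    · have := G.lt j₁
      have := G.lt j₂
      rcases (hunion x).1 hx with h' | h'
      · rw [hla x h']; omega
      · rw [hlb' x h']; omega
    · rw [hold x hx]
      have := h.alive x
      have := mt (hr _).1 hx
      omega
  · by_cases hj1 : j = j₁
    · rw [hj1, hfib1, hcard1]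
    by_cases hj2 : j = j₂
    · rw [hj2, hfib2, hcard2]
    obtain ⟨h3, h4, h5⟩ := hout j hj1 hj2 h1 h2
    simp only [h5]
    exact h.card j h3 h4
  · by_cases hx : lab x = j₃
    · rcases (hunion x).1 hx with h' | h'
      · rw [hbar1 x h', hla x h']
      · rw [hbar2 x h', hlb' x h']
    · rw [hold x hx, hold, h.bar]
      rw [h.bar]
      intro h'
      refine hx ?_
      rw [← G.bar_bar (lab x), h', (G.bar_eq _).2 h3]
  · by_cases hj1 : j = j₁
    · exact absurd (hj1 ▸ hj) hfix1
    by_cases hj2 : j = j₂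
    · subst hj2
      rw [← hfix hj hinv hcard2]
      simp only [hib]
    obtain ⟨h3, h4, h5⟩ := hout j hj1 hj2 h1 h2
    simp only [h5]
    exact h.fix j h3 h4 hj
  · rcases (hunion z).1 ((hr _).1 hz) with h' | h'
    · rw [hla z h']; exact h1a
    · rw [hlb' z h']; exact h2a
  · have h4 := (hr _).1 hz
    rcases (hunion z).1 h4 with h' | h'
    · refine ⟨b, fun h'' => hne ?_⟩
      have := h''.2 (by rw [hlb, h4])
      rw [← hla z h', ← this, hlb' b (Perm.SameCycle.refl _ _)]
    · refine ⟨a, fun h'' => hne ?_⟩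
      have := h''.2 (by rw [ha, h4])
      rw [← hlb' z h', ← this, hla a (Perm.SameCycle.refl _ _)]
  · rw [(hr j).1 hj]; exact Or.inl ha
  · rcases (hl j).1 hj with rfl | rfl
    · exact Or.inl (hla a (Perm.SameCycle.refl _ _))
    · exact Or.inr (hlb' b (Perm.SameCycle.refl _ _))

-- An odd cycle always contains a fixed point of `P * γ`; an even one does if and only if γ has none
-- on it, which is what the colour says. For two cycles exchanged by γ, a point and its image are
-- used instead.
omit [Fintype ι] in
theorem ColouredGraph.IsState.step_join (h : G.IsState i ε P γ lab) {j₁ j₂ j₃ : ι} (hne : j₁ ≠ j₂)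
    (hw : (G.ed j₃).weight = (G.ed j₁).weight + (G.ed j₂).weight)
    (hcol : G.VertexColours ε j₁ j₂ j₃)
    (hr : ∀ j, (G.ed j).right = i + 1 ↔ j = j₁ ∨ j = j₂)
    (hl : ∀ j, (G.ed j).left = i + 1 ↔ j = j₃) :
    ∃ a b lab', G.IsState (i + 1) ε (swap a b * P) γ lab' ∧ G.IsStep i P γ lab lab' a b := by
  have hr1 := (hr j₁).2 (Or.inl rfl)
  have hr2 := (hr j₂).2 (Or.inr rfl)
  have hl1 := G.lt j₁
  have hl2 := G.lt j₂
  obtain ⟨x₁, hx₁⟩ := h.exists_lab (j := j₁) (by omega) (by omega)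
  obtain ⟨x₂, hx₂⟩ := h.exists_lab (j := j₂) (by omega) (by omega)
  have hρ := h.inverts.mul_left
  have hsc : ∀ {x}, G.col (lab x) ≠ .dotted → P.SameCycle x ((P * γ) x) := fun hx => by
    rw [Perm.mul_apply, Perm.sameCycle_apply_right]
    exact h.sameCycle_gamma hx
  have hodd : ∀ {x}, G.col (lab x) = .normal → ∃ y, lab y = lab x ∧ (P * γ) y = y := by
    intro x hx
    obtain ⟨y, hy, hy'⟩ := hρ.exists_fixed_of_odd (hsc (by rw [hx]; simp))
      (by rw [h.card_cyc]; exact G.odd _ hx)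
    exact ⟨y, ((h.same _ _).1 hy).symm, hy'⟩
  rcases hcol with ⟨c1, c2, c3, c4⟩ | ⟨c1, c2, c3, c4⟩ | ⟨c1, c3, c4⟩
  · obtain ⟨a, ha, ha'⟩ := hodd (x := x₁) (by rw [hx₁]; exact c1)
    have hc2 : G.col (lab x₂) = .red ∨ G.col (lab x₂) = .blue := by rw [hx₂]; exact c2
    have hnd : G.col (lab x₂) ≠ .dotted := by rcases hc2 with hj | hj <;> simp [hj]
    obtain ⟨b, hb, hb'⟩ := (h.inverts.fixed_mul_left_iff (h.sameCycle_gamma hnd)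
      (by rw [h.card_cyc]; exact G.even _ hc2)).2 (by rw [h.fix_iff hc2, hx₂]; exact c4)
    rw [h.same] at hb
    refine ⟨a, b, h.join hne hw hr hl (by rw [c3]; simp) ?_ (ha.trans hx₁) (hb.symm.trans hx₂)
      (mul_swap_comm_of_fixed ha' hb') ?_⟩
    · rintro j (rfl | rfl)
      · left; rw [G.bar_eq, c1]; simp
      · right; rw [G.bar_eq, ← hx₂]; exact hnd
    · rw [c3]; simp
  -- On the new even cycle the reflection after the swap carries `a` to `b`, which is an odd number
  -- of steps away. So this reflection has no fixed point and γ has one.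
  · obtain ⟨a, ha, ha'⟩ := hodd (x := x₁) (by rw [hx₁]; exact c1)
    obtain ⟨b, hb, hb'⟩ := hodd (x := x₂) (by rw [hx₂]; exact c2)
    have hab : ¬ P.SameCycle a b := by rw [h.same, ha, hb, hx₁, hx₂]; exact hne
    refine ⟨a, b, h.join hne hw hr hl (by rcases c3 with c3 | c3 <;> rw [c3] <;> simp) ?_
      (ha.trans hx₁) (hb.trans hx₂) (mul_swap_comm_of_fixed ha' hb') ?_⟩
    · rintro j (rfl | rfl)
      · left; rw [G.bar_eq, c1]; simp
      · right; rw [G.bar_eq, c2]; simp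
    · intro _ hinv hcard
      refine iff_of_true ?_ c4
      have heven : Even (cyc (swap a b * P) a).card := by rw [hcard]; exact G.even _ c3
      have h1 : (swap a b * P * γ) a = b := by
        rw [mul_assoc, Perm.mul_apply, ha', swap_apply_left]
      have h2 : (swap a b * P).SameCycle a (γ a) := by
        have h3 : (swap a b * P).SameCycle (γ a) b := ⟨1, by rw [zpow_one]; exact h1⟩
        exact (sameCycle_join_pair hab).trans h3.symm
      have h3 : ((swap a b * P) ^ ((G.ed j₁).weight : ℤ)) a = b := by
        rw [← hx₁, ← ha, ← h.card_cyc, zpow_natCast]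
        have h5 := card_cyc_pos P a
        obtain ⟨l, hl⟩ : ∃ l, (cyc P a).card = l + 1 := ⟨(cyc P a).card - 1, by omega⟩
        have h6 : (P ^ (l + 1)) a = a := by rw [pow_apply_eq_self_iff, hl]
        rw [hl, pow_succ', Perm.mul_apply, swap_mul_pow_apply, Perm.mul_apply, ← Perm.mul_apply P,
          ← pow_succ', h6, swap_apply_left]
        intro j hj hjl
        refine ⟨fun h' => ?_, fun h' => hab ⟨j, by simpa using h'⟩⟩
        have := Nat.le_of_dvd hj ((pow_apply_eq_self_iff P a j).1 h')
        omega
      by_contra hno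
      have h4 := (hinv.fixed_mul_left_iff h2 heven).2 hno
      rw [hinv.mul_left.exists_fixed_iff_even (h1.trans h3.symm) heven] at h4
      have h5 := G.odd _ c1
      rw [Int.even_coe_nat] at h4
      exact (Nat.not_even_iff_odd.2 h5) h4
  -- After the join the reflection fixes `x₁`, hence γ has no fixed point on the new even cycle, in
  -- agreement with the colour.
  · set b := (P * γ) x₁ with hb
    have hlb : lab b = j₂ := by rw [hb, Perm.mul_apply, h.lab_apply, h.bar, hx₁, c1]
    have hab : ¬ P.SameCycle x₁ b := by rw [h.same, hx₁, hlb]; exact hne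
    refine ⟨x₁, b, h.join hne hw hr hl (by rcases c3 with c3 | c3 <;> rw [c3] <;> simp) ?_
      hx₁ hlb (mul_swap_comm_of_swapped rfl (hρ.apply_apply x₁)) ?_⟩
    · rintro j (rfl | rfl)
      · right; exact c1
      · left; rw [← c1, G.bar_bar]
    · intro _ hinv hcard
      refine iff_of_false ?_ c4
      have heven : Even (cyc (swap x₁ b * P) x₁).card := by rw [hcard]; exact G.even _ c3
      have h1 : (swap x₁ b * P * γ) x₁ = x₁ := by
        rw [mul_assoc, Perm.mul_apply, ← hb, swap_apply_right]
      have h2 : (swap x₁ b * P).SameCycle x₁ (γ x₁) := by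
        have h3 : (swap x₁ b * P).SameCycle (γ x₁) x₁ := ⟨1, by rw [zpow_one]; exact h1⟩
        exact h3.symm
      exact (hinv.fixed_mul_left_iff h2 heven).1 ⟨x₁, Perm.SameCycle.refl _ _, h1⟩

-- On the cycle to be cut, `P * γ` moves the i-th point by t + 1 - 2i steps. Exchanging the two
-- points of the swap means that this number is congruent to the length of the first part, and
-- fixing both means two opposite points. Solvability is decided by parity, which the colours
-- prescribe.
omit [Fintype ι] in
theorem ColouredGraph.IsState.step_cut (h : G.IsState i ε P γ lab) {j₁ j₂ j₃ : ι} (hne : j₁ ≠ j₂)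
    (hw : (G.ed j₃).weight = (G.ed j₁).weight + (G.ed j₂).weight)
    (hcol : G.VertexColours ε j₁ j₂ j₃)
    (hr : ∀ j, (G.ed j).right = i + 1 ↔ j = j₃)
    (hl : ∀ j, (G.ed j).left = i + 1 ↔ j = j₁ ∨ j = j₂) :
    ∃ a b lab', G.IsState (i + 1) ε (swap a b * P) γ lab' ∧ G.IsStep i P γ lab lab' a b := by
  have hr3 := (hr j₃).2 rfl
  have hl3 := G.lt j₃
  obtain ⟨x, hx⟩ := h.exists_lab (j := j₃) (by omega) (by omega)
  have hρ := h.inverts.mul_left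
  have hnd : G.col j₃ ≠ .dotted := by
    rcases hcol with ⟨_, _, c3, _⟩ | ⟨_, _, c3 | c3, _⟩ | ⟨_, c3 | c3, _⟩ <;> rw [c3] <;> simp
  have hx' : G.col (lab x) ≠ .dotted := by rw [hx]; exact hnd
  obtain ⟨t, ht⟩ := h.sameCycle_gamma hx'
  have hρx : (P * γ) x = (P ^ (t + 1)) x := by
    rw [Perm.mul_apply, ← ht, add_comm, zpow_one_add, Perm.mul_apply]
  have hcard : (cyc P x).card = (G.ed j₃).weight := by rw [h.card_cyc, hx]
  have hρi : ∀ i : ℤ, (P * γ) ((P ^ i) x) = (P ^ (t + 1 - 2 * i)) ((P ^ i) x) := by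
    intro i
    rw [hρ.apply_zpow, hρx, ← Perm.mul_apply, ← Perm.mul_apply, ← zpow_add, ← zpow_add]
    congr 2; ring
  have hlab : ∀ i : ℤ, lab ((P ^ i) x) = j₃ := by
    intro i
    rw [← hx]
    exact ((h.same _ _).1 ⟨i, rfl⟩).symm
  have hmod : ∀ (i u v : ℤ), ((G.ed j₃).weight : ℤ) ∣ u - v →
      (P ^ u) ((P ^ i) x) = (P ^ v) ((P ^ i) x) := by
    intro i u v huv
    have h1 : (P ^ (u - v)) ((P ^ i) x) = (P ^ i) x := by
      rw [zpow_apply_eq_self_iff, h.card_cyc, hlab]; exact huv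
    have h2 := congrArg (P ^ v) h1
    rwa [← Perm.mul_apply, ← zpow_add, add_sub_cancel] at h2
  -- the two points of the swap are exchanged by the reflection
  have key1 : ∀ i : ℤ, ((G.ed j₃).weight : ℤ) ∣ t + 1 - 2 * i - (G.ed j₁).weight →
      ∃ a b, lab a = j₃ ∧ (P ^ (G.ed j₁).weight) a = b ∧ (P * γ) a = b ∧ (P * γ) b = a := by
    intro i hi
    have h1 : (P * γ) ((P ^ i) x) = (P ^ (G.ed j₁).weight) ((P ^ i) x) := by
      rw [hρi, hmod i _ _ hi, zpow_natCast]
    refine ⟨_, _, hlab i, rfl, h1, ?_⟩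
    rw [← h1, hρ.apply_apply]
  rcases hcol with ⟨c1, c2, c3, c4⟩ | ⟨c1, c2, c3, c4⟩ | ⟨c1, c3, c4⟩
  · obtain ⟨m, hm⟩ := G.odd _ c3
    -- The cycle has odd length 2m + 1, so m + 1 is the inverse of two modulo the length.
    obtain ⟨a, b, ha, hb, hab, hba⟩ := key1 ((t + 1 - (G.ed j₁).weight) * (m + 1))
      ⟨-(t + 1 - (G.ed j₁).weight), by rw [hm]; push_cast; ring⟩
    have hnd2 : G.col j₂ ≠ .dotted := by rcases c2 with hj | hj <;> simp [hj]
    refine ⟨a, b, h.cut hne hw hr hl hnd ha hb (mul_swap_comm_of_swapped hab hba)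
      (Or.inl ⟨hab, hba, ?_, ?_⟩) (by rw [c1]; simp) ?_⟩
    · rw [G.bar_eq, c1]; simp
    · rw [G.bar_eq]; exact hnd2
    · intro _ hinv hcard2
      refine iff_of_false ?_ c4
      have heven : Even (cyc (swap a b * P) b).card := by rw [hcard2]; exact G.even _ c2
      have h1 : (swap a b * P * γ) b = b := by
        rw [mul_assoc, Perm.mul_apply, hba, swap_apply_left]
      have h2 : (swap a b * P).SameCycle b (γ b) := by
        have h3 : (swap a b * P).SameCycle (γ b) b := ⟨1, by rw [zpow_one]; exact h1⟩
        exact h3.symm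
      exact (hinv.fixed_mul_left_iff h2 heven).1 ⟨b, Perm.SameCycle.refl _ _, h1⟩
  · have ht_even : Even t := by
      rw [← h.inverts.exists_fixed_iff_even ht.symm (by rw [hcard]; exact G.even _ c3),
        h.fix_iff (by rw [hx]; exact c3), hx]
      exact c4
    obtain ⟨u, hu⟩ := ht_even
    obtain ⟨m, hm⟩ := G.odd _ c1
    -- Here t = 2u and the first part has length 2m + 1, so the congruence is solved by an equality
    -- of integers.
    obtain ⟨a, b, ha, hb, hab, hba⟩ := key1 (u - m) ⟨0, by rw [hm, hu]; push_cast; ring⟩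
    refine ⟨a, b, h.cut hne hw hr hl hnd ha hb (mul_swap_comm_of_swapped hab hba)
      (Or.inl ⟨hab, hba, ?_, ?_⟩) (by rw [c1]; simp) ?_⟩
    · rw [G.bar_eq, c1]; simp
    · rw [G.bar_eq, c2]; simp
    · rw [c2]; simp
  · have ht_odd : ¬ Even t := by
      rw [← h.inverts.exists_fixed_iff_even ht.symm (by rw [hcard]; exact G.even _ c3),
        h.fix_iff (by rw [hx]; exact c3), hx]
      exact c4
    rw [Int.not_even_iff_odd] at ht_odd
    obtain ⟨u, hu⟩ := ht_odd
    have hw' : (G.ed j₃).weight = 2 * (G.ed j₁).weight := by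
      rw [hw, ← c1, G.ed_bar]; ring
    -- Now t = 2u + 1, so the reflection has a fixed point, and the opposite point of the even cycle
    -- is fixed too. The cut between them gives two halves of equal length, exchanged by γ.
    have ha : (P * γ) ((P ^ (u + 1)) x) = (P ^ (u + 1)) x := by
      rw [hρi, hu, show 2 * u + 1 + 1 - 2 * (u + 1) = 0 by ring, zpow_zero, Perm.one_apply]
    have hb : (P * γ) ((P ^ (G.ed j₁).weight) ((P ^ (u + 1)) x)) =
        (P ^ (G.ed j₁).weight) ((P ^ (u + 1)) x) := by
      rw [← zpow_natCast, hρ.apply_zpow, ha]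
      refine hmod _ _ _ ⟨-1, ?_⟩
      rw [hw']; push_cast; ring
    have hj : ∀ {j}, (j = j₁ ∨ j = j₂) → G.col j = .dotted := by
      intro j hj
      by_contra h'
      rw [← Ne, ← G.bar_eq] at h'
      rcases hj with rfl | rfl
      · exact hne (h'.symm.trans c1)
      · rw [← c1, G.bar_bar] at h'; exact hne (h'.trans c1)
    refine ⟨_, _, h.cut hne hw hr hl hnd (hlab (u + 1)) rfl (mul_swap_comm_of_fixed ha hb)
      (Or.inr ⟨ha, hb, c1⟩) (by rw [hj (Or.inl rfl)]; simp) (by rw [hj (Or.inr rfl)]; simp)⟩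

omit [Fintype ι] in
/-- A state before a vertex can be continued to a state after the vertex. -/
theorem ColouredGraph.IsState.step (h : G.IsState i ε P γ lab) (hv : G.IsVertex (i + 1) ε) :
    ∃ a b lab', G.IsState (i + 1) ε (swap a b * P) γ lab' ∧ G.IsStep i P γ lab lab' a b := by
  obtain ⟨j₁, j₂, j₃, hne, hw, hcol, ⟨hr, hl⟩ | ⟨hr, hl⟩⟩ := hv
  · exact h.step_join hne hw hcol hr hl
  · exact h.step_cut hne hw hcol hr hl

end States


/-! ### A permutation and an involution to the left of all vertices. -/

section InitialState

variable {ι : Type*} [Fintype ι] [DecidableEq ι]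

/-- The sheets over a point to the left of all vertices: for each in-end of weight `w` there are `w`. -/
abbrev ColouredGraph.Sheets (G : ColouredGraph ι) : Type _ :=
  Σ j : {j : ι // (G.ed j).left = 0}, Fin (G.ed j).weight

variable (G : ColouredGraph ι)

omit [Fintype ι] [DecidableEq ι] in
theorem ColouredGraph.sheets_ext {x y : G.Sheets} (h : x.1.1 = y.1.1) (h' : x.2.1 = y.2.1) :
    x = y := by
  obtain ⟨⟨j, hj⟩, i, hi⟩ := x
  obtain ⟨⟨j', hj'⟩, i', hi'⟩ := y
  dsimp at h h'
  subst h h'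
  rfl

/-- The reflection of the cycles that fixes the position `0`. -/
def reflIdx (w i : ℕ) : ℕ := if i = 0 then 0 else w - i

/-- The reflection of the cycles that exchanges the first and the last position. -/
def revIdx (w i : ℕ) : ℕ := w - 1 - i

/-- The permutation of the sheets given by a function on the positions that is an involution. -/
def ColouredGraph.sheetPerm (bar : ι → ι) (hbar : ∀ j, bar (bar j) = j)
    (hed : ∀ j, G.ed (bar j) = G.ed j) (f : Edge × Colour → ℕ → ℕ → ℕ)
    (hcol : ∀ j, G.col (bar j) = G.col j)
    (hf : ∀ c w i, i < w → f c w i < w ∧ f c w (f c w i) = i) : Perm G.Sheets :=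
  Function.Involutive.toPerm
    (fun x => ⟨⟨bar x.1.1, by rw [hed]; exact x.1.2⟩,
      ⟨f (G.ed x.1.1, G.col x.1.1) (G.ed x.1.1).weight x.2, by
        rw [hed]; exact (hf _ _ _ x.2.2).1⟩⟩)
    (fun x => G.sheets_ext (hbar _) (by
      dsimp only
      rw [hed, hcol]
      exact (hf _ _ _ x.2.2).2))

theorem reflIdx_spec (w i : ℕ) (h : i < w) : reflIdx w i < w ∧ reflIdx w (reflIdx w i) = i := by
  unfold reflIdx
  split_ifs <;> omega

theorem revIdx_spec (w i : ℕ) (h : i < w) : revIdx w i < w ∧ revIdx w (revIdx w i) = i := by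
  unfold revIdx
  omega

/-- There is a state to the left of all vertices, on a set of sheets of the right size. -/
theorem ColouredGraph.exists_initial : ∃ (P γ : Perm G.Sheets) (lab : G.Sheets → ι),
    G.IsState 0 1 P γ lab := by
  set a : Perm G.Sheets := G.sheetPerm id (fun _ => rfl) (fun _ => rfl) (fun _ => revIdx)
    (fun _ => rfl) (fun _ => revIdx_spec) with ha
  set b : Perm G.Sheets := G.sheetPerm id (fun _ => rfl) (fun _ => rfl) (fun _ => reflIdx)
    (fun _ => rfl) (fun _ => reflIdx_spec) with hb
  -- The sign at the start is +1, so a blue cycle must have no fixed point and a red one must have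
  -- one. On an even number of positions `revIdx` fixes nothing, while `reflIdx` always fixes the
  -- position 0. For odd and dotted edges either choice would do.
  set f : Edge × Colour → ℕ → ℕ → ℕ := fun c => if c.2 = .blue then revIdx else reflIdx with hf
  have hfspec : ∀ c w i, i < w → f c w i < w ∧ f c w (f c w i) = i := by
    intro c w i h
    simp only [hf]
    split_ifs
    · exact revIdx_spec w i h
    · exact reflIdx_spec w i h
  set γ : Perm G.Sheets := G.sheetPerm G.bar G.bar_bar G.ed_bar f G.col_bar hfspec with hγ
  have ha1 : ∀ x, (a x).1.1 = x.1.1 := fun _ => rfl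
  have ha2 : ∀ x, (a x).2.1 = revIdx (G.ed x.1.1).weight x.2 := fun _ => rfl
  have hb1 : ∀ x, (b x).1.1 = x.1.1 := fun _ => rfl
  have hb2 : ∀ x, (b x).2.1 = reflIdx (G.ed x.1.1).weight x.2 := fun _ => rfl
  have hγ1 : ∀ x, (γ x).1.1 = G.bar x.1.1 := fun _ => rfl
  have hγ2 : ∀ x, (γ x).2.1 = f (G.ed x.1.1, G.col x.1.1) (G.ed x.1.1).weight x.2 := fun _ => rfl
  have haa : ∀ x, a (a x) = x := fun x => G.sheets_ext rfl (revIdx_spec _ _ x.2.2).2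
  have hbb : ∀ x, b (b x) = x := fun x => G.sheets_ext rfl (reflIdx_spec _ _ x.2.2).2
  have hγγ : ∀ x, γ (γ x) = x := Function.Involutive.toPerm_involutive _
  -- The product of the two reflections is the rotation by one position on every in-end. It is
  -- inverted by either of them, also when the two sheets sets of a dotted pair are exchanged in
  -- addition.
  set P : Perm G.Sheets := b * a with hP
  have hP1 : ∀ x, (P x).1.1 = x.1.1 := fun _ => rfl
  have hP2 : ∀ x, x.2.1 + 1 < (G.ed x.1.1).weight → (P x).2.1 = x.2.1 + 1 := by
    intro x hx
    have : (P x).2.1 = reflIdx (G.ed x.1.1).weight (revIdx (G.ed x.1.1).weight x.2) := rfl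
    rw [this, reflIdx, revIdx]
    split_ifs <;> omega
  have hpow1 : ∀ (m : ℕ) x, ((P ^ m) x).1.1 = x.1.1 := by
    intro m x
    induction m with
    | zero => rfl
    | succ m ih => rw [pow_succ', Perm.mul_apply, hP1, ih]
  have hpow2 : ∀ (m : ℕ) x, x.2.1 + m < (G.ed x.1.1).weight → ((P ^ m) x).2.1 = x.2.1 + m := by
    intro m x hm
    induction m with
    | zero => rfl
    | succ m ih =>
      have h1 := ih (by omega)
      have h2 : (G.ed ((P ^ m) x).1.1).weight = (G.ed x.1.1).weight :=
        congrArg (fun j => (G.ed j).weight) (hpow1 m x)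
      rw [pow_succ', Perm.mul_apply, hP2 _ (by omega), h1]
      omega
  have hsame : ∀ x y, P.SameCycle x y ↔ x.1.1 = y.1.1 := by
    intro x y
    constructor
    · intro h
      obtain ⟨m, rfl⟩ := h.exists_nat_pow_eq
      rw [hpow1]
    · intro h
      have key : ∀ x : G.Sheets, P.SameCycle ⟨x.1, ⟨0, G.pos _⟩⟩ x := by
        intro x
        refine ⟨(x.2.1 : ℕ), ?_⟩
        rw [zpow_natCast]
        refine G.sheets_ext (hpow1 _ _) ?_
        rw [hpow2]
        · simp
        · have := x.2.2
          simp only [zero_add]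
          exact this
      obtain ⟨⟨j, hj⟩, i⟩ := x
      obtain ⟨⟨j', hj'⟩, i'⟩ := y
      dsimp only at h
      subst h
      exact (key ⟨⟨j, hj⟩, i⟩).symm.trans (key ⟨⟨j, hj⟩, i'⟩)
  have hγP : γ * P * γ = P⁻¹ := by
    have hcase : ∀ x, P (γ (P x)) = γ x := by
      intro x
      refine G.sheets_ext rfl ?_
      have e : (P (γ (P x))).2.1 = reflIdx (G.ed (G.bar x.1.1)).weight
        (revIdx (G.ed (G.bar x.1.1)).weight (f (G.ed x.1.1, G.col x.1.1) (G.ed x.1.1).weight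
          (reflIdx (G.ed x.1.1).weight (revIdx (G.ed x.1.1).weight x.2)))) := rfl
      have hx := x.2.2
      rw [e, hγ2, G.ed_bar]
      clear e
      obtain ⟨y, i, hi⟩ := x
      dsimp only at hx ⊢
      generalize (G.ed y.1).weight = w at hx
      simp only [hf]
      split_ifs
      · rw [(revIdx_spec w _ (reflIdx_spec w _ (revIdx_spec w _ hx).1).1).2,
          (reflIdx_spec w _ (revIdx_spec w _ hx).1).2]
      · rw [(reflIdx_spec w _ (revIdx_spec w _ hx).1).2, (revIdx_spec w _ hx).2]
    have h1 : P * γ * P = γ := Equiv.ext hcase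
    have h2 : γ * γ = 1 := Equiv.ext hγγ
    have h3 : γ * P * γ * P = 1 := by
      rw [mul_assoc, mul_assoc, ← mul_assoc P, h1, h2]
    exact eq_inv_of_mul_eq_one_left h3
  refine ⟨P, γ, fun x => x.1.1, ⟨⟨Equiv.ext hγγ, hγP⟩, hsame, fun x => ⟨x.1.2.le, ?_⟩,
    fun j h1 h2 => ?_, fun x => rfl, fun j h1 h2 hj => ?_⟩⟩
  · have := G.lt x.1.1
    omega
  · have hj : (G.ed j).left = 0 := by omega
    rw [show (Finset.univ.filter fun x : G.Sheets => x.1.1 = j) =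
      Finset.univ.image fun i : Fin (G.ed j).weight => (⟨⟨j, hj⟩, i⟩ : G.Sheets) from ?_]
    · rw [Finset.card_image_of_injective, Finset.card_univ, Fintype.card_fin]
      intro i i' h
      simpa using h
    · ext ⟨⟨j', hj'⟩, i⟩
      simp only [Finset.mem_filter, Finset.mem_univ, true_and, Finset.mem_image]
      constructor
      · rintro rfl; exact ⟨i, rfl⟩
      · rintro ⟨i', h⟩
        exact (congrArg (fun x : G.Sheets => x.1.1) h).symm
  · have hj0 : (G.ed j).left = 0 := by omega
    have heven := G.even j hj
    have hnd : G.bar j = j := by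
      rw [G.bar_eq]; rcases hj with hj | hj <;> simp [hj]
    rw [iff_true_right rfl]
    constructor
    · rintro ⟨x, rfl, hx⟩
      have h3 := hγ2 x
      rw [hx] at h3
      rcases hj with hj | hj
      · exact hj
      · exfalso
        simp only [hf, hj, if_true, revIdx] at h3
        have := x.2.2
        obtain ⟨m, hm⟩ := heven
        omega
    · intro hred
      refine ⟨⟨⟨j, hj0⟩, ⟨0, G.pos _⟩⟩, rfl, G.sheets_ext hnd ?_⟩
      rw [hγ2]
      simp [hf, hred, reflIdx]

omit [Fintype ι] in
theorem ColouredGraph.IsState.transport {α β : Type*} [Fintype α] [DecidableEq α] [Fintype β]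
    [DecidableEq β] {G : ColouredGraph ι} {i : ℕ} {ε : ℤˣ} {P γ : Perm α} {lab : α → ι}
    (h : G.IsState i ε P γ lab) (e : α ≃ β) :
    G.IsState i ε (e.permCongrHom P) (e.permCongrHom γ) (lab ∘ e.symm) where
  inverts := by
    refine ⟨?_, ?_⟩
    · rw [← map_mul, h.inverts.1, map_one]
    · rw [← map_mul, ← map_mul, h.inverts.2, map_inv]
  same x y := by
    rw [Function.comp_apply, Function.comp_apply, ← h.same]
    constructor
    · rintro ⟨m, hm⟩
      refine ⟨m, ?_⟩
      rw [← map_zpow] at hm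
      rw [← hm]; simp
    · rintro ⟨m, hm⟩
      refine ⟨m, ?_⟩
      rw [← map_zpow]
      simp [hm]
  alive x := h.alive _
  card j h1 h2 := by
    rw [← h.card j h1 h2, ← Finset.card_map e.toEmbedding]
    congr 1
    ext x
    simp only [Finset.mem_filter, Finset.mem_univ, true_and, Finset.mem_map_equiv,
      Function.comp_apply]
  bar x := by simp [h.bar]
  fix j h1 h2 hj := by
    rw [← h.fix j h1 h2 hj]
    constructor
    · rintro ⟨x, hx, hx'⟩
      refine ⟨e.symm x, hx, ?_⟩
      have := congrArg e.symm hx'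
      simpa using this
    · rintro ⟨x, hx, hx'⟩
      exact ⟨e x, by simpa using hx, by simp [hx']⟩

end InitialState

/-! ### Factorizations that realize a coloured graph. -/

section Realization

variable {ι : Type*} [Fintype ι] [DecidableEq ι]

/-- The real tuple `T` with the labelling `lab` of the cycles by edges realizes the coloured graph. -/
structure ColouredGraph.Realizes (G : ColouredGraph ι) {n r : ℕ} (s : Fin r → ℤˣ)
    (T : RealTuple n r) (lab : ℕ → Fin n → ι) : Prop where
  state : ∀ i ≤ r, G.IsState i (signAt s i) (T.partialProd i) (T.involution s i) (lab i)
  step : ∀ i (hi : i < r), ∃ a b, T.τ ⟨i, hi⟩ = swap a b ∧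
    G.IsStep i (T.partialProd i) (T.involution s (i + 1)) (lab i) (lab (i + 1)) a b
  last : T.σ₂ = (T.partialProd r)⁻¹

/-- The states are continued from left to right; the transpositions are the quotients of consecutive
permutations. -/
theorem ColouredGraph.exists_realizes (G : ColouredGraph ι) {n r : ℕ} (s : Fin r → ℤˣ)
    (hv : ∀ i < r, G.IsVertex (i + 1) (signAt s (i + 1)))
    (hn : ∑ j with (G.ed j).left = 0, (G.ed j).weight = n) :
    ∃ (T : RealTuple n r) (lab : ℕ → Fin n → ι), G.Realizes s T lab := by
  obtain ⟨P₀, γ₀, lab₀, h₀⟩ : ∃ (P γ : Perm (Fin n)) (lab : Fin n → ι), G.IsState 0 1 P γ lab := by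
    obtain ⟨P, γ, lab, h⟩ := G.exists_initial
    have hc : Fintype.card G.Sheets = Fintype.card (Fin n) := by
      rw [Fintype.card_sigma, Fintype.card_fin, ← hn]
      simp only [Fintype.card_fin]
      exact (Finset.sum_subtype (Finset.univ.filter fun j => (G.ed j).left = 0) (by simp)
        fun j => (G.ed j).weight).symm
    exact ⟨_, _, _, h.transport (Fintype.equivOfCardEq hc)⟩
  let Inv : ℕ → Perm (Fin n) × Perm (Fin n) × (Fin n → ι) → Prop := fun i d =>
    G.IsState i (signAt s i) d.1 d.2.1 d.2.2
  have hstep : ∀ i (d : Perm (Fin n) × Perm (Fin n) × (Fin n → ι)),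
      ∃ d' : Perm (Fin n) × Perm (Fin n) × (Fin n → ι), i < r → Inv i d → Inv (i + 1) d' ∧
      (d'.2.1 = if signAt s (i + 1) = signAt s i then d.2.1 else d.2.1 * d.1) ∧
      ∃ a b, d'.1 = swap a b * d.1 ∧ G.IsStep i d.1 d'.2.1 d.2.2 d'.2.2 a b := by
    intro i d
    by_cases hi : i < r
    swap
    · exact ⟨d, fun h => absurd h hi⟩
    by_cases hd : Inv i d
    swap
    · exact ⟨d, fun _ h => absurd h hd⟩
    -- The swap at a vertex must fit the involution that belongs to the sign of this vertex, so a
    -- change of sign is carried out before the step.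
    by_cases hs : signAt s (i + 1) = signAt s i
    · have hd' : G.IsState i (signAt s (i + 1)) d.1 d.2.1 d.2.2 := by rw [hs]; exact hd
      obtain ⟨a, b, lab', h1, h2⟩ := hd'.step (hv i hi)
      exact ⟨(swap a b * d.1, d.2.1, lab'), fun _ _ => ⟨h1, (if_pos hs).symm, a, b, rfl, h2⟩⟩
    · have hd' : G.IsState i (signAt s (i + 1)) d.1 (d.2.1 * d.1) d.2.2 := by
        have h3 : signAt s (i + 1) = - signAt s i := by
          rcases Int.units_eq_one_or (signAt s (i + 1)) with h4 | h4 <;>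
          rcases Int.units_eq_one_or (signAt s i) with h5 | h5 <;> simp_all
        rw [h3]
        exact ColouredGraph.IsState.switch hd
      obtain ⟨a, b, lab', h1, h2⟩ := hd'.step (hv i hi)
      exact ⟨(swap a b * d.1, d.2.1 * d.1, lab'),
        fun _ _ => ⟨h1, (if_neg hs).symm, a, b, rfl, h2⟩⟩
  choose nxt hnxt using hstep
  let f : ℕ → Perm (Fin n) × Perm (Fin n) × (Fin n → ι) := fun i =>
    Nat.rec (P₀, γ₀, lab₀) (fun i d => nxt i d) i
  have hf : ∀ i, f (i + 1) = nxt i (f i) := fun _ => rfl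
  have hinv : ∀ i ≤ r, Inv i (f i) := by
    intro i hi
    induction i with
    | zero => exact h₀
    | succ i ih =>
      rw [hf]
      exact (hnxt i (f i) hi (ih (by omega))).1
  let T : RealTuple n r :=
    { σ₁ := P₀
      τ := fun i => (f (i + 1)).1 * ((f i).1)⁻¹
      σ₂ := ((f r).1)⁻¹
      γ := γ₀ }
  have hP : ∀ i ≤ r, T.partialProd i = (f i).1 := by
    intro i hi
    induction i with
    | zero => rfl
    | succ i ih =>
      rw [PermTuple.partialProd, dif_pos (show i < r from hi), ih (by omega)]
      simp [T]
  have hγ : ∀ i ≤ r, T.involution s i = (f i).2.1 := by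
    intro i hi
    induction i with
    | zero => rfl
    | succ i ih =>
      rw [RealTuple.involution, ih (by omega), hP i (by omega),
        ← (hnxt i (f i) hi (hinv i (by omega))).2.1]
  refine ⟨T, fun i => (f i).2.2, ⟨fun i hi => ?_, fun i hi => ?_, ?_⟩⟩
  · rw [hP i hi, hγ i hi]; exact hinv i hi
  · obtain ⟨-, -, a, b, h1, h2⟩ := hnxt i (f i) hi (hinv i hi.le)
    refine ⟨a, b, ?_, ?_⟩
    · change (f (i + 1)).1 * ((f i).1)⁻¹ = _
      rw [hf, h1, mul_inv_cancel_right]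
    · rw [hP i hi.le, hγ (i + 1) hi]; exact h2
  · rw [hP r le_rfl]

omit [Fintype ι] in
theorem ColouredGraph.IsState.parts [Fintype ι] {G : ColouredGraph ι} {n i : ℕ} {ε : ℤˣ}
    {P γ : Perm (Fin n)} {lab : Fin n → ι} (h : G.IsState i ε P γ lab) :
    P.partition.parts = (Finset.univ.filter fun j =>
      (G.ed j).left ≤ i ∧ i < (G.ed j).right).val.map fun j => (G.ed j).weight := by
  have h1 : cycles P = (Finset.univ.filter fun j => (G.ed j).left ≤ i ∧ i < (G.ed j).right).image
      fun j => Finset.univ.filter fun x => lab x = j := by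
    ext B
    simp only [mem_cycles, Finset.mem_image, Finset.mem_filter, Finset.mem_univ, true_and]
    constructor
    · rintro ⟨x, rfl⟩
      exact ⟨lab x, h.alive x, (h.cyc_eq x).symm⟩
    · rintro ⟨j, ⟨h1, h2⟩, rfl⟩
      obtain ⟨x, rfl⟩ := h.exists_lab h1 h2
      exact ⟨x, h.cyc_eq x⟩
  rw [partition_parts_eq, h1, Finset.image_val_of_injOn, Multiset.map_map]
  · refine Multiset.map_congr rfl fun j hj => ?_
    rw [Finset.mem_val, Finset.mem_filter] at hj
    exact h.card j hj.2.1 hj.2.2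
  · intro j hj j' hj' hjj
    rw [Finset.mem_coe, Finset.mem_filter] at hj
    obtain ⟨x, rfl⟩ := h.exists_lab hj.2.1 hj.2.2
    simpa using (Finset.ext_iff.1 hjj x).1 (by simp)

theorem cycles_inv {α : Type*} [Fintype α] [DecidableEq α] (σ : Perm α) :
    cycles σ⁻¹ = cycles σ := by
  unfold cycles cyc
  simp only [Perm.sameCycle_inv]

variable {G : ColouredGraph ι} {n r : ℕ} {s : Fin r → ℤˣ} {T : RealTuple n r}
  {lab : ℕ → Fin n → ι}

omit [Fintype ι] in
theorem ColouredGraph.Realizes.lab_succ_iff (h : G.Realizes s T lab) {i : ℕ} (hi : i < r) {x : Fin n}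
    {j : ι} (h1 : (G.ed j).left ≤ i) (h2 : i + 1 < (G.ed j).right) :
    lab (i + 1) x = j ↔ lab i x = j := by
  obtain ⟨a, b, -, hs⟩ := h.step i hi
  by_cases hx : (G.ed (lab i x)).right = i + 1
  · have := hs.new x hx
    refine iff_of_false (fun h' => ?_) (fun h' => ?_)
    · rw [h'] at this; omega
    · rw [h'] at hx; omega
  · rw [hs.lab_eq x hx]

omit [Fintype ι] in
theorem ColouredGraph.Realizes.lab_iff (h : G.Realizes s T lab) {i i' : ℕ} (hii : i ≤ i')
    (hi : i' ≤ r) {x : Fin n} {j : ι} (h1 : (G.ed j).left ≤ i) (h2 : i' < (G.ed j).right) :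
    lab i' x = j ↔ lab i x = j := by
  induction i', hii using Nat.le_induction with
  | base => rfl
  | succ m hm ih =>
    rw [h.lab_succ_iff (by omega) (by omega) h2, ih (by omega) (by omega)]

-- Points that carry the same edge, possibly at different times, lie in one orbit, and at a vertex
-- the transposition links all edges that meet there. Connectedness of the graph does the rest.
omit [Fintype ι] in
theorem ColouredGraph.Realizes.transitive [NeZero n] (h : G.Realizes s T lab)
    (hright : ∀ j, (G.ed j).right ≤ r + 1)
    (hconn : ∀ j j', Relation.ReflTransGen (fun a b => ∃ v ∈ Set.Icc 1 r,
      Incident v (G.ed a) ∧ Incident v (G.ed b)) j j') :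
    MulAction.IsPretransitive
      (Subgroup.closure (insert T.σ₁ (insert T.σ₂ (Set.range T.τ)))) (Fin n) := by
  set H := Subgroup.closure (insert T.σ₁ (insert T.σ₂ (Set.range T.τ))) with hH
  have hτ : ∀ i, T.τ i ∈ H := fun i =>
    Subgroup.subset_closure (Or.inr (Or.inr ⟨i, rfl⟩))
  have hP : ∀ i, T.partialProd i ∈ H := by
    intro i
    induction i with
    | zero => exact Subgroup.subset_closure (Or.inl rfl)
    | succ i ih =>
      rw [PermTuple.partialProd]
      split_ifs with hi
      · exact H.mul_mem (hτ _) ih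
      · exact ih
  let R : Fin n → Fin n → Prop := fun x y => ∃ σ ∈ H, σ x = y
  have Rrefl : ∀ x, R x x := fun x => ⟨1, H.one_mem, rfl⟩
  have Rsymm : ∀ {x y}, R x y → R y x := by
    rintro x y ⟨σ, hσ, rfl⟩
    exact ⟨σ⁻¹, H.inv_mem hσ, by simp⟩
  have Rtrans : ∀ {x y z}, R x y → R y z → R x z := by
    rintro x y z ⟨σ, hσ, rfl⟩ ⟨σ', hσ', rfl⟩
    exact ⟨σ' * σ, H.mul_mem hσ' hσ, rfl⟩
  have hA : ∀ i ≤ r, ∀ x y, lab i x = lab i y → R x y := by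
    intro i hi x y hxy
    obtain ⟨m, hm⟩ := ((h.state i hi).same x y).2 hxy
    exact ⟨_, H.zpow_mem (hP i) m, hm⟩
  have hB' : ∀ i i', i ≤ i' → i' ≤ r → ∀ x y, lab i x = lab i' y → R x y := by
    intro i i' hii hi' x y hxy
    refine hA i' hi' x y ?_
    have h1 := (h.state i (hii.trans hi')).alive x
    have h2 := (h.state i' hi').alive y
    rw [← hxy] at h2
    rw [← hxy]
    exact (h.lab_iff hii hi' h1.1 h2.2).2 rfl
  have hB : ∀ i ≤ r, ∀ i' ≤ r, ∀ x y, lab i x = lab i' y → R x y := by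
    intro i hi i' hi' x y hxy
    rcases le_total i i' with hii | hii
    · exact hB' i i' hii hi' x y hxy
    · exact Rsymm (hB' i' i hii hi y x hxy.symm)
  have hC : ∀ j j' i i' x y, (∃ v ∈ Set.Icc 1 r, Incident v (G.ed j) ∧ Incident v (G.ed j')) →
      i ≤ r → i' ≤ r → lab i x = j → lab i' y = j' → R x y := by
    rintro j j' i i' x y ⟨v, ⟨hv1, hv2⟩, hj, hj'⟩ hi hi' hx hy
    obtain ⟨m, rfl⟩ : ∃ m, v = m + 1 := ⟨v - 1, by omega⟩
    obtain ⟨a, b, hab, hs⟩ := h.step m (by omega)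
    have hRab : R a b := ⟨_, hτ ⟨m, by omega⟩, by rw [hab, swap_apply_left]⟩
    have key : ∀ j i x, i ≤ r → lab i x = j → Incident (m + 1) (G.ed j) → R x a := by
      intro j i x hi hx hj
      rcases hj with hj | hj
      · rcases hs.hit_new j hj with h1 | h1
        · exact hB i hi (m + 1) hv2 x a (hx.trans h1.symm)
        · exact Rtrans (hB i hi (m + 1) hv2 x b (hx.trans h1.symm)) (Rsymm hRab)
      · rcases hs.hit_old j hj with h1 | h1
        · exact hB i hi m (by omega) x a (hx.trans h1.symm)
        · exact Rtrans (hB i hi m (by omega) x b (hx.trans h1.symm)) (Rsymm hRab)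
    exact Rtrans (key j i x hi hx hj) (Rsymm (key j' i' y hi' hy hj'))
  have hD : ∀ j j', Relation.ReflTransGen (fun a b => ∃ v ∈ Set.Icc 1 r,
      Incident v (G.ed a) ∧ Incident v (G.ed b)) j j' →
      ∀ i x, i ≤ r → lab i x = j → ∀ i' y, i' ≤ r → lab i' y = j' → R x y := by
    intro j j' hjj
    induction hjj with
    | refl =>
      intro i x hi hx i' y hi' hy
      exact hB i hi i' hi' x y (hx.trans hy.symm)
    | tail hab hbc ih =>
      rename_i b c
      intro i x hi hx i' y hi' hy
      have h1 := G.lt b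
      have h2 := hright b
      obtain ⟨z, hz⟩ := (h.state (G.ed b).left (by omega)).exists_lab le_rfl h1
      exact Rtrans (ih i x hi hx _ z (by omega) hz)
        (hC b c _ i' z y hbc (by omega) hi' hz hy)
  refine ⟨fun x y => ?_⟩
  obtain ⟨σ, hσ, hxy⟩ := hD _ _ (hconn (lab 0 x) (lab 0 y)) 0 x (Nat.zero_le _) rfl 0 y
    (Nat.zero_le _) rfl
  exact ⟨⟨σ, hσ⟩, hxy⟩

end Realization


/-! ### Recovering type, edges and colours from a realization. -/

section Consequences

variable {ι : Type*} [Fintype ι] [DecidableEq ι]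
variable {G : ColouredGraph ι} {n r : ℕ} {s : Fin r → ℤˣ} {T : RealTuple n r}
  {lab : ℕ → Fin n → ι}

/-- A realization of a connected coloured graph is a real factorization. -/
theorem ColouredGraph.Realizes.isRealFactorization {g : ℕ} [NeZero n] {lam mu : n.Partition}
    {s : Fin (numBranch g lam mu) → ℤˣ} {T : RealTuple n (numBranch g lam mu)}
    (h : G.Realizes s T lab)
    (hleft : (Finset.univ.filter fun j => (G.ed j).left = 0).val.map (fun j => (G.ed j).weight) =
      lam.parts)
    (hright : (Finset.univ.filter fun j => (G.ed j).right = numBranch g lam mu + 1).val.map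
      (fun j => (G.ed j).weight) = mu.parts)
    (hr : ∀ j, (G.ed j).right ≤ numBranch g lam mu + 1)
    (hconn : ∀ j j', Relation.ReflTransGen (fun a b => ∃ v ∈ Set.Icc 1 (numBranch g lam mu),
      Incident v (G.ed a) ∧ Incident v (G.ed b)) j j') :
    IsRealFactorization g lam mu s T := by
  have h0 := h.state 0 (Nat.zero_le _)
  have hl := h.state _ le_rfl
  refine ⟨⟨?_, ?_, ?_, fun i => ?_, h.transitive hr hconn⟩, h0.inverts.1, h0.inverts.2,
    fun i _ hi => (h.state i hi).inverts.2⟩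
  · rw [h.last, inv_mul_cancel]
  · have h1 : T.σ₁.partition.parts = _ := h0.parts
    rw [h1, ← hleft]
    congr 2
    ext j
    have := G.lt j
    simp only [Finset.mem_filter, Finset.mem_univ, true_and]
    omega
  · rw [h.last, partition_parts_eq, cycles_inv, ← partition_parts_eq, hl.parts, ← hright]
    congr 2
    ext j
    have := G.lt j
    have := hr j
    simp only [Finset.mem_filter, Finset.mem_univ, true_and]
    omega
  · obtain ⟨a, b, hab, hs⟩ := h.step i i.2
    exact ⟨a, b, hs.ne, hab⟩

/-- The elements of the cycle that corresponds to the edge `j`. -/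
def fibre (lab : Fin n → ι) (j : ι) : Finset (Fin n) := Finset.univ.filter fun x => lab x = j

omit [Fintype ι] in
theorem mem_fibre {lab : Fin n → ι} {j : ι} {x : Fin n} : x ∈ fibre lab j ↔ lab x = j := by
  simp [fibre]

omit [Fintype ι] in
theorem ColouredGraph.IsState.isCycleSet_iff {i : ℕ} {ε : ℤˣ} {P γ : Perm (Fin n)}
    {lab : Fin n → ι} (h : G.IsState i ε P γ lab) (B : Finset (Fin n)) :
    IsCycleSet P B ↔ ∃ j, (G.ed j).left ≤ i ∧ i < (G.ed j).right ∧ B = fibre lab j := by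
  constructor
  · rintro ⟨x, hx⟩
    refine ⟨lab x, (h.alive x).1, (h.alive x).2, ?_⟩
    ext y
    rw [hx, mem_fibre, h.same, eq_comm]
  · rintro ⟨j, h1, h2, rfl⟩
    obtain ⟨x, rfl⟩ := h.exists_lab h1 h2
    exact ⟨x, fun y => by rw [mem_fibre, h.same, eq_comm]⟩

omit [Fintype ι] in
theorem ColouredGraph.Realizes.fibre_eq (h : G.Realizes s T lab) {i : ℕ} {j : ι}
    (hi : i ≤ r) (h1 : (G.ed j).left ≤ i) (h2 : i < (G.ed j).right) :
    fibre (lab i) j = fibre (lab (G.ed j).left) j := by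
  ext x
  rw [mem_fibre, mem_fibre, h.lab_iff h1 hi le_rfl h2]

-- A set that survived the step would show that nobody enters or leaves the cycle, contrary to the
-- field `changed` of a step.
omit [Fintype ι] in
theorem ColouredGraph.Realizes.not_isCycleSet_right (h : G.Realizes s T lab) {i : ℕ} {j : ι}
    (hi : i < r) (h2 : (G.ed j).right = i + 1) :
    ¬ IsCycleSet (T.partialProd (i + 1)) (fibre (lab i) j) := by
  have h1 := G.lt j
  intro hc
  obtain ⟨j', -, -, hj⟩ := ((h.state (i + 1) hi).isCycleSet_iff _).1 hc
  obtain ⟨z, rfl⟩ := (h.state i hi.le).exists_lab (j := j) (by omega) (by omega)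
  obtain ⟨a, b, -, hs⟩ := h.step i hi
  obtain ⟨z', hz'⟩ := hs.changed z h2
  have hz := mem_fibre.1 (hj ▸ mem_fibre.2 rfl : z ∈ fibre (lab (i + 1)) j')
  rw [hz, ← mem_fibre, ← hj, mem_fibre] at hz'
  exact hz' Iff.rfl

omit [Fintype ι] in
theorem ColouredGraph.Realizes.not_isCycleSet_left (h : G.Realizes s T lab) {i : ℕ} {j : ι}
    (hi : i < r) (h2 : (G.ed j).left = i + 1) :
    ¬ IsCycleSet (T.partialProd i) (fibre (lab (i + 1)) j) := by
  have h1 := G.lt j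
  intro hc
  obtain ⟨j', h3, h4, hj⟩ := ((h.state i hi.le).isCycleSet_iff _).1 hc
  obtain ⟨z, rfl⟩ := (h.state (i + 1) hi).exists_lab (j := j) (by omega) (by omega)
  have hz := mem_fibre.1 (hj ▸ mem_fibre.2 rfl : z ∈ fibre (lab i) j')
  obtain ⟨a, b, -, hs⟩ := h.step i hi
  by_cases h5 : (G.ed (lab i z)).right = i + 1
  · refine h.not_isCycleSet_right hi h5 ?_
    rw [hz, ← hj]
    exact ((h.state (i + 1) hi).isCycleSet_iff _).2 ⟨_, h2.le, by omega, rfl⟩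
  · rw [hs.lab_eq z h5, hz] at h2
    omega

-- The elements of an edge form a cycle exactly as long as the edge lasts: they do so at all times
-- in between, and the set is destroyed at the right end and did not exist before the left end.
omit [Fintype ι] in
theorem ColouredGraph.Realizes.isCycleEdge_iff (h : G.Realizes s T lab)
    (hr : ∀ j, (G.ed j).right ≤ r + 1) (a b : ℕ) (B : Finset (Fin n)) :
    T.IsCycleEdge a b B ↔ ∃ j, (G.ed j).left = a ∧ (G.ed j).right = b ∧ B = fibre (lab a) j := by
  constructor
  · rintro ⟨h1, h2, h3, h4, h5⟩
    obtain ⟨j, h6, h7, rfl⟩ := ((h.state a (by omega)).isCycleSet_iff _).1 (h3 a le_rfl h1)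
    have h8 := h.fibre_eq (by omega) h6 h7
    have key : ∀ i ≤ r, (G.ed j).left ≤ i → i < (G.ed j).right →
        IsCycleSet (T.partialProd i) (fibre (lab a) j) := by
      intro i hi h9 h10
      rw [h8, ← h.fibre_eq hi h9 h10]
      exact ((h.state i hi).isCycleSet_iff _).2 ⟨j, h9, h10, rfl⟩
    refine ⟨j, ?_, ?_, rfl⟩
    · by_contra h9
      exact h4 (by omega) (key (a - 1) (by omega) (by omega) (by omega))
    · have h11 := hr j
      rcases lt_trichotomy (G.ed j).right b with h9 | h9 | h9
      · exfalso
        obtain ⟨i, hi⟩ : ∃ i, (G.ed j).right = i + 1 := ⟨(G.ed j).right - 1, by omega⟩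
        refine h.not_isCycleSet_right (by omega) hi ?_
        rw [h.fibre_eq (by omega) (by omega) (by omega), ← h8]
        exact h3 _ (by omega) (by omega)
      · exact h9
      · exact absurd (key b (by omega) (by omega) h9) (h5 (by omega))
  · rintro ⟨j, rfl, rfl, rfl⟩
    have h1 := G.lt j
    have h2 := hr j
    refine ⟨h1, h2, fun i h3 h4 => ?_, fun h3 => ?_, fun h3 => ?_⟩
    · rw [← h.fibre_eq (by omega) h3 h4]
      exact ((h.state i (by omega)).isCycleSet_iff _).2 ⟨j, h3, h4, rfl⟩
    · obtain ⟨i, hi⟩ : ∃ i, (G.ed j).left = i + 1 := ⟨(G.ed j).left - 1, by omega⟩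
      have := h.not_isCycleSet_left (by omega) hi
      rwa [hi]
    · obtain ⟨i, hi⟩ : ∃ i, (G.ed j).right = i + 1 := ⟨(G.ed j).right - 1, by omega⟩
      have := h.not_isCycleSet_right (by omega) hi
      rw [h.fibre_eq (by omega) (by omega) (by omega)] at this
      rwa [hi]

omit [Fintype ι] in
theorem ColouredGraph.Realizes.colour_eq (h : G.Realizes s T lab)
    (hr : ∀ j, (G.ed j).right ≤ r + 1) (j : ι) :
    T.colour s (G.ed j).left (fibre (lab (G.ed j).left) j) = G.col j := by
  have h1 := G.lt j
  have h2 := hr j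
  have hst := h.state (G.ed j).left (by omega)
  have hdot : (∃ x ∈ fibre (lab (G.ed j).left) j,
      T.involution s (G.ed j).left x ∉ fibre (lab (G.ed j).left) j) ↔ G.col j = .dotted := by
    simp only [mem_fibre, hst.bar]
    rw [← not_iff_not, ← Ne, ← G.bar_eq]
    push Not
    constructor
    · intro h3
      obtain ⟨x, hx⟩ := hst.exists_lab le_rfl h1
      have := h3 x hx
      rwa [hx] at this
    · rintro h3 x hx
      rw [hx, h3]
  have hcard : (fibre (lab (G.ed j).left) j).card = (G.ed j).weight := hst.card j le_rfl h1
  have hfix : (∃ x ∈ fibre (lab (G.ed j).left) j, T.involution s (G.ed j).left x = x) ↔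
      ∃ x, lab (G.ed j).left x = j ∧ T.involution s (G.ed j).left x = x := by
    simp only [mem_fibre]
  rw [RealTuple.colour, if_congr hdot rfl rfl, hcard]
  rcases hc : G.col j with _ | _ | _ | _
  · have := G.odd j hc
    simp [this]
  · have h3 := G.even j (Or.inl hc)
    have h4 := hfix.trans (hst.fix j le_rfl h1 (Or.inl hc))
    rw [if_congr (iff_congr h4 Iff.rfl) rfl rfl, hc]
    simp [Nat.not_odd_iff_even.2 h3]
  · have h3 := G.even j (Or.inr hc)
    have h4 := hfix.trans (hst.fix j le_rfl h1 (Or.inr hc))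
    rw [if_congr (iff_congr h4 Iff.rfl) rfl rfl, hc]
    by_cases h5 : signAt s (G.ed j).left = 1 <;> simp [Nat.not_odd_iff_even.2 h3, h5]
  · simp

/-- The real tropical cover that is produced by a realization is the given coloured graph. -/
theorem ColouredGraph.Realizes.realCover_eq (h : G.Realizes s T lab)
    (hr : ∀ j, (G.ed j).right ≤ r + 1) :
    T.realCover s = (Finset.univ : Finset ι).val.map fun j => (G.ed j, G.col j) := by
  classical
  have hlt : ∀ j, (G.ed j).left < r + 1 := fun j => (G.lt j).trans_le (hr j)
  let φ : ι → Fin (r + 1) × Fin (r + 2) × Finset (Fin n) := fun j =>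
    (⟨(G.ed j).left, hlt j⟩, ⟨(G.ed j).right, Nat.lt_succ_of_le (hr j)⟩,
      fibre (lab (G.ed j).left) j)
  have hφ : Function.Injective φ := by
    intro j j' hjj
    simp only [φ, Prod.mk.injEq, Fin.mk.injEq] at hjj
    obtain ⟨h1, -, h3⟩ := hjj
    obtain ⟨x, hx⟩ := (h.state (G.ed j).left (by have := hlt j; omega)).exists_lab le_rfl (G.lt j)
    have h4 : x ∈ fibre (lab (G.ed j').left) j' := by rw [← h3, mem_fibre]; exact hx
    rw [mem_fibre, ← h1, hx] at h4
    exact h4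
  have hfil : (Finset.univ : Finset (Fin (r + 1) × Fin (r + 2) × Finset (Fin n))).filter
      (fun t => T.IsCycleEdge t.1 t.2.1 t.2.2) = Finset.univ.map ⟨φ, hφ⟩ := by
    ext ⟨a, b, B⟩
    simp only [Finset.mem_filter, Finset.mem_univ, true_and, Finset.mem_map,
      Function.Embedding.coeFn_mk, h.isCycleEdge_iff hr]
    constructor
    · rintro ⟨j, h1, h2, h3⟩
      refine ⟨j, ?_⟩
      simp only [φ, Prod.mk.injEq, Fin.ext_iff]
      exact ⟨h1, h2, by rw [h3, h1]⟩
    · rintro ⟨j, hj⟩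
      simp only [φ, Prod.mk.injEq, Fin.ext_iff] at hj
      refine ⟨j, hj.1, hj.2.1, ?_⟩
      rw [← hj.2.2, hj.1]
  rw [RealTuple.realCover]
  have : (Finset.univ : Finset (Fin (r + 1) × Fin (r + 2) × Finset (Fin n))).filter
      (fun t => T.IsCycleEdge t.1 t.2.1 t.2.2) = Finset.univ.map ⟨φ, hφ⟩ := by
    rw [← hfil]
  rw [this, Finset.map_val, Multiset.map_map]
  refine Multiset.map_congr rfl fun j _ => ?_
  simp only [Function.comp_apply, Function.Embedding.coeFn_mk, φ]
  rw [h.colour_eq hr]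
  congr 1
  ext
  · rfl
  · rfl
  · exact (h.state (G.ed j).left (by have := hlt j; omega)).card j le_rfl (G.lt j)

end Consequences

/-! ### From a multiset of coloured edges to a coloured graph. -/

section FromMultiset

theorem exists_of_filter_map_eq_singleton {ι β : Type*} [Fintype ι] [DecidableEq ι] {f : ι → β}
    {p : β → Prop} [DecidablePred p] {x : β}
    (h : ((Finset.univ : Finset ι).val.map f).filter p = {x}) :
    ∃ j, f j = x ∧ ∀ j', p (f j') ↔ j' = j := by
  rw [Multiset.filter_map] at h
  obtain ⟨j, hj, hx⟩ := Multiset.map_eq_singleton.1 h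
  refine ⟨j, hx, fun j' => ?_⟩
  have h1 : j' ∈ Multiset.filter (p ∘ f) (Finset.univ : Finset ι).val ↔ p (f j') := by simp
  rw [← h1, hj, Multiset.mem_singleton]

theorem exists_of_filter_map_eq_pair {ι β : Type*} [Fintype ι] [DecidableEq ι] {f : ι → β}
    {p : β → Prop} [DecidablePred p] {x y : β}
    (h : ((Finset.univ : Finset ι).val.map f).filter p = {x, y}) :
    ∃ j₁ j₂, j₁ ≠ j₂ ∧ f j₁ = x ∧ f j₂ = y ∧ ∀ j', p (f j') ↔ j' = j₁ ∨ j' = j₂ := by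
  classical
  rw [Multiset.filter_map] at h
  have hnd : (Multiset.filter (p ∘ f) (Finset.univ : Finset ι).val).Nodup :=
    Finset.univ.nodup.filter _
  obtain ⟨j, hj, hx, hy⟩ := (Multiset.map_eq_cons _ _ _ _).2 h
  obtain ⟨j₂, hj₂, hy⟩ := Multiset.map_eq_singleton.1 hy
  have h2 : Multiset.filter (p ∘ f) (Finset.univ : Finset ι).val = j ::ₘ {j₂} := by
    rw [← hj₂, Multiset.cons_erase hj]
  refine ⟨j, j₂, ?_, hx, hy, fun j' => ?_⟩
  · rw [h2, Multiset.nodup_cons, Multiset.mem_singleton] at hnd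
    exact hnd.1
  · have h1 : j' ∈ Multiset.filter (p ∘ f) (Finset.univ : Finset ι).val ↔ p (f j') := by simp
    rw [← h1, h2, Multiset.mem_cons, Multiset.mem_singleton]

/-- The edges of a coloured cover with `r` vertices are as required for a coloured graph. -/
structure EdgesOK (r : ℕ) (R : Multiset (Edge × Colour)) : Prop where
  lt : ∀ e ∈ R, e.1.left < e.1.right
  le : ∀ e ∈ R, e.1.right ≤ r + 1
  pos : ∀ e ∈ R, 0 < e.1.weight
  odd : ∀ e ∈ R, e.2 = .normal → Odd e.1.weight
  even : ∀ e ∈ R, e.2 = .red ∨ e.2 = .blue → Even e.1.weight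
  dotted : ∀ e ∈ R, e.2 = .dotted → R.count e = 2

/-- The vertex `v` is 3-valent and balanced, with colours as at the vertices of zigzag covers. -/
def VertexOK (R : Multiset (Edge × Colour)) (v : ℕ) (ε : ℤˣ) : Prop :=
  ∃ e₁ e₂ e₃ : Edge × Colour, e₃.1.weight = e₁.1.weight + e₂.1.weight ∧
    ((e₁.2 = .normal ∧ (e₂.2 = .red ∨ e₂.2 = .blue) ∧ e₃.2 = .normal ∧
        ¬ (e₂.2 = .red ↔ ε = 1)) ∨
      (e₁.2 = .normal ∧ e₂.2 = .normal ∧ (e₃.2 = .red ∨ e₃.2 = .blue) ∧ (e₃.2 = .red ↔ ε = 1)) ∨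
      (e₁.2 = .dotted ∧ e₁ = e₂ ∧ (e₃.2 = .red ∨ e₃.2 = .blue) ∧ ¬ (e₃.2 = .red ↔ ε = 1))) ∧
    ((R.filter (fun e => e.1.right = v) = {e₁, e₂} ∧ R.filter (fun e => e.1.left = v) = {e₃}) ∨
      (R.filter (fun e => e.1.right = v) = {e₃} ∧ R.filter (fun e => e.1.left = v) = {e₁, e₂}))

noncomputable instance (R : Multiset (Edge × Colour)) : DecidableEq R.ToType := Classical.decEq _

/-- The coloured graph with a given multiset of coloured edges. -/
def EdgesOK.graph {r : ℕ} {R : Multiset (Edge × Colour)} (h : EdgesOK r R) :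
    ColouredGraph R.ToType where
  ed j := j.1.1
  col j := j.1.2
  -- A dotted edge has multiplicity two, so reversing the index exchanges its two copies and fixes
  -- neither.
  bar j := ⟨j.1, if j.1.2 = .dotted then j.2.rev else j.2⟩
  lt j := h.lt _ (Multiset.coe_mem)
  pos j := h.pos _ (Multiset.coe_mem)
  odd j := h.odd _ (Multiset.coe_mem)
  even j := h.even _ (Multiset.coe_mem)
  bar_bar j := by
    obtain ⟨x, i⟩ := j
    by_cases hj : x.2 = .dotted <;> simp [hj] <;> rfl
  ed_bar j := rfl
  col_bar j := rfl
  bar_eq j := by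
    obtain ⟨x, i⟩ := j
    dsimp only
    by_cases hj : x.2 = .dotted
    · rw [if_pos hj]
      refine iff_of_false (fun h1 => ?_) (fun h1 => h1 hj)
      have h2 := h.dotted x (Multiset.count_pos.1 (by have := i.2; omega)) hj
      have h3 : i.rev = i := by
        exact eq_of_heq (Sigma.mk.inj h1).2
      rw [Fin.ext_iff, Fin.val_rev] at h3
      have := i.2
      omega
    · rw [if_neg hj]
      exact iff_of_true rfl hj

theorem EdgesOK.graph_map {r : ℕ} {R : Multiset (Edge × Colour)} (h : EdgesOK r R) :
    (Finset.univ : Finset R.ToType).val.map (fun j => (h.graph.ed j, h.graph.col j)) = R :=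
  Multiset.map_univ_coe R

theorem EdgesOK.isVertex {r : ℕ} {R : Multiset (Edge × Colour)} (h : EdgesOK r R) {v : ℕ} {ε : ℤˣ}
    (hv : VertexOK R v ε) : h.graph.IsVertex v ε := by
  obtain ⟨e₁, e₂, e₃, hw, hc, hpos⟩ := hv
  have main : ∀ {j₁ j₂ j₃ : R.ToType} (S : Prop) , (S → ∀ j, (h.graph.ed j = h.graph.ed j₁) →
      j = j₁ ∨ j = j₂) → S → j₁ ≠ j₂ → (h.graph.ed j₁, h.graph.col j₁) = e₁ →
      (h.graph.ed j₂, h.graph.col j₂) = e₂ → (h.graph.ed j₃, h.graph.col j₃) = e₃ →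
      (h.graph.ed j₃).weight = (h.graph.ed j₁).weight + (h.graph.ed j₂).weight ∧
      h.graph.VertexColours ε j₁ j₂ j₃ := by
    intro j₁ j₂ j₃ S hS hS' hne h1 h2 h3
    subst h1 h2 h3
    refine ⟨hw, ?_⟩
    rcases hc with hc | hc | hc
    · exact Or.inl hc
    · exact Or.inr (Or.inl hc)
    · refine Or.inr (Or.inr ⟨?_, hc.2.2⟩)
      rcases hS hS' (h.graph.bar j₁) (h.graph.ed_bar j₁) with h4 | h4
      · exact absurd hc.1 ((h.graph.bar_eq j₁).1 h4)
      · exact h4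
  rcases hpos with ⟨h1, h2⟩ | ⟨h1, h2⟩
  · rw [← h.graph_map] at h1 h2
    obtain ⟨j₁, j₂, hne, hj₁, hj₂, h12⟩ := exists_of_filter_map_eq_pair h1
    obtain ⟨j₃, hj₃, h3⟩ := exists_of_filter_map_eq_singleton h2
    have := main (j₁ := j₁) (j₂ := j₂) (j₃ := j₃) True (fun _ j hj => (h12 j).1
      (by dsimp only; rw [hj]; exact (h12 j₁).2 (Or.inl rfl))) trivial hne hj₁ hj₂ hj₃
    exact ⟨j₁, j₂, j₃, hne, this.1, this.2, Or.inl ⟨h12, h3⟩⟩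
  · rw [← h.graph_map] at h1 h2
    obtain ⟨j₁, j₂, hne, hj₁, hj₂, h12⟩ := exists_of_filter_map_eq_pair h2
    obtain ⟨j₃, hj₃, h3⟩ := exists_of_filter_map_eq_singleton h1
    have := main (j₁ := j₁) (j₂ := j₂) (j₃ := j₃) True (fun _ j hj => (h12 j).1
      (by dsimp only; rw [hj]; exact (h12 j₁).2 (Or.inl rfl))) trivial hne hj₁ hj₂ hj₃
    exact ⟨j₁, j₂, j₃, hne, this.1, this.2, Or.inr ⟨h3, h12⟩⟩

theorem EdgesOK.filter_map_weight {r : ℕ} {R : Multiset (Edge × Colour)} (h : EdgesOK r R)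
    (p : Edge → Prop) [DecidablePred p] :
    (Finset.univ.filter fun j => p (h.graph.ed j)).val.map (fun j => (h.graph.ed j).weight) =
      ((R.map Prod.fst).filter p).map Edge.weight := by
  conv_rhs => rw [← h.graph_map]
  rw [Multiset.map_map, Multiset.filter_map, Multiset.map_map, Finset.filter_val]
  rfl

/-- Every connected coloured cover with admissible vertices is produced by a real factorization. -/
theorem EdgesOK.exists_realFactorization {g n : ℕ} [NeZero n] {lam mu : n.Partition}
    {R : Multiset (Edge × Colour)} (h : EdgesOK (numBranch g lam mu) R)
    (s : Fin (numBranch g lam mu) → ℤˣ)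
    (hv : ∀ i < numBranch g lam mu, VertexOK R (i + 1) (signAt s (i + 1)))
    (hleft : ((R.map Prod.fst).filter fun e => e.left = 0).map Edge.weight = lam.parts)
    (hright : ((R.map Prod.fst).filter fun e => e.right = numBranch g lam mu + 1).map Edge.weight =
      mu.parts)
    (hconn : EdgesConnected (Set.Icc 1 (numBranch g lam mu)) (R.map Prod.fst))
    (hr : 0 < numBranch g lam mu) :
    (∃ (T : RealTuple n (numBranch g lam mu)) (lab : ℕ → Fin n → R.ToType),
      h.graph.Realizes s T lab) ∧
    ∀ (T : RealTuple n (numBranch g lam mu)) (lab : ℕ → Fin n → R.ToType),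
      h.graph.Realizes s T lab → IsRealFactorization g lam mu s T ∧ T.realCover s = R := by
  have h1 := h.filter_map_weight fun e => e.left = 0
  have h2 := h.filter_map_weight fun e => e.right = numBranch g lam mu + 1
  refine ⟨h.graph.exists_realizes s (fun i hi => h.isVertex (hv i hi)) (n := n) (by
    rw [Finset.sum_eq_multiset_sum, h1, hleft, lam.parts_sum]), fun T lab hT => ?_⟩
  have hle : ∀ j, (h.graph.ed j).right ≤ numBranch g lam mu + 1 := fun j =>
    h.le _ Multiset.coe_mem
  have hed : ∀ {j}, h.graph.ed j ∈ R.map Prod.fst := fun {j} =>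
    Multiset.mem_map_of_mem Prod.fst (Multiset.coe_mem (x := j))
  have hlift : ∀ e e', Relation.ReflTransGen (fun a b => a ∈ R.map Prod.fst ∧ b ∈ R.map Prod.fst ∧
      ∃ v ∈ Set.Icc 1 (numBranch g lam mu), Incident v a ∧ Incident v b) e e' → e ∈ R.map Prod.fst →
      ∀ j, h.graph.ed j = e → ∃ j', h.graph.ed j' = e' ∧ Relation.ReflTransGen (fun a b =>
        ∃ v ∈ Set.Icc 1 (numBranch g lam mu),
          Incident v (h.graph.ed a) ∧ Incident v (h.graph.ed b)) j j' := by
    intro e e' hee he j hj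
    induction hee with
    | refl => exact ⟨j, hj, .refl⟩
    | tail hab hbc ih =>
      rename_i b c
      obtain ⟨j', hj', hjj⟩ := ih
      obtain ⟨-, hc, v, hv1, hv2, hv3⟩ := hbc
      rw [← h.graph_map, Multiset.map_map] at hc
      obtain ⟨j'', -, hj''⟩ := Multiset.mem_map.1 hc
      exact ⟨j'', hj'', hjj.tail ⟨v, hv1, hj' ▸ hv2, by
        have hj₃ : h.graph.ed j'' = c := hj''
        rwa [hj₃]⟩⟩
  -- copies of one edge are linked through one of its vertices
  have hcopy : ∀ j j', h.graph.ed j = h.graph.ed j' →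
      Relation.ReflTransGen (fun a b => ∃ v ∈ Set.Icc 1 (numBranch g lam mu),
        Incident v (h.graph.ed a) ∧ Incident v (h.graph.ed b)) j j' := by
    intro j j' hjj
    obtain ⟨v, hv1, hv2⟩ : ∃ v ∈ Set.Icc 1 (numBranch g lam mu), Incident v (h.graph.ed j) := by
      have h3 := h.graph.lt j
      have h4 := hle j
      by_cases h5 : (h.graph.ed j).left = 0
      · by_cases h6 : (h.graph.ed j).right = numBranch g lam mu + 1
        -- An edge from one infinite point to the other meets no inner vertex, so it could not be
        -- linked to an edge at the first vertex.
        · exfalso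
          obtain ⟨j₁, j₂, j₃, _, _, _, hpos⟩ := h.isVertex (hv 0 hr)
          obtain ⟨j₀, hj₀⟩ : ∃ j₀, Incident 1 (h.graph.ed j₀) := by
            rcases hpos with ⟨hp, -⟩ | ⟨-, hp⟩
            · exact ⟨j₁, Or.inr ((hp j₁).2 (Or.inl rfl))⟩
            · exact ⟨j₁, Or.inl ((hp j₁).2 (Or.inl rfl))⟩
          have h7 := hconn _ (hed (j := j)) _ (hed (j := j₀))
          rcases Relation.ReflTransGen.cases_head h7 with h8 | ⟨c, ⟨-, -, v, hv1, hv2, -⟩, -⟩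
          · rw [← h8] at hj₀
            rcases hj₀ with hj₀ | hj₀ <;> omega
          · have := hv1.1
            have := hv1.2
            rcases hv2 with hv2 | hv2 <;> omega
        · exact ⟨_, ⟨by omega, by omega⟩, Or.inr rfl⟩
      · exact ⟨_, ⟨by omega, by omega⟩, Or.inl rfl⟩
    exact .single ⟨v, hv1, hv2, hjj ▸ hv2⟩
  refine ⟨hT.isRealFactorization (h1.trans hleft) (h2.trans hright) hle
    fun j j' => ?_, (hT.realCover_eq hle).trans h.graph_map⟩
  obtain ⟨j'', h3, h4⟩ := hlift _ _ (hconn _ (hed (j := j)) _ (hed (j := j'))) hed j rfl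
  exact h4.trans (hcopy _ _ h3)

end FromMultiset


/-! ### Choosing an element of each of the first transpositions. -/

section Active

variable {ι : Type*} [DecidableEq ι]
variable {G : ColouredGraph ι} {n r : ℕ} {s : Fin r → ℤˣ} {T : RealTuple n r}
  {lab : ℕ → Fin n → ι}

theorem commute_swap {α : Type*} [DecidableEq α] {ρ : Perm α} {a b : α} (hab : a ≠ b)
    (h : ρ * swap a b = swap a b * ρ) : (ρ a = a ∧ ρ b = b) ∨ (ρ a = b ∧ ρ b = a) := by
  have h1 : ρ b = swap a b (ρ a) := by
    simpa using congrArg (fun f : Perm α => f a) h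
  by_cases h2 : ρ a = a
  · rw [h2, swap_apply_left] at h1
    exact Or.inl ⟨h2, h1⟩
  by_cases h3 : ρ a = b
  · rw [h3, swap_apply_right] at h1
    exact Or.inr ⟨h3, h1⟩
  rw [swap_apply_of_ne_of_ne h2 h3] at h1
  exact absurd (ρ.injective h1).symm hab

/-- Only the edge `j` has its right end at `v`. -/
def ColouredGraph.Only (G : ColouredGraph ι) (v : ℕ) (j : ι) : Prop :=
  ∀ j', (G.ed j').right = v ↔ j' = j

/-- The edge `j` ends at the vertex `v`, and its elements are moved only by few of the
transpositions before `v`: it is an in-end, or arises from an in-end by one or two cuts. -/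
inductive ColouredGraph.Active (G : ColouredGraph ι) : ℕ → ι → Prop
  | fresh {v : ℕ} {j : ι} (hr : (G.ed j).right = v) (hl : (G.ed j).left = 0) : G.Active v j
  | once {u : ℕ} {j j' : ι} (hr : (G.ed j).right = u + 2) (hl : (G.ed j).left = u + 1)
      (h' : G.Only (u + 1) j') (hl' : (G.ed j').left = 0) : G.Active (u + 2) j
  | twice {u : ℕ} {j j' j'' j₂ : ι} (hr : (G.ed j).right = u + 3) (hl : (G.ed j).left = u + 2)
      (h' : G.Only (u + 2) j') (hl' : (G.ed j').left = u + 1)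
      (h'' : G.Only (u + 1) j'') (hl'' : (G.ed j'').left = 0)
      (hc : G.col j = .normal) (hw : 3 ≤ (G.ed j').weight)
      (hd : ∀ i, (G.ed i).left = u + 1 ∨ (G.ed i).left = u + 2 ∨ (G.ed i).right = u + 3 →
        G.col i ≠ .dotted)
      (hj₂ : j₂ ≠ j) (hr₂ : (G.ed j₂).right = u + 3) : G.Active (u + 3) j

/-- The transposition with index `i` (counted from `0`) moves `x`. -/
def PermTuple.Moves (T : PermTuple n r) (i : ℕ) (x : Fin n) : Prop :=
  ∃ h : i < r, T.τ ⟨i, h⟩ x ≠ x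

theorem PermTuple.partialProd_succ (T : PermTuple n r) {i : ℕ} (hi : i < r) :
    T.partialProd (i + 1) = T.τ ⟨i, hi⟩ * T.partialProd i := by
  rw [PermTuple.partialProd, dif_pos hi]

theorem swap_ne_self_iff {α : Type*} [DecidableEq α] {a b x : α} (hab : a ≠ b) :
    swap a b x ≠ x ↔ x = a ∨ x = b := by
  rw [swap_apply_ne_self_iff]
  tauto

/-- The transposition at a vertex, with one of its two elements chosen. -/
theorem ColouredGraph.Realizes.step_of_moves (h : G.Realizes s T lab) {i : ℕ} {x : Fin n}
    (hx : T.Moves i x) : ∃ (hi : i < r) (y : Fin n), T.τ ⟨i, hi⟩ = swap x y ∧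
      G.IsStep i (T.partialProd i) (T.involution s (i + 1)) (lab i) (lab (i + 1)) x y := by
  obtain ⟨hi, hx⟩ := hx
  obtain ⟨a, b, hab, hs⟩ := h.step i hi
  rw [hab, swap_ne_self_iff hs.ne] at hx
  rcases hx with rfl | rfl
  · exact ⟨hi, b, hab, hs⟩
  · exact ⟨hi, a, by rw [hab, swap_comm], ⟨hs.ne.symm, by rw [swap_comm]; exact hs.comm, hs.lab_eq,
      hs.new, hs.changed, hs.right_right, hs.right_left, fun j hj => (hs.hit_old j hj).symm,
      fun j hj => (hs.hit_new j hj).symm⟩⟩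

theorem ColouredGraph.Realizes.right_of_moves (h : G.Realizes s T lab) {i : ℕ} {x : Fin n}
    (hx : T.Moves i x) : (G.ed (lab i x)).right = i + 1 := by
  obtain ⟨hi, y, -, hs⟩ := h.step_of_moves hx
  exact hs.right_left

theorem ColouredGraph.Realizes.moves_hit (h : G.Realizes s T lab) {i : ℕ} (hi : i < r) {j : ι}
    (hj : (G.ed j).right = i + 1) : ∃ x, T.Moves i x ∧ lab i x = j := by
  obtain ⟨a, b, hab, hs⟩ := h.step i hi
  rcases hs.hit_old j hj with h1 | h1
  · exact ⟨a, ⟨hi, by rw [hab, swap_ne_self_iff hs.ne]; exact Or.inl rfl⟩, h1⟩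
  · exact ⟨b, ⟨hi, by rw [hab, swap_ne_self_iff hs.ne]; exact Or.inr rfl⟩, h1⟩

theorem ColouredGraph.Realizes.moves_hit_new (h : G.Realizes s T lab) {i : ℕ} (hi : i < r) {j : ι}
    (hj : (G.ed j).left = i + 1) : ∃ x, T.Moves i x ∧ lab (i + 1) x = j := by
  obtain ⟨a, b, hab, hs⟩ := h.step i hi
  rcases hs.hit_new j hj with h1 | h1
  · exact ⟨a, ⟨hi, by rw [hab, swap_ne_self_iff hs.ne]; exact Or.inl rfl⟩, h1⟩
  · exact ⟨b, ⟨hi, by rw [hab, swap_ne_self_iff hs.ne]; exact Or.inr rfl⟩, h1⟩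

/-- The elements of an edge have not been moved before its left end. -/
theorem ColouredGraph.Realizes.left_lt_of_moves (h : G.Realizes s T lab) {i i' : ℕ} {x : Fin n}
    (hx : T.Moves i x) (hii : i < i') (hi' : i' < r) : i < (G.ed (lab i' x)).left := by
  by_contra hlt
  have h1 := ((h.state i' hi'.le).alive x).2
  have h2 := (h.lab_iff (x := x) (j := lab i' x) hii.le hi'.le (by omega) h1).1 rfl
  have h3 := h.right_of_moves hx
  rw [h2] at h3
  omega

theorem ColouredGraph.Realizes.lab_of_only (h : G.Realizes s T lab) {u : ℕ} (hu : u < r) {j : ι}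
    (hj : G.Only (u + 1) j) {x : Fin n} (hx : (G.ed (lab (u + 1) x)).left = u + 1) : lab u x = j := by
  rw [← hj]
  by_contra h1
  obtain ⟨a, b, -, hs⟩ := h.step u hu
  rw [hs.lab_eq x h1] at hx
  have := ((h.state u hu.le).alive x).1
  omega

theorem ColouredGraph.Realizes.sameCycle_reflect (h : G.Realizes s T lab) {i : ℕ} (hi : i ≤ r)
    {x : Fin n} (hx : G.col (lab i x) ≠ .dotted) :
    (T.partialProd i).SameCycle x ((T.partialProd i * T.involution s i) x) := by
  rw [Perm.mul_apply, Perm.sameCycle_apply_right]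
  exact (h.state i hi).sameCycle_gamma hx

/-- After a cut into two undotted edges, the reflection fixes the elements of the transposition. -/
theorem ColouredGraph.Realizes.fixed_of_cut (h : G.Realizes s T lab) {i : ℕ} {x : Fin n}
    (hx : T.Moves i x) {j : ι} (hj : G.Only (i + 1) j)
    (hd : ∀ j', (G.ed j').left = i + 1 → G.col j' ≠ .dotted) :
    (T.partialProd (i + 1) * T.involution s (i + 1)) x = x := by
  obtain ⟨hi, y, hxy, hs⟩ := h.step_of_moves hx
  have hlab : lab i x = lab i y := by
    rw [(hj _).1 hs.right_left, (hj _).1 hs.right_right]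
  obtain ⟨m, hm, rfl⟩ := exists_pow_of_sameCycle (((h.state i hi.le).same x y).2 hlab)
  have hm0 : 0 < m := Nat.pos_of_ne_zero fun h0 => hs.ne (by simp [h0])
  have hns := not_sameCycle_cut (P := T.partialProd i) (x := x) hm0 hm
  have h1 := h.sameCycle_reflect (i := i + 1) hi (x := x) (hd _ (hs.new x hs.right_left))
  have hP := T.partialProd_succ hi
  rw [hxy] at hP
  rw [hP, mul_assoc, Perm.mul_apply] at h1 ⊢
  -- If the reflection before the cut fixed `x`, the reflection after it would carry `x` to the
  -- other part, which is impossible for undotted edges. So it exchanges the two points, and the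
  -- reflection after the cut fixes `x`.
  rcases commute_swap hs.ne hs.comm with ⟨h2, -⟩ | ⟨h2, -⟩
  · rw [h2, swap_apply_left] at h1
    exact absurd h1 hns
  · rw [h2, swap_apply_right]

theorem RealTuple.involution_succ (T : RealTuple n r) (s : Fin r → ℤˣ) (i : ℕ) :
    T.involution s (i + 1) = T.involution s i ∨
      T.involution s (i + 1) = T.involution s i * T.partialProd i := by
  rw [RealTuple.involution]
  split_ifs
  · exact Or.inl rfl
  · exact Or.inr rfl

/-- At a vertex that joins undotted edges, the reflection before the vertex fixes the elements of the
transposition. -/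
theorem ColouredGraph.Realizes.fixed_of_join (h : G.Realizes s T lab) {i : ℕ} {x : Fin n}
    (hx : T.Moves i x) {j : ι} (hj : (G.ed j).right = i + 1) (hne : j ≠ lab i x)
    (hd : G.col (lab i x) ≠ .dotted) :
    (T.partialProd i * T.involution s (i + 1)) x = x := by
  obtain ⟨hi, y, hxy, hs⟩ := h.step_of_moves hx
  have hst := h.state i hi.le
  have hy : lab i y ≠ lab i x := by
    rcases hs.hit_old j hj with h1 | h1
    · exact absurd h1.symm hne
    · rw [h1]; exact hne
  have h1 : lab i ((T.partialProd i * T.involution s (i + 1)) x) = lab i x := by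
    rw [Perm.mul_apply, hst.lab_apply]
    rcases T.involution_succ s i with h2 | h2
    · rw [h2, hst.bar, (G.bar_eq _).2 hd]
    · rw [h2, Perm.mul_apply, hst.bar, hst.lab_apply, (G.bar_eq _).2 hd]
  rcases commute_swap hs.ne hs.comm with ⟨h2, -⟩ | ⟨h2, -⟩
  · exact h2
  · rw [h2] at h1
    exact absurd h1 hy

theorem Inverts.pow_two_apply {α : Type*} {γ P : Perm α} (h : Inverts γ P) {x : α}
    (h1 : (P * γ) x = x) (h2 : γ x = x ∨ (γ * P) x = x) : (P ^ 2) x = x := by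
  rw [Perm.mul_apply] at h1
  rw [pow_two, Perm.mul_apply]
  rcases h2 with h2 | h2
  · rw [h2] at h1; rw [h1, h1]
  · rw [Perm.mul_apply] at h2
    have h3 : P x = γ x := by rw [← h2, h.apply_apply, h2]
    rw [h3, h1]

/-- Both cuts and the join force certain reflections to fix the elements of their transpositions. If
the involution does not change before the join, then `x` and the element of the middle transposition
on the same odd cycle are fixed points of one reflection, hence equal. If it changes, then γ itself
fixes `x`, and together with the reflection after the first cut this shows that two steps on the
cycle of `j'` lead back to `x`; the weight of at least three excludes that. -/
theorem ColouredGraph.Realizes.moves_middle (h : G.Realizes s T lab) {u : ℕ} {j j' j'' j₂ : ι}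
    (hl : (G.ed j).left = u + 2)
    (h' : G.Only (u + 2) j') (hl' : (G.ed j').left = u + 1)
    (h'' : G.Only (u + 1) j'') (hc : G.col j = .normal) (hw : 3 ≤ (G.ed j').weight)
    (hd : ∀ i, (G.ed i).left = u + 1 ∨ (G.ed i).left = u + 2 ∨ (G.ed i).right = u + 3 →
      G.col i ≠ .dotted)
    (hj₂ : j₂ ≠ j) (hr₂ : (G.ed j₂).right = u + 3) {x : Fin n} (hx : T.Moves u x)
    (hx' : T.Moves (u + 2) x) (hlab : lab (u + 2) x = j) : T.Moves (u + 1) x := by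
  have hu := hx'.1
  have f1 := h.fixed_of_cut hx h'' fun i hi => hd i (Or.inl hi)
  have f3 := h.fixed_of_join hx' hr₂ (by rw [hlab]; exact hj₂) (by rw [hlab, hc]; simp)
  obtain ⟨p, hp, hpj⟩ := h.moves_hit_new (i := u + 1) (by omega) hl
  have f2 := h.fixed_of_cut hp h' fun i hi => hd i (Or.inr (Or.inl hi))
  have hst1 := h.state (u + 1) (by omega)
  have hst2 := h.state (u + 2) (by omega)
  have hlab1 : lab (u + 1) x = j' :=
    h.lab_of_only (u := u + 1) (by omega) h' (by rw [hlab]; exact hl)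
  rcases T.involution_succ s (u + 2) with h3 | h3
  · rw [h3] at f3
    have : x = p := hst2.inverts.mul_left.fixed_unique
      ((hst2.same x p).2 (by rw [hlab]; exact hpj.symm)) f3 f2
      (by rw [hst2.card_cyc, hlab]; exact G.odd _ hc)
    rw [this]; exact hp
  · exfalso
    have h4 : T.involution s (u + 2) x = x := by
      have h5 : T.partialProd (u + 2) * (T.involution s (u + 2) * T.partialProd (u + 2)) =
          T.involution s (u + 2) := by
        rw [hst2.inverts.mul_eq, mul_inv_cancel_left]
      rwa [h3, h5] at f3
    have h6 := hst1.inverts.pow_two_apply f1 (by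
      rcases T.involution_succ s (u + 1) with h7 | h7
      · exact Or.inl (h7 ▸ h4)
      · exact Or.inr (h7 ▸ h4))
    rw [pow_apply_eq_self_iff, hst1.card_cyc, hlab1] at h6
    have := Nat.le_of_dvd (by norm_num) h6
    omega

/-- An element of an active edge that is moved at its end and at an earlier point is moved everywhere
in between. -/
theorem ColouredGraph.Realizes.moves_between (h : G.Realizes s T lab) {i t : ℕ} {j : ι}
    (hact : G.Active (t + 1) j) {x : Fin n} (hlab : lab t x = j) (hx : T.Moves t x) (hit : i < t)
    (hxi : T.Moves i x) {l : ℕ} (hil : i ≤ l) (hlt : l ≤ t) : T.Moves l x := by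
  have htr := hx.1
  have h0 := h.left_lt_of_moves hxi hit htr
  rw [hlab] at h0
  generalize hv : t + 1 = v at hact
  -- An element of an in-end has never been moved before. In the other cases the element can be
  -- traced back to an in-end through consecutive vertices, and only two earlier transpositions at
  -- most can have moved it.
  rcases hact with ⟨-, hl⟩ | ⟨hr, hl, h', hl'⟩ | ⟨hr, hl, h', hl', h'', hl'', hc, hw, hd, hj₂, hr₂⟩
  · omega
  · rename_i u j'
    obtain rfl : t = u + 1 := by omega
    have h1 : lab u x = j' := h.lab_of_only (by omega) h' (by rw [hlab]; exact hl)
    have h2 : i = u := by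
      by_contra h3
      have := h.left_lt_of_moves hxi (show i < u by omega) (by omega)
      rw [h1] at this
      omega
    rcases (show l = i ∨ l = u + 1 by omega) with rfl | rfl
    · exact hxi
    · exact hx
  · rename_i u j' j'' j₂
    obtain rfl : t = u + 2 := by omega
    have h1 : lab (u + 1) x = j' :=
      h.lab_of_only (u := u + 1) (by omega) h' (by rw [hlab]; exact hl)
    have h2 : lab u x = j'' := h.lab_of_only (by omega) h'' (by rw [h1]; exact hl')
    have h3 : u ≤ i := by
      by_contra h3
      have := h.left_lt_of_moves hxi (show i < u by omega) (by omega)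
      rw [h2] at this
      omega
    rcases (show l = i ∨ l = u + 2 ∨ l = u + 1 ∧ i = u by omega) with rfl | rfl | ⟨rfl, rfl⟩
    · exact hxi
    · exact hx
    · exact h.moves_middle hl h' hl' h'' hc hw hd hj₂ hr₂ hxi hx hlab

/-- If the first `k` vertices have active edges, then one can choose an element of each of the first `k`
transpositions such that these choices change as little as possible. -/
theorem ColouredGraph.Realizes.exists_choice [NeZero n] (h : G.Realizes s T lab) {k : ℕ} (hk : k ≤ r)
    (hact : ∀ v, 1 ≤ v → v ≤ k → ∃ j, G.Active v j) :
    ∃ m : ℕ → Fin n, (∀ i < k, T.Moves i (m i)) ∧ ∀ i j, i < j → j < k → T.Moves i (m j) →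
      ∀ l, i ≤ l → l ≤ j → m l = m j := by
  classical
  have hA : ∀ i, ∃ x : Fin n, i < k → T.Moves i x ∧ G.Active (i + 1) (lab i x) := by
    intro i
    by_cases hi : i < k
    · obtain ⟨j, hj⟩ := hact (i + 1) (by omega) hi
      have hjr : (G.ed j).right = i + 1 := by
        generalize hv : i + 1 = v at hj
        rcases hj with ⟨hr, -⟩ | ⟨hr, -⟩ | ⟨hr, -⟩ <;> exact hr
      obtain ⟨x, hx, hxj⟩ := h.moves_hit (show i < r by omega) hjr
      exact ⟨x, fun _ => ⟨hx, by rw [hxj]; exact hj⟩⟩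
    · exact ⟨0, fun h => absurd h hi⟩
  choose act hact' using hA
  -- The choice runs backwards from the last transposition: the current element is kept as long as
  -- it is moved, otherwise one restarts with an element of an active edge. Here `d` counts the
  -- steps back.
  let m' : ℕ → Fin n := fun d =>
    Nat.rec (act (k - 1)) (fun d x => if T.Moves (k - 2 - d) x then x else act (k - 2 - d)) d
  have hm0 : m' 0 = act (k - 1) := rfl
  have hms : ∀ d, m' (d + 1) = if T.Moves (k - 2 - d) (m' d) then m' d else act (k - 2 - d) :=
    fun _ => rfl
  set m : ℕ → Fin n := fun i => m' (k - 1 - i) with hm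
  have hlast : m (k - 1) = act (k - 1) := by simp [hm, hm0]
  have hstep : ∀ i, i + 1 < k → m i = if T.Moves i (m (i + 1)) then m (i + 1) else act i := by
    intro i hi
    have h1 := hms (k - 2 - i)
    rw [show k - 2 - (k - 2 - i) = i by omega, show k - 2 - i + 1 = k - 1 - i by omega,
      show k - 2 - i = k - 1 - (i + 1) by omega] at h1
    exact h1
  have hgood : ∀ d i, i + d + 1 = k → T.Moves i (m i) ∧ ∃ t, i ≤ t ∧ t < k ∧ m t = m i ∧
      T.Moves t (m t) ∧ G.Active (t + 1) (lab t (m t)) := by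
    intro d
    induction d with
    | zero =>
      intro i hi
      obtain rfl : i = k - 1 := by omega
      rw [hlast]
      have := hact' (k - 1) (by omega)
      exact ⟨this.1, k - 1, le_rfl, by omega, hlast, hlast ▸ this⟩
    | succ d ih =>
      intro i hi
      obtain ⟨h1, t, h2, h3, h4, h5⟩ := ih (i + 1) (by omega)
      have h6 := hstep i (by omega)
      split_ifs at h6 with h7
      · exact ⟨h6 ▸ h7, t, by omega, h3, h4.trans h6.symm, h5⟩
      · have := hact' i (by omega)
        rw [h6]
        exact ⟨this.1, i, le_rfl, by omega, h6, h6 ▸ this⟩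
  refine ⟨m, fun i hi => (hgood (k - 1 - i) i (by omega)).1, fun i j hij hj hmv l hil hlj => ?_⟩
  obtain ⟨-, t, h1, h2, h3, h4, h5⟩ := hgood (k - 1 - j) j (by omega)
  have hall : ∀ l, i ≤ l → l ≤ t → T.Moves l (m j) := by
    intro l hl hlt
    rw [h3] at h4 h5
    exact h.moves_between h5 rfl h4 (by omega) hmv hl hlt
  have hdown : ∀ e l, l + e = j → i ≤ l → m l = m j := by
    intro e
    induction e with
    | zero => rintro l rfl -; rfl
    | succ e ih =>
      intro l hl hil
      have h6 := ih (l + 1) (by omega) (by omega)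
      rw [hstep l (by omega), h6, if_pos (hall l hil (by omega))]
  exact hdown (j - l) l (by omega) hil

end Active


/-! ### Renaming the sheets. -/

section Conjugation

variable {ι : Type*} [DecidableEq ι]
variable {G : ColouredGraph ι} {n r : ℕ} {s : Fin r → ℤˣ} {T : RealTuple n r}
  {lab : ℕ → Fin n → ι}

/-- The tuple with the elements renamed. -/
def RealTuple.conj (T : RealTuple n r) (e : Perm (Fin n)) : RealTuple n r where
  σ₁ := e.permCongrHom T.σ₁
  τ i := e.permCongrHom (T.τ i)
  σ₂ := e.permCongrHom T.σ₂
  γ := e.permCongrHom T.γ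

theorem permCongrHom_apply (e σ : Perm (Fin n)) : e.permCongrHom σ = e * σ * e⁻¹ := rfl

theorem permCongrHom_swap (e : Perm (Fin n)) (a b : Fin n) :
    e.permCongrHom (swap a b) = swap (e a) (e b) := by
  rw [permCongrHom_apply, mul_swap_eq_swap_mul, mul_inv_cancel_right]

theorem RealTuple.conj_partialProd (T : RealTuple n r) (e : Perm (Fin n)) (i : ℕ) :
    (T.conj e).partialProd i = e.permCongrHom (T.partialProd i) := by
  induction i with
  | zero => rfl
  | succ i ih =>
    rw [PermTuple.partialProd, PermTuple.partialProd]
    split_ifs with hi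
    · rw [ih, map_mul]; rfl
    · exact ih

theorem RealTuple.conj_involution (T : RealTuple n r) (s : Fin r → ℤˣ) (e : Perm (Fin n)) (i : ℕ) :
    (T.conj e).involution s i = e.permCongrHom (T.involution s i) := by
  induction i with
  | zero => rfl
  | succ i ih =>
    rw [RealTuple.involution, RealTuple.involution]
    split_ifs with hi
    · exact ih
    · rw [ih, conj_partialProd, map_mul]

theorem ColouredGraph.Realizes.conj (h : G.Realizes s T lab) (e : Perm (Fin n)) :
    G.Realizes s (T.conj e) (fun i => lab i ∘ e.symm) where
  state i hi := by
    rw [RealTuple.conj_partialProd, RealTuple.conj_involution]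
    exact (h.state i hi).transport e
  step i hi := by
    obtain ⟨a, b, hab, hs⟩ := h.step i hi
    refine ⟨e a, e b, ?_, ⟨fun h' => hs.ne (e.injective h'), ?_, fun z hz => hs.lab_eq _ hz,
      fun z hz => hs.new _ hz, fun z hz => ?_, by simpa using hs.right_left,
      by simpa using hs.right_right, by simpa using hs.hit_old, by simpa using hs.hit_new⟩⟩
    · change e.permCongrHom (T.τ ⟨i, hi⟩) = _
      rw [hab, permCongrHom_swap]
    · rw [RealTuple.conj_partialProd, RealTuple.conj_involution, ← permCongrHom_swap, ← map_mul,
        ← map_mul, ← map_mul, hs.comm]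
    · obtain ⟨z', hz'⟩ := hs.changed _ hz
      exact ⟨e z', by simpa using hz'⟩
  last := by
    rw [RealTuple.conj_partialProd, ← map_inv, ← h.last]
    rfl

theorem swap_eq_swap_cases {α : Type*} [DecidableEq α] {a b c d : α} (hab : a ≠ b)
    (h : swap a b = swap c d) : (a = c ∧ b = d) ∨ (a = d ∧ b = c) := by
  have h1 : b = swap c d a := by rw [← h, swap_apply_left]
  by_cases hc : a = c
  · rw [hc, swap_apply_left] at h1; exact Or.inl ⟨hc, h1⟩
  by_cases hd : a = d
  · rw [hd, swap_apply_right] at h1; exact Or.inr ⟨hd, h1⟩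
  rw [swap_apply_of_ne_of_ne hc hd] at h1
  exact absurd h1.symm hab

/-- The elements can be renamed such that the first `k` transpositions are monotone. -/
theorem ColouredGraph.Realizes.exists_monotone [NeZero n] (h : G.Realizes s T lab) {k : ℕ} (hk : k ≤ r)
    (hact : ∀ v, 1 ≤ v → v ≤ k → ∃ j, G.Active v j) :
    ∃ e : Perm (Fin n), IsMonotoneUpTo k (T.conj e).toPermTuple := by
  classical
  obtain ⟨m, hm, hB⟩ := h.exists_choice hk hact
  -- the first index at which an element is chosen
  let key : Fin n → ℕ := fun x => if hx : ∃ j, j < k ∧ m j = x then Nat.find hx + 1 else 0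
  have key_spec : ∀ i < k, ∃ t ≤ i, m t = m i ∧ key (m i) = t + 1 ∧
      ∀ l, t ≤ l → l ≤ i → m l = m i := by
    intro i hi
    have hx : ∃ j, j < k ∧ m j = m i := ⟨i, hi, rfl⟩
    have h1 := Nat.find_spec hx
    have h2 : Nat.find hx ≤ i := Nat.find_min' hx ⟨hi, rfl⟩
    refine ⟨Nat.find hx, h2, h1.2, dif_pos hx, fun l hl hli => ?_⟩
    rcases h2.lt_or_eq with h3 | h3
    · have h5 := hm _ h1.1
      rw [h1.2] at h5
      exact hB _ i h3 hi h5 l hl hli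
    · rw [show l = i by omega]
  have key_succ : ∀ i, i + 1 < k → m i = m (i + 1) ∨ key (m i) < key (m (i + 1)) := by
    intro i hi
    obtain ⟨t, ht, h1, h2, h3⟩ := key_spec i (by omega)
    obtain ⟨t', ht', h1', h2', h3'⟩ := key_spec (i + 1) hi
    by_cases h4 : t' ≤ i
    · exact Or.inl (h3' i h4 (by omega))
    · right; omega
  -- The other element of a transposition has a smaller key: elements that are never chosen have key
  -- 0, and an element chosen first at a later time is moved now only if it is the chosen one.
  have key_moves : ∀ i < k, ∀ y, T.Moves i y → y = m i ∨ key y < key (m i) := by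
    intro i hi y hy
    obtain ⟨t, ht, h1, h2, h3⟩ := key_spec i hi
    by_cases hx : ∃ j, j < k ∧ m j = y
    · obtain ⟨j, hj, rfl⟩ := hx
      obtain ⟨t', ht', h1', h2', h3'⟩ := key_spec j hj
      by_cases h4 : i < t'
      · exact Or.inl ((hB i t' h4 (by omega) (h1' ▸ hy) i le_rfl h4.le).trans h1').symm
      by_cases h5 : t' < t
      · right; omega
      · exact Or.inl (h1'.symm.trans (h3 t' (by omega) (by omega)))
    · right
      have : key y = 0 := dif_neg hx
      omega
  -- After sorting by the first time of choice, the chosen element is the larger one in each of the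
  -- first k transpositions, and the chosen elements do not decrease.
  set e : Perm (Fin n) := (Tuple.sort key).symm with he
  have he_lt : ∀ x y, key x < key y → e x < e y := by
    intro x y hxy
    by_contra hlt
    have h1 := Tuple.monotone_sort key (not_lt.1 hlt)
    simp only [Function.comp_apply, he, Equiv.apply_symm_apply] at h1
    omega
  have hmax : ∀ i (hi : i < r), i < k → ∀ a b : Fin n, a < b →
      (T.conj e).τ ⟨i, hi⟩ = swap a b → b = e (m i) := by
    intro i hi hik a b hab hτ
    obtain ⟨hi', y, hy, hs⟩ := h.step_of_moves (hm i hik)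
    have hτ' : (T.conj e).τ ⟨i, hi⟩ = swap (e (m i)) (e y) := by
      rw [← permCongrHom_swap, ← hy]; rfl
    rw [hτ'] at hτ
    have hym : T.Moves i y := ⟨hi, by rw [hy, swap_ne_self_iff hs.ne]; exact Or.inr rfl⟩
    have hlt : e y < e (m i) := by
      rcases key_moves i hik y hym with h1 | h1
      · exact absurd h1.symm hs.ne
      · exact he_lt _ _ h1
    rcases swap_eq_swap_cases hlt.ne' hτ with ⟨h1, h2⟩ | ⟨h1, h2⟩
    · rw [h1, h2] at hlt
      exact absurd hab (not_lt.2 hlt.le)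
    · exact h1.symm
  refine ⟨e, fun i hi hik a b a' b' hab hab' h1 h2 => ?_⟩
  rw [hmax i _ (by omega) a b hab h1, hmax (i + 1) _ hik a' b' hab' h2]
  rcases key_succ i hik with h3 | h3
  · rw [h3]
  · exact (he_lt _ _ h3).le

/-- The number of permutations that fix all elements of `S`. -/
theorem factorial_le_card_fix (S : Finset (Fin n)) :
    (n - S.card).factorial ≤ Nat.card {e : Perm (Fin n) // ∀ x ∈ S, e x = x} := by
  have h1 : Nat.card (Perm {x : Fin n // x ∉ S}) = (n - S.card).factorial := by
    rw [Nat.card_perm, Nat.card_eq_fintype_card, Fintype.card_subtype_compl, Fintype.card_fin,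
      Fintype.card_coe]
  rw [← h1]
  refine Nat.card_le_card_of_injective
    (fun e => ⟨Perm.ofSubtype e, fun x hx => Perm.ofSubtype_apply_of_not_mem e (by simpa using hx)⟩) ?_
  intro e e' hee
  exact Perm.ofSubtype_injective (Subtype.ext_iff.1 hee)

/-- A realization with monotone transpositions can be renamed in many ways. -/
theorem ColouredGraph.Realizes.factorial_le [NeZero n] (h : G.Realizes s T lab) {k : ℕ} (hk : k ≤ r)
    (hT : IsMonotoneUpTo k T.toPermTuple)
    (htrans : MulAction.IsPretransitive
      (Subgroup.closure (insert T.σ₁ (insert T.σ₂ (Set.range T.τ)))) (Fin n)) :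
    (n - 2 * k).factorial ≤ Nat.card {T' : RealTuple n r //
      (∃ lab', G.Realizes s T' lab') ∧ IsMonotoneUpTo k T'.toPermTuple} * n := by
  classical
  let S : Finset (Fin n) :=
    (Finset.univ : Finset (Fin k)).biUnion fun i => (T.τ ⟨i, i.2.trans_le hk⟩).support
  have hS : S.card ≤ 2 * k := by
    refine Finset.card_biUnion_le.trans ?_
    refine (Finset.sum_le_card_nsmul _ _ 2 fun i _ => ?_).trans (by simp [mul_comm])
    obtain ⟨a, b, hab, hs⟩ := h.step i (i.2.trans_le hk)
    rw [hab, Perm.card_support_swap hs.ne]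
  have hfin : Finite (RealTuple n r) :=
    Finite.of_injective (fun T => (T.σ₁, T.τ, T.σ₂, T.γ)) (by rintro ⟨⟨⟩, _⟩ ⟨⟨⟩, _⟩ h; simp_all)
  have hfix : ∀ e : Perm (Fin n), (∀ x ∈ S, e x = x) → ∀ i (hi : i < r), i < k →
      (T.conj e).τ ⟨i, hi⟩ = T.τ ⟨i, hi⟩ := by
    intro e he i hi hik
    obtain ⟨a, b, hab, hs⟩ := h.step i hi
    have hmem : ∀ x, T.τ ⟨i, hi⟩ x ≠ x → x ∈ S := fun x hx =>
      Finset.mem_biUnion.2 ⟨⟨i, hik⟩, Finset.mem_univ _, by simpa using hx⟩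
    change e.permCongrHom (T.τ ⟨i, hi⟩) = _
    have h1 := he a (hmem a (by rw [hab, swap_apply_left]; exact hs.ne.symm))
    have h2 := he b (hmem b (by rw [hab, swap_apply_right]; exact hs.ne))
    rw [hab, permCongrHom_swap, h1, h2]
  refine (Nat.factorial_le (Nat.sub_le_sub_left hS n)).trans ((factorial_le_card_fix S).trans ?_)
  have hc : Nat.card ({T' : RealTuple n r //
      (∃ lab', G.Realizes s T' lab') ∧ IsMonotoneUpTo k T'.toPermTuple} × Fin n) =
      Nat.card {T' : RealTuple n r //
        (∃ lab', G.Realizes s T' lab') ∧ IsMonotoneUpTo k T'.toPermTuple} * n := by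
    rw [Nat.card_prod, Nat.card_fin]
  rw [← hc]
  refine Nat.card_le_card_of_injective (fun e => (⟨T.conj e.1, ⟨_, h.conj e.1⟩, ?_⟩, e.1 0)) ?_
  · intro i hi hik a b a' b' hab hab' h1 h2
    rw [hfix e.1 e.2 _ _ (by omega)] at h1
    rw [hfix e.1 e.2 _ _ hik] at h2
    exact hT i hi hik a b a' b' hab hab' h1 h2
  · rintro ⟨e, he⟩ ⟨e', he'⟩ hee
    simp only [Prod.mk.injEq, Subtype.mk.injEq] at hee
    obtain ⟨h1, h2⟩ := hee
    -- Two renamings with the same result differ by an element of the centralizer of a transitive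
    -- group. It is trivial once the images of one point agree, and recording this image costs the
    -- factor `n`.
    set δ := e⁻¹ * e' with hδ
    have hcomm : ∀ σ, e.permCongrHom σ = e'.permCongrHom σ →
        σ ∈ Subgroup.centralizer {δ} := by
      intro σ hσ
      rw [Subgroup.mem_centralizer_singleton_iff]
      rw [permCongrHom_apply, permCongrHom_apply] at hσ
      calc σ * δ = e⁻¹ * (e * σ * e⁻¹) * e' := by rw [hδ]; group
        _ = δ * σ := by rw [hσ, hδ]; group
    have hle : Subgroup.closure (insert T.σ₁ (insert T.σ₂ (Set.range T.τ))) ≤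
        Subgroup.centralizer {δ} := by
      rw [Subgroup.closure_le]
      rintro σ (rfl | rfl | ⟨i, rfl⟩)
      · exact hcomm _ (congrArg (fun T : RealTuple n r => T.σ₁) h1)
      · exact hcomm _ (congrArg (fun T : RealTuple n r => T.σ₂) h1)
      · exact hcomm _ (congrArg (fun T : RealTuple n r => T.τ i) h1)
    have hδ0 : δ 0 = 0 := by
      rw [hδ, Perm.mul_apply, Perm.inv_eq_iff_eq, h2]
    have hδ1 : δ = 1 := by
      ext1 x
      obtain ⟨⟨σ, hσ⟩, hx⟩ := htrans.exists_smul_eq 0 x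
      have h3 := Subgroup.mem_centralizer_singleton_iff.1 (hle hσ)
      have h4 : σ 0 = x := hx
      rw [← h4, ← Perm.mul_apply, ← h3, Perm.mul_apply, hδ0, Perm.one_apply]
    apply Subtype.ext
    rw [hδ, inv_mul_eq_one] at hδ1
    exact hδ1

end Conjugation


/-! ### Coloured tails of a zigzag cover, treated alike in both directions. -/

section Tails

/-- The point `u` comes before `v` when one runs to the right (`o = true`) or to the left. -/
def Before (o : Bool) (u v : ℕ) : Prop := if o then u < v else v < u

/-- The end at which one enters the edge when running to the right or to the left. -/
def Edge.src (o : Bool) (e : Edge) : ℕ := if o then e.left else e.right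

/-- The end at which one leaves the edge when running to the right or to the left. -/
def Edge.dst (o : Bool) (e : Edge) : ℕ := if o then e.right else e.left

theorem Before.trans {o : Bool} {u v w : ℕ} (h : Before o u v) (h' : Before o v w) : Before o u w := by
  unfold Before at *
  split_ifs at * <;> omega

theorem Before.ne {o : Bool} {u v : ℕ} (h : Before o u v) : u ≠ v := by
  unfold Before at *
  split_ifs at * <;> omega

theorem seg_src {o : Bool} {u v w : ℕ} (h : Before o u v) : (seg u v w).src o = u := by
  unfold Before at h
  unfold Edge.src seg
  split_ifs at * <;> simp <;> omega

theorem seg_dst {o : Bool} {u v w : ℕ} (h : Before o u v) : (seg u v w).dst o = v := by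
  unfold Before at h
  unfold Edge.dst seg
  split_ifs at * <;> simp <;> omega

theorem incident_seg {u v w x : ℕ} : Incident x (seg u v w) ↔ x = u ∨ x = v := by
  unfold Incident seg
  simp only
  omega

theorem incident_iff (o : Bool) {v : ℕ} {e : Edge} : Incident v e ↔ e.src o = v ∨ e.dst o = v := by
  unfold Incident Edge.src Edge.dst
  cases o <;> simp [or_comm]

/-- The colours at a vertex, without reference to the position of the edges. -/
def ColoursOK (ε : ℤˣ) (e₁ e₂ e₃ : Edge × Colour) : Prop :=
  (e₁.2 = .normal ∧ (e₂.2 = .red ∨ e₂.2 = .blue) ∧ e₃.2 = .normal ∧ ¬ (e₂.2 = .red ↔ ε = 1)) ∨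
  (e₁.2 = .normal ∧ e₂.2 = .normal ∧ (e₃.2 = .red ∨ e₃.2 = .blue) ∧ (e₃.2 = .red ↔ ε = 1)) ∨
  (e₁.2 = .dotted ∧ e₁ = e₂ ∧ (e₃.2 = .red ∨ e₃.2 = .blue) ∧ ¬ (e₃.2 = .red ↔ ε = 1))

theorem vertexOK_iff (o : Bool) {R : Multiset (Edge × Colour)} {v : ℕ} {ε : ℤˣ} :
    VertexOK R v ε ↔ ∃ e₁ e₂ e₃ : Edge × Colour, e₃.1.weight = e₁.1.weight + e₂.1.weight ∧
      ColoursOK ε e₁ e₂ e₃ ∧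
      ((R.filter (fun e => e.1.dst o = v) = {e₁, e₂} ∧ R.filter (fun e => e.1.src o = v) = {e₃}) ∨
        (R.filter (fun e => e.1.dst o = v) = {e₃} ∧
          R.filter (fun e => e.1.src o = v) = {e₁, e₂})) := by
  unfold Edge.src Edge.dst
  cases o
  · simp only [Bool.false_eq_true, if_false]
    constructor
    · rintro ⟨e₁, e₂, e₃, h1, h2, h3⟩
      exact ⟨e₁, e₂, e₃, h1, h2, by tauto⟩
    · rintro ⟨e₁, e₂, e₃, h1, h2, h3⟩
      exact ⟨e₁, e₂, e₃, h1, h2, by tauto⟩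
  · simp only [if_true]
    rfl

theorem VertexOK.add_left {R R' : Multiset (Edge × Colour)} {v : ℕ} {ε : ℤˣ} (h : VertexOK R v ε)
    (h' : ∀ e ∈ R', ¬ Incident v e.1) : VertexOK (R' + R) v ε := by
  obtain ⟨e₁, e₂, e₃, h1, h2, h3⟩ := h
  refine ⟨e₁, e₂, e₃, h1, h2, ?_⟩
  rw [Multiset.filter_add, Multiset.filter_add,
    Multiset.filter_eq_nil.2 fun e he h'' => h' e he (Or.inr h''),
    Multiset.filter_eq_nil.2 fun e he h'' => h' e he (Or.inl h''), zero_add, zero_add]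
  exact h3

/-- The colour of a symmetric pair at a vertex where it meets an even edge. -/
def pairColour (c : Colour) (ε : ℤˣ) : Colour :=
  if (c = .red ↔ ε = 1) then .normal else .dotted

/-- The colour of the even edge at a vertex where it meets a symmetric pair. -/
def evenColour (d : Colour) (ε : ℤˣ) : Colour :=
  if (d = .normal ↔ ε = 1) then .red else .blue

/-- The coloured edges of a tail beyond its first edge, which has the colour `c`. -/
def colouredRest (far w : ℕ) (s : ℕ → ℤˣ) : Colour → List ℕ → Multiset (Edge × Colour)
  | _, [] => 0
  | c, [v] => {(seg v far (w / 2), pairColour c (s v)), (seg v far (w / 2), pairColour c (s v))}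
  | c, v :: v' :: l =>
    {(seg v v' (w / 2), pairColour c (s v)), (seg v v' (w / 2), pairColour c (s v))} +
      ((seg v' (l.headD far) w, evenColour (pairColour c (s v)) (s v')) ::ₘ
        colouredRest far w s (evenColour (pairColour c (s v)) (s v')) l)

/-- The coloured edges of a tail whose first edge has the colour `c`. -/
def colouredTail (far w : ℕ) (s : ℕ → ℤˣ) (c : Colour) (u : ℕ) (l : List ℕ) :
    Multiset (Edge × Colour) :=
  (seg u (l.headD far) w, c) ::ₘ colouredRest far w s c l

theorem colouredTail_map (far w : ℕ) (s : ℕ → ℤˣ) : ∀ (c : Colour) (u : ℕ) (l : List ℕ),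
    (colouredTail far w s c u l).map Prod.fst = tailEdges far w u l
  | c, u, [] => rfl
  | c, u, [v] => rfl
  | c, u, v :: v' :: l => by
    have h := colouredTail_map far w s (evenColour (pairColour c (s v)) (s v')) v' l
    rw [colouredTail] at h
    rw [colouredTail, colouredRest, tailEdges, ← h]
    simp only [Multiset.insert_eq_cons, Multiset.map_cons, List.headD_cons, Multiset.cons_add,
      Multiset.singleton_add]

theorem evenColour_even (d : Colour) (ε : ℤˣ) : evenColour d ε = .red ∨ evenColour d ε = .blue := by
  unfold evenColour
  split_ifs <;> simp

theorem incident_colouredRest {far w : ℕ} {s : ℕ → ℤˣ} {x : ℕ} :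
    ∀ {c : Colour} {l : List ℕ} {e : Edge × Colour}, e ∈ colouredRest far w s c l →
      Incident x e.1 → x = far ∨ x ∈ l
  | c, [], e, he, _ => by simp [colouredRest] at he
  | c, [v], e, he, hx => by
    simp only [colouredRest, Multiset.insert_eq_cons, Multiset.mem_cons, Multiset.mem_singleton,
      or_self] at he
    rw [he, incident_seg] at hx
    simp only [List.mem_cons, List.not_mem_nil, or_false]
    tauto
  | c, v :: v' :: l, e, he, hx => by
    simp only [colouredRest, Multiset.insert_eq_cons, Multiset.mem_add, Multiset.mem_cons,
      Multiset.mem_singleton, or_self] at he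
    rcases he with rfl | rfl | he
    · rw [incident_seg] at hx
      simp only [List.mem_cons]
      tauto
    · rw [incident_seg] at hx
      rcases l with _ | ⟨v'', l⟩
      · simp only [List.headD_nil] at hx
        simp only [List.mem_cons]
        tauto
      · simp only [List.headD_cons] at hx
        simp only [List.mem_cons]
        tauto
    · rcases incident_colouredRest he hx with h | h
      · exact Or.inl h
      · right
        simp only [List.mem_cons]
        tauto

theorem incident_colouredTail {far w : ℕ} {s : ℕ → ℤˣ} {x : ℕ} {c : Colour} {u : ℕ} {l : List ℕ}
    {e : Edge × Colour} (he : e ∈ colouredTail far w s c u l) (hx : Incident x e.1) :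
    x = far ∨ x = u ∨ x ∈ l := by
  rw [colouredTail, Multiset.mem_cons] at he
  rcases he with rfl | he
  · rw [incident_seg] at hx
    rcases l with _ | ⟨v'', l⟩
    · simp only [List.headD_nil] at hx
      tauto
    · simp only [List.headD_cons] at hx
      simp only [List.mem_cons]
      tauto
  · have := incident_colouredRest he hx
    tauto

theorem before_headD {o : Bool} {far u : ℕ} {l : List ℕ} (hc : (u :: l).Pairwise (Before o))
    (hfar : ∀ x ∈ u :: l, Before o x far) : Before o u (l.headD far) := by
  rcases l with _ | ⟨v, l⟩
  · exact hfar u (by simp)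
  · exact (List.pairwise_cons.1 hc).1 v (by simp)

/-- The colour of the even edge and the sign leave one possibility for the pair: it is undotted when
the even edge looks red for the sign +1 or blue for -1, and dotted otherwise. Together with
`coloursOK_even` this propagates a colouring along a tail for any signs. -/
theorem coloursOK_pair {ε : ℤˣ} {c : Colour} (hc : c = .red ∨ c = .blue) (p e : Edge) :
    ColoursOK ε (p, pairColour c ε) (p, pairColour c ε) (e, c) := by
  unfold ColoursOK pairColour
  by_cases h : c = .red ↔ ε = 1
  · right; left
    rw [if_pos h]
    exact ⟨rfl, rfl, hc, h⟩
  · right; right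
    rw [if_neg h]
    exact ⟨rfl, rfl, hc, h⟩

theorem coloursOK_even {ε : ℤˣ} {d : Colour} (hd : d = .normal ∨ d = .dotted) (p e : Edge) :
    ColoursOK ε (p, d) (p, d) (e, evenColour d ε) := by
  unfold ColoursOK evenColour
  rcases hd with rfl | rfl
  · right; left
    by_cases h : ε = 1 <;> simp [h]
  · right; right
    by_cases h : ε = 1 <;> simp [h]

theorem pairColour_cases (c : Colour) (ε : ℤˣ) :
    pairColour c ε = .normal ∨ pairColour c ε = .dotted := by
  unfold pairColour
  split_ifs <;> simp

/-- The inner vertices of a tail are admissible. -/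
theorem vertexOK_colouredTail {o : Bool} {far w : ℕ} {s : ℕ → ℤˣ} (hw : Even w) {x : ℕ} :
    ∀ {c : Colour} {u : ℕ} {l : List ℕ}, (c = .red ∨ c = .blue) → (u :: l).Pairwise (Before o) →
      (∀ y ∈ u :: l, Before o y far) → x ∈ l → VertexOK (colouredTail far w s c u l) x (s x)
  | c, u, [], _, _, _, hx => by simp at hx
  | c, u, [v], hcol, hc, hfar, hx => by
    obtain rfl : x = v := by simpa using hx
    have h1 : Before o u x := (List.pairwise_cons.1 hc).1 x (by simp)
    have h2 : Before o x far := hfar x (by simp)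
    have n1 := h1.ne
    have n2 := h2.ne
    obtain ⟨m, hm⟩ := hw
    refine (vertexOK_iff o).2 ⟨(seg x far (w / 2), pairColour c (s x)),
      (seg x far (w / 2), pairColour c (s x)), (seg u x w, c), ?_, coloursOK_pair hcol _ _,
      Or.inr ⟨?_, ?_⟩⟩
    · simp only [seg]; omega
    · simp [colouredTail, colouredRest, Multiset.filter_singleton, seg_dst h1,
        seg_dst h2, n2.symm]
    · simp [colouredTail, colouredRest, Multiset.filter_singleton, seg_src h1,
        seg_src h2, n1]
  | c, u, v :: v' :: l, hcol, hc, hfar, hx => by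
    have hc' := (List.pairwise_cons.1 hc).2
    have hc'' := (List.pairwise_cons.1 hc').2
    have h1 : Before o u v := (List.pairwise_cons.1 hc).1 v (by simp)
    have h2 : Before o v v' := (List.pairwise_cons.1 hc').1 v' (by simp)
    have h3 : Before o v' (l.headD far) := before_headD hc'' fun y hy =>
      hfar y (List.mem_cons_of_mem _ (List.mem_cons_of_mem _ hy))
    have n1 := h1.ne
    have n2 := h2.ne
    have n3 := h3.ne
    have n4 := (h1.trans h2).ne
    have n5 := (h2.trans h3).ne
    have hrest : ∀ y, Before o y v' ∨ y = v' → Before o y far → ∀ c', ∀ e ∈ colouredRest far w s c' l,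
        ¬ Incident y e.1 := by
      intro y hy hyf c' e he hi
      rcases incident_colouredRest he hi with h | h
      · exact hyf.ne h
      · have := (List.pairwise_cons.1 hc'').1 y h
        rcases hy with hy | rfl
        · exact (hy.trans this).ne rfl
        · exact this.ne rfl
    have hrest0 : ∀ y, Before o y v' ∨ y = v' → Before o y far → ∀ c',
        (colouredRest far w s c' l).filter (fun e => e.1.src o = y) = 0 ∧
        (colouredRest far w s c' l).filter (fun e => e.1.dst o = y) = 0 := by
      intro y hy hyf c'
      exact ⟨Multiset.filter_eq_nil.2 fun e he h => hrest y hy hyf c' e he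
        ((incident_iff o).2 (Or.inl h)), Multiset.filter_eq_nil.2 fun e he h =>
        hrest y hy hyf c' e he ((incident_iff o).2 (Or.inr h))⟩
    obtain ⟨m, hm⟩ := id hw
    have hfv : Before o v far := hfar v (by simp)
    have hfv' : Before o v' far := hfar v' (by simp)
    have hct : colouredTail far w s c u (v :: v' :: l) = (seg u v w, c) ::ₘ
        (seg v v' (w / 2), pairColour c (s v)) ::ₘ (seg v v' (w / 2), pairColour c (s v)) ::ₘ
        colouredTail far w s (evenColour (pairColour c (s v)) (s v')) v' l := by
      simp only [colouredTail, colouredRest, List.headD_cons, Multiset.insert_eq_cons,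
        Multiset.cons_add, Multiset.singleton_add]
    rw [hct]
    by_cases hxv : x = v
    · subst hxv
      have h4 := fun c' => (hrest0 x (Or.inl h2) hfv c').1
      have h5 := fun c' => (hrest0 x (Or.inl h2) hfv c').2
      rw [colouredTail]
      generalize l.headD far = z at h3 n5
      refine (vertexOK_iff o).2 ⟨(seg x v' (w / 2), pairColour c (s x)),
        (seg x v' (w / 2), pairColour c (s x)), (seg u x w, c), ?_, coloursOK_pair hcol _ _,
        Or.inr ⟨?_, ?_⟩⟩
      · simp only [seg]; omega
      · simp [seg_dst h1, seg_dst h2, seg_dst h3, n2.symm, n5.symm, h5]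
      · simp [seg_src h1, seg_src h2, seg_src h3, n1, n2.symm, h4]
    by_cases hxv' : x = v'
    · subst hxv'
      have h4 := fun c' => (hrest0 x (Or.inr rfl) hfv' c').1
      have h5 := fun c' => (hrest0 x (Or.inr rfl) hfv' c').2
      rw [colouredTail]
      generalize l.headD far = z at h3 n3
      refine (vertexOK_iff o).2 ⟨(seg v x (w / 2), pairColour c (s v)),
        (seg v x (w / 2), pairColour c (s v)),
        (seg x z w, evenColour (pairColour c (s v)) (s x)), ?_,
        coloursOK_even (pairColour_cases _ _) _ _, Or.inl ⟨?_, ?_⟩⟩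
      · simp only [seg]; omega
      · simp [seg_dst h1, seg_dst h2, seg_dst h3, n2, n3.symm, h5]
      · simp [seg_src h1, seg_src h2, seg_src h3, n4, n2, h4]
    · have hxl : x ∈ l := by simpa [hxv, hxv'] using hx
      have h4 : Before o v' x := (List.pairwise_cons.1 hc'').1 x hxl
      have ih := vertexOK_colouredTail (o := o) (far := far) (s := s) hw
        (c := evenColour (pairColour c (s v)) (s v')) (u := v') (l := l) (evenColour_even _ _) hc''
        (fun y hy => hfar y (List.mem_cons_of_mem _ (List.mem_cons_of_mem _ hy))) hxl
      have hsplit : ∀ R : Multiset (Edge × Colour), (seg u v w, c) ::ₘ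
          (seg v v' (w / 2), pairColour c (s v)) ::ₘ (seg v v' (w / 2), pairColour c (s v)) ::ₘ R =
          {(seg u v w, c), (seg v v' (w / 2), pairColour c (s v)),
            (seg v v' (w / 2), pairColour c (s v))} + R := by
        intro R
        simp only [Multiset.insert_eq_cons, Multiset.cons_add, Multiset.singleton_add]
      rw [hsplit]
      refine ih.add_left fun e he hi => ?_
      have n6 := h4.ne
      simp only [Multiset.insert_eq_cons, Multiset.mem_cons, Multiset.mem_singleton, or_self] at he
      rcases he with rfl | rfl <;> rw [incident_seg] at hi
      · rcases hi with rfl | rfl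
        · exact (h1.trans (h2.trans h4)).ne rfl
        · exact hxv rfl
      · tauto

end Tails


/-! ### Coloured covers described by the list of nodes along their string. -/

section Covers

/-- A vertex of the string with the tail at it, and the weight of the string behind it. -/
structure Node where
  pos : ℕ
  out : Bool
  tw : ℕ
  inner : List ℕ
  wt : ℕ

def Node.verts (nd : Node) : List ℕ := nd.pos :: nd.inner

/-- All vertices of a cover that is given by the nodes on its string. -/
def nodeVerts (L : List Node) : List ℕ := L.flatMap Node.verts

theorem nodeVerts_cons (nd : Node) (L : List Node) :
    nodeVerts (nd :: L) = nd.pos :: (nd.inner ++ nodeVerts L) := rfl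

def Node.far (r : ℕ) (nd : Node) : ℕ := if nd.out then r + 1 else 0

/-- The next point of the string. -/
def nextPos (r : ℕ) : List Node → ℕ
  | [] => r + 1
  | nd :: _ => nd.pos

/-- The string bends at `p`, between `u` and `z`. -/
def Bends (u p z : ℕ) : Prop := (u < p ∧ z < p) ∨ (p < u ∧ p < z)

instance (u p z : ℕ) : Decidable (Bends u p z) := inferInstanceAs (Decidable (_ ∨ _))

/-- The colour of the first edge of a tail. -/
def tailColour (ε : ℤˣ) (u p z : ℕ) : Colour :=
  if (Bends u p z ↔ ε = 1) then .red else .blue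

/-- The coloured cover whose string starts at `u` with the weight `w`, passes the given nodes and ends
at `+∞`. -/
def colouredCover (r : ℕ) (s : ℕ → ℤˣ) : ℕ → ℕ → List Node → Multiset (Edge × Colour)
  | u, w, [] => {(seg u (r + 1) w, .normal)}
  | u, w, nd :: L => (seg u nd.pos w, .normal) ::ₘ
      (colouredTail (nd.far r) nd.tw s (tailColour (s nd.pos) u nd.pos (nextPos r L)) nd.pos nd.inner +
        colouredCover r s nd.pos nd.wt L)

/-- The conditions at a node between `u` and `z`, where the string arrives with the weight `w`. -/
structure NodeOK (u z w : ℕ) (nd : Node) : Prop where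
  even : Even nd.tw
  pos : 0 < nd.tw
  half : nd.inner ≠ [] → Odd (nd.tw / 2)
  chain : (nd.pos :: nd.inner).Pairwise (Before nd.out)
  -- The two kinds of bends, then the unbent nodes: an out-tail or an in-tail on a string running
  -- right, and an in-tail on a string running left. An out-tail on a string running left is never
  -- used.
  balance :
    (u < nd.pos ∧ z < nd.pos ∧ nd.out = true ∧ nd.tw = w + nd.wt) ∨
    (nd.pos < u ∧ nd.pos < z ∧ nd.out = false ∧ nd.tw = w + nd.wt) ∨
    (u < nd.pos ∧ nd.pos < z ∧ nd.out = true ∧ w = nd.wt + nd.tw) ∨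
    (u < nd.pos ∧ nd.pos < z ∧ nd.out = false ∧ nd.wt = w + nd.tw) ∨
    (nd.pos < u ∧ z < nd.pos ∧ nd.out = false ∧ w = nd.wt + nd.tw)

/-- The conditions at all nodes of a string that starts at `u` with the weight `w`. -/
def ValidNodes (r : ℕ) : ℕ → ℕ → List Node → Prop
  | u, w, [] => Odd w ∧ u ≤ r
  | u, w, nd :: L => Odd w ∧ NodeOK u (nextPos r L) w nd ∧ ValidNodes r nd.pos nd.wt L

theorem colouredCover_eq_cons (r : ℕ) (s : ℕ → ℤˣ) (u w : ℕ) (L : List Node) :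
    ∃ R, colouredCover r s u w L = (seg u (nextPos r L) w, .normal) ::ₘ R ∧
      ∀ e ∈ R, ∀ x, Incident x e.1 → x = 0 ∨ x = r + 1 ∨ x ∈ nodeVerts L := by
  induction L generalizing u w with
  | nil => exact ⟨0, rfl, by simp⟩
  | cons nd L ih =>
    refine ⟨_, rfl, fun e he x hx => ?_⟩
    rw [Multiset.mem_add] at he
    rw [nodeVerts_cons, List.mem_cons, List.mem_append]
    rcases he with he | he
    · rcases incident_colouredTail he hx with h | h | h
      · unfold Node.far at h
        split_ifs at h <;> tauto
      · tauto
      · tauto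
    · obtain ⟨R, hR, hR'⟩ := ih nd.pos nd.wt
      rw [hR, Multiset.mem_cons] at he
      rcases he with rfl | he
      · rw [incident_seg] at hx
        rcases hx with rfl | rfl
        · exact Or.inr (Or.inr (Or.inl rfl))
        · cases L with
          | nil => exact Or.inr (Or.inl rfl)
          | cons nd' L => simp [nextPos, nodeVerts_cons]
      · rcases hR' e he x hx with h | h | h <;> tauto

theorem seg_of_lt {u v w : ℕ} (h : u < v) : seg u v w = ⟨u, v, w⟩ := by
  unfold seg; congr 1 <;> omega

theorem seg_of_gt {u v w : ℕ} (h : v < u) : seg u v w = ⟨v, u, w⟩ := by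
  unfold seg; congr 1 <;> omega

theorem Node.far_before {r : ℕ} {nd : Node} (h : ∀ x ∈ nd.verts, 1 ≤ x ∧ x ≤ r) :
    ∀ y ∈ nd.pos :: nd.inner, Before nd.out y (nd.far r) := by
  intro y hy
  have := h y hy
  unfold Before Node.far
  split_ifs <;> omega

theorem tailColour_even (ε : ℤˣ) (u p z : ℕ) :
    tailColour ε u p z = .red ∨ tailColour ε u p z = .blue := by
  unfold tailColour
  split_ifs <;> simp

/-- At a bend the two odd edges lie on one side and the even edge on the other; at an unbent node
the even edge lies beside an odd one. The two situations ask for opposite colours for a given sign,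
which is how `tailColour` is defined. -/
theorem NodeOK.vertexOK {r u z w : ℕ} {nd : Node} (h : NodeOK u z w nd)
    (hb : ∀ x ∈ nd.verts, 1 ≤ x ∧ x ≤ r) (s : ℕ → ℤˣ) {R R' : Multiset (Edge × Colour)}
    (hR : ∀ e ∈ R, ¬ Incident nd.pos e.1) (hR' : ∀ e ∈ R', ¬ Incident nd.pos e.1) :
    VertexOK ((seg u nd.pos w, .normal) ::ₘ
      ((seg nd.pos (nd.inner.headD (nd.far r)) nd.tw, tailColour (s nd.pos) u nd.pos z) ::ₘ R +
        (seg nd.pos z nd.wt, .normal) ::ₘ R')) nd.pos (s nd.pos) := by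
  have h1 := before_headD h.chain (Node.far_before hb)
  have hre : ∀ a b c : Edge × Colour, a ::ₘ (b ::ₘ R + c ::ₘ R') = (R + R') + {a, b, c} := by
    intro a b c
    simp only [Multiset.insert_eq_cons, ← Multiset.singleton_add]
    abel
  rw [hre]
  refine VertexOK.add_left ?_ (by
    intro e he
    rcases Multiset.mem_add.1 he with he | he
    · exact hR e he
    · exact hR' e he)
  generalize nd.inner.headD (nd.far r) = y at h1
  obtain ⟨hev, hpos, -, -, hbal⟩ := h
  have hc := tailColour_even (s nd.pos) u nd.pos z
  generalize hcol : tailColour (s nd.pos) u nd.pos z = c at hc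
  unfold tailColour at hcol
  generalize s nd.pos = ε at hcol
  have hbend : Bends u nd.pos z → (c = .red ↔ ε = 1) := by
    intro h2
    rw [← hcol]
    by_cases h3 : ε = 1 <;> simp [h2, h3]
  have hunbend : ¬ Bends u nd.pos z → ¬ (c = .red ↔ ε = 1) := by
    intro h2
    rw [← hcol]
    by_cases h3 : ε = 1 <;> simp [h2, h3]
  obtain ⟨p, o, tw, inner, wt⟩ := nd
  dsimp only at *
  clear hcol hre hR hR' hb
  unfold Before at h1
  rcases hbal with ⟨b1, b2, rfl, b4⟩ | ⟨b1, b2, rfl, b4⟩ | ⟨b1, b2, rfl, b4⟩ | ⟨b1, b2, rfl, b4⟩ |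
    ⟨b1, b2, rfl, b4⟩
  · rw [if_pos rfl] at h1
    rw [seg_of_lt b1, seg_of_lt h1, seg_of_gt b2]
    refine ⟨(⟨u, p, w⟩, .normal), (⟨z, p, wt⟩, .normal), (⟨p, y, tw⟩, c), b4,
      Or.inr (Or.inl ⟨rfl, rfl, hc, hbend (Or.inl ⟨b1, b2⟩)⟩), Or.inl ⟨?_, ?_⟩⟩
    · simp [Multiset.filter_singleton, h1.ne', Multiset.insert_eq_cons]
    · simp [Multiset.filter_singleton, b1.ne, b2.ne, Multiset.insert_eq_cons]
  · rw [if_neg (by simp)] at h1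
    rw [seg_of_gt b1, seg_of_gt h1, seg_of_lt b2]
    refine ⟨(⟨p, u, w⟩, .normal), (⟨p, z, wt⟩, .normal), (⟨y, p, tw⟩, c), b4,
      Or.inr (Or.inl ⟨rfl, rfl, hc, hbend (Or.inr ⟨b1, b2⟩)⟩), Or.inr ⟨?_, ?_⟩⟩
    · simp [Multiset.filter_singleton, b1.ne', b2.ne', Multiset.insert_eq_cons]
    · simp [Multiset.filter_singleton, h1.ne, Multiset.insert_eq_cons]
  · rw [if_pos rfl] at h1
    rw [seg_of_lt b1, seg_of_lt h1, seg_of_lt b2]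
    refine ⟨(⟨p, z, wt⟩, .normal), (⟨p, y, tw⟩, c), (⟨u, p, w⟩, .normal), b4,
      Or.inl ⟨rfl, hc, rfl, hunbend (by unfold Bends; omega)⟩, Or.inr ⟨?_, ?_⟩⟩
    · simp [Multiset.filter_singleton, h1.ne', b2.ne', Multiset.insert_eq_cons]
    · simp [Multiset.filter_singleton, b1.ne, Multiset.insert_eq_cons]
      exact Multiset.cons_swap _ _ _
  · rw [if_neg (by simp)] at h1
    rw [seg_of_lt b1, seg_of_gt h1, seg_of_lt b2]
    refine ⟨(⟨u, p, w⟩, .normal), (⟨y, p, tw⟩, c), (⟨p, z, wt⟩, .normal), b4,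
      Or.inl ⟨rfl, hc, rfl, hunbend (by unfold Bends; omega)⟩, Or.inl ⟨?_, ?_⟩⟩
    · simp [Multiset.filter_singleton, b2.ne', Multiset.insert_eq_cons]
    · simp [Multiset.filter_singleton, b1.ne, h1.ne, Multiset.insert_eq_cons]
  · rw [if_neg (by simp)] at h1
    rw [seg_of_gt b1, seg_of_gt h1, seg_of_gt b2]
    refine ⟨(⟨z, p, wt⟩, .normal), (⟨y, p, tw⟩, c), (⟨p, u, w⟩, .normal), b4,
      Or.inl ⟨rfl, hc, rfl, hunbend (by unfold Bends; omega)⟩, Or.inl ⟨?_, ?_⟩⟩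
    · simp [Multiset.filter_singleton, b1.ne', Multiset.insert_eq_cons]
      exact Multiset.cons_swap _ _ _
    · simp [Multiset.filter_singleton, b2.ne, h1.ne, Multiset.insert_eq_cons]

/-- All vertices of a valid cover are admissible. -/
theorem ValidNodes.vertexOK {r : ℕ} (s : ℕ → ℤˣ) {x : ℕ} : ∀ {u w : ℕ} {L : List Node},
    ValidNodes r u w L → (nodeVerts L).Nodup → (∀ x ∈ nodeVerts L, 1 ≤ x ∧ x ≤ r) →
    u ∉ nodeVerts L → x ∈ nodeVerts L → VertexOK (colouredCover r s u w L) x (s x)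
  | u, w, [], _, _, _, _, hx => by simp [nodeVerts] at hx
  | u, w, nd :: L, ⟨_, hnd, hL⟩, hnod, hb, hu, hx => by
    rw [nodeVerts_cons, List.nodup_cons, List.mem_append, List.nodup_append] at hnod
    obtain ⟨n1, n2, n3, n4⟩ := hnod
    push Not at n1
    rw [nodeVerts_cons, List.mem_cons, List.mem_append] at hu hx
    push Not at hu
    have hb' : ∀ x ∈ nd.verts, 1 ≤ x ∧ x ≤ r := fun y hy => hb y (by
      rw [nodeVerts_cons, ← List.cons_append]; exact List.mem_append_left _ hy)
    have hbL : ∀ x ∈ nodeVerts L, 1 ≤ x ∧ x ≤ r := fun y hy => hb y (by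
      rw [nodeVerts_cons, ← List.cons_append]; exact List.mem_append_right _ hy)
    have hfar := Node.far_before hb'
    obtain ⟨R, hR, hR'⟩ := colouredCover_eq_cons r s nd.pos nd.wt L
    have hpos := hb' nd.pos (by simp [Node.verts])
    rcases hx with rfl | hx | hx
    · rw [colouredCover, hR, colouredTail]
      refine hnd.vertexOK hb' s (fun e he hi => ?_) (fun e he hi => ?_)
      · rcases incident_colouredRest he hi with h | h
        · exact (hfar nd.pos (by simp)).ne h
        · exact n1.1 h
      · rcases hR' e he _ hi with h | h | h
        · omega
        · omega
        · exact n1.2 h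
    · have hxr := hb' x (by simp [Node.verts, hx])
      have h1 := vertexOK_colouredTail (s := s) (far := nd.far r) hnd.even
        (tailColour_even (s nd.pos) u nd.pos (nextPos r L)) hnd.chain hfar hx
      rw [colouredCover, ← Multiset.singleton_add, add_comm (colouredTail _ _ _ _ _ _), ← add_assoc]
      refine h1.add_left fun e he hi => ?_
      rw [hR, Multiset.mem_add, Multiset.mem_singleton, Multiset.mem_cons] at he
      have hxp : x ≠ nd.pos := fun h => n1.1 (h ▸ hx)
      have hxL : x ∉ nodeVerts L := fun h => n4 x hx x h rfl
      rcases he with rfl | rfl | he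
      · rw [incident_seg] at hi
        rcases hi with rfl | hi
        · exact hu.2.1 hx
        · exact hxp hi
      · rw [incident_seg] at hi
        rcases hi with hi | hi
        · exact hxp hi
        · cases L with
          | nil => rw [nextPos] at hi; omega
          | cons nd' L => exact hxL (by rw [hi]; simp [nextPos, nodeVerts_cons])
      · rcases hR' e he _ hi with h | h | h
        · omega
        · omega
        · exact hxL h
    · have hxr := hbL x hx
      have ih := ValidNodes.vertexOK s hL n3 hbL n1.2 hx
      rw [colouredCover, ← Multiset.singleton_add, ← add_assoc]
      refine ih.add_left fun e he hi => ?_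
      rw [Multiset.mem_add, Multiset.mem_singleton] at he
      rcases he with rfl | he
      · rw [incident_seg] at hi
        rcases hi with rfl | rfl
        · exact hu.2.2 hx
        · exact n1.2 hx
      · rcases incident_colouredTail he hi with h | rfl | h
        · unfold Node.far at h
          split_ifs at h <;> omega
        · exact n1.2 hx
        · exact n4 x h x hx rfl

end Covers


/-! ### From admissible vertices to colourings, splittings and tropical covers. -/

section GoodCovers

/-- A coloured cover with `r` vertices, all of which are admissible for the signs `s`. -/
structure GoodCover (r : ℕ) (s : ℕ → ℤˣ) (R : Multiset (Edge × Colour)) : Prop where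
  lt : ∀ e ∈ R, e.1.left < e.1.right
  le : ∀ e ∈ R, e.1.right ≤ r + 1
  pos : ∀ e ∈ R, 0 < e.1.weight
  odd : ∀ e ∈ R, e.2 = .normal → Odd e.1.weight
  even : ∀ e ∈ R, e.2 = .red ∨ e.2 = .blue → Even e.1.weight
  inner : ∀ e ∈ R, ∃ v, 1 ≤ v ∧ v ≤ r ∧ Incident v e.1
  vertex : ∀ v, 1 ≤ v → v ≤ r → VertexOK R v (s v)

variable {r : ℕ} {s : ℕ → ℤˣ} {R : Multiset (Edge × Colour)}

theorem count_of_filter_eq_pair {α : Type*} [DecidableEq α] {R : Multiset α} {p : α → Prop}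
    [DecidablePred p] {e : α} (he : p e) (h : R.filter p = {e, e}) : R.count e = 2 := by
  rw [← Multiset.count_filter_of_pos he, h]
  simp [Multiset.insert_eq_cons]

/-- Each edge has an inner endpoint, and at an admissible vertex a dotted edge occurs only as one of
two equal edges, so its multiplicity is two. -/
theorem GoodCover.edgesOK (h : GoodCover r s R) : EdgesOK r R where
  lt := h.lt
  le := h.le
  pos := h.pos
  odd := h.odd
  even := h.even
  dotted e he hd := by
    obtain ⟨v, h1, h2, hv⟩ := h.inner e he
    obtain ⟨e₁, e₂, e₃, -, hc, hf⟩ := h.vertex v h1 h2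
    have hne : e ≠ e₃ := by
      rintro rfl
      rcases hc with ⟨_, _, c, _⟩ | ⟨_, _, c | c, _⟩ | ⟨_, _, c | c, _⟩ <;> simp [c] at hd
    have heq : e = e₁ ∨ e = e₂ → e₁ = e ∧ e₂ = e := by
      rintro (rfl | rfl)
      · rcases hc with ⟨c, _⟩ | ⟨c, _⟩ | ⟨_, c, _⟩
        · simp [c] at hd
        · simp [c] at hd
        · exact ⟨rfl, c.symm⟩
      · rcases hc with ⟨_, c | c, _⟩ | ⟨_, c, _⟩ | ⟨_, c, _⟩
        · simp [c] at hd
        · simp [c] at hd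
        · simp [c] at hd
        · exact ⟨c, rfl⟩
    have key : ∀ (p : Edge × Colour → Prop) [DecidablePred p], p e →
        (R.filter p = {e₁, e₂} ∨ R.filter p = {e₃}) → R.count e = 2 := by
      intro p _ hp hpf
      have hmem : e ∈ R.filter p := Multiset.mem_filter.2 ⟨he, hp⟩
      rcases hpf with hpf | hpf
      · obtain ⟨rfl, h4⟩ := heq (by rw [hpf] at hmem; simpa using hmem)
        exact count_of_filter_eq_pair hp (by rw [hpf, h4])
      · rw [hpf, Multiset.mem_singleton] at hmem
        exact absurd hmem hne
    rcases hv with hv | hv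
    · exact key (fun e => e.1.left = v) hv (by tauto)
    · exact key (fun e => e.1.right = v) hv (by tauto)

theorem mem_vertex {v : ℕ} {e₁ e₂ e₃ e : Edge × Colour}
    (hf : (R.filter (fun e => e.1.right = v) = {e₁, e₂} ∧ R.filter (fun e => e.1.left = v) = {e₃}) ∨
      (R.filter (fun e => e.1.right = v) = {e₃} ∧ R.filter (fun e => e.1.left = v) = {e₁, e₂}))
    (he : e ∈ R) (hv : Incident v e.1) : e = e₁ ∨ e = e₂ ∨ e = e₃ := by
  have h1 : e ∈ R.filter (fun e => e.1.right = v) ∨ e ∈ R.filter (fun e => e.1.left = v) := by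
    rw [Multiset.mem_filter, Multiset.mem_filter]
    rcases hv with hv | hv
    · exact Or.inr ⟨he, hv⟩
    · exact Or.inl ⟨he, hv⟩
  rcases hf with ⟨h2, h3⟩ | ⟨h2, h3⟩ <;> rw [h2, h3] at h1 <;> simp at h1 <;> tauto

/-- An admissible vertex has only one edge that is red or blue, so the two colours never meet. -/
theorem GoodCover.isColouring (h : GoodCover r s R) : IsColouring r (R.map Prod.fst) R where
  forget := rfl
  dotted e he := by
    refine ⟨h.edgesOK.dotted _ he rfl, ?_⟩
    rintro ⟨h1, h2⟩
    obtain ⟨v, h3, h4, h5 | h5⟩ := h.inner _ he <;> dsimp only at h5 <;> omega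
  normal e he := h.odd _ he rfl
  red e he := h.even _ he (Or.inl rfl)
  blue e he := h.even _ he (Or.inr rfl)
  component e e' he he' v h1 h2 := by
    rintro ⟨h3, h4⟩
    obtain ⟨e₁, e₂, e₃, -, hc, hf⟩ := h.vertex v h1 h2
    have h5 := mem_vertex hf he h3
    have h6 := mem_vertex hf he' h4
    rcases hc with ⟨c1, -, c3, -⟩ | ⟨c1, c2, -, -⟩ | ⟨c1, c2, -, -⟩
    · rcases h5 with rfl | rfl | rfl
      · simp at c1
      · rcases h6 with h6 | h6 | h6
        · rw [← h6] at c1; simp at c1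
        · simp at h6
        · rw [← h6] at c3; simp at c3
      · simp at c3
    · rcases h5 with rfl | rfl | rfl
      · simp at c1
      · simp at c2
      · rcases h6 with h6 | h6 | h6
        · rw [← h6] at c1; simp at c1
        · rw [← h6] at c2; simp at c2
        · simp at h6
    · subst c2
      rcases h5 with rfl | rfl | rfl
      · simp at c1
      · simp at c1
      · rcases h6 with h6 | h6 | h6
        · rw [← h6] at c1; simp at c1
        · rw [← h6] at c1; simp at c1
        · simp at h6

theorem VertexOK.isPositiveVertex {v : ℕ} (h : VertexOK R v 1) : IsPositiveVertex R v := by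
  obtain ⟨e₁, e₂, e₃, -, hc, hf⟩ := h
  have hV : HasVertex R v e₃.2 e₁.2 e₂.2 := by
    rcases hf with ⟨h1, h2⟩ | ⟨h1, h2⟩
    · right; rw [h1, h2]; exact ⟨rfl, rfl⟩
    · left; rw [h1, h2]; exact ⟨rfl, rfl⟩
  rcases hc with ⟨c1, c2, c3, c4⟩ | ⟨c1, c2, c3, c4⟩ | ⟨c1, c2, c3, c4⟩
  · have c5 : e₂.2 = .blue := by rcases c2 with c2 | c2 <;> simp_all
    rw [c1, c3, c5] at hV; exact Or.inl hV
  · have c5 : e₃.2 = .red := by simpa using c4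
    rw [c1, c2, c5] at hV; exact Or.inr (Or.inr (Or.inl hV))
  · have c5 : e₃.2 = .blue := by rcases c3 with c3 | c3 <;> simp_all
    rw [← c2, c1, c5] at hV; exact Or.inr (Or.inr (Or.inr hV))

theorem VertexOK.isNegativeVertex {v : ℕ} (h : VertexOK R v (-1)) : IsNegativeVertex R v := by
  obtain ⟨e₁, e₂, e₃, -, hc, hf⟩ := h
  have hV : HasVertex R v e₃.2 e₁.2 e₂.2 := by
    rcases hf with ⟨h1, h2⟩ | ⟨h1, h2⟩
    · right; rw [h1, h2]; exact ⟨rfl, rfl⟩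
    · left; rw [h1, h2]; exact ⟨rfl, rfl⟩
  have hne : ¬ ((-1 : ℤˣ) = 1) := by decide
  rcases hc with ⟨c1, c2, c3, c4⟩ | ⟨c1, c2, c3, c4⟩ | ⟨c1, c2, c3, c4⟩
  · have c5 : e₂.2 = .red := by rcases c2 with c2 | c2 <;> simp_all
    rw [c1, c3, c5] at hV; exact Or.inl hV
  · have c5 : e₃.2 = .blue := by rcases c3 with c3 | c3 <;> simp_all
    rw [c1, c2, c5] at hV; exact Or.inr (Or.inr (Or.inl hV))
  · have c5 : e₃.2 = .red := by rcases c3 with c3 | c3 <;> simp_all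
    rw [← c2, c1, c5] at hV; exact Or.inr (Or.inr (Or.inr hV))

theorem signAt_succ (s : Fin r → ℤˣ) (i : Fin r) : signAt s (i + 1) = s i := by
  rw [signAt, dif_pos i.2]

theorem GoodCover.hasSplitting {s : Fin r → ℤˣ} (h : GoodCover r (signAt s) R) :
    HasSplitting R s := by
  intro i
  have h1 := h.vertex (i + 1) (by omega) i.2
  rw [signAt_succ] at h1
  exact ⟨fun h2 => (h2 ▸ h1).isPositiveVertex, fun h2 => (h2 ▸ h1).isNegativeVertex⟩

theorem filter_map_fst (R : Multiset (Edge × Colour)) (p : Edge → Prop) [DecidablePred p] :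
    (R.map Prod.fst).filter p = (R.filter fun e => p e.1).map Prod.fst :=
  Multiset.filter_map _ _ _

theorem GoodCover.isTropicalCover (h : GoodCover r s R) (hr : 0 < r)
    (hconn : EdgesConnected (Set.Icc 1 r) (R.map Prod.fst)) : IsTropicalCover r (R.map Prod.fst) where
  pos := hr
  edge e he := by
    obtain ⟨e, h0, rfl⟩ := Multiset.mem_map.1 he
    exact ⟨h.lt e h0, h.le e h0, h.pos e h0⟩
  inner e he := by
    obtain ⟨e, h0, rfl⟩ := Multiset.mem_map.1 he
    rintro ⟨h1, h2⟩
    obtain ⟨v, h3, h4, h5 | h5⟩ := h.inner _ h0 <;> omega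
  trivalent v h1 h2 := by
    obtain ⟨e₁, e₂, e₃, -, hc, hf⟩ := h.vertex v h1 h2
    have h3 : (R.filter fun e => Incident v e.1) =
        R.filter (fun e => e.1.right = v) + R.filter (fun e => e.1.left = v) := by
      rw [Multiset.filter_add_filter, (Multiset.filter_eq_nil (p := fun e : Edge × Colour =>
        e.1.right = v ∧ e.1.left = v)).2, add_zero]
      · refine Multiset.filter_congr fun e _ => ?_
        unfold Incident
        exact or_comm
      · intro e he h4
        have := h.lt e he
        omega
    rw [filter_map_fst, Multiset.card_map, h3]
    rcases hf with ⟨h4, h5⟩ | ⟨h4, h5⟩ <;> rw [h4, h5] <;> rfl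
  balanced v h1 h2 := by
    obtain ⟨e₁, e₂, e₃, hw, hc, hf⟩ := h.vertex v h1 h2
    rw [filter_map_fst, filter_map_fst]
    rcases hf with ⟨h4, h5⟩ | ⟨h4, h5⟩ <;> rw [h4, h5] <;> simp [hw]
  connected := hconn

end GoodCovers

/-! ### Lists of nodes that yield good covers. -/

section NodeCovers

theorem mem_colouredRest {o : Bool} {far w : ℕ} {s : ℕ → ℤˣ} : ∀ {c : Colour} {u : ℕ} {l : List ℕ}
    {e : Edge × Colour}, (u :: l).Pairwise (Before o) → (∀ y ∈ u :: l, Before o y far) →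
    e ∈ colouredRest far w s c l → ∃ x ∈ l, ∃ y, Before o x y ∧ (y = far ∨ y ∈ l) ∧
      ((e.1 = seg x y (w / 2) ∧ (e.2 = .normal ∨ e.2 = .dotted)) ∨
        (e.1 = seg x y w ∧ (e.2 = .red ∨ e.2 = .blue)))
  | c, u, [], e, _, _, he => by simp [colouredRest] at he
  | c, u, [v], e, hc, hfar, he => by
    simp only [colouredRest, Multiset.insert_eq_cons, Multiset.mem_cons, Multiset.mem_singleton,
      or_self] at he
    subst he
    exact ⟨v, by simp, far, hfar v (by simp), Or.inl rfl, Or.inl ⟨rfl, pairColour_cases _ _⟩⟩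
  | c, u, v :: v' :: l, e, hc, hfar, he => by
    have hc' := (List.pairwise_cons.1 hc).2
    have hc'' := (List.pairwise_cons.1 hc').2
    have hfar' : ∀ y ∈ v' :: l, Before o y far := fun y hy =>
      hfar y (List.mem_cons_of_mem _ (List.mem_cons_of_mem _ hy))
    simp only [colouredRest, Multiset.insert_eq_cons, Multiset.mem_add, Multiset.mem_cons,
      Multiset.mem_singleton, or_self] at he
    rcases he with rfl | rfl | he
    · exact ⟨v, by simp, v', (List.pairwise_cons.1 hc').1 v' (by simp), Or.inr (by simp),
        Or.inl ⟨rfl, pairColour_cases _ _⟩⟩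
    · refine ⟨v', by simp, _, before_headD hc'' hfar', ?_, Or.inr ⟨rfl, evenColour_even _ _⟩⟩
      rcases l with _ | ⟨v'', l⟩
      · exact Or.inl rfl
      · exact Or.inr (by simp)
    · obtain ⟨x, hx, y, h1, h2, h3⟩ := mem_colouredRest hc'' hfar' he
      refine ⟨x, by simp [hx], y, h1, ?_, h3⟩
      rcases h2 with h2 | h2
      · exact Or.inl h2
      · exact Or.inr (by simp [h2])

/-- The edges of a cover: edges of the string, first edges of tails, and the other edges of tails. -/
theorem mem_colouredCover {r : ℕ} {s : ℕ → ℤˣ} {e : Edge × Colour} : ∀ {u w : ℕ} {L : List Node},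
    ValidNodes r u w L → (∀ x ∈ nodeVerts L, 1 ≤ x ∧ x ≤ r) → u ≤ r →
    e ∈ colouredCover r s u w L → ∃ x y, x ≠ y ∧ e.1.left = min x y ∧ e.1.right = max x y ∧
      x ≤ r + 1 ∧ y ≤ r + 1 ∧ 0 < e.1.weight ∧ (e.2 = .normal → Odd e.1.weight) ∧
      (e.2 = .red ∨ e.2 = .blue → Even e.1.weight) ∧
      ((e = (seg u (nextPos r L) w, .normal) ∧ x = u ∧ y = nextPos r L) ∨ x ∈ nodeVerts L)
  | u, w, [], h, hb, hu, he => by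
    simp only [colouredCover, Multiset.mem_singleton] at he
    subst he
    have := h.2
    refine ⟨u, r + 1, by omega, rfl, rfl, by omega, le_rfl, h.1.pos, fun _ => h.1, by simp,
      Or.inl ⟨rfl, rfl, rfl⟩⟩
  | u, w, nd :: L, ⟨hw, hnd, hL⟩, hb, hu, he => by
    have hb' : ∀ x ∈ nd.verts, 1 ≤ x ∧ x ≤ r := fun y hy => hb y (by
      rw [nodeVerts_cons, ← List.cons_append]; exact List.mem_append_left _ hy)
    have hbL : ∀ x ∈ nodeVerts L, 1 ≤ x ∧ x ≤ r := fun y hy => hb y (by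
      rw [nodeVerts_cons, ← List.cons_append]; exact List.mem_append_right _ hy)
    have hfar := Node.far_before hb'
    have hfarle : nd.far r ≤ r + 1 := by unfold Node.far; split_ifs <;> omega
    have hpos := hb' nd.pos (by simp [Node.verts])
    have hle : ∀ y, y = nd.far r ∨ y ∈ nd.inner → y ≤ r + 1 := by
      rintro y (rfl | hy)
      · exact hfarle
      · have := hb' y (by simp [Node.verts, hy])
        omega
    rw [colouredCover, Multiset.mem_cons, Multiset.mem_add] at he
    rcases he with rfl | he | he
    · refine ⟨u, nd.pos, ?_, rfl, rfl, by omega, by omega, hw.pos, fun _ => hw, by simp,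
        Or.inl ⟨rfl, rfl, rfl⟩⟩
      have := hnd.balance
      omega
    · rw [colouredTail, Multiset.mem_cons] at he
      rcases he with rfl | he
      · refine ⟨nd.pos, nd.inner.headD (nd.far r), (before_headD hnd.chain hfar).ne, rfl, rfl,
          by omega, hle _ ?_, hnd.pos, ?_, fun _ => hnd.even, Or.inr (by simp [nodeVerts_cons])⟩
        · rcases hi : nd.inner with _ | ⟨v, l⟩
          · exact Or.inl rfl
          · exact Or.inr (by simp)
        · rcases tailColour_even (s nd.pos) u nd.pos (nextPos r L) with h | h <;> simp [h]
      · obtain ⟨x, hx, y, h1, h2, h3⟩ := mem_colouredRest hnd.chain hfar he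
        have hodd := hnd.half (List.ne_nil_of_mem hx)
        refine ⟨x, y, h1.ne, ?_, ?_, ?_, hle y h2, ?_, ?_, ?_,
          Or.inr (by simp [nodeVerts_cons, hx])⟩
        · rcases h3 with ⟨h3, -⟩ | ⟨h3, -⟩ <;> rw [h3] <;> rfl
        · rcases h3 with ⟨h3, -⟩ | ⟨h3, -⟩ <;> rw [h3] <;> rfl
        · exact hle x (Or.inr hx)
        · rcases h3 with ⟨h3, -⟩ | ⟨h3, -⟩ <;> rw [h3]
          · exact hodd.pos
          · exact hnd.pos
        · intro h4
          rcases h3 with ⟨h3, -⟩ | ⟨-, h3⟩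
          · rw [h3]; exact hodd
          · simp [h4] at h3
        · intro h4
          rcases h3 with ⟨-, h3⟩ | ⟨h3, -⟩
          · rcases h3 with h3 | h3 <;> simp [h3] at h4
          · rw [h3]; exact hnd.even
    · obtain ⟨x, y, h1, h2, h3, h4, h5, h6, h7, h8, h9⟩ := mem_colouredCover hL hbL hpos.2 he
      refine ⟨x, y, h1, h2, h3, h4, h5, h6, h7, h8, Or.inr ?_⟩
      rw [nodeVerts_cons, List.mem_cons, List.mem_append]
      rcases h9 with ⟨-, h9, -⟩ | h9
      · exact Or.inl h9
      · exact Or.inr (Or.inr h9)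

/-- The conditions on the nodes of a cover with `r` vertices whose string starts at `-∞` with the
weight `a`. -/
structure GoodNodes (r a : ℕ) (L : List Node) : Prop where
  valid : ValidNodes r 0 a L
  verts : (nodeVerts L : Multiset ℕ) = (Finset.Icc 1 r).val
  ne : L ≠ []

theorem GoodNodes.mem_verts {r a : ℕ} {L : List Node} (h : GoodNodes r a L) (x : ℕ) :
    x ∈ nodeVerts L ↔ 1 ≤ x ∧ x ≤ r := by
  rw [← Multiset.mem_coe, h.verts, Finset.mem_val, Finset.mem_Icc]

theorem GoodNodes.nodup {r a : ℕ} {L : List Node} (h : GoodNodes r a L) : (nodeVerts L).Nodup := by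
  rw [← Multiset.coe_nodup, h.verts]
  exact Finset.nodup _

theorem GoodNodes.goodCover {r a : ℕ} {L : List Node} (h : GoodNodes r a L) (s : ℕ → ℤˣ) :
    GoodCover r s (colouredCover r s 0 a L) := by
  have key := fun e he => mem_colouredCover (s := s) (e := e) h.valid
    (fun x hx => (h.mem_verts x).1 hx) (Nat.zero_le _) he
  refine ⟨fun e he => ?_, fun e he => ?_, fun e he => ?_, fun e he => ?_, fun e he => ?_,
    fun e he => ?_, fun v h1 h2 => ?_⟩
  · obtain ⟨x, y, h1, h2, h3, -⟩ := key e he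
    omega
  · obtain ⟨x, y, h1, h2, h3, h4, h5, -⟩ := key e he
    omega
  · obtain ⟨x, y, -, -, -, -, -, h1, -⟩ := key e he
    exact h1
  · obtain ⟨x, y, -, -, -, -, -, -, h1, -⟩ := key e he
    exact h1
  · obtain ⟨x, y, -, -, -, -, -, -, -, h1, -⟩ := key e he
    exact h1
  · obtain ⟨x, y, h1, h2, h3, -, -, -, -, -, h9⟩ := key e he
    have h4 : ∃ v, (v = x ∨ v = y) ∧ 1 ≤ v ∧ v ≤ r := by
      rcases h9 with ⟨-, -, h9⟩ | h9
      · refine ⟨y, Or.inr rfl, (h.mem_verts y).1 ?_⟩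
        cases L with
        | nil => exact absurd rfl h.ne
        | cons nd L => rw [h9]; simp [nextPos, nodeVerts_cons]
      · exact ⟨x, Or.inl rfl, (h.mem_verts x).1 h9⟩
    obtain ⟨v, h5, h6, h7⟩ := h4
    refine ⟨v, h6, h7, ?_⟩
    unfold Incident
    rw [h2, h3]
    omega
  · exact h.valid.vertexOK s h.nodup (fun x hx => (h.mem_verts x).1 hx)
      (by rw [h.mem_verts]; omega) ((h.mem_verts v).2 ⟨h1, h2⟩)

end NodeCovers


/-! ### Connectedness of tails, strings and covers. -/

section Connected

variable {V : Set ℕ} {A B : Multiset Edge}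

theorem EdgesConnected.symm_aux {e e' : Edge} (h : Relation.ReflTransGen
    (fun a b => a ∈ A ∧ b ∈ A ∧ ∃ v ∈ V, Incident v a ∧ Incident v b) e e') :
    Relation.ReflTransGen
      (fun a b => a ∈ A ∧ b ∈ A ∧ ∃ v ∈ V, Incident v a ∧ Incident v b) e' e := by
  induction h with
  | refl => exact .refl
  | tail _ h' ih =>
    obtain ⟨h1, h2, v, h3, h4, h5⟩ := h'
    exact .head ⟨h2, h1, v, h3, h5, h4⟩ ih

theorem EdgesConnected.add (hA : EdgesConnected V A) (hB : EdgesConnected V B) {a b : Edge}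
    (ha : a ∈ A) (hb : b ∈ B) {v : ℕ} (hv : v ∈ V) (hva : Incident v a) (hvb : Incident v b) :
    EdgesConnected V (A + B) := by
  have hA' : ∀ e ∈ A, ∀ e' ∈ A, Relation.ReflTransGen (fun a b => a ∈ A + B ∧ b ∈ A + B ∧
      ∃ v ∈ V, Incident v a ∧ Incident v b) e e' := fun e he e' he' =>
    Relation.ReflTransGen.mono (fun x y ⟨h1, h2, h3⟩ =>
      ⟨Multiset.mem_add.2 (Or.inl h1), Multiset.mem_add.2 (Or.inl h2), h3⟩) _ _ (hA e he e' he')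
  have hB' : ∀ e ∈ B, ∀ e' ∈ B, Relation.ReflTransGen (fun a b => a ∈ A + B ∧ b ∈ A + B ∧
      ∃ v ∈ V, Incident v a ∧ Incident v b) e e' := fun e he e' he' =>
    Relation.ReflTransGen.mono (fun x y ⟨h1, h2, h3⟩ =>
      ⟨Multiset.mem_add.2 (Or.inr h1), Multiset.mem_add.2 (Or.inr h2), h3⟩) _ _ (hB e he e' he')
  have hAB : ∀ e ∈ A, ∀ e' ∈ B, Relation.ReflTransGen (fun a b => a ∈ A + B ∧ b ∈ A + B ∧
      ∃ v ∈ V, Incident v a ∧ Incident v b) e e' := fun e he e' he' =>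
    ((hA' e he a ha).tail ⟨Multiset.mem_add.2 (Or.inl ha), Multiset.mem_add.2 (Or.inr hb), v, hv,
      hva, hvb⟩).trans (hB' b hb e' he')
  intro e he e' he'
  rcases Multiset.mem_add.1 he with he | he <;> rcases Multiset.mem_add.1 he' with he' | he'
  · exact hA' e he e' he'
  · exact hAB e he e' he'
  · exact EdgesConnected.symm_aux (hAB e' he' e he)
  · exact hB' e he e' he'

theorem edgesConnected_of_incident {v : ℕ} (hv : v ∈ V) (h : ∀ e ∈ A, Incident v e) :
    EdgesConnected V A := fun e he e' he' => .single ⟨he, he', v, hv, h e he, h e' he'⟩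

theorem edgesConnected_singleton (e : Edge) : EdgesConnected V {e} := by
  intro a ha b hb
  rw [Multiset.mem_singleton] at ha hb
  rw [ha, hb]

theorem exists_mem_tailEdges (far w u : ℕ) (l : List ℕ) :
    ∃ e ∈ tailEdges far w u l, Incident u e := by
  rcases l with _ | ⟨v, _ | ⟨v', l⟩⟩
  · exact ⟨seg u far w, by simp [tailEdges], incident_seg.2 (Or.inl rfl)⟩
  · exact ⟨seg u v w, by simp [tailEdges], incident_seg.2 (Or.inl rfl)⟩
  · exact ⟨seg u v w, by simp [tailEdges], incident_seg.2 (Or.inl rfl)⟩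

theorem edgesConnected_tailEdges (far w : ℕ) : ∀ (u : ℕ) (l : List ℕ), (∀ x ∈ l, x ∈ V) →
    EdgesConnected V (tailEdges far w u l)
  | u, [], _ => edgesConnected_singleton _
  | u, [v], h => edgesConnected_of_incident (h v (by simp)) (by
      simp [tailEdges, incident_seg])
  | u, v :: v' :: l, h => by
    obtain ⟨e, he, hv'⟩ := exists_mem_tailEdges far w v' l
    refine EdgesConnected.add (edgesConnected_of_incident (h v (by simp)) (by simp [incident_seg]))
      (edgesConnected_tailEdges far w v' l fun x hx => h x (by simp [hx]))
      (a := seg v v' (w / 2)) (by simp) he (h v' (by simp)) (incident_seg.2 (Or.inr rfl)) hv'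

/-- The string. -/
def stringEdges (r : ℕ) : ℕ → ℕ → List Node → Multiset Edge
  | u, w, [] => {seg u (r + 1) w}
  | u, w, nd :: L => seg u nd.pos w ::ₘ stringEdges r nd.pos nd.wt L

def Node.toTail (r : ℕ) (nd : Node) : Tail := ⟨nd.pos, nd.far r, nd.tw, nd.inner⟩

def tailsOf (r : ℕ) (L : List Node) : Multiset Tail := (L.map (Node.toTail r) : List Tail)

/-- The cover without colours. -/
def cover (r u w : ℕ) (L : List Node) : Multiset Edge :=
  stringEdges r u w L + ((tailsOf r L).map Tail.edges).sum

theorem cover_cons (r u w : ℕ) (nd : Node) (L : List Node) : cover r u w (nd :: L) =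
    {seg u nd.pos w} + tailEdges (nd.far r) nd.tw nd.pos nd.inner + cover r nd.pos nd.wt L := by
  simp only [cover, stringEdges, tailsOf, List.map_cons, ← Multiset.cons_coe, Multiset.map_cons,
    Multiset.sum_cons, Node.toTail, Tail.edges]
  rw [← Multiset.singleton_add]
  abel

theorem colouredCover_map (r : ℕ) (s : ℕ → ℤˣ) (u w : ℕ) (L : List Node) :
    (colouredCover r s u w L).map Prod.fst = cover r u w L := by
  induction L generalizing u w with
  | nil => simp [colouredCover, cover, stringEdges, tailsOf]
  | cons nd L ih =>
    rw [colouredCover, Multiset.map_cons, Multiset.map_add, colouredTail_map, ih, cover_cons,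
      ← Multiset.singleton_add, add_assoc]

theorem exists_mem_stringEdges (r u w : ℕ) (L : List Node) :
    ∃ e ∈ stringEdges r u w L, Incident u e := by
  cases L with
  | nil => exact ⟨seg u (r + 1) w, by simp [stringEdges], incident_seg.2 (Or.inl rfl)⟩
  | cons nd L => exact ⟨seg u nd.pos w, by simp [stringEdges], incident_seg.2 (Or.inl rfl)⟩

theorem edgesConnected_stringEdges (r : ℕ) : ∀ (u w : ℕ) (L : List Node), (∀ nd ∈ L, nd.pos ∈ V) →
    EdgesConnected V (stringEdges r u w L)
  | u, w, [], _ => edgesConnected_singleton _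
  | u, w, nd :: L, h => by
    obtain ⟨e, he, hv⟩ := exists_mem_stringEdges r nd.pos nd.wt L
    rw [stringEdges, ← Multiset.singleton_add]
    exact EdgesConnected.add (edgesConnected_singleton _)
      (edgesConnected_stringEdges r nd.pos nd.wt L fun x hx => h x (by simp [hx]))
      (Multiset.mem_singleton_self _) he (h nd (by simp)) (incident_seg.2 (Or.inr rfl)) hv

theorem edgesConnected_cover (r : ℕ) : ∀ (u w : ℕ) (L : List Node), (∀ x ∈ nodeVerts L, x ∈ V) →
    EdgesConnected V (cover r u w L)
  | u, w, [], _ => by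
    have : cover r u w [] = {seg u (r + 1) w} := by simp [cover, stringEdges, tailsOf]
    rw [this]
    exact edgesConnected_singleton _
  | u, w, nd :: L, h => by
    obtain ⟨e, he, hv⟩ := exists_mem_stringEdges r nd.pos nd.wt L
    obtain ⟨e', he', hv'⟩ := exists_mem_tailEdges (nd.far r) nd.tw nd.pos nd.inner
    rw [cover_cons]
    have hp : nd.pos ∈ V := h _ (by simp [nodeVerts_cons])
    refine EdgesConnected.add (EdgesConnected.add (edgesConnected_singleton _)
      (edgesConnected_tailEdges _ _ _ _ fun x hx => h x (by simp [nodeVerts_cons, hx]))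
      (Multiset.mem_singleton_self _) he' hp (incident_seg.2 (Or.inr rfl)) hv')
      (edgesConnected_cover r nd.pos nd.wt L fun x hx => h x (by simp [nodeVerts_cons, hx]))
      (a := e') ?_ (Multiset.mem_add.2 (Or.inl he)) hp hv' hv
    exact Multiset.mem_add.2 (Or.inr he')

end Connected

/-! ### The covers are zigzag covers. -/

section Zigzag

theorem pos_mem_nodeVerts {L : List Node} {nd : Node} (h : nd ∈ L) : nd.pos ∈ nodeVerts L :=
  List.mem_flatMap.2 ⟨nd, h, by simp [Node.verts]⟩

theorem inner_mem_nodeVerts {L : List Node} {nd : Node} (h : nd ∈ L) {x : ℕ} (hx : x ∈ nd.inner) :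
    x ∈ nodeVerts L :=
  List.mem_flatMap.2 ⟨nd, h, by simp [Node.verts, hx]⟩

theorem incident_stringEdges {r : ℕ} {e : Edge} {x : ℕ} : ∀ {u w : ℕ} {L : List Node},
    e ∈ stringEdges r u w L → Incident x e → x = u ∨ x = r + 1 ∨ x ∈ L.map Node.pos
  | u, w, [], he, hx => by
    rw [stringEdges, Multiset.mem_singleton] at he
    rw [he, incident_seg] at hx
    tauto
  | u, w, nd :: L, he, hx => by
    rw [stringEdges, Multiset.mem_cons] at he
    rw [List.map_cons, List.mem_cons]
    rcases he with rfl | he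
    · rw [incident_seg] at hx
      tauto
    · have := incident_stringEdges he hx
      tauto

theorem ValidNodes.odd_stringEdges {r : ℕ} {e : Edge} : ∀ {u w : ℕ} {L : List Node},
    ValidNodes r u w L → e ∈ stringEdges r u w L → Odd e.weight
  | u, w, [], h, he => by
    rw [stringEdges, Multiset.mem_singleton] at he
    rw [he]; exact h.1
  | u, w, nd :: L, h, he => by
    rw [stringEdges, Multiset.mem_cons] at he
    rcases he with rfl | he
    · exact h.1
    · exact h.2.2.odd_stringEdges he

theorem ValidNodes.nodeOK {r : ℕ} {nd : Node} : ∀ {u w : ℕ} {L : List Node},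
    ValidNodes r u w L → nd ∈ L → ∃ u z w, NodeOK u z w nd
  | u, w, [], h, he => by simp at he
  | u, w, nd' :: L, h, he => by
    rcases List.mem_cons.1 he with rfl | he
    · exact ⟨_, _, _, h.2.1⟩
    · exact h.2.2.nodeOK he

theorem card_filter_stringEdges {r x : ℕ} (hx : x ≠ r + 1) : ∀ {u w : ℕ} {L : List Node},
    u ∉ L.map Node.pos → (L.map Node.pos).Nodup →
    ((stringEdges r u w L).filter fun e => Incident x e).card =
      (if x = u then 1 else 0) + (if x ∈ L.map Node.pos then 2 else 0)
  | u, w, [], _, _ => by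
    rw [stringEdges, Multiset.filter_singleton]
    by_cases h : x = u
    · rw [if_pos (incident_seg.2 (Or.inl h))]
      simp [h]
    · rw [if_neg (by rw [incident_seg]; tauto)]
      simp [h]
  | u, w, nd :: L, hu, hn => by
    rw [List.map_cons, List.nodup_cons] at hn
    rw [List.map_cons, List.mem_cons] at hu
    push Not at hu
    rw [stringEdges, Multiset.filter_cons, Multiset.card_add,
      card_filter_stringEdges hx hn.1 hn.2, List.map_cons]
    by_cases h1 : x = u
    · subst h1
      rw [if_pos (incident_seg.2 (Or.inl rfl))]
      simp [hu.1, hu.2]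
    · by_cases h2 : x = nd.pos
      · subst h2
        rw [if_pos (incident_seg.2 (Or.inr rfl))]
        simp [h1, hn.1]
      · rw [if_neg (by rw [incident_seg]; tauto)]
        simp [h1, h2]

theorem nodup_stringEdges {r : ℕ} : ∀ {u w : ℕ} {L : List Node}, u ∉ L.map Node.pos → u ≠ r + 1 →
    (L.map Node.pos).Nodup → (∀ nd ∈ L, nd.pos ≠ r + 1) → (stringEdges r u w L).Nodup
  | u, w, [], _, _, _, _ => Multiset.nodup_singleton _
  | u, w, nd :: L, hu, hur, hn, hr => by
    rw [List.map_cons, List.nodup_cons] at hn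
    rw [List.map_cons, List.mem_cons] at hu
    rw [stringEdges, Multiset.nodup_cons]
    refine ⟨fun h => ?_, nodup_stringEdges hn.1 (hr nd (by simp)) hn.2 fun nd' h => hr nd' (by simp [h])⟩
    have := incident_stringEdges h (x := u) (incident_seg.2 (Or.inl rfl))
    tauto

theorem mem_tailEdges {far w : ℕ} (hw : Even w) {e : Edge} : ∀ {u : ℕ} {l : List ℕ},
    e ∈ tailEdges far w u l → Even e.weight ∨ ∃ x ∈ l, Incident x e
  | u, [], he => by
    rw [tailEdges, Multiset.mem_singleton] at he
    rw [he]; exact Or.inl hw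
  | u, [v], he => by
    simp only [tailEdges, Multiset.insert_eq_cons, Multiset.mem_cons, Multiset.mem_singleton] at he
    rcases he with rfl | rfl | rfl
    · exact Or.inl hw
    · exact Or.inr ⟨v, by simp, incident_seg.2 (Or.inl rfl)⟩
    · exact Or.inr ⟨v, by simp, incident_seg.2 (Or.inl rfl)⟩
  | u, v :: v' :: l, he => by
    simp only [tailEdges, Multiset.insert_eq_cons, Multiset.mem_add, Multiset.mem_cons,
      Multiset.mem_singleton] at he
    rcases he with (rfl | rfl | rfl) | he
    · exact Or.inl hw
    · exact Or.inr ⟨v, by simp, incident_seg.2 (Or.inl rfl)⟩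
    · exact Or.inr ⟨v, by simp, incident_seg.2 (Or.inl rfl)⟩
    · rcases mem_tailEdges hw he with h | ⟨x, hx, h⟩
      · exact Or.inl h
      · exact Or.inr ⟨x, by simp [hx], h⟩

theorem nodup_pos {L : List Node} (h : (nodeVerts L).Nodup) : (L.map Node.pos).Nodup := by
  induction L with
  | nil => simp
  | cons nd L ih =>
    rw [nodeVerts_cons, List.nodup_cons, List.mem_append, List.nodup_append] at h
    rw [List.map_cons, List.nodup_cons]
    refine ⟨fun h' => h.1 (Or.inr ?_), ih h.2.2.1⟩
    obtain ⟨nd', h1, h2⟩ := List.mem_map.1 h'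
    rw [← h2]
    exact pos_mem_nodeVerts h1

theorem pos_not_mem_inner {L : List Node} (h : (nodeVerts L).Nodup) {nd nd' : Node} (hnd : nd ∈ L)
    (hnd' : nd' ∈ L) : nd.pos ∉ nd'.inner := by
  induction L with
  | nil => simp at hnd
  | cons nd₀ L ih =>
    rw [nodeVerts_cons, List.nodup_cons, List.mem_append, List.nodup_append] at h
    intro hx
    rcases List.mem_cons.1 hnd with h1 | h1 <;> rcases List.mem_cons.1 hnd' with h2 | h2
    · rw [h1, h2] at hx
      exact h.1 (Or.inl hx)
    · rw [h1] at hx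
      exact h.1 (Or.inr (inner_mem_nodeVerts h2 hx))
    · rw [h2] at hx
      exact h.2.2.2 _ hx _ (pos_mem_nodeVerts h1) rfl
    · exact ih h.2.2.1 h1 h2 hx

theorem mem_multiset_sum {α : Type*} {x : α} {B : Multiset (Multiset α)} :
    x ∈ B.sum ↔ ∃ A ∈ B, x ∈ A := by
  induction B using Multiset.induction_on with
  | empty => simp
  | cons A B ih => simp [ih]

theorem exists_mem_stringEdges_pos {r u w : ℕ} {L : List Node} {nd : Node} (h : nd ∈ L) :
    ∃ e ∈ stringEdges r u w L, Incident nd.pos e := by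
  induction L generalizing u w with
  | nil => simp at h
  | cons nd' L ih =>
    rw [stringEdges]
    rcases List.mem_cons.1 h with rfl | h
    · exact ⟨_, Multiset.mem_cons_self _ _, incident_seg.2 (Or.inr rfl)⟩
    · obtain ⟨e, he, hv⟩ := ih (u := nd'.pos) (w := nd'.wt) h
      exact ⟨e, Multiset.mem_cons_of_mem he, hv⟩

variable {r a : ℕ} {L : List Node}

theorem GoodNodes.bounds (h : GoodNodes r a L) {nd : Node} (hnd : nd ∈ L) : 1 ≤ nd.pos ∧ nd.pos ≤ r :=
  (h.mem_verts _).1 (pos_mem_nodeVerts hnd)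

theorem GoodNodes.zero_notMem (h : GoodNodes r a L) : 0 ∉ L.map Node.pos := by
  intro h'
  obtain ⟨nd, h1, h2⟩ := List.mem_map.1 h'
  have := h.bounds h1
  omega

/-- A string edge is odd and visits only string vertices and the infinite points, whereas an edge of
a tail is even or touches an inner vertex of the tail. So the string shares no edge with the tails
and has no repeated edge itself. -/
theorem GoodNodes.isZigzagWith (h : GoodNodes r a L) :
    IsZigzagWith r (cover r 0 a L) (stringEdges r 0 a L) (tailsOf r L) where
  string := by
    refine ⟨?_, fun v h1 h2 => ?_, edgesConnected_stringEdges r 0 a L fun nd hnd => h.bounds hnd⟩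
    · obtain ⟨e, he, -⟩ := exists_mem_stringEdges r 0 a L
      intro h0
      rw [h0] at he
      simp at he
    · rw [card_filter_stringEdges (by omega) h.zero_notMem (nodup_pos h.nodup), if_neg (by omega)]
      split_ifs <;> simp
  odd e he := h.valid.odd_stringEdges he
  notSymmetric e he := by
    have hodd := h.valid.odd_stringEdges he
    rw [cover, Multiset.count_add, Multiset.count_eq_one_of_mem
      (nodup_stringEdges h.zero_notMem (by omega) (nodup_pos h.nodup) fun nd hnd => by
        have := h.bounds hnd
        omega) he, Multiset.count_eq_zero_of_notMem]
    intro hmem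
    obtain ⟨B, hB, heB⟩ := mem_multiset_sum.1 hmem
    obtain ⟨t, ht, rfl⟩ := Multiset.mem_map.1 hB
    obtain ⟨nd, hnd, rfl⟩ := List.mem_map.1 (Multiset.mem_coe.1 ht)
    obtain ⟨_, _, _, hok⟩ := h.valid.nodeOK hnd
    rcases mem_tailEdges hok.even heB with h1 | ⟨x, hx, hxe⟩
    · exact (Nat.not_even_iff_odd.2 hodd) h1
    · have hxb := (h.mem_verts x).1 (inner_mem_nodeVerts hnd hx)
      rcases incident_stringEdges he hxe with h2 | h2 | h2
      · omega
      · omega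
      · obtain ⟨nd', hnd', rfl⟩ := List.mem_map.1 h2
        exact pos_not_mem_inner h.nodup hnd' hnd hx
  decomposition := rfl
  tail t ht := by
    obtain ⟨nd, hnd, rfl⟩ := List.mem_map.1 (Multiset.mem_coe.1 ht)
    obtain ⟨_, _, _, hok⟩ := h.valid.nodeOK hnd
    have := h.bounds hnd
    refine ⟨⟨?_, hok.even, hok.half, fun v hv => (h.mem_verts v).1 (inner_mem_nodeVerts hnd hv)⟩,
      this.1, this.2, exists_mem_stringEdges_pos hnd⟩
    simp only [Node.toTail, Node.far]
    split_ifs <;> simp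

end Zigzag

/-! ### Ends, number of edges and genus. -/

section Ends

/-- The weights of the ends of a tail. -/
def Node.ends (nd : Node) : Multiset ℕ :=
  if Even nd.inner.length then {nd.tw} else {nd.tw / 2, nd.tw / 2}

def lastWt : ℕ → List Node → ℕ
  | w, [] => w
  | _, nd :: L => lastWt nd.wt L

theorem filter_tailEdges_eq_zero {far w x : ℕ} (hx : x ≠ far) : ∀ {u : ℕ} {l : List ℕ}, x ∉ u :: l →
    (tailEdges far w u l).filter (fun e => Incident x e) = 0
  | u, [], h => by
    simp only [List.mem_cons, List.not_mem_nil, or_false] at h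
    simp [tailEdges, Multiset.filter_singleton, incident_seg, h, hx]
  | u, [v], h => by
    simp only [List.mem_cons, List.not_mem_nil, or_false, not_or] at h
    simp [tailEdges, Multiset.filter_singleton, incident_seg, h.1, h.2, hx]
  | u, v :: v' :: l, h => by
    have h' : x ∉ v' :: l := fun h' => h (by simp only [List.mem_cons] at h' ⊢; tauto)
    simp only [List.mem_cons, not_or] at h
    rw [tailEdges, Multiset.filter_add, filter_tailEdges_eq_zero hx h']
    simp [Multiset.filter_singleton, incident_seg, h.1, h.2]

theorem filter_tailEdges_far {far w : ℕ} : ∀ {u : ℕ} {l : List ℕ}, far ∉ u :: l →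
    ((tailEdges far w u l).filter (fun e => Incident far e)).map Edge.weight =
      if Even l.length then {w} else {w / 2, w / 2}
  | u, [], h => by
    have h1 : Incident far (seg u far w) := incident_seg.2 (Or.inr rfl)
    simp only [tailEdges, Multiset.filter_singleton, if_pos h1, Multiset.map_singleton]
    rfl
  | u, [v], h => by
    simp only [List.mem_cons, List.not_mem_nil, or_false, not_or] at h
    have h0 : ¬ Incident far (seg u v w) := by rw [incident_seg]; tauto
    have h1 : Incident far (seg v far (w / 2)) := incident_seg.2 (Or.inr rfl)
    simp only [tailEdges, Multiset.insert_eq_cons, Multiset.filter_cons_of_neg _ h0,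
      Multiset.filter_cons_of_pos _ h1, Multiset.filter_singleton, if_pos h1, Multiset.map_cons,
      Multiset.map_singleton]
    rfl
  | u, v :: v' :: l, h => by
    have h' : far ∉ v' :: l := fun h' => h (by simp only [List.mem_cons] at h' ⊢; tauto)
    simp only [List.mem_cons, not_or] at h
    rw [tailEdges, Multiset.filter_add, Multiset.map_add, filter_tailEdges_far h']
    simp [Multiset.filter_singleton, incident_seg, h.1, h.2, Nat.even_add_one]

theorem card_tailEdges (far w : ℕ) : ∀ (u : ℕ) (l : List ℕ), (tailEdges far w u l).card =
    l.length / 2 + l.length + Multiset.card (if Even l.length then {w} else {w / 2, w / 2})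
  | u, [] => by simp [tailEdges]
  | u, [v] => by simp [tailEdges]
  | u, v :: v' :: l => by
    rw [tailEdges, Multiset.card_add, card_tailEdges far w v' l]
    have h2 : Even (v :: v' :: l).length ↔ Even l.length := by simp [Nat.even_add_one]
    rw [if_congr h2 rfl rfl]
    simp only [Multiset.insert_eq_cons, Multiset.card_cons, Multiset.card_singleton, List.length_cons]
    omega

theorem filter_stringEdges_last {r : ℕ} : ∀ {u w : ℕ} {L : List Node}, u ≠ r + 1 →
    (∀ nd ∈ L, nd.pos ≠ r + 1) →
    ((stringEdges r u w L).filter fun e => Incident (r + 1) e).map Edge.weight = {lastWt w L}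
  | u, w, [], hu, h => by
    have h1 : Incident (r + 1) (seg u (r + 1) w) := incident_seg.2 (Or.inr rfl)
    simp only [stringEdges, Multiset.filter_singleton, if_pos h1, Multiset.map_singleton, lastWt]
    rfl
  | u, w, nd :: L, hu, h => by
    have h1 := h nd (by simp)
    have h2 : ¬ Incident (r + 1) (seg u nd.pos w) := by rw [incident_seg]; tauto
    rw [stringEdges, Multiset.filter_cons_of_neg _ h2,
      filter_stringEdges_last h1 fun nd' h' => h nd' (by simp [h']), lastWt]

theorem filter_stringEdges_eq_zero {r : ℕ} : ∀ {u w : ℕ} {L : List Node}, u ≠ 0 →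
    (∀ nd ∈ L, nd.pos ≠ 0) → (stringEdges r u w L).filter (fun e => Incident 0 e) = 0
  | u, w, [], hu, h => by
    simp [stringEdges, Multiset.filter_singleton, incident_seg, hu.symm]
  | u, w, nd :: L, hu, h => by
    have h1 := h nd (by simp)
    have h2 : ¬ Incident 0 (seg u nd.pos w) := by rw [incident_seg]; tauto
    rw [stringEdges, Multiset.filter_cons_of_neg _ h2,
      filter_stringEdges_eq_zero h1 fun nd' h' => h nd' (by simp [h'])]

theorem filter_tails {r x : ℕ} {b : Bool} : ∀ {L : List Node},
    (∀ nd ∈ L, x ∉ nd.verts) → (∀ nd ∈ L, x = nd.far r ↔ nd.out = b) →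
    ((((tailsOf r L).map Tail.edges).sum).filter fun e => Incident x e).map Edge.weight =
      (L.map fun nd => if nd.out = b then nd.ends else 0).sum
  | [], _, _ => by simp [tailsOf]
  | nd :: L, h, hf => by
    have ih := filter_tails (r := r) (x := x) (b := b) (L := L) (fun nd' h' => h nd' (by simp [h']))
      (fun nd' h' => hf nd' (by simp [h']))
    have h1 := h nd (by simp)
    have h2 := hf nd (by simp)
    simp only [tailsOf, List.map_cons, ← Multiset.cons_coe, Multiset.map_cons, Multiset.sum_cons,
      List.sum_cons, Multiset.filter_add, Multiset.map_add] at ih ⊢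
    rw [ih]
    congr 1
    by_cases hb : nd.out = b
    · rw [if_pos hb]
      have h3 := h2.2 hb
      simp only [Node.toTail, Tail.edges, Node.ends]
      rw [← h3]
      exact filter_tailEdges_far h1
    · rw [if_neg hb]
      have h3 := mt h2.1 hb
      simp only [Node.toTail, Tail.edges]
      rw [filter_tailEdges_eq_zero h3 h1, Multiset.map_zero]

variable {r a : ℕ} {L : List Node}

theorem GoodNodes.edges (h : GoodNodes r a L) {e : Edge} (he : e ∈ cover r 0 a L) :
    e.left < e.right ∧ e.right ≤ r + 1 := by
  rw [← colouredCover_map r (fun _ => 1)] at he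
  obtain ⟨e, he', rfl⟩ := Multiset.mem_map.1 he
  exact ⟨(h.goodCover _).lt e he', (h.goodCover _).le e he'⟩

theorem GoodNodes.left_ends (h : GoodNodes r a L) :
    ((cover r 0 a L).filter fun e => e.left = 0).map Edge.weight =
      a ::ₘ (L.map fun nd => if nd.out = false then nd.ends else 0).sum := by
  have h1 : (cover r 0 a L).filter (fun e => e.left = 0) =
      (cover r 0 a L).filter (fun e => Incident 0 e) := by
    refine Multiset.filter_congr fun e he => ?_
    have := h.edges he
    unfold Incident
    omega
  rw [h1, cover, Multiset.filter_add, Multiset.map_add, filter_tails (b := false)]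
  · have h2 : ((stringEdges r 0 a L).filter fun e => Incident 0 e).map Edge.weight = {a} := by
      cases hL : L with
      | nil => exact absurd hL h.ne
      | cons nd L' =>
        have h3 : Incident 0 (seg 0 nd.pos a) := incident_seg.2 (Or.inl rfl)
        have h4 : ∀ nd' ∈ L, nd'.pos ≠ 0 := fun nd' h' => by have := h.bounds h'; omega
        rw [stringEdges, Multiset.filter_cons_of_pos _ h3, filter_stringEdges_eq_zero
          (h4 nd (by simp [hL])) fun nd' h' => h4 nd' (by simp [hL, h'])]
        rfl
    rw [h2, Multiset.singleton_add]
  · intro nd hnd hx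
    have := (h.mem_verts 0).1 (List.mem_flatMap.2 ⟨nd, hnd, hx⟩)
    omega
  · intro nd hnd
    unfold Node.far
    cases nd.out <;> simp

theorem GoodNodes.right_ends (h : GoodNodes r a L) :
    ((cover r 0 a L).filter fun e => e.right = r + 1).map Edge.weight =
      lastWt a L ::ₘ (L.map fun nd => if nd.out = true then nd.ends else 0).sum := by
  have h1 : (cover r 0 a L).filter (fun e => e.right = r + 1) =
      (cover r 0 a L).filter (fun e => Incident (r + 1) e) := by
    refine Multiset.filter_congr fun e he => ?_
    have := h.edges he
    unfold Incident
    omega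
  rw [h1, cover, Multiset.filter_add, Multiset.map_add, filter_tails (b := true),
    filter_stringEdges_last (by omega) fun nd hnd => by have := h.bounds hnd; omega,
    Multiset.singleton_add]
  · intro nd hnd hx
    have := (h.mem_verts _).1 (List.mem_flatMap.2 ⟨nd, hnd, hx⟩)
    omega
  · intro nd hnd
    unfold Node.far
    cases nd.out <;> simp

/-- Cutting at the vertices, a tail with l inner vertices has ⌊l/2⌋ symmetric cycles, each of which
contributes one additional edge and thereby one to the genus. A fork shows up in the number of ends
instead. -/
theorem card_cover (r : ℕ) : ∀ (u w : ℕ) (L : List Node), (cover r u w L).card =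
    1 + (nodeVerts L).length + (L.map fun nd => nd.inner.length / 2).sum +
      (L.map fun nd => nd.ends.card).sum
  | u, w, [] => by simp [cover, stringEdges, tailsOf, nodeVerts]
  | u, w, nd :: L => by
    rw [cover_cons, Multiset.card_add, Multiset.card_add, card_tailEdges, card_cover r nd.pos nd.wt L,
      nodeVerts_cons]
    simp only [Multiset.card_singleton, List.length_cons, List.length_append, List.map_cons,
      List.sum_cons, Node.ends]
    omega

theorem GoodNodes.isCoverOfType (h : GoodNodes r a L) {g n : ℕ} {lam mu : n.Partition}
    (hr : numBranch g lam mu = r)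
    (hlam : a ::ₘ (L.map fun nd => if nd.out = false then nd.ends else 0).sum = lam.parts)
    (hmu : lastWt a L ::ₘ (L.map fun nd => if nd.out = true then nd.ends else 0).sum = mu.parts)
    (hg : (L.map fun nd => nd.inner.length / 2).sum = g) :
    IsCoverOfType g lam mu (cover r 0 a L) := by
  subst hr
  have hr0 : 0 < numBranch g lam mu := by
    obtain ⟨nd, hnd⟩ := List.exists_mem_of_ne_nil _ h.ne
    have := h.bounds hnd
    omega
  refine ⟨?_, h.left_ends.trans hlam, h.right_ends.trans hmu, ?_⟩
  · rw [← colouredCover_map _ (fun _ => 1)]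
    refine (h.goodCover _).isTropicalCover hr0 ?_
    rw [colouredCover_map]
    exact edgesConnected_cover _ _ _ _ fun x hx => (h.mem_verts x).1 hx
  · rw [card_cover, hg, ← hlam, ← hmu]
    have h1 : (nodeVerts L).length = numBranch g lam mu := by
      have := congrArg Multiset.card h.verts
      simpa using this
    have h2 : ∀ L : List Node, (L.map fun nd : Node => nd.ends.card).sum =
        (L.map fun nd : Node => if nd.out = false then nd.ends else 0).sum.card +
          (L.map fun nd : Node => if nd.out = true then nd.ends else 0).sum.card := by
      intro L
      induction L with
      | nil => rfl
      | cons nd L ih =>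
        simp only [List.map_cons, List.sum_cons, Multiset.card_add, ih]
        cases nd.out <;> simp <;> omega
    rw [h1, h2, Multiset.card_cons, Multiset.card_cons]
    omega

end Ends


/-! ### Active vertices of a list of nodes, and the multiplicity of its cover. -/

section Active

/-- The last point of a string that starts at `u`. -/
def lastPos : ℕ → List Node → ℕ
  | u, [] => u
  | _, nd :: L => lastPos nd.pos L

theorem lastWt_append (w : ℕ) (L L' : List Node) :
    lastWt w (L ++ L') = lastWt (lastWt w L) L' := by
  induction L generalizing w with
  | nil => rfl
  | cons nd L ih => exact ih _

theorem lastPos_append_singleton (u : ℕ) (L : List Node) (nd : Node) :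
    lastPos u (L ++ [nd]) = nd.pos := by
  induction L generalizing u with
  | nil => rfl
  | cons nd' L ih => exact ih _

theorem nodeVerts_append (L L' : List Node) : nodeVerts (L ++ L') = nodeVerts L ++ nodeVerts L' :=
  List.flatMap_append

theorem colouredCover_append (r : ℕ) (s : ℕ → ℤˣ) (L' : List Node) : ∀ (u w : ℕ) (L : List Node),
    ∃ A, colouredCover r s u w (L ++ L') = A + colouredCover r s (lastPos u L) (lastWt w L) L' ∧
      ∀ e ∈ A, ∀ x, Incident x e.1 → x = u ∨ x = 0 ∨ x = r + 1 ∨ x ∈ nodeVerts L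
  | u, w, [] => ⟨0, by simp [lastPos, lastWt], by simp⟩
  | u, w, nd :: L => by
    obtain ⟨A, hA, hA'⟩ := colouredCover_append r s L' nd.pos nd.wt L
    refine ⟨(seg u nd.pos w, .normal) ::ₘ
      (colouredTail (nd.far r) nd.tw s (tailColour (s nd.pos) u nd.pos (nextPos r (L ++ L'))) nd.pos
        nd.inner + A), ?_, fun e he x hx => ?_⟩
    · rw [List.cons_append, colouredCover, hA, Multiset.cons_add, add_assoc]
      rfl
    · rw [nodeVerts_cons, List.mem_cons, List.mem_append]
      rw [Multiset.mem_cons, Multiset.mem_add] at he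
      rcases he with rfl | he | he
      · rw [incident_seg] at hx
        tauto
      · rcases incident_colouredTail he hx with h | h | h
        · unfold Node.far at h
          split_ifs at h <;> tauto
        · tauto
        · tauto
      · rcases hA' e he x hx with h | h | h | h <;> tauto

variable {r a : ℕ} {s : ℕ → ℤˣ}

/-- The edges at a vertex of the string whose tail is an end. -/
theorem GoodNodes.filter_incident {L₁ L₂ : List Node} {nd : Node}
    (h : GoodNodes r a (L₁ ++ nd :: L₂)) (hi : nd.inner = []) :
    ∃ c, (c = Colour.red ∨ c = Colour.blue) ∧
      (colouredCover r s 0 a (L₁ ++ nd :: L₂)).filter (fun e => Incident nd.pos e.1) =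
        {(seg (lastPos 0 L₁) nd.pos (lastWt a L₁), .normal), (seg nd.pos (nd.far r) nd.tw, c),
          (seg nd.pos (nextPos r L₂) nd.wt, .normal)} := by
  obtain ⟨A, hA, hA'⟩ := colouredCover_append r s (nd :: L₂) 0 a L₁
  obtain ⟨B, hB, hB'⟩ := colouredCover_eq_cons r s nd.pos nd.wt L₂
  have hn := h.nodup
  rw [nodeVerts_append, List.nodup_append, nodeVerts_cons, List.nodup_cons, hi, List.nil_append] at hn
  have hb : 1 ≤ nd.pos ∧ nd.pos ≤ r := h.bounds (by simp)
  refine ⟨_, tailColour_even (s nd.pos) (lastPos 0 L₁) nd.pos (nextPos r L₂), ?_⟩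
  have h1 : A.filter (fun e => Incident nd.pos e.1) = 0 := by
    refine Multiset.filter_eq_nil.2 fun e he hx => ?_
    rcases hA' e he _ hx with h2 | h2 | h2 | h2
    · omega
    · omega
    · omega
    · exact hn.2.2 _ h2 nd.pos (by simp) rfl
  have h2 : B.filter (fun e => Incident nd.pos e.1) = 0 := by
    refine Multiset.filter_eq_nil.2 fun e he hx => ?_
    rcases hB' e he _ hx with h2 | h2 | h2
    · omega
    · omega
    · exact hn.2.1.1 h2
  rw [hA, Multiset.filter_add, h1, zero_add, colouredCover, hB, hi, colouredTail, colouredRest,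
    Multiset.filter_cons_of_pos, Multiset.filter_add, Multiset.filter_cons_of_pos,
    Multiset.filter_cons_of_pos, h2]
  · rfl
  · exact incident_seg.2 (Or.inl rfl)
  · exact incident_seg.2 (Or.inl rfl)
  · exact incident_seg.2 (Or.inr rfl)

theorem filter_right_eq (R : Multiset (Edge × Colour)) (v : ℕ) : R.filter (fun e => e.1.right = v) =
    (R.filter fun e => Incident v e.1).filter fun e => e.1.right = v := by
  rw [Multiset.filter_filter]
  exact Multiset.filter_congr fun e _ => ⟨fun h => ⟨h, Or.inr h⟩, fun h => h.1⟩

/-- A vertex of the string to which only an in-end leads. -/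
def Single (u : ℕ) (nd : Node) : Prop :=
  nd.inner = [] ∧ ((u = 0 ∧ nd.out = true) ∨ (nd.pos < u ∧ nd.out = false))

theorem GoodNodes.filter_single {L₁ L₂ : List Node} {nd : Node}
    (h : GoodNodes r a (L₁ ++ nd :: L₂)) (hs : Single (lastPos 0 L₁) nd)
    (hz : nd.pos < nextPos r L₂) :
    ∃ e, (colouredCover r s 0 a (L₁ ++ nd :: L₂)).filter (fun e => e.1.right = nd.pos) = {e} ∧
      e.1.left = 0 := by
  obtain ⟨c, -, hc⟩ := h.filter_incident (s := s) hs.1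
  have hb : 1 ≤ nd.pos ∧ nd.pos ≤ r := h.bounds (by simp)
  rw [filter_right_eq, hc, Node.far, seg_of_lt hz]
  rcases hs.2 with ⟨h1, h2⟩ | ⟨h1, h2⟩
  · rw [if_pos h2, h1, seg_of_lt (show 0 < nd.pos by omega), seg_of_lt (show nd.pos < r + 1 by omega)]
    refine ⟨(⟨0, nd.pos, lastWt a L₁⟩, .normal), ?_, rfl⟩
    have h3 : nd.pos ≠ r + 1 := by omega
    simp [Multiset.filter_singleton, hz.ne', h3.symm, Multiset.insert_eq_cons]
  · rw [if_neg (by simp [h2]), seg_of_gt h1, seg_of_gt (show 0 < nd.pos by omega)]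
    refine ⟨(⟨0, nd.pos, nd.tw⟩, c), ?_, rfl⟩
    simp [Multiset.filter_singleton, hz.ne', h1.ne', Multiset.insert_eq_cons]

theorem GoodNodes.filter_ascending {L₁ L₂ : List Node} {nd : Node}
    (h : GoodNodes r a (L₁ ++ nd :: L₂)) (hi : nd.inner = []) (ho : nd.out = true)
    (hu : lastPos 0 L₁ < nd.pos) (hz : nd.pos < nextPos r L₂) :
    (colouredCover r s 0 a (L₁ ++ nd :: L₂)).filter (fun e => e.1.right = nd.pos) =
      {(⟨lastPos 0 L₁, nd.pos, lastWt a L₁⟩, .normal)} := by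
  obtain ⟨c, -, hc⟩ := h.filter_incident (s := s) hi
  have hb : 1 ≤ nd.pos ∧ nd.pos ≤ r := h.bounds (by simp)
  have h3 : nd.pos ≠ r + 1 := by omega
  rw [filter_right_eq, hc, Node.far, seg_of_lt hz, if_pos ho, seg_of_lt hu,
    seg_of_lt (show nd.pos < r + 1 by omega)]
  simp [Multiset.filter_singleton, hz.ne', h3.symm, Multiset.insert_eq_cons]

theorem GoodNodes.filter_bend {L₁ L₂ : List Node} {nd : Node}
    (h : GoodNodes r a (L₁ ++ nd :: L₂)) (hi : nd.inner = []) (ho : nd.out = true)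
    (hu : lastPos 0 L₁ < nd.pos) (hz : nextPos r L₂ < nd.pos) :
    (colouredCover r s 0 a (L₁ ++ nd :: L₂)).filter (fun e => e.1.right = nd.pos) =
      {(⟨lastPos 0 L₁, nd.pos, lastWt a L₁⟩, .normal), (⟨nextPos r L₂, nd.pos, nd.wt⟩, .normal)} := by
  obtain ⟨c, -, hc⟩ := h.filter_incident (s := s) hi
  have hb : 1 ≤ nd.pos ∧ nd.pos ≤ r := h.bounds (by simp)
  have h3 : nd.pos ≠ r + 1 := by omega
  rw [filter_right_eq, hc, Node.far, seg_of_gt hz, if_pos ho, seg_of_lt hu,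
    seg_of_lt (show nd.pos < r + 1 by omega)]
  simp [Multiset.filter_singleton, h3.symm, Multiset.insert_eq_cons]

theorem GoodNodes.not_dotted {L₁ L₂ : List Node} {nd : Node}
    (h : GoodNodes r a (L₁ ++ nd :: L₂)) (hi : nd.inner = []) {e : Edge × Colour}
    (he : e ∈ colouredCover r s 0 a (L₁ ++ nd :: L₂)) (hv : Incident nd.pos e.1) :
    e.2 ≠ .dotted := by
  obtain ⟨c, hc', hc⟩ := h.filter_incident (s := s) hi
  have h1 : e ∈ (colouredCover r s 0 a (L₁ ++ nd :: L₂)).filter (fun e => Incident nd.pos e.1) :=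
    Multiset.mem_filter.2 ⟨he, hv⟩
  rw [hc] at h1
  simp only [Multiset.insert_eq_cons, Multiset.mem_cons, Multiset.mem_singleton] at h1
  rcases h1 with rfl | rfl | rfl
  · simp
  · rcases hc' with rfl | rfl <;> simp
  · simp

/-- The vertex `v` of the string is an active vertex; the string starts at `u`. -/
inductive NodeActive : ℕ → List Node → ℕ → Prop
  | freshIn {u : ℕ} {nd : Node} {L : List Node} (hi : nd.inner = []) (ho : nd.out = false) :
      NodeActive u (nd :: L) nd.pos
  | freshStart {nd : Node} {L : List Node} : NodeActive 0 (nd :: L) nd.pos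
  | once {u : ℕ} {nd nd' : Node} {L : List Node} (hs : Single u nd) (hp : nd'.pos = nd.pos + 1) :
      NodeActive u (nd :: nd' :: L) nd'.pos
  | twice {u : ℕ} {nd nd' nd'' nd₃ : Node} {L : List Node} (hs : Single u nd)
      (hi' : nd'.inner = []) (ho' : nd'.out = true) (hp' : nd'.pos = nd.pos + 1)
      (hi'' : nd''.inner = []) (ho'' : nd''.out = true) (hp'' : nd''.pos = nd.pos + 2)
      (hw : 3 ≤ nd.wt) (hl : nd₃.pos < nd''.pos) :
      NodeActive u (nd :: nd' :: nd'' :: nd₃ :: L) nd''.pos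
  | tail {u : ℕ} {nd : Node} {L : List Node} {v : ℕ} (h : NodeActive nd.pos L v) :
      NodeActive u (nd :: L) v

theorem EdgesOK.exists_graph_eq {R : Multiset (Edge × Colour)} (h : EdgesOK r R) {e : Edge × Colour}
    (he : e ∈ R) : ∃ j, h.graph.ed j = e.1 ∧ h.graph.col j = e.2 := by
  rw [← h.graph_map] at he
  obtain ⟨j, -, hj⟩ := Multiset.mem_map.1 he
  exact ⟨j, by rw [← hj], by rw [← hj]⟩

theorem EdgesOK.mem_of_graph {R : Multiset (Edge × Colour)} (h : EdgesOK r R) (j : R.ToType) :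
    (h.graph.ed j, h.graph.col j) ∈ R := by
  have h1 := Multiset.mem_map_of_mem (fun j => (h.graph.ed j, h.graph.col j))
    (Finset.mem_univ_val j)
  rwa [h.graph_map] at h1

theorem EdgesOK.exists_only {R : Multiset (Edge × Colour)} (h : EdgesOK r R) {v : ℕ}
    {e : Edge × Colour} (hf : R.filter (fun e => e.1.right = v) = {e}) :
    ∃ j, h.graph.ed j = e.1 ∧ h.graph.Only v j := by
  rw [← h.graph_map] at hf
  obtain ⟨j, hj, hj'⟩ := exists_of_filter_map_eq_singleton hf
  exact ⟨j, by rw [← hj], hj'⟩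

theorem string_mem_colouredCover (L₁ L₂ : List Node) :
    (seg (lastPos 0 L₁) (nextPos r L₂) (lastWt a L₁), Colour.normal) ∈
      colouredCover r s 0 a (L₁ ++ L₂) := by
  obtain ⟨A, hA, hA'⟩ := colouredCover_append r s L₂ 0 a L₁
  obtain ⟨B, hB, hB'⟩ := colouredCover_eq_cons r s (lastPos 0 L₁) (lastWt a L₁) L₂
  rw [hA, hB]
  simp

/-- The list is split at the nodes in question, where the edges at a vertex are known explicitly. In
the third and fourth case the string edge that arrives at the last vertex is the active edge. -/
theorem NodeActive.exists_active {u v : ℕ} {L : List Node} (hv : NodeActive u L v) :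
    ∀ {L₁ : List Node} (h : GoodNodes r a (L₁ ++ L)), lastPos 0 L₁ = u →
      ∃ j, (h.goodCover s).edgesOK.graph.Active v j := by
  induction hv with
  | @freshIn u nd L hi ho =>
    intro L₁ h hu
    obtain ⟨c, -, hc⟩ := h.filter_incident (s := s) hi
    have hb : 1 ≤ nd.pos ∧ nd.pos ≤ r := h.bounds (by simp)
    have h1 : (seg nd.pos (nd.far r) nd.tw, c) ∈ colouredCover r s 0 a (L₁ ++ nd :: L) := by
      refine Multiset.mem_of_mem_filter (p := fun e => Incident nd.pos e.1) ?_
      rw [hc]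
      simp
    obtain ⟨j, hj, -⟩ := (h.goodCover s).edgesOK.exists_graph_eq h1
    refine ⟨j, .fresh ?_ ?_⟩ <;>
      rw [hj, Node.far, if_neg (by simp [ho]), seg_of_gt (show 0 < nd.pos by omega)]
  | @freshStart nd L =>
    intro L₁ h hu
    have hb : 1 ≤ nd.pos ∧ nd.pos ≤ r := h.bounds (by simp)
    obtain ⟨j, hj, -⟩ := (h.goodCover s).edgesOK.exists_graph_eq
      (string_mem_colouredCover (r := r) (a := a) (s := s) L₁ (nd :: L))
    refine ⟨j, .fresh ?_ ?_⟩ <;>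
      rw [hj, hu, nextPos, seg_of_lt (show 0 < nd.pos by omega)]
  | @once u nd nd' L hs hp =>
    intro L₁ h hu
    have hb : 1 ≤ nd.pos ∧ nd.pos ≤ r := h.bounds (by simp)
    obtain ⟨e, he, he0⟩ := h.filter_single (s := s) (by rw [hu]; exact hs)
      (by rw [nextPos]; omega)
    obtain ⟨j', hj', hO⟩ := (h.goodCover s).edgesOK.exists_only he
    have h2 := string_mem_colouredCover (r := r) (a := a) (s := s) (L₁ ++ [nd]) (nd' :: L)
    rw [lastPos_append_singleton, List.append_assoc, List.singleton_append, nextPos,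
      seg_of_lt (show nd.pos < nd'.pos by omega)] at h2
    obtain ⟨j, hj, -⟩ := (h.goodCover s).edgesOK.exists_graph_eq h2
    obtain ⟨q, hq⟩ : ∃ q, nd.pos = q + 1 := ⟨nd.pos - 1, by omega⟩
    rw [hp, hq]
    rw [hq] at hO
    refine ⟨j, .once ?_ ?_ hO (by rw [hj', he0])⟩
    · rw [hj]; dsimp only; omega
    · rw [hj]; dsimp only; omega
  | @twice u nd nd' nd'' nd₃ L hs hi' ho' hp' hi'' ho'' hp'' hw hl =>
    intro L₁ h hu
    have hb : 1 ≤ nd.pos ∧ nd.pos ≤ r := h.bounds (by simp)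
    have e1 : L₁ ++ nd :: nd' :: nd'' :: nd₃ :: L = (L₁ ++ [nd]) ++ nd' :: nd'' :: nd₃ :: L := by simp
    have e2 : L₁ ++ nd :: nd' :: nd'' :: nd₃ :: L = ((L₁ ++ [nd]) ++ [nd']) ++ nd'' :: nd₃ :: L := by
      simp
    obtain ⟨e, he, he0⟩ := h.filter_single (s := s) (by rw [hu]; exact hs) (by rw [nextPos]; omega)
    obtain ⟨j'', hj'', hO''⟩ := (h.goodCover s).edgesOK.exists_only he
    have h' := h
    rw [e1] at h'
    have f' := h'.filter_ascending (s := s) hi' ho' (by rw [lastPos_append_singleton]; omega)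
      (by rw [nextPos]; omega)
    rw [← e1, lastPos_append_singleton, lastWt_append] at f'
    obtain ⟨j', hj', hO'⟩ := (h.goodCover s).edgesOK.exists_only f'
    have h'' := h
    rw [e2] at h''
    have f'' := h''.filter_bend (s := s) hi'' ho'' (by rw [lastPos_append_singleton]; omega)
      (by rw [nextPos]; omega)
    rw [← e2, lastPos_append_singleton, lastWt_append, nextPos] at f''
    rw [← (h.goodCover s).edgesOK.graph_map] at f''
    obtain ⟨j, j₂, hne, hj, hj₂, hall⟩ := exists_of_filter_map_eq_pair f''
    have hj1 := congrArg Prod.fst hj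
    have hj2 := congrArg Prod.snd hj
    have hj₂1 := congrArg Prod.fst hj₂
    dsimp only at hj1 hj2 hj₂1
    obtain ⟨q, hq⟩ : ∃ q, nd.pos = q + 1 := ⟨nd.pos - 1, by omega⟩
    have hq' : nd'.pos = q + 2 := by omega
    have hq'' : nd''.pos = q + 3 := by omega
    rw [hq''] at hj1 hj₂1 ⊢
    rw [hq'] at hO' hj1 hj'
    rw [hq] at hO'' hj'
    refine ⟨j, .twice (j₂ := j₂) (by rw [hj1]) (by rw [hj1]) hO' (by rw [hj']) hO''
      (by rw [hj'', he0]) hj2 (by rw [hj']; exact hw) ?_ hne.symm (by rw [hj₂1])⟩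
    intro i hi
    have hm := (h.goodCover s).edgesOK.mem_of_graph i
    rcases hi with hi | hi | hi
    · exact h.not_dotted hs.1 hm (Or.inl (hi.trans hq.symm))
    · exact h'.not_dotted hi' (by rw [← e1]; exact hm) (Or.inl (hi.trans hq'.symm))
    · exact h''.not_dotted hi'' (by rw [← e2]; exact hm) (Or.inr (hi.trans hq''.symm))
  | @tail u nd L v _ ih =>
    intro L₁ h hu
    have e1 : L₁ ++ nd :: L = (L₁ ++ [nd]) ++ L := by simp
    have h' := h
    rw [e1] at h'
    have := ih h' (lastPos_append_singleton _ _ _)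
    revert this h
    rw [e1]
    exact fun h this => this

instance (n r : ℕ) : Finite (RealTuple n r) :=
  Finite.of_injective (fun T => (T.σ₁, T.τ, T.σ₂, T.γ)) (by rintro ⟨⟨⟩, _⟩ ⟨⟨⟩, _⟩ h; simp_all)

/-- A lower bound for the multiplicity of a cover. -/
theorem GoodNodes.factorial_le_mixedMultiplicityAt {g n k : ℕ} [NeZero n] {lam mu : n.Partition}
    {L : List Node} (h : GoodNodes r a L) (hr : numBranch g lam mu = r)
    (hM : IsCoverOfType g lam mu (cover r 0 a L)) (hk : k ≤ r)
    (hact : ∀ v, 1 ≤ v → v ≤ k → NodeActive 0 L v) (s : Fin (numBranch g lam mu) → ℤˣ) :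
    (n - 2 * k).factorial ≤ mixedMultiplicityAt g lam mu k (cover r 0 a L) s * n := by
  subst hr
  have hg := h.goodCover (signAt s)
  have hmap := colouredCover_map (numBranch g lam mu) (signAt s) 0 a L
  have hR : 0 < numBranch g lam mu := hM.cover.pos
  have hleft := hM.left_ends
  have hright := hM.right_ends
  have hconn := hM.cover.connected
  rw [← hmap] at hleft hright hconn
  have hv : ∀ i < numBranch g lam mu, VertexOK (colouredCover (numBranch g lam mu) (signAt s) 0 a L)
      (i + 1) (signAt s (i + 1)) := fun i hi => hg.vertex _ (by omega) (by omega)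
  obtain ⟨⟨T, lab, hT⟩, hall⟩ := hg.edgesOK.exists_realFactorization s hv hleft hright hconn hR
  have hact' : ∀ v, 1 ≤ v → v ≤ k → ∃ j, hg.edgesOK.graph.Active v j := fun v h1 h2 =>
    (hact v h1 h2).exists_active (L₁ := []) h rfl
  -- One realization is renamed so as to be monotone; all renamings that fix its first
  -- transpositions produce the same coloured cover, because every realization does.
  obtain ⟨e, he⟩ := hT.exists_monotone hk hact'
  have hT' := hT.conj e
  refine (hT'.factorial_le hk he (hall _ _ hT').1.factorization.transitive).trans
    (Nat.mul_le_mul_right _ ?_)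
  refine Nat.card_le_card_of_injective (fun T' => ⟨T'.1, ?_⟩)
    (fun T₁ T₂ h12 => Subtype.ext (Subtype.mk.inj h12))
  obtain ⟨T', ⟨lab', hT₁⟩, hmon⟩ := T'
  obtain ⟨h1, h2⟩ := hall _ _ hT₁
  exact ⟨⟨h1, hmon⟩, _, hmap ▸ hg.isColouring, hg.hasSplitting, h2⟩

theorem GoodNodes.factorial_le_mixedMultiplicity {g n k : ℕ} [NeZero n] {lam mu : n.Partition}
    {L : List Node} (h : GoodNodes r a L) (hr : numBranch g lam mu = r)
    (hM : IsCoverOfType g lam mu (cover r 0 a L)) (hk : k ≤ r)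
    (hact : ∀ v, 1 ≤ v → v ≤ k → NodeActive 0 L v) :
    (n - 2 * k).factorial ≤ mixedMultiplicity g lam mu k (cover r 0 a L) * n := by
  obtain ⟨s, hs⟩ := exists_eq_ciInf_of_finite
    (f := fun s : Fin (numBranch g lam mu) → ℤˣ => mixedMultiplicityAt g lam mu k (cover r 0 a L) s)
  rw [mixedMultiplicity, ← hs]
  exact h.factorial_le_mixedMultiplicityAt hr hM hk hact s

end Active


/-! ### A local criterion for universal monotonicity. -/

section Monotone

/-- The points through which a string runs. -/
def pts (r : ℕ) : ℕ → List Node → ℕ → ℕ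
  | u, _, 0 => u
  | _, [], _ + 1 => r + 1
  | _, nd :: L, i + 1 => pts r nd.pos L i

/-- The weights of the edges of a string. -/
def wts : ℕ → List Node → ℕ → ℕ
  | w, _, 0 => w
  | w, [], _ + 1 => w
  | _, nd :: L, i + 1 => wts nd.wt L i

theorem pts_one (r u : ℕ) (L : List Node) : pts r u L 1 = nextPos r L := by
  rcases L with _ | ⟨nd, L⟩ <;> simp [pts, nextPos]

theorem pts_two (r u : ℕ) (nd : Node) (L : List Node) : pts r u (nd :: L) 2 = nextPos r L := by
  rw [pts, pts_one]

theorem pts_last (r u : ℕ) (L : List Node) : pts r u L (L.length + 1) = r + 1 := by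
  induction L generalizing u with
  | nil => rfl
  | cons nd L ih => exact ih _

theorem stringEdges_eq (r : ℕ) (u w : ℕ) (L : List Node) : stringEdges r u w L =
    (Multiset.range (L.length + 1)).map fun i => seg (pts r u L i) (pts r u L (i + 1)) (wts w L i) := by
  induction L generalizing u w with
  | nil => simp [stringEdges, pts, wts]
  | cons nd L ih =>
    have h : (Multiset.range (L.length + 1 + 1)) =
        0 ::ₘ (Multiset.range (L.length + 1)).map Nat.succ := by
      rw [← Multiset.coe_range, List.range_succ_eq_map]
      rfl
    rw [stringEdges, ih, List.length_cons, h, Multiset.map_cons, Multiset.map_map]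
    rfl

/-- The local conditions on the nodes of a universally monotone cover. -/
def StairLike (r : ℕ) : ℕ → List Node → Prop
  | _, [] => True
  | u, nd :: L => (u < nd.pos → nd.pos < nextPos r L → nd.out = true) ∧
      (nd.pos < u → nextPos r L < nd.pos → nd.out = false) ∧
      ¬ (u < nd.pos ∧ nd.pos < nextPos r L ∧ nextPos r L < nextPos r L.tail) ∧
      (L ≠ [] → nextPos r L ≤ nd.pos + 1) ∧ nd.inner = [] ∧ StairLike r nd.pos L

theorem StairLike.at {r : ℕ} : ∀ {u : ℕ} {L : List Node}, StairLike r u L → ∀ i < L.length,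
    ∃ nd ∈ L, pts r u L (i + 1) = nd.pos ∧
      (pts r u L i < nd.pos → nd.pos < pts r u L (i + 2) → nd.out = true) ∧
      (nd.pos < pts r u L i → pts r u L (i + 2) < nd.pos → nd.out = false) ∧
      ¬ (i + 1 < L.length ∧ pts r u L i < nd.pos ∧ nd.pos < pts r u L (i + 2) ∧
        pts r u L (i + 2) < pts r u L (i + 3)) ∧
      (i + 1 < L.length → pts r u L (i + 2) ≤ nd.pos + 1) ∧ nd.inner = []
  | u, [], _, i, hi => by simp at hi
  | u, nd :: L, h, 0, _ => by
    obtain ⟨h1, h2, h3, h4, h5, -⟩ := h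
    refine ⟨nd, by simp, rfl, ?_⟩
    rw [Nat.zero_add, pts_two]
    refine ⟨h1, h2, ?_, fun h => h4 ?_, h5⟩
    · rintro ⟨hl, h⟩
      rcases L with _ | ⟨nd', L⟩
      · simp at hl
      · refine h3 ?_
        rw [Nat.zero_add, show pts r u (nd :: nd' :: L) 3 = nextPos r L by
          rw [pts, pts_two]] at h
        exact h
    · rintro rfl
      simp at h
  | u, nd :: L, h, i + 1, hi => by
    obtain ⟨nd', h1, h2⟩ := StairLike.at h.2.2.2.2.2 i (by simpa using hi)
    refine ⟨nd', by simp [h1], ?_⟩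
    rw [List.length_cons, Nat.add_lt_add_iff_right]
    exact h2

theorem exists_pts {r : ℕ} {nd : Node} : ∀ {u : ℕ} {L : List Node}, nd ∈ L →
    ∃ i, 1 ≤ i ∧ i ≤ L.length ∧ pts r u L i = nd.pos
  | u, [], h => by simp at h
  | u, nd' :: L, h => by
    rcases List.mem_cons.1 h with rfl | h
    · exact ⟨1, le_rfl, by simp, rfl⟩
    · obtain ⟨i, h1, h2, h3⟩ := exists_pts (u := nd'.pos) h
      exact ⟨i + 1, by omega, by simpa using h2, h3⟩

theorem pts_mem {r : ℕ} : ∀ {u : ℕ} {L : List Node} {i : ℕ}, i < L.length →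
    pts r u L (i + 1) ∈ L.map Node.pos
  | u, [], _, h => by simp at h
  | u, nd :: L, 0, _ => by simp [pts]
  | u, nd :: L, i + 1, h => by
    rw [List.map_cons, List.mem_cons]
    exact Or.inr (pts_mem (by simpa using h))

theorem pts_injOn {r : ℕ} : ∀ {u : ℕ} {L : List Node}, (L.map Node.pos).Nodup → ∀ i j,
    i < L.length → j < L.length → pts r u L (i + 1) = pts r u L (j + 1) → i = j
  | u, [], _, i, j, hi, _, _ => by simp at hi
  | u, nd :: L, _, 0, 0, _, _, _ => rfl
  | u, nd :: L, h, 0, j + 1, _, hj, hp => by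
    rw [List.map_cons, List.nodup_cons] at h
    have h1 := pts_mem (r := r) (u := nd.pos) (L := L) (i := j) (by simpa using hj)
    exact absurd ((show nd.pos = pts r nd.pos L (j + 1) from hp) ▸ h1) h.1
  | u, nd :: L, h, i + 1, 0, hi, _, hp => by
    rw [List.map_cons, List.nodup_cons] at h
    have h1 := pts_mem (r := r) (u := nd.pos) (L := L) (i := i) (by simpa using hi)
    exact absurd ((show pts r nd.pos L (i + 1) = nd.pos from hp) ▸ h1) h.1
  | u, nd :: L, h, i + 1, j + 1, hi, hj, hp => by
    rw [List.map_cons, List.nodup_cons] at h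
    rw [pts_injOn h.2 i j (by simpa using hi) (by simpa using hj) hp]

theorem pieceIndex_succ (p : ℕ → ℕ) (i : ℕ) :
    pieceIndex p i ≤ pieceIndex p (i + 1) ∧
      (¬ IsBent p (i + 1) → pieceIndex p (i + 1) = pieceIndex p i) ∧
      (IsBent p (i + 1) → pieceIndex p (i + 1) = pieceIndex p i + 1) := by
  classical
  have h : pieceIndex p (i + 1) = pieceIndex p i + if IsBent p (i + 1) then 1 else 0 := by
    unfold pieceIndex
    rw [← Finset.insert_Icc_right_eq_Icc_add_one (by omega), Finset.filter_insert]
    split_ifs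
    · rw [Finset.card_insert_of_notMem (by simp)]
    · rfl
  split_ifs at h with h1 <;> simp [h, h1]

theorem pieceIndex_mono (p : ℕ → ℕ) : Monotone (pieceIndex p) :=
  monotone_nat_of_le_succ fun i => (pieceIndex_succ p i).1

theorem componentIndex_le_succ (p : ℕ → ℕ) (i : ℕ) : componentIndex p i ≤ componentIndex p (i + 1) := by
  have h1 : componentIndex p i ≤ pieceIndex p i := by
    unfold componentIndex
    split_ifs
    · rfl
    · exact pieceIndex_mono p (Nat.sub_le _ _)
  refine h1.trans ?_
  unfold componentIndex
  split_ifs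
  · exact pieceIndex_mono p (Nat.le_succ _)
  · exact le_rfl

theorem componentIndex_mono (p : ℕ → ℕ) : Monotone (componentIndex p) :=
  monotone_nat_of_le_succ fun i => componentIndex_le_succ p i

/-- A step to the right stays in its in-component even if it leads to a bend, as bent vertices
belong to in-components. -/
theorem componentIndex_eq (p : ℕ → ℕ) {i : ℕ} (h : p i < p (i + 1)) :
    componentIndex p (i + 1) = componentIndex p i := by
  unfold componentIndex
  rw [if_pos h]
  split_ifs with h1
  · refine (pieceIndex_succ p i).2.1 ?_
    unfold IsBent
    rw [Nat.add_sub_cancel]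
    omega
  · rfl

/-- If every step upwards has length one, then a sequence without repetitions that reaches a higher
point has only ascended. -/
theorem ascends_of_lt {p : ℕ → ℕ} {n : ℕ} (hinj : Set.InjOn p (Set.Icc 1 n))
    (hstep : ∀ i, 1 ≤ i → i < n → p (i + 1) ≤ p i + 1) {i j : ℕ} (hi : 1 ≤ i) (hij : i < j)
    (hj : j ≤ n) (hp : p i < p j) : ∀ l, i ≤ l → l < j → p l < p (l + 1) := by
  have below : ∀ l, i < l → p l < p i → ∀ t, l + t ≤ n → p (l + t) < p i := by
    intro l hl hlp t
    induction t with
    | zero => exact fun _ => hlp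
    | succ t ih =>
      intro ht
      have h1 := ih (by omega)
      have h2 := hstep (l + t) (by omega) (by omega)
      have h3 : p (l + t + 1) ≠ p i := fun h => by
        have := hinj ⟨by omega, by omega⟩ ⟨hi, by omega⟩ h
        omega
      rw [← Nat.add_assoc]
      omega
  -- as long as the sequence ascends, it takes all values from `p i` on
  have up : ∀ t, i + t < j → (∀ l, i ≤ l → l < i + t → p l < p (l + 1)) →
      p (i + t) = p i + t ∧ p (i + t) < p (i + t + 1) := by
    intro t
    induction t with
    | zero =>
      intro h1 _
      refine ⟨rfl, ?_⟩
      rw [Nat.add_zero]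
      by_contra h2
      have h3 : p (i + 1) ≠ p i := fun h => by
        have := hinj ⟨by omega, by omega⟩ ⟨hi, by omega⟩ h
        omega
      have h4 := below (i + 1) (by omega) (by omega) (j - (i + 1)) (by omega)
      rw [show i + 1 + (j - (i + 1)) = j by omega] at h4
      omega
    | succ t ih =>
      intro h1 h2
      obtain ⟨h3, h4⟩ := ih (by omega) fun l hl hl' => h2 l hl (by omega)
      have h5 := hstep (i + t) (by omega) (by omega)
      have h6 : p (i + (t + 1)) = p i + (t + 1) := by
        rw [← Nat.add_assoc]; omega
      refine ⟨h6, ?_⟩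
      by_contra h7
      have h8 : p (i + (t + 1) + 1) < p i := by
        by_contra h9
        -- the value has been taken before
        have h10 : ∀ t', t' ≤ t + 1 → p (i + t') = p i + t' := by
          intro t'
          induction t' with
          | zero => intro _; rfl
          | succ t' ih' =>
            intro ht'
            have a1 := ih' (by omega)
            have a2 := h2 (i + t') (by omega) (by omega)
            have a3 := hstep (i + t') (by omega) (by omega)
            rw [← Nat.add_assoc]
            omega
        have h11 := h10 (p (i + (t + 1) + 1) - p i) (by omega)
        have h12 : p (i + (p (i + (t + 1) + 1) - p i)) = p (i + (t + 1) + 1) := by omega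
        have := hinj ⟨by omega, by omega⟩ ⟨by omega, by omega⟩ h12
        omega
      have h9 := below (i + (t + 1) + 1) (by omega) h8 (j - (i + (t + 1) + 1)) (by omega)
      rw [show i + (t + 1) + 1 + (j - (i + (t + 1) + 1)) = j by omega] at h9
      omega
  intro l hl hlj
  induction l using Nat.strong_induction_on with
  | _ l ih =>
    obtain ⟨t, rfl⟩ : ∃ t, l = i + t := ⟨l - i, by omega⟩
    exact (up t hlj fun l' h1 h2 => ih l' h2 h1 (by omega)).2

theorem separated_symm {A B : Set ℕ} (h : Separated A B) : Separated B A := by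
  rcases h with h | h
  · exact Or.inr fun a ha b hb => h b hb a ha
  · exact Or.inl fun a ha b hb => h b hb a ha

variable {r a : ℕ} {L : List Node}

/-- All tails are single ends, so they occupy one vertex each and the conditions on cycles and forks
are void. What remains is the order of the components and the bound for the out-tails of an
in-piece. -/
theorem GoodNodes.isUniversallyMonotone (h : GoodNodes r a L) (hM : IsTropicalCover r (cover r 0 a L))
    (hS : StairLike r 0 L) : IsUniversallyMonotone r (cover r 0 a L) := by
  have hnod := nodup_pos h.nodup
  have hinjpos : ∀ nd ∈ L, ∀ nd' ∈ L, nd.pos = nd'.pos → nd = nd' := fun nd h1 nd' h2 h3 =>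
    List.inj_on_of_nodup_map hnod h1 h2 h3
  have hinner : ∀ nd ∈ L, nd.inner = [] := by
    intro nd hnd
    obtain ⟨i, h1, h2, h3⟩ := exists_pts (r := r) (u := 0) hnd
    obtain ⟨nd', h4, h5, -, -, -, -, h6⟩ := hS.at (i - 1) (by omega)
    rw [Nat.sub_add_cancel h1, h3] at h5
    rw [hinjpos nd hnd nd' h4 h5, h6]
  generalize hp : pts r 0 L = p at *
  have hAt : ∀ i, 1 ≤ i → i ≤ L.length → ∃ nd ∈ L, p i = nd.pos ∧
      (p (i - 1) < p i → p i < p (i + 1) → nd.out = true) ∧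
      (p i < p (i - 1) → p (i + 1) < p i → nd.out = false) ∧
      ¬ (i < L.length ∧ p (i - 1) < p i ∧ p i < p (i + 1) ∧ p (i + 1) < p (i + 2)) ∧
      (i < L.length → p (i + 1) ≤ p i + 1) := by
    intro i h1 h2
    obtain ⟨nd, h3, h4, h5, h6, h7, h8, -⟩ := hS.at (i - 1) (by omega)
    obtain ⟨i, rfl⟩ : ∃ i', i = i' + 1 := ⟨i - 1, by omega⟩
    rw [Nat.add_sub_cancel, hp] at h4 h5 h6 h7 h8
    rw [Nat.add_sub_cancel]
    rw [← h4] at h5 h6 h7 h8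
    exact ⟨nd, h3, h4, h5, h6, h7, h8⟩
  have hinj : Set.InjOn p (Set.Icc 1 L.length) := by
    rintro i ⟨h1, h2⟩ j ⟨h3, h4⟩ hij
    have := pts_injOn (r := r) (u := 0) hnod (i - 1) (j - 1) (by omega) (by omega) (by
      rw [Nat.sub_add_cancel h1, Nat.sub_add_cancel h3, hp, hij])
    omega
  have hstep : ∀ i, 1 ≤ i → i < L.length → p (i + 1) ≤ p i + 1 := fun i h1 h2 => by
    obtain ⟨_, _, _, _, _, _, h8⟩ := hAt i h1 h2.le
    exact h8 h2
  have hbd : ∀ i, 1 ≤ i → i ≤ L.length → 1 ≤ p i ∧ p i ≤ r := fun i h1 h2 => by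
    obtain ⟨nd, hnd, h3, _⟩ := hAt i h1 h2
    rw [h3]
    exact h.bounds hnd
  have hmem : ∀ t ∈ tailsOf r L, ∃ nd ∈ L, t = nd.toTail r := fun t ht => by
    obtain ⟨nd, hnd, h1⟩ := List.mem_map.1 (Multiset.mem_coe.1 ht)
    exact ⟨nd, hnd, h1.symm⟩
  have hvert : ∀ t ∈ tailsOf r L, ∀ x ∈ t.vertices, x = t.attach := by
    intro t ht x hx
    obtain ⟨nd, hnd, rfl⟩ := hmem t ht
    rcases hx with hx | hx
    · exact hx
    · rw [Node.toTail, hinner nd hnd] at hx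
      simp at hx
  have hcomp : ∀ c x, x ∈ componentVertices (tailsOf r L) L.length p c →
      ∃ i, 1 ≤ i ∧ i ≤ L.length ∧ componentIndex p i = c ∧ x = p i := by
    rintro c x ⟨i, h1, h2, h3, h4 | ⟨t, ht, h4, h5⟩⟩
    · exact ⟨i, h1, h2, h3, h4⟩
    · exact ⟨i, h1, h2, h3, (hvert t ht x h5).trans h4⟩
  refine ⟨hM, stringEdges r 0 a L, tailsOf r L, L.length, p, wts a L, h.isZigzagWith,
    ⟨?_, ?_, hbd, hinj, ?_⟩, ?_, ?_, ?_, ?_, ?_, ?_⟩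
  · rw [← hp]; exact Or.inl (by cases L <;> rfl)
  · rw [← hp]; exact Or.inr (pts_last r 0 L)
  · rw [← hp]; exact stringEdges_eq r 0 a L
  · intro t ht i h1 h2 h3 h4 h5
    obtain ⟨nd, hnd, rfl⟩ := hmem t ht
    obtain ⟨nd', hnd', h6, h7, -⟩ := hAt i h1 h2
    have h8 : nd = nd' := hinjpos nd hnd nd' hnd' (h3.trans h6)
    subst h8
    have hne : p (i - 1) ≠ p i := by
      rcases Nat.eq_or_lt_of_le h1 with rfl | h9
      · have := hbd 1 le_rfl h2
        have h0 : p 0 = 0 := by rw [← hp]; cases L <;> rfl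
        rw [Nat.sub_self, h0]
        omega
      · intro he
        have := hinj ⟨by omega, by omega⟩ ⟨h1, h2⟩ he
        omega
    have h9 : nd.out = true := h7 (by unfold IsBent at h4; omega) h5
    refine ⟨?_, hinner nd hnd⟩
    simp [Node.toTail, Node.far, h9]
  · intro t ht i h1 h2 h3 h4 h5
    obtain ⟨nd, hnd, rfl⟩ := hmem t ht
    obtain ⟨nd', hnd', h6, -, h7, -⟩ := hAt i h1 h2
    have h8 : nd = nd' := hinjpos nd hnd nd' hnd' (h3.trans h6)
    subst h8
    have hne : p (i - 1) ≠ p i := by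
      rcases Nat.eq_or_lt_of_le h1 with rfl | h9
      · have := hbd 1 le_rfl h2
        have h0 : p 0 = 0 := by rw [← hp]; cases L <;> rfl
        rw [Nat.sub_self, h0]
        omega
      · intro he
        have := hinj ⟨by omega, by omega⟩ ⟨h1, h2⟩ he
        omega
    have h9 : nd.out = false := h7 (by unfold IsBent at h4; omega) h5
    refine ⟨?_, by simp [Node.toTail, hinner nd hnd]⟩
    simp [Node.toTail, Node.far, h9]
  · intro t ht i h1 h2 h3 h4 h5
    obtain ⟨nd, hnd, rfl⟩ := hmem t ht
    exact absurd (hinner nd hnd) h5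
  · intro t ht t' ht' hne
    have hne' : t.attach ≠ t'.attach := by
      obtain ⟨nd, hnd, rfl⟩ := hmem t ht
      obtain ⟨nd', hnd', rfl⟩ := hmem t' ht'
      intro he
      exact hne (by rw [hinjpos nd hnd nd' hnd' he])
    rcases Nat.lt_or_gt_of_ne hne' with h1 | h1
    · exact Or.inl fun x hx y hy => by rw [hvert t ht x hx, hvert t' ht' y hy]; exact h1
    · exact Or.inr fun x hx y hy => by rw [hvert t ht x hx, hvert t' ht' y hy]; exact h1
  -- Later components lie further to the left: by `ascends_of_lt` a later point can be higher only
  -- after a pure ascent, and an ascent does not change the component.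
  · have key : ∀ c c', c < c' → Separated (componentVertices (tailsOf r L) L.length p c)
        (componentVertices (tailsOf r L) L.length p c') := by
      intro c c' hcc
      refine Or.inr fun x hx y hy => ?_
      obtain ⟨i, h1, h2, rfl, rfl⟩ := hcomp _ _ hx
      obtain ⟨j, h3, h4, rfl, rfl⟩ := hcomp _ _ hy
      have hij : i < j := by
        by_contra hji
        exact absurd (componentIndex_mono p (not_lt.1 hji)) (by omega)
      by_contra hpp
      have hlt : p i < p j := lt_of_le_of_ne (not_lt.1 hpp) fun he => by
        have := hinj ⟨h1, h2⟩ ⟨h3, h4⟩ he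
        omega
      have hasc := ascends_of_lt hinj hstep h1 hij h4 hlt
      have hconst : ∀ t, i + t ≤ j → componentIndex p (i + t) = componentIndex p i := by
        intro t
        induction t with
        | zero => intro _; rfl
        | succ t ih =>
          intro ht
          rw [← Nat.add_assoc, componentIndex_eq p (hasc _ (by omega) (by omega)), ih (by omega)]
      have := hconst (j - i) (by omega)
      rw [show i + (j - i) = j by omega] at this
      omega
    intro c c' hcc
    rcases Nat.lt_or_gt_of_ne hcc with h1 | h1
    · exact key c c' h1
    · exact separated_symm (key c' c h1)
  -- Two unbent vertices on one in-piece would make the point after the first one unbent as well, so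
  -- the string would ascend three times in a row, which `StairLike` forbids.
  · have key : ∀ i j, 1 ≤ i → i < j → j ≤ L.length → ¬ IsBent p i → ¬ IsBent p j → p i < p (i + 1) →
        p j < p (j + 1) → pieceIndex p i = pieceIndex p j → False := by
      intro i j h1 h2 h3 h4 h5 h6 h7 h8
      have h9 : ¬ IsBent p (i + 1) := fun hb => by
        have := (pieceIndex_succ p i).2.2 hb
        have := pieceIndex_mono p (show i + 1 ≤ j by omega)
        omega
      obtain ⟨_, _, _, _, _, h10, _⟩ := hAt i h1 (by omega)
      have hne : p (i - 1) ≠ p i := by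
        rcases Nat.eq_or_lt_of_le h1 with rfl | h9
        · have := hbd 1 le_rfl (by omega)
          have h0 : p 0 = 0 := by rw [← hp]; cases L <;> rfl
          rw [Nat.sub_self, h0]
          omega
        · intro he
          have := hinj ⟨by omega, by omega⟩ ⟨h1, by omega⟩ he
          omega
      refine h10 ⟨by omega, by unfold IsBent at h4; omega, h6, ?_⟩
      have hne' : p (i + 1) ≠ p (i + 2) := by
        rcases Nat.lt_or_ge (i + 1) L.length with h11 | h11
        · intro he
          have := hinj ⟨by omega, by omega⟩ ⟨by omega, by omega⟩ he
          omega
        · have h12 : i + 2 = L.length + 1 := by omega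
          have := hbd (i + 1) (by omega) (by omega)
          have hl : p (L.length + 1) = r + 1 := by rw [← hp]; exact pts_last r 0 L
          rw [h12, hl]
          omega
      unfold IsBent at h9
      rw [Nat.add_sub_cancel] at h9
      have h13 : i + 1 + 1 = i + 2 := rfl
      rw [h13] at h9
      omega
    intro i j h1 h2 h3 h4 h5 h6 h7 h8 h9 _ _
    rcases Nat.lt_trichotomy i j with h10 | h10 | h10
    · exact (key i j h1 h10 h4 h5 h6 h7 h8 h9).elim
    · exact h10
    · exact (key j i h3 h10 h2 h6 h5 h8 h7 h9.symm).elim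

end Monotone


/-! ### The staircase that uses up the parts of λ' and μ'. -/

section Stairs

/-- The weights of the in-ends (`o = false`) or out-ends (`o = true`) of the tails at the given
nodes. -/
def endsOf (o : Bool) (L : List Node) : Multiset ℕ :=
  (L.map fun nd => if nd.out = o then nd.ends else 0).sum

theorem endsOf_cons (o : Bool) (nd : Node) (L : List Node) :
    endsOf o (nd :: L) = (if nd.out = o then nd.ends else 0) + endsOf o L := by
  simp [endsOf]

theorem endsOf_append (o : Bool) (L L' : List Node) :
    endsOf o (L ++ L') = endsOf o L + endsOf o L' := by
  simp [endsOf]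

theorem ends_of_nil (p : ℕ) (o : Bool) (x c : ℕ) : (Node.mk p o x [] c).ends = {x} := rfl

/-- The nodes of a string that arrives from the right with the weight `w`, has the vertices
`1, …, N`, and leaves them to the right with the weight `b`. -/
inductive Stair (b : ℕ) : ℕ → ℕ → List Node → Prop
  | join {N c x : ℕ} {L : List Node} (hx : Even x) (hx0 : 0 < x) (hc : Odd c) (h : Stair b N c L) :
      Stair b (N + 1) (c + x) (⟨N + 1, false, x, [], c⟩ :: L)
  | bend {w : ℕ} (hw : Odd w) (hb : Odd b) : Stair b 1 w [⟨1, false, w + b, [], b⟩]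
  | bendCut {w y : ℕ} (hw : Odd w) (hb : Odd b) (hy : Even y) (hy0 : 0 < y) :
      Stair b 2 w [⟨1, false, w + (b + y), [], b + y⟩, ⟨2, true, y, [], b⟩]
  | bends {N w c c' : ℕ} {L : List Node} (hw : Odd w) (hc : Odd c) (hc' : Odd c')
      (h : Stair b N c' L) : Stair b (N + 2) w
        (⟨N + 1, false, w + c, [], c⟩ :: ⟨N + 2, true, c + c', [], c'⟩ :: L)
  | bendCutBend {N w y c c' : ℕ} {L : List Node} (hw : Odd w) (hc : Odd c) (hc' : Odd c')
      (hy : Even y) (hy0 : 0 < y) (h : Stair b N c' L) : Stair b (N + 3) w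
        (⟨N + 1, false, w + (c + y), [], c + y⟩ :: ⟨N + 2, true, y, [], c⟩ ::
          ⟨N + 3, true, c + c', [], c'⟩ :: L)

variable {b N w : ℕ} {L : List Node}

theorem Stair.exists_cons (h : Stair b N w L) :
    ∃ nd L', L = nd :: L' ∧ 1 ≤ nd.pos ∧ nd.pos ≤ N ∧ nd.out = false ∧ nd.inner = [] := by
  cases h <;> exact ⟨_, _, rfl, by simp⟩

theorem Icc_val_succ (N : ℕ) : (Finset.Icc 1 (N + 1)).val = (N + 1) ::ₘ (Finset.Icc 1 N).val := by
  rw [← Finset.insert_Icc_right_eq_Icc_add_one (by omega),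
    Finset.insert_val_of_notMem (by simp)]

theorem Stair.verts (h : Stair b N w L) : (nodeVerts L : Multiset ℕ) = (Finset.Icc 1 N).val := by
  induction h with
  | join hx hx0 hc h ih =>
    rw [Icc_val_succ, ← ih]; rfl
  | bend hw hb => rfl
  | bendCut hw hb hy hy0 => rfl
  | @bends N w c c' L hw hc hc' h ih =>
    rw [Icc_val_succ, Icc_val_succ, ← ih, Multiset.cons_swap]; rfl
  | @bendCutBend N w y c c' L hw hc hc' hy hy0 h ih =>
    rw [Icc_val_succ, Icc_val_succ, Icc_val_succ, ← ih, Multiset.cons_swap (N + 2),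
      Multiset.cons_swap (N + 2 + 1), Multiset.cons_swap (N + 2 + 1)]
    rfl

theorem Stair.lastWt_eq (h : Stair b N w L) (w' : ℕ) : lastWt w' L = b := by
  induction h generalizing w' with
  | join hx hx0 hc h ih => exact ih _
  | bend hw hb => rfl
  | bendCut hw hb hy hy0 => rfl
  | bends hw hc hc' h ih => exact ih _
  | bendCutBend hw hc hc' hy hy0 h ih => exact ih _

theorem Stair.odd (h : Stair b N w L) : Odd b := by
  induction h with
  | join _ _ _ _ ih => exact ih
  | bend _ hb => exact hb
  | bendCut _ hb _ _ => exact hb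
  | bends _ _ _ _ ih => exact ih
  | bendCutBend _ _ _ _ _ _ ih => exact ih

theorem Stair.valid {r : ℕ} {L' : List Node} (h : Stair b N w L)
    (hL' : ∀ p, 1 ≤ p → p ≤ N → ValidNodes r p b L') (hN : N < nextPos r L') {u : ℕ} (hu : N < u) :
    ValidNodes r u w (L ++ L') := by
  induction h generalizing u with
  | @join N c x L hx hx0 hc h ih =>
    obtain ⟨nd, L'', rfl, h1, h2, -⟩ := h.exists_cons
    have h3 := ih (fun p h3 h4 => hL' p h3 (by omega)) (by omega) (u := N + 1) (by omega)
    refine ⟨hc.add_even hx, ⟨hx, hx0, by simp, by simp, ?_⟩, h3⟩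
    right; right; right; right
    exact ⟨hu, by show nd.pos < N + 1; omega, rfl, rfl⟩
  | @bend w hw hb =>
    refine ⟨hw, ⟨hw.add_odd hb, Nat.add_pos_left hw.pos _, by simp, by simp, ?_⟩,
      hL' 1 le_rfl le_rfl⟩
    right; left
    exact ⟨hu, hN, rfl, rfl⟩
  | @bendCut w y hw hb hy hy0 =>
    refine ⟨hw, ⟨hw.add_odd (hb.add_even hy), Nat.add_pos_left hw.pos _, by simp, by simp, ?_⟩,
      hb.add_even hy, ⟨hy, hy0, by simp, by simp, ?_⟩, hL' 2 (by omega) le_rfl⟩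
    · right; left
      exact ⟨by show 1 < u; omega, by simp [nextPos], rfl, rfl⟩
    · right; right; left
      exact ⟨by simp, hN, rfl, rfl⟩
  | @bends N w c c' L hw hc hc' h ih =>
    obtain ⟨nd, L'', rfl, h1, h2, -⟩ := h.exists_cons
    have h3 := ih (fun p h3 h4 => hL' p h3 (by omega)) (by omega) (u := N + 2) (by omega)
    refine ⟨hw, ⟨hw.add_odd hc, Nat.add_pos_left hw.pos _, by simp, by simp, ?_⟩,
      hc, ⟨hc.add_odd hc', Nat.add_pos_left hc.pos _, by simp, by simp, ?_⟩, h3⟩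
    · right; left
      exact ⟨by show N + 1 < u; omega, by simp [nextPos], rfl, rfl⟩
    · left
      exact ⟨by simp, by show nd.pos < N + 2; omega, rfl, rfl⟩
  | @bendCutBend N w y c c' L hw hc hc' hy hy0 h ih =>
    obtain ⟨nd, L'', rfl, h1, h2, -⟩ := h.exists_cons
    have h3 := ih (fun p h3 h4 => hL' p h3 (by omega)) (by omega) (u := N + 3) (by omega)
    refine ⟨hw, ⟨hw.add_odd (hc.add_even hy), Nat.add_pos_left hw.pos _, by simp, by simp, ?_⟩,
      hc.add_even hy, ⟨hy, hy0, by simp, by simp, ?_⟩,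
      hc, ⟨hc.add_odd hc', Nat.add_pos_left hc.pos _, by simp, by simp, ?_⟩, h3⟩
    · right; left
      exact ⟨by show N + 1 < u; omega, by simp [nextPos], rfl, rfl⟩
    · right; right; left
      exact ⟨by simp, by simp [nextPos], rfl, rfl⟩
    · left
      exact ⟨by simp, by show nd.pos < N + 3; omega, rfl, rfl⟩

theorem Stair.active {L' : List Node} (h : Stair b N w L) {u : ℕ} (hu : N < u) {v : ℕ} (h1 : 1 ≤ v)
    (h2 : v ≤ N) : NodeActive u (L ++ L') v := by
  induction h generalizing u with
  | @join N c x L hx hx0 hc h ih =>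
    rcases Nat.lt_or_ge N v with h3 | h3
    · obtain rfl : v = N + 1 := by omega
      exact .freshIn rfl rfl
    · exact .tail (ih (by simp) h3)
  | @bend w hw hb =>
    obtain rfl : v = 1 := by omega
    exact .freshIn rfl rfl
  | @bendCut w y hw hb hy hy0 =>
    rcases Nat.lt_or_ge v 2 with h3 | h3
    · obtain rfl : v = 1 := by omega
      exact .freshIn rfl rfl
    · obtain rfl : v = 2 := by omega
      exact .once (nd' := ⟨2, true, y, [], b⟩) ⟨rfl, Or.inr ⟨by show 1 < u; omega, rfl⟩⟩ rfl
  | @bends N w c c' L hw hc hc' h ih =>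
    rcases Nat.lt_or_ge N v with h3 | h3
    · rcases Nat.lt_or_ge v (N + 2) with h4 | h4
      · obtain rfl : v = N + 1 := by omega
        exact .freshIn rfl rfl
      · obtain rfl : v = N + 2 := by omega
        exact .once (nd' := ⟨N + 2, true, c + c', [], c'⟩)
          ⟨rfl, Or.inr ⟨by show N + 1 < u; omega, rfl⟩⟩ rfl
    · exact .tail (.tail (ih (by simp) h3))
  | @bendCutBend N w y c c' L hw hc hc' hy hy0 h ih =>
    rcases Nat.lt_or_ge N v with h3 | h3
    · have hs : Single u ⟨N + 1, false, w + (c + y), [], c + y⟩ :=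
        ⟨rfl, Or.inr ⟨by show N + 1 < u; omega, rfl⟩⟩
      have h5 : v = N + 1 ∨ v = N + 2 ∨ v = N + 3 := by omega
      rcases h5 with rfl | rfl | rfl
      · exact .freshIn rfl rfl
      · exact .once (nd' := ⟨N + 2, true, y, [], c⟩) hs rfl
      · obtain ⟨nd, L'', rfl, h6, h7, -⟩ := h.exists_cons
        refine .twice (nd' := ⟨N + 2, true, y, [], c⟩) (nd'' := ⟨N + 3, true, c + c', [], c'⟩)
          hs rfl rfl rfl rfl rfl rfl ?_ (by show nd.pos < N + 3; omega)
        have := hc.pos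
        obtain ⟨z, rfl⟩ := hy
        show 3 ≤ c + (z + z)
        omega
    · exact .tail (.tail (.tail (ih (by simp) h3)))

theorem Stair.stairLike {k : ℕ} (h : Stair b N w L) (hk : N ≤ k) {u : ℕ} (hu : N < u) :
    StairLike k u L := by
  induction h generalizing u with
  | @join N c x L hx hx0 hc h ih =>
    obtain ⟨nd, L'', rfl, h1, h2, -⟩ := h.exists_cons
    refine ⟨?_, fun _ _ => rfl, ?_, ?_, rfl, ih (by omega) (by simp)⟩
    · intro h3
      exact absurd h3 (not_lt.2 hu.le)
    · rintro ⟨h3, -⟩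
      exact absurd h3 (not_lt.2 hu.le)
    · intro _
      show nd.pos ≤ N + 1 + 1
      omega
  | @bend w hw hb =>
    refine ⟨?_, fun _ _ => rfl, ?_, by simp, rfl, trivial⟩
    · intro h3
      exact absurd h3 (not_lt.2 hu.le)
    · rintro ⟨h3, -⟩
      exact absurd h3 (not_lt.2 hu.le)
  | @bendCut w y hw hb hy hy0 =>
    refine ⟨?_, fun _ _ => rfl, ?_, by simp [nextPos], rfl, fun _ _ => rfl, ?_, ?_, by simp, rfl,
      trivial⟩
    · intro h3
      have h4 : u < 1 := h3
      omega
    · rintro ⟨h3, -⟩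
      have h4 : u < 1 := h3
      omega
    · intro h3
      have h4 : 2 < 1 := h3
      omega
    · rintro ⟨-, -, h3⟩
      exact absurd h3 (lt_irrefl _)
  | @bends N w c c' L hw hc hc' h ih =>
    obtain ⟨nd, L'', rfl, h1, h2, -⟩ := h.exists_cons
    refine ⟨?_, fun _ _ => rfl, ?_, by simp [nextPos], rfl, fun _ _ => rfl, ?_, ?_, ?_, rfl,
      ih (by omega) (by simp)⟩
    · intro h3
      have h4 : u < N + 1 := h3
      omega
    · rintro ⟨h3, -⟩
      have h4 : u < N + 1 := h3
      omega
    · intro h3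
      have h4 : N + 2 < N + 1 := h3
      omega
    · rintro ⟨-, h3, -⟩
      have h4 : N + 2 < nd.pos := h3
      omega
    · intro _
      show nd.pos ≤ N + 2 + 1
      omega
  | @bendCutBend N w y c c' L hw hc hc' hy hy0 h ih =>
    obtain ⟨nd, L'', rfl, h1, h2, -⟩ := h.exists_cons
    refine ⟨?_, fun _ _ => rfl, ?_, by simp [nextPos], rfl, fun _ _ => rfl, ?_, ?_, by simp [nextPos],
      rfl, fun _ _ => rfl, ?_, ?_, ?_, rfl, ih (by omega) (by simp)⟩
    · intro h3
      have h4 : u < N + 1 := h3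
      omega
    · rintro ⟨h3, -⟩
      have h4 : u < N + 1 := h3
      omega
    · intro h3
      have h4 : N + 2 < N + 1 := h3
      omega
    · rintro ⟨-, -, h3⟩
      have h4 : N + 3 < nd.pos := h3
      omega
    · intro h3
      have h4 : N + 3 < N + 2 := h3
      omega
    · rintro ⟨-, h3, -⟩
      have h4 : N + 3 < nd.pos := h3
      omega
    · intro _
      show nd.pos ≤ N + 3 + 1
      omega

/-- A string going to the right can be turned around by at most one cut and a bend. -/
theorem exists_turn {b M S c : ℕ} {Y : Multiset ℕ} (hc : Odd c) (hcM : c ≤ M) (hb : b < S)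
    (hY : ∀ y ∈ Y, Even y ∧ 0 < y) (hYM : ∀ y₁ y₂ : ℕ, {y₁, y₂} ≤ Y → M < y₁ + y₂)
    (hS : S + c = b + Y.sum) :
    (∃ c' Y', Odd c' ∧ Y = (c + c') ::ₘ Y' ∧ S = c' + b + Y'.sum) ∨
    ∃ c₁ y c' Y', Odd c₁ ∧ Odd c' ∧ Even y ∧ 0 < y ∧ c = c₁ + y ∧ Y = y ::ₘ (c₁ + c') ::ₘ Y' ∧
      S = c' + b + Y'.sum := by
  -- A part heavier than the string turns it around at once. Otherwise all parts are lighter,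
  -- equality being excluded by parity; cutting off y₁ leaves less than y₂, since y₁ + y₂ > M ≥ c.
  -- Two parts are available because `b < S`: with none, or with one lighter than c, the sums could
  -- not balance.
  by_cases h : ∃ y ∈ Y, c < y
  · obtain ⟨y, hy, hcy⟩ := h
    obtain ⟨Y', rfl⟩ := Multiset.exists_cons_of_mem hy
    left
    refine ⟨y - c, Y', Nat.Even.sub_odd hcy.le (hY y hy).1 hc, by rw [Nat.add_sub_cancel' hcy.le], ?_⟩
    rw [Multiset.sum_cons] at hS
    omega
  · push Not at h
    right
    have hlt : ∀ y ∈ Y, y < c := fun y hy => lt_of_le_of_ne (h y hy) fun he =>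
      Nat.not_even_iff_odd.2 hc (he ▸ (hY y hy).1)
    rcases Multiset.empty_or_exists_mem Y with rfl | ⟨y₁, hy₁⟩
    · simp at hS
      omega
    · obtain ⟨Y₁, rfl⟩ := Multiset.exists_cons_of_mem hy₁
      have h1 := hlt y₁ hy₁
      rcases Multiset.empty_or_exists_mem Y₁ with rfl | ⟨y₂, hy₂⟩
      · simp at hS
        omega
      · obtain ⟨Y₂, rfl⟩ := Multiset.exists_cons_of_mem hy₂
        have h2 := hYM y₁ y₂ (by
          rw [Multiset.insert_eq_cons]
          exact Multiset.cons_le_cons _ (by simp))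
        have h3 := hY y₁ (by simp)
        have h4 := hY y₂ (by simp)
        have h5 : Odd (c - y₁) := Nat.Odd.sub_even h1.le hc h3.1
        refine ⟨c - y₁, y₁, y₂ - (c - y₁), Y₂, h5, Nat.Even.sub_odd (by omega) h4.1 h5, h3.1, h3.2,
          by omega, by rw [Nat.add_sub_cancel' (by omega)], ?_⟩
        rw [Multiset.sum_cons, Multiset.sum_cons] at hS
        omega

/-- At the last bend the remaining out-weights sum up to at most `M`, so the condition on pairs
leaves at most one of them. -/
theorem sum_le_of_pair {Y : Multiset ℕ} {M : ℕ} (hYM : ∀ y₁ y₂ : ℕ, {y₁, y₂} ≤ Y → M < y₁ + y₂)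
    (hY : Y.sum ≤ M) : Y = 0 ∨ ∃ y, Y = {y} := by
  rcases Multiset.empty_or_exists_mem Y with rfl | ⟨y₁, hy₁⟩
  · exact Or.inl rfl
  · obtain ⟨Y₁, rfl⟩ := Multiset.exists_cons_of_mem hy₁
    rcases Multiset.empty_or_exists_mem Y₁ with rfl | ⟨y₂, hy₂⟩
    · exact Or.inr ⟨y₁, rfl⟩
    · obtain ⟨Y₂, rfl⟩ := Multiset.exists_cons_of_mem hy₂
      have h2 := hYM y₁ y₂ (by
        rw [Multiset.insert_eq_cons]
        exact Multiset.cons_le_cons _ (by simp))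
      rw [Multiset.sum_cons, Multiset.sum_cons] at hY
      omega

/-- Greedy construction, using the in-weights in `X` in any order. A weight lighter than the string,
which runs left, is attached as an in-tail. A heavier one bends the string to the right, with a
weight at most `M`, and `exists_turn` turns it back after at most one cut. Equality never occurs,
since the string is odd and the parts are even. The weight `X₀` is saved for the last bend: being
larger than `b` and not yet used, it guarantees that a turn is always possible. -/
theorem exists_stair {b X₀ M : ℕ} (hb : Odd b) (hbX : b < X₀) (hXM : X₀ ≤ M) :
    ∀ (n : ℕ) (X Y : Multiset ℕ) (w : ℕ), X.card = n → (∀ x ∈ X, Even x ∧ 0 < x ∧ x ≤ M) →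
      (∀ y ∈ Y, Even y ∧ 0 < y) → (∀ y₁ y₂ : ℕ, {y₁, y₂} ≤ Y → M < y₁ + y₂) → Odd w →
      X₀ + X.sum = w + b + Y.sum → ∃ L, Stair b (X.card + 1 + Y.card) w L ∧
        endsOf false L = X₀ ::ₘ X ∧ endsOf true L = Y := by
  intro n
  induction n with
  | zero =>
    intro X Y w hX hX' hY hYM hw hS
    rw [Multiset.card_eq_zero] at hX
    subst hX
    simp only [Multiset.sum_zero, add_zero] at hS
    -- The string bends for the last time at `X₀` and leaves with weight `b`, after at most one cut.
    rcases sum_le_of_pair hYM (by omega) with rfl | ⟨y, rfl⟩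
    · refine ⟨_, .bend hw hb, ?_, ?_⟩
      · simp only [Multiset.sum_zero, add_zero] at hS
        rw [hS]; rfl
      · rfl
    · have hy := hY y (by simp)
      refine ⟨_, .bendCut hw hb hy.1 hy.2, ?_, ?_⟩
      · rw [Multiset.sum_singleton, add_assoc] at hS
        rw [hS]; rfl
      · rfl
  | succ n ih =>
    intro X Y w hX hX' hY hYM hw hS
    obtain ⟨x, hxX⟩ := Multiset.card_pos_iff_exists_mem.1 (show 0 < X.card by omega)
    obtain ⟨X', rfl⟩ := Multiset.exists_cons_of_mem hxX
    have hX1 : X'.card = n := by simpa using hX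
    have hx := hX' x (by simp)
    have hX'' : ∀ x ∈ X', Even x ∧ 0 < x ∧ x ≤ M := fun x hx => hX' x (by simp [hx])
    rw [Multiset.sum_cons] at hS
    have hne : x ≠ w := fun he => Nat.not_even_iff_odd.2 hw (he ▸ hx.1)
    rcases Nat.lt_or_gt_of_ne hne with hlt | hlt
    · have hc : Odd (w - x) := Nat.Odd.sub_even hlt.le hw hx.1
      obtain ⟨L, hL, h1, h2⟩ := ih X' Y (w - x) hX1 hX'' hY hYM hc (by omega)
      have h3 := Stair.join hx.1 hx.2.1 hc hL
      rw [Nat.sub_add_cancel hlt.le] at h3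
      rw [show (x ::ₘ X').card + 1 + Y.card = X'.card + 1 + Y.card + 1 by
        rw [Multiset.card_cons]; omega]
      refine ⟨_, h3, ?_, ?_⟩
      · rw [endsOf_cons, h1, if_pos rfl, ends_of_nil, Multiset.singleton_add, Multiset.cons_swap]
      · rw [endsOf_cons, h2, if_neg (by simp), zero_add]
    · have hc : Odd (x - w) := Nat.Even.sub_odd hlt.le hx.1 hw
      rcases exists_turn (b := b) (S := X₀ + X'.sum) hc (by omega) (by omega) hY hYM (by omega) with
        ⟨c', Y', h1, rfl, h2⟩ | ⟨c₁, y, c', Y', h1, h2, h3, h4, h5, rfl, h6⟩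
      · obtain ⟨L, hL, h3, h4⟩ := ih X' Y' c' hX1 hX'' (fun y hy => hY y (by simp [hy]))
          (fun y₁ y₂ h => hYM y₁ y₂ (h.trans (Multiset.le_cons_self _ _))) h1 h2
        rw [show (x ::ₘ X').card + 1 + ((x - w + c') ::ₘ Y').card = X'.card + 1 + Y'.card + 2 by
          rw [Multiset.card_cons, Multiset.card_cons]; omega]
        refine ⟨_, Stair.bends hw hc h1 hL, ?_, ?_⟩
        · rw [endsOf_cons, endsOf_cons, h3, if_pos rfl, if_neg (by simp), ends_of_nil, zero_add,
            Multiset.singleton_add, Multiset.cons_swap, Nat.add_sub_cancel' hlt.le]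
        · rw [endsOf_cons, endsOf_cons, h4, if_pos rfl, if_neg (by simp), ends_of_nil, zero_add,
            Multiset.singleton_add]
      · obtain ⟨L, hL, h7, h8⟩ := ih X' Y' c' hX1 hX'' (fun y hy => hY y (by simp [hy]))
          (fun y₁ y₂ h => hYM y₁ y₂ (h.trans ((Multiset.le_cons_self _ _).trans
            (Multiset.le_cons_self _ _)))) h2 h6
        rw [show (x ::ₘ X').card + 1 + (y ::ₘ (c₁ + c') ::ₘ Y').card =
          X'.card + 1 + Y'.card + 3 by
            rw [Multiset.card_cons, Multiset.card_cons, Multiset.card_cons]; omega]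
        refine ⟨_, Stair.bendCutBend hw h1 h2 h3 h4 hL, ?_, ?_⟩
        · rw [endsOf_cons, endsOf_cons, endsOf_cons, h7, if_pos rfl, if_neg (by simp),
            if_neg (by simp), ends_of_nil, zero_add, zero_add,
            Multiset.singleton_add, Multiset.cons_swap, ← h5, Nat.add_sub_cancel' hlt.le]
        · rw [endsOf_cons, endsOf_cons, endsOf_cons, h8, if_pos rfl, if_neg (by simp), if_pos rfl,
            ends_of_nil, ends_of_nil, zero_add, Multiset.singleton_add, Multiset.singleton_add]

/-- The nodes of a string that starts at `-∞` with the weight `a`, has the vertices `1, …, k`, and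
leaves them to the right with the weight `b`. -/
inductive FullStair (b : ℕ) : ℕ → ℕ → List Node → Prop
  | bend {N a c : ℕ} {L : List Node} (ha : Odd a) (hc : Odd c) (h : Stair b N c L) :
      FullStair b (N + 1) a (⟨N + 1, true, a + c, [], c⟩ :: L)
  | cutBend {N y c c' : ℕ} {L : List Node} (hc : Odd c) (hc' : Odd c') (hy : Even y) (hy0 : 0 < y)
      (h : Stair b N c' L) :
      FullStair b (N + 2) (c + y) (⟨N + 1, true, y, [], c⟩ :: ⟨N + 2, true, c + c', [], c'⟩ :: L)

variable {k a : ℕ}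

theorem FullStair.verts (h : FullStair b k a L) :
    (nodeVerts L : Multiset ℕ) = (Finset.Icc 1 k).val := by
  cases h with
  | bend _ _ h => rw [Icc_val_succ, ← h.verts]; rfl
  | cutBend _ _ _ _ h =>
    rw [Icc_val_succ, Icc_val_succ, ← h.verts, Multiset.cons_swap]; rfl

theorem FullStair.lastWt_eq (h : FullStair b k a L) (w' : ℕ) : lastWt w' L = b := by
  cases h with
  | bend _ _ h => exact h.lastWt_eq _
  | cutBend _ _ _ _ h => exact h.lastWt_eq _

theorem FullStair.ne_nil (h : FullStair b k a L) : L ≠ [] := by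
  cases h <;> simp

theorem FullStair.odd (h : FullStair b k a L) : Odd b := by
  cases h with
  | bend _ _ h => exact h.odd
  | cutBend _ _ _ _ h => exact h.odd

theorem FullStair.valid {r : ℕ} {L' : List Node} (h : FullStair b k a L)
    (hL' : ∀ p, 1 ≤ p → p ≤ k → ValidNodes r p b L') (hk : k < nextPos r L') :
    ValidNodes r 0 a (L ++ L') := by
  cases h with
  | @bend N a c L ha hc h =>
    obtain ⟨nd, L'', rfl, h1, h2, -⟩ := h.exists_cons
    have h3 := h.valid (L' := L') (fun p h3 h4 => hL' p h3 (by omega)) (by omega) (u := N + 1)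
      (by omega)
    refine ⟨ha, ⟨ha.add_odd hc, Nat.add_pos_left ha.pos _, by simp, by simp, ?_⟩, h3⟩
    left
    exact ⟨by simp, by show nd.pos < N + 1; omega, rfl, rfl⟩
  | @cutBend N y c c' L hc hc' hy hy0 h =>
    obtain ⟨nd, L'', rfl, h1, h2, -⟩ := h.exists_cons
    have h3 := h.valid (L' := L') (fun p h3 h4 => hL' p h3 (by omega)) (by omega) (u := N + 2)
      (by omega)
    refine ⟨hc.add_even hy, ⟨hy, hy0, by simp, by simp, ?_⟩,
      hc, ⟨hc.add_odd hc', Nat.add_pos_left hc.pos _, by simp, by simp, ?_⟩, h3⟩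
    · right; right; left
      exact ⟨by simp, by simp [nextPos], rfl, rfl⟩
    · left
      exact ⟨by simp, by show nd.pos < N + 2; omega, rfl, rfl⟩

theorem FullStair.active {L' : List Node} (h : FullStair b k a L) {v : ℕ} (h1 : 1 ≤ v)
    (h2 : v ≤ k) : NodeActive 0 (L ++ L') v := by
  cases h with
  | @bend N a c L ha hc h =>
    rcases Nat.lt_or_ge N v with h3 | h3
    · obtain rfl : v = N + 1 := by omega
      exact .freshStart
    · exact .tail (h.active (by simp) h1 h3)
  | @cutBend N y c c' L hc hc' hy hy0 h =>
    rcases Nat.lt_or_ge N v with h3 | h3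
    · rcases Nat.lt_or_ge v (N + 2) with h4 | h4
      · obtain rfl : v = N + 1 := by omega
        exact .freshStart
      · obtain rfl : v = N + 2 := by omega
        exact .once (nd' := ⟨N + 2, true, c + c', [], c'⟩) ⟨rfl, Or.inl ⟨rfl, rfl⟩⟩ rfl
    · exact .tail (.tail (h.active (by simp) h1 h3))

theorem FullStair.stairLike (h : FullStair b k a L) : StairLike k 0 L := by
  cases h with
  | @bend N a c L ha hc h =>
    obtain ⟨nd, L'', rfl, h1, h2, -⟩ := h.exists_cons
    refine ⟨fun _ _ => rfl, ?_, ?_, ?_, rfl, h.stairLike (by omega) (by simp)⟩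
    · intro h3
      exact absurd h3 (Nat.not_lt_zero _)
    · rintro ⟨-, h3, -⟩
      have h4 : N + 1 < nd.pos := h3
      omega
    · intro _
      show nd.pos ≤ N + 1 + 1
      omega
  | @cutBend N y c c' L hc hc' hy hy0 h =>
    obtain ⟨nd, L'', rfl, h1, h2, -⟩ := h.exists_cons
    refine ⟨fun _ _ => rfl, ?_, ?_, by simp [nextPos], rfl, fun _ _ => rfl, ?_, ?_, ?_, rfl,
      h.stairLike (by omega) (by simp)⟩
    · intro h3
      exact absurd h3 (Nat.not_lt_zero _)
    · rintro ⟨-, -, h3⟩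
      have h4 : N + 2 < nd.pos := h3
      omega
    · intro h3
      have h4 : N + 2 < N + 1 := h3
      omega
    · rintro ⟨-, h3, -⟩
      have h4 : N + 2 < nd.pos := h3
      omega
    · intro _
      show nd.pos ≤ N + 2 + 1
      omega

theorem FullStair.goodNodes (h : FullStair b k a L) : GoodNodes k a L := by
  have h1 := h.valid (r := k) (L' := []) (fun p _ h2 => ⟨h.odd, h2⟩) (Nat.lt_succ_self k)
  rw [List.append_nil] at h1
  exact ⟨h1, h.verts, h.ne_nil⟩

theorem StairLike.inner_eq_nil {r u : ℕ} {L : List Node} (h : StairLike r u L) {nd : Node}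
    (hnd : nd ∈ L) : nd.inner = [] := by
  induction L generalizing u with
  | nil => simp at hnd
  | cons nd' L ih =>
    rcases List.mem_cons.1 hnd with rfl | h1
    · exact h.2.2.2.2.1
    · exact ih h.2.2.2.2.2 h1

/-- The string comes from -∞, so it first needs a turn to the left; this is why `M` must also bound
`a`. Then the staircase takes over. -/
theorem exists_fullStair {a b X₀ M : ℕ} {X Y : Multiset ℕ} (ha : Odd a) (hb : Odd b) (haM : a ≤ M)
    (hbX : b < X₀) (hXM : X₀ ≤ M) (hX : ∀ x ∈ X, Even x ∧ 0 < x ∧ x ≤ M)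
    (hY : ∀ y ∈ Y, Even y ∧ 0 < y) (hYM : ∀ y₁ y₂ : ℕ, {y₁, y₂} ≤ Y → M < y₁ + y₂)
    (hS : a + (X₀ + X.sum) = b + Y.sum) : ∃ L, FullStair b (X.card + 1 + Y.card) a L ∧
      endsOf false L = X₀ ::ₘ X ∧ endsOf true L = Y := by
  rcases exists_turn (b := b) (S := X₀ + X.sum) ha haM (by omega) hY hYM (by omega) with
    ⟨c', Y', h1, rfl, h2⟩ | ⟨c₁, y, c', Y', h1, h2, h3, h4, rfl, rfl, h6⟩
  · obtain ⟨L, hL, h3, h4⟩ := exists_stair hb hbX hXM _ X Y' c' rfl hX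
      (fun y hy => hY y (by simp [hy]))
      (fun y₁ y₂ h => hYM y₁ y₂ (h.trans (Multiset.le_cons_self _ _))) h1 h2
    rw [show X.card + 1 + ((a + c') ::ₘ Y').card = X.card + 1 + Y'.card + 1 by
      rw [Multiset.card_cons]; omega]
    refine ⟨_, FullStair.bend ha h1 hL, ?_, ?_⟩
    · rw [endsOf_cons, h3, if_neg (by simp), zero_add]
    · rw [endsOf_cons, h4, if_pos rfl, ends_of_nil, Multiset.singleton_add]
  · obtain ⟨L, hL, h7, h8⟩ := exists_stair hb hbX hXM _ X Y' c' rfl hX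
      (fun y hy => hY y (by simp [hy]))
      (fun y₁ y₂ h => hYM y₁ y₂ (h.trans ((Multiset.le_cons_self _ _).trans
            (Multiset.le_cons_self _ _)))) h2 h6
    rw [show X.card + 1 + (y ::ₘ (c₁ + c') ::ₘ Y').card = X.card + 1 + Y'.card + 2 by
      rw [Multiset.card_cons, Multiset.card_cons]; omega]
    refine ⟨_, FullStair.cutBend h1 h2 h3 h4 hL, ?_, ?_⟩
    · rw [endsOf_cons, endsOf_cons, h7, if_neg (by simp), if_neg (by simp), zero_add, zero_add]
    · rw [endsOf_cons, endsOf_cons, h8, if_pos rfl, if_pos rfl, ends_of_nil, ends_of_nil,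
        Multiset.singleton_add, Multiset.singleton_add]

end Stairs


/-! ### Covers that start with a staircase are k-mixed. -/

section Mixed

theorem touches_iff {k : ℕ} {e : Edge} : Touches k e ↔ ∃ x, 1 ≤ x ∧ x ≤ k ∧ Incident x e := by
  constructor
  · rintro (h | h)
    · exact ⟨_, h.1, h.2, Or.inl rfl⟩
    · exact ⟨_, h.1, h.2, Or.inr rfl⟩
  · rintro ⟨x, h1, h2, rfl | rfl⟩
    · exact Or.inl ⟨h1, h2⟩
    · exact Or.inr ⟨h1, h2⟩

theorem restrictTo_add (k : ℕ) (A B : Multiset Edge) :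
    restrictTo k (A + B) = restrictTo k A + restrictTo k B := by
  simp [restrictTo, Multiset.filter_add]

theorem restrictTo_singleton {k : ℕ} {e : Edge} (h : Touches k e) :
    restrictTo k {e} = {⟨e.left, min e.right (k + 1), e.weight⟩} := by
  rw [restrictTo, Multiset.filter_singleton, if_pos h, Multiset.map_singleton]

theorem cover_eq_cons (r u w : ℕ) (L : List Node) :
    ∃ R, cover r u w L = seg u (nextPos r L) w ::ₘ R ∧
      ∀ e ∈ R, ∀ x, Incident x e → x = 0 ∨ x = r + 1 ∨ x ∈ nodeVerts L := by
  obtain ⟨R, hR, hR'⟩ := colouredCover_eq_cons r (fun _ => 1) u w L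
  refine ⟨R.map Prod.fst, ?_, fun e he => ?_⟩
  · rw [← colouredCover_map r (fun _ => 1), hR, Multiset.map_cons]
  · obtain ⟨e, he', rfl⟩ := Multiset.mem_map.1 he
    exact hR' e he'

theorem cover_append (r : ℕ) (L' : List Node) (u w : ℕ) (L : List Node) :
    ∃ A, cover r u w (L ++ L') = A + cover r (lastPos u L) (lastWt w L) L' ∧
      ∀ e ∈ A, ∀ x, Incident x e → x = u ∨ x = 0 ∨ x = r + 1 ∨ x ∈ nodeVerts L := by
  obtain ⟨A, hA, hA'⟩ := colouredCover_append r (fun _ => 1) L' u w L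
  refine ⟨A.map Prod.fst, ?_, fun e he => ?_⟩
  · rw [← colouredCover_map r (fun _ => 1), hA, Multiset.map_add, colouredCover_map]
  · obtain ⟨e, he', rfl⟩ := Multiset.mem_map.1 he
    exact hA' e he'

variable {r k : ℕ} {L' : List Node}

/-- Ends at +∞ and the string edge that leaves the first k vertices are both truncated at k + 1,
where the smaller cover has its right ends. -/
theorem restrictTo_cover (hkr : k ≤ r) (hL' : ∀ x ∈ nodeVerts L', k < x) :
    ∀ {u w : ℕ} {L : List Node}, (∀ nd ∈ L, 1 ≤ nd.pos ∧ nd.pos ≤ k ∧ nd.inner = []) →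
      u ≤ k → (L = [] → 1 ≤ u) → restrictTo k (cover r u w (L ++ L')) = cover k u w L
  | u, w, [], _, hu, hu1 => by
    have hnext : k < nextPos r L' := by
      rcases L' with _ | ⟨nd, L'⟩
      · exact Nat.lt_succ_of_le hkr
      · exact hL' _ (by simp [nodeVerts_cons, nextPos])
    obtain ⟨R, hR, hR'⟩ := cover_eq_cons r u w L'
    have h1 : cover k u w [] = {seg u (k + 1) w} := by simp [cover, stringEdges, tailsOf]
    have h2 : restrictTo k R = 0 := by
      rw [restrictTo, Multiset.filter_eq_nil.2, Multiset.map_zero]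
      intro e he ht
      obtain ⟨x, hx1, hx2, hx⟩ := touches_iff.1 ht
      rcases hR' e he x hx with h3 | h3 | h3
      · omega
      · omega
      · have := hL' x h3
        omega
    have ht : Touches k (seg u (nextPos r L') w) :=
      touches_iff.2 ⟨u, hu1 rfl, hu, incident_seg.2 (Or.inl rfl)⟩
    rw [List.nil_append, hR, ← Multiset.singleton_add, restrictTo_add, h2, restrictTo_singleton ht, h1,
      seg_of_lt (show u < nextPos r L' by omega), seg_of_lt (show u < k + 1 by omega), add_zero]
    congr 2
    dsimp only
    omega
  | u, w, nd :: L, h, hu, _ => by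
    obtain ⟨h1, h2, h3⟩ := h nd (by simp)
    rw [List.cons_append, cover_cons, cover_cons, restrictTo_add, restrictTo_add,
      restrictTo_cover hkr hL' (fun nd' h' => h nd' (by simp [h'])) h2 (fun _ => h1), h3, tailEdges,
      tailEdges, restrictTo_singleton (touches_iff.2 ⟨nd.pos, h1, h2, incident_seg.2 (Or.inr rfl)⟩),
      restrictTo_singleton (touches_iff.2 ⟨nd.pos, h1, h2, incident_seg.2 (Or.inl rfl)⟩)]
    congr 3
    · unfold seg
      congr 1
      dsimp only
      omega
    · unfold seg Node.far
      congr 1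
      · dsimp only
        split_ifs <;> omega
      · dsimp only
        split_ifs <;> omega

theorem filter_stringEdges_not_touches {nd : Node} {L'' : List Node} (hkr : k ≤ r)
    (hL' : ∀ x ∈ nodeVerts (nd :: L''), k < x) :
    ∀ {u w : ℕ} {L : List Node}, (∀ nd ∈ L, 1 ≤ nd.pos ∧ nd.pos ≤ k) →
      u ≤ k → (L = [] → 1 ≤ u) →
      (stringEdges r u w (L ++ nd :: L'')).filter (fun e => ¬ Touches k e) =
        stringEdges r nd.pos nd.wt L''
  | u, w, [], _, hu, hu1 => by
    have ht : ¬ ¬ Touches k (seg u nd.pos w) := not_not.2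
      (touches_iff.2 ⟨u, hu1 rfl, hu, incident_seg.2 (Or.inl rfl)⟩)
    rw [List.nil_append, stringEdges, Multiset.filter_cons_of_neg (p := fun e => ¬ Touches k e) _ ht,
      Multiset.filter_eq_self]
    intro e he ht
    obtain ⟨x, hx1, hx2, hx⟩ := touches_iff.1 ht
    rcases incident_stringEdges he hx with h3 | h3 | h3
    · have := hL' nd.pos (by simp [nodeVerts_cons])
      omega
    · omega
    · obtain ⟨nd', h4, rfl⟩ := List.mem_map.1 h3
      have := hL' nd'.pos (pos_mem_nodeVerts (by simp [h4]))
      omega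
  | u, w, nd₀ :: L, h, hu, _ => by
    obtain ⟨h1, h2⟩ := h nd₀ (by simp)
    have ht : ¬ ¬ Touches k (seg u nd₀.pos w) := not_not.2
      (touches_iff.2 ⟨nd₀.pos, h1, h2, incident_seg.2 (Or.inr rfl)⟩)
    rw [List.cons_append, stringEdges, Multiset.filter_cons_of_neg (p := fun e => ¬ Touches k e) _ ht]
    exact filter_stringEdges_not_touches hkr hL' (fun nd' h' => h nd' (by simp [h'])) h2 fun _ => h1

theorem lastPos_mem {u : ℕ} : ∀ {L : List Node}, L ≠ [] → lastPos u L ∈ nodeVerts L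
  | [], h => absurd rfl h
  | [nd], _ => by simp [lastPos, nodeVerts_cons]
  | nd :: nd' :: L, _ => by
    have := lastPos_mem (u := nd.pos) (L := nd' :: L) (by simp)
    rw [nodeVerts_cons]
    rw [lastPos]
    exact List.mem_cons_of_mem _ (List.mem_append_right _ this)

/-- The string edge after the staircase is the only edge between the first k vertices and the
others. It is a leaf edge of the subgraph, and the string behind it is connected. -/
theorem GoodNodes.isMixedZigzag {a b : ℕ} {L : List Node} (h : GoodNodes r a (L ++ L'))
    (hL : FullStair b k a L) (hL' : L' ≠ []) (hk : ∀ x ∈ nodeVerts L', k < x) :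
    IsMixedZigzag r k (cover r 0 a (L ++ L')) := by
  obtain ⟨nd, L'', rfl⟩ := List.exists_cons_of_ne_nil hL'
  have hgood := hL.goodNodes
  have hndk : k < nd.pos := hk _ (by simp [nodeVerts_cons])
  have hndr : nd.pos ≤ r := (h.bounds (by simp)).2
  have hkr : k ≤ r := by omega
  have hlike := hL.stairLike
  have hnodes : ∀ nd ∈ L, 1 ≤ nd.pos ∧ nd.pos ≤ k := fun nd hnd => hgood.bounds hnd
  have hr := restrictTo_cover (w := a) hkr hk (fun nd hnd => ⟨(hnodes nd hnd).1, (hnodes nd hnd).2,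
    hlike.inner_eq_nil hnd⟩) (Nat.zero_le k) (fun h0 => absurd h0 hL.ne_nil)
  obtain ⟨A, hA, hA'⟩ := cover_append r (nd :: L'') 0 a L
  obtain ⟨B, hB, hB'⟩ := cover_eq_cons r (lastPos 0 L) (lastWt a L) (nd :: L'')
  have hlast : 1 ≤ lastPos 0 L ∧ lastPos 0 L ≤ k := (hgood.mem_verts _).1 (lastPos_mem hL.ne_nil)
  -- the edges that are adjacent both to `C'` and to another vertex
  have key : ∀ e ∈ A + B, Touches k e → ∀ v, k < v → v ≤ r → ¬ Incident v e := by
    intro e he ht v h1 h2 hv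
    rcases Multiset.mem_add.1 he with he | he
    · rcases hA' e he v hv with h3 | h3 | h3 | h3
      · omega
      · omega
      · omega
      · have := ((hgood.mem_verts v).1 h3).2
        omega
    · obtain ⟨x, hx1, hx2, hx⟩ := touches_iff.1 ht
      rcases hB' e he x hx with h3 | h3 | h3
      · omega
      · omega
      · have := hk x h3
        omega
  have hM : cover r 0 a (L ++ nd :: L'') =
      seg (lastPos 0 L) nd.pos (lastWt a L) ::ₘ (A + B) := by
    rw [hA, hB, Multiset.add_cons]
    rfl
  refine ⟨hkr, _, _, h.isZigzagWith, fun v h1 h2 => ?_, ?_, ?_⟩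
  · have h3 : (A + B).filter (fun e => Touches k e ∧ e.right = v) = 0 :=
      Multiset.filter_eq_nil.2 fun e he hv => key e he hv.1 v h1 h2 (Or.inr hv.2)
    rw [hM, ← Multiset.singleton_add, Multiset.filter_add, h3, add_zero, Multiset.filter_singleton]
    split_ifs <;> simp
  · rw [hr]
    refine hgood.isUniversallyMonotone ?_ hlike
    rw [← colouredCover_map _ (fun _ => 1)]
    refine (hgood.goodCover _).isTropicalCover (by omega) ?_
    rw [colouredCover_map]
    exact edgesConnected_cover _ _ _ _ fun x hx => (hgood.mem_verts x).1 hx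
  · rw [filter_stringEdges_not_touches hkr hk hnodes (Nat.zero_le k) (fun h0 => absurd h0 hL.ne_nil)]
    refine edgesConnected_stringEdges r _ _ _ fun nd' hnd' => ?_
    have h1 : k < nd'.pos := hk _ (pos_mem_nodeVerts (by simp [hnd']))
    have h2 : nd'.pos ≤ r := (h.bounds (by simp [hnd'])).2
    refine ⟨h1, h2, fun e he ht hv => ?_⟩
    rw [hM, Multiset.mem_cons] at he
    rcases he with rfl | he
    · rw [incident_seg] at hv
      have hn := nodup_pos h.nodup
      rw [List.map_append, List.nodup_append] at hn
      have hn' := hn.2.1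
      rw [List.map_cons, List.nodup_cons] at hn'
      rcases hv with hv | hv
      · omega
      · exact hn'.1 (hv ▸ List.mem_map_of_mem hnd')
    · exact key e he ht _ h1 h2 hv

end Mixed


/-! ### Tails attached one after the other to a string that runs to the right. -/

section Ladder

/-- Tails of weight `g.1` with `g.2` further vertices. -/
def TailsOK (l : List (ℕ × ℕ)) : Prop := ∀ g ∈ l, Even g.1 ∧ 0 < g.1 ∧ (g.2 ≠ 0 → Odd (g.1 / 2))

def ladderSize (l : List (ℕ × ℕ)) : ℕ := (l.map fun g => g.2 + 1).sum

/-- The weights of the ends of the given tails. -/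
def ladderEnds (l : List (ℕ × ℕ)) : Multiset ℕ :=
  (l.map fun g => if Even g.2 then {g.1} else {g.1 / 2, g.1 / 2}).sum

/-- In-tails that are attached, one after the other, to a string that runs to the right; `t` is the
last vertex before them, and `w` is the weight with which the string arrives. -/
def inLadder : ℕ → ℕ → List (ℕ × ℕ) → List Node
  | _, _, [] => []
  | t, w, g :: l => ⟨t + g.2 + 1, false, g.1, (List.range g.2).map fun i => t + g.2 - i, w + g.1⟩ ::
      inLadder (t + g.2 + 1) (w + g.1) l

/-- Out-tails that are attached, one after the other, to a string that runs to the right; `t` is the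
last vertex before them, and `w` is the weight with which the string leaves. -/
def outLadder (w : ℕ) : ℕ → List (ℕ × ℕ) → List Node
  | _, [] => []
  | t, g :: l => ⟨t + 1, true, g.1, (List.range g.2).map fun i => t + 2 + i,
      w + (l.map Prod.fst).sum⟩ :: outLadder w (t + g.2 + 1) l

theorem Ioc_val_add {a b c : ℕ} (hab : a ≤ b) (hbc : b ≤ c) :
    (Finset.Ioc a b).val + (Finset.Ioc b c).val = (Finset.Ioc a c).val := by
  rw [← Finset.Ioc_union_Ioc_eq_Ioc hab hbc, ← Finset.disjUnion_eq_union _ _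
    (Finset.Ioc_disjoint_Ioc_of_le le_rfl)]
  rfl

theorem lastWt_inLadder (l : List (ℕ × ℕ)) : ∀ t w, lastWt w (inLadder t w l) =
    w + (l.map Prod.fst).sum := by
  induction l with
  | nil => simp [inLadder, lastWt]
  | cons g l ih =>
    intro t w
    rw [inLadder, lastWt, ih, List.map_cons, List.sum_cons, add_assoc]

theorem lastWt_outLadder (w : ℕ) (l : List (ℕ × ℕ)) : ∀ t,
    lastWt (w + (l.map Prod.fst).sum) (outLadder w t l) = w := by
  induction l with
  | nil => simp [outLadder, lastWt]
  | cons g l ih =>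
    intro t
    rw [outLadder, lastWt, ih]

theorem verts_inLadder (l : List (ℕ × ℕ)) : ∀ t w, (nodeVerts (inLadder t w l) : Multiset ℕ) =
    (Finset.Ioc t (t + ladderSize l)).val := by
  induction l with
  | nil => intro t w; simp [inLadder, nodeVerts, ladderSize]
  | cons g l ih =>
    intro t w
    have h1 : ladderSize (g :: l) = g.2 + 1 + ladderSize l := rfl
    rw [h1, ← add_assoc, ← Ioc_val_add (b := t + (g.2 + 1)) (by omega) (by omega), inLadder, nodeVerts_cons,
      ← List.cons_append, ← Multiset.coe_add]
    congr 1
    · refine Multiset.Nodup.ext ?_ (Finset.nodup _) |>.2 fun x => ?_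
      · rw [Multiset.coe_nodup, List.nodup_cons]
        constructor
        · simp only [List.mem_map, List.mem_range, not_exists, not_and]
          intro i hi
          omega
        · refine List.Nodup.map_on ?_ List.nodup_range
          intro x hx y hy hxy
          rw [List.mem_range] at hx hy
          omega
      · simp only [Multiset.mem_coe, List.mem_cons, List.mem_map, List.mem_range, Finset.mem_val,
          Finset.mem_Ioc]
        constructor
        · rintro (rfl | ⟨i, hi, rfl⟩) <;> omega
        · intro hx
          by_cases hx' : x = t + g.2 + 1
          · exact Or.inl hx'
          · exact Or.inr ⟨t + g.2 - x, by omega, by omega⟩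
    · exact ih _ _

theorem verts_outLadder (w : ℕ) (l : List (ℕ × ℕ)) : ∀ t, (nodeVerts (outLadder w t l) : Multiset ℕ) =
    (Finset.Ioc t (t + ladderSize l)).val := by
  induction l with
  | nil => intro t; simp [outLadder, nodeVerts, ladderSize]
  | cons g l ih =>
    intro t
    have h1 : ladderSize (g :: l) = g.2 + 1 + ladderSize l := rfl
    rw [h1, ← add_assoc, ← Ioc_val_add (b := t + (g.2 + 1)) (by omega) (by omega), outLadder, nodeVerts_cons,
      ← List.cons_append, ← Multiset.coe_add]
    congr 1
    · refine Multiset.Nodup.ext ?_ (Finset.nodup _) |>.2 fun x => ?_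
      · rw [Multiset.coe_nodup, List.nodup_cons]
        constructor
        · simp only [List.mem_map, List.mem_range, not_exists, not_and]
          intro i hi
          omega
        · refine List.Nodup.map_on ?_ List.nodup_range
          intro x hx y hy hxy
          omega
      · simp only [Multiset.mem_coe, List.mem_cons, List.mem_map, List.mem_range, Finset.mem_val,
          Finset.mem_Ioc]
        constructor
        · rintro (rfl | ⟨i, hi, rfl⟩) <;> omega
        · intro hx
          by_cases hx' : x = t + 1
          · exact Or.inl hx'
          · exact Or.inr ⟨x - (t + 2), by omega, by omega⟩
    · exact ih _

theorem ends_length_range (p : ℕ) (o : Bool) (x n : ℕ) (f : ℕ → ℕ) (c : ℕ) :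
    (Node.mk p o x ((List.range n).map f) c).ends = if Even n then {x} else {x / 2, x / 2} := by
  simp [Node.ends]

theorem endsOf_inLadder (o : Bool) (l : List (ℕ × ℕ)) : ∀ t w, endsOf o (inLadder t w l) =
    if o = false then ladderEnds l else 0 := by
  induction l with
  | nil => intro t w; simp [inLadder, endsOf, ladderEnds]
  | cons g l ih =>
    intro t w
    rw [inLadder, endsOf_cons, ih, ends_length_range]
    cases o <;> simp [ladderEnds]

theorem endsOf_outLadder (o : Bool) (w : ℕ) (l : List (ℕ × ℕ)) : ∀ t, endsOf o (outLadder w t l) =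
    if o = true then ladderEnds l else 0 := by
  induction l with
  | nil => intro t; simp [outLadder, endsOf, ladderEnds]
  | cons g l ih =>
    intro t
    rw [outLadder, endsOf_cons, ih, ends_length_range]
    cases o <;> simp [ladderEnds]

theorem cycles_inLadder (l : List (ℕ × ℕ)) : ∀ t w,
    ((inLadder t w l).map fun nd => nd.inner.length / 2).sum = (l.map fun g => g.2 / 2).sum := by
  induction l with
  | nil => intro t w; rfl
  | cons g l ih => intro t w; simp [inLadder, ih]

theorem cycles_outLadder (w : ℕ) (l : List (ℕ × ℕ)) : ∀ t,
    ((outLadder w t l).map fun nd => nd.inner.length / 2).sum = (l.map fun g => g.2 / 2).sum := by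
  induction l with
  | nil => intro t; rfl
  | cons g l ih => intro t; simp [outLadder, ih]

theorem inLadder_next (r t w : ℕ) (l : List (ℕ × ℕ)) (L' : List Node) {t' : ℕ} (ht : t' ≤ t)
    (hN : t + ladderSize l < nextPos r L') : t' < nextPos r (inLadder t w l ++ L') := by
  cases l with
  | nil =>
    rw [inLadder, List.nil_append]
    simp [ladderSize] at hN
    omega
  | cons g l =>
    show t' < t + g.2 + 1
    omega

theorem outLadder_next (r w t : ℕ) (l : List (ℕ × ℕ)) (L' : List Node) {t' : ℕ} (ht : t' ≤ t)
    (hN : t + ladderSize l < nextPos r L') : t' < nextPos r (outLadder w t l ++ L') := by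
  cases l with
  | nil =>
    rw [outLadder, List.nil_append]
    simp [ladderSize] at hN
    omega
  | cons g l =>
    show t' < t + 1
    omega

theorem valid_inLadder {r : ℕ} {L' : List Node} : ∀ {l : List (ℕ × ℕ)} {t w u : ℕ}, TailsOK l →
    Odd w → 1 ≤ u → u ≤ t →
    (∀ p, 1 ≤ p → p ≤ t + ladderSize l → ValidNodes r p (w + (l.map Prod.fst).sum) L') →
    t + ladderSize l < nextPos r L' → ValidNodes r u w (inLadder t w l ++ L')
  | [], t, w, u, _, hw, h1, h2, hL', _ => by
    have := hL' u h1 (by omega)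
    simpa [inLadder] using this
  | g :: l, t, w, u, hl, hw, h1, h2, hL', hN => by
    have hg := hl g (by simp)
    have hs : ladderSize (g :: l) = g.2 + 1 + ladderSize l := rfl
    rw [hs] at hL' hN
    refine ⟨hw, ⟨hg.1, hg.2.1, ?_, ?_, ?_⟩, valid_inLadder (fun g' h' => hl g' (by simp [h']))
      (hw.add_even hg.1) (by simp) le_rfl ?_ (by omega)⟩
    · intro h
      refine hg.2.2 fun h0 => h ?_
      rw [h0]; rfl
    · rw [List.pairwise_cons]
      constructor
      · intro x hx
        obtain ⟨i, hi, rfl⟩ := List.mem_map.1 hx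
        rw [List.mem_range] at hi
        show t + g.2 - i < t + g.2 + 1
        omega
      · rw [List.pairwise_map]
        refine List.Pairwise.imp_of_mem ?_ List.pairwise_lt_range
        intro i j hi hj hij
        rw [List.mem_range] at hi hj
        show t + g.2 - j < t + g.2 - i
        omega
    · right; right; right; left
      refine ⟨by show u < t + g.2 + 1; omega, ?_, rfl, rfl⟩
      exact inLadder_next r _ _ l L' le_rfl (by omega)
    · intro p h3 h4
      have := hL' p h3 (by omega)
      rwa [List.map_cons, List.sum_cons, ← add_assoc] at this

theorem valid_outLadder {r w : ℕ} {L' : List Node} : ∀ {l : List (ℕ × ℕ)} {t u : ℕ}, TailsOK l →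
    Odd w → 1 ≤ u → u ≤ t →
    (∀ p, 1 ≤ p → p ≤ t + ladderSize l → ValidNodes r p w L') →
    t + ladderSize l < nextPos r L' →
    ValidNodes r u (w + (l.map Prod.fst).sum) (outLadder w t l ++ L')
  | [], t, u, _, hw, h1, h2, hL', _ => by
    have := hL' u h1 (by omega)
    simpa [outLadder] using this
  | g :: l, t, u, hl, hw, h1, h2, hL', hN => by
    have hg := hl g (by simp)
    have hs : ladderSize (g :: l) = g.2 + 1 + ladderSize l := rfl
    rw [hs] at hL' hN
    have heven : Even ((g :: l).map Prod.fst).sum := by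
      have : ∀ l : List (ℕ × ℕ), TailsOK l → Even (l.map Prod.fst).sum := by
        intro l
        induction l with
        | nil => intro _; simp
        | cons g l ih =>
          intro h
          rw [List.map_cons, List.sum_cons]
          exact (h g (by simp)).1.add (ih fun g' h' => h g' (by simp [h']))
      exact this _ hl
    refine ⟨hw.add_even heven, ⟨hg.1, hg.2.1, ?_, ?_, ?_⟩, valid_outLadder
      (fun g' h' => hl g' (by simp [h'])) hw (by simp) ?_ ?_ (by omega)⟩
    · intro h
      refine hg.2.2 fun h0 => h ?_
      rw [h0]; rfl
    · rw [List.pairwise_cons]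
      constructor
      · intro x hx
        obtain ⟨i, hi, rfl⟩ := List.mem_map.1 hx
        show t + 1 < t + 2 + i
        omega
      · rw [List.pairwise_map]
        refine List.Pairwise.imp ?_ List.pairwise_lt_range
        intro i j hij
        show t + 2 + i < t + 2 + j
        omega
    · right; right; left
      refine ⟨by show u < t + 1; omega, ?_, rfl, ?_⟩
      · exact outLadder_next r _ _ l L' (t' := t + 1) (by omega) (by omega)
      · rw [List.map_cons, List.sum_cons]
        dsimp only
        omega
    · show t + 1 ≤ _
      omega
    · intro p h3 h4
      exact hL' p h3 (by omega)

end Ladder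

/-! ### The long zigzag whose vertices can be permuted. -/

section Zone

variable {m : ℕ}

/-- A zigzag of bends with tails of weight two, each ending in a fork; the out-bends and their forks
and the in-bends and their forks lie in four zones, in each of which they are arranged by a
permutation. -/
def zone (T : ℕ) (q : Fin 4 → Perm (Fin m)) (l : List (Fin m)) : List Node :=
  l.flatMap fun i => [⟨T + 2 * m + q 2 i + 1, true, 2, [T + 3 * m + q 3 i + 1], 1⟩,
    ⟨T + m + q 1 i + 1, false, 2, [T + q 0 i + 1], 1⟩]

theorem zone_cons (T : ℕ) (q : Fin 4 → Perm (Fin m)) (i : Fin m) (l : List (Fin m)) :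
    zone T q (i :: l) = ⟨T + 2 * m + q 2 i + 1, true, 2, [T + 3 * m + q 3 i + 1], 1⟩ ::
      ⟨T + m + q 1 i + 1, false, 2, [T + q 0 i + 1], 1⟩ :: zone T q l := rfl

theorem lastWt_zone (T : ℕ) (q : Fin 4 → Perm (Fin m)) (l : List (Fin m)) :
    lastWt 1 (zone T q l) = 1 := by
  induction l with
  | nil => rfl
  | cons i l ih => exact ih

theorem endsOf_zone (o : Bool) (T : ℕ) (q : Fin 4 → Perm (Fin m)) (l : List (Fin m)) :
    endsOf o (zone T q l) = Multiset.replicate (2 * l.length) 1 := by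
  induction l with
  | nil => rfl
  | cons i l ih =>
    rw [zone_cons, endsOf_cons, endsOf_cons, ih, List.length_cons, Nat.mul_add, mul_one, add_comm,
      Multiset.replicate_add]
    cases o
    · simp [Node.ends]
      rw [add_comm]; rfl
    · simp [Node.ends]

theorem cycles_zone (T : ℕ) (q : Fin 4 → Perm (Fin m)) (l : List (Fin m)) :
    ((zone T q l).map fun nd => nd.inner.length / 2).sum = 0 := by
  induction l with
  | nil => rfl
  | cons i l ih => simp [zone_cons, ih]

/-- Forks of in-bends, in-bends, out-bends and forks of out-bends occupy four consecutive blocks of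
m points in this order. Validity compares only points of different blocks, so the permutations
inside the blocks are arbitrary. -/
theorem valid_zone {r T : ℕ} {q : Fin 4 → Perm (Fin m)} {L' : List Node}
    (hL' : ∀ p, 1 ≤ p → p ≤ T + 2 * m → ValidNodes r p 1 L') (hN : T + 2 * m < nextPos r L') :
    ∀ {l : List (Fin m)} {u : ℕ}, 1 ≤ u → u ≤ T + 2 * m → ValidNodes r u 1 (zone T q l ++ L')
  | [], u, h1, h2 => hL' u h1 h2
  | i :: l, u, h1, h2 => by
    have h0 := (q 0 i).2
    have h3 := (q 1 i).2
    have hodd : Odd 1 := odd_one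
    refine ⟨hodd, ⟨even_two, by simp, fun _ => by norm_num, ?_, ?_⟩, hodd,
      ⟨even_two, by simp, fun _ => by norm_num, ?_, ?_⟩, valid_zone hL' hN ?_ ?_⟩
    · rw [List.pairwise_cons]
      refine ⟨fun x hx => ?_, by simp⟩
      rw [List.mem_singleton.1 hx]
      show T + 2 * m + q 2 i + 1 < T + 3 * m + q 3 i + 1
      have := (q 2 i).2
      omega
    · left
      refine ⟨?_, ?_, rfl, rfl⟩
      · show u < T + 2 * m + q 2 i + 1
        omega
      · show T + m + q 1 i + 1 < T + 2 * m + q 2 i + 1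
        omega
    · rw [List.pairwise_cons]
      refine ⟨fun x hx => ?_, by simp⟩
      rw [List.mem_singleton.1 hx]
      show T + q 0 i + 1 < T + m + q 1 i + 1
      omega
    · right; left
      refine ⟨?_, ?_, rfl, rfl⟩
      · show T + m + q 1 i + 1 < T + 2 * m + q 2 i + 1
        omega
      · cases l with
        | nil =>
          show T + m + q 1 i + 1 < nextPos r L'
          omega
        | cons j l =>
          show T + m + q 1 i + 1 < T + 2 * m + q 2 j + 1
          omega
    · show 1 ≤ T + m + q 1 i + 1
      omega
    · show T + m + q 1 i + 1 ≤ T + 2 * m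
      omega

theorem map_perm_val (c : ℕ) (σ : Perm (Fin m)) :
    (Finset.univ : Finset (Fin m)).val.map (fun i => c + σ i + 1) = (Finset.Ioc c (c + m)).val := by
  refine Multiset.Nodup.ext ?_ (Finset.nodup _) |>.2 fun x => ?_
  · refine Multiset.Nodup.map ?_ (Finset.nodup _)
    intro i j hij
    have : (σ i : ℕ) = σ j := by simp only at hij; omega
    exact σ.injective (Fin.ext this)
  · simp only [Multiset.mem_map, Finset.mem_val, Finset.mem_univ, true_and, Finset.mem_Ioc]
    constructor
    · rintro ⟨i, rfl⟩
      have := (σ i).2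
      omega
    · intro hx
      refine ⟨σ.symm ⟨x - c - 1, by omega⟩, ?_⟩
      rw [Equiv.apply_symm_apply]
      dsimp only
      omega

theorem verts_zone (T : ℕ) (q : Fin 4 → Perm (Fin m)) :
    (nodeVerts (zone T q (List.finRange m)) : Multiset ℕ) = (Finset.Ioc T (T + 4 * m)).val := by
  have h : ∀ l : List (Fin m), (nodeVerts (zone T q l) : Multiset ℕ) =
      (l : Multiset (Fin m)).map (fun i => T + q 0 i + 1) +
        ((l : Multiset (Fin m)).map (fun i => T + m + q 1 i + 1) +
          ((l : Multiset (Fin m)).map (fun i => T + 2 * m + q 2 i + 1) +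
            (l : Multiset (Fin m)).map (fun i => T + 3 * m + q 3 i + 1))) := by
    intro l
    induction l with
    | nil => rfl
    | cons i l ih =>
      have h1 : (nodeVerts (zone T q (i :: l)) : Multiset ℕ) =
          (T + 2 * m + q 2 i + 1) ::ₘ (T + 3 * m + q 3 i + 1) ::ₘ (T + m + q 1 i + 1) ::ₘ
            (T + q 0 i + 1) ::ₘ (nodeVerts (zone T q l) : Multiset ℕ) := rfl
      rw [h1, ih]
      simp only [← Multiset.cons_coe, Multiset.map_cons]
      simp only [← Multiset.singleton_add]
      abel
  have hu : ((List.finRange m : List (Fin m)) : Multiset (Fin m)) = (Finset.univ : Finset (Fin m)).val :=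
    rfl
  rw [h, hu, map_perm_val, map_perm_val, map_perm_val, map_perm_val,
    show T + 2 * m + m = T + 3 * m by ring, show T + m + m = T + 2 * m by ring,
    show T + 3 * m + m = T + 4 * m by ring, Ioc_val_add (by omega) (by omega),
    Ioc_val_add (by omega) (by omega), Ioc_val_add (by omega) (by omega)]

end Zone

/-! ### The part of the string behind the staircase. -/

section Assembly

variable {m : ℕ}

/-- The part of the string outside the monotone part. -/
def tailNodes (k b : ℕ) (pI pO post : List (ℕ × ℕ)) (q : Fin 4 → Perm (Fin m)) : List Node :=
  inLadder k b pI ++ (outLadder 1 (k + ladderSize pI) pO ++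
    (zone (k + ladderSize pI + ladderSize pO) q (List.finRange m) ++
      inLadder (k + ladderSize pI + ladderSize pO + 4 * m) 1 post))

def totalSize (k : ℕ) (pI pO post : List (ℕ × ℕ)) (m : ℕ) : ℕ :=
  k + ladderSize pI + ladderSize pO + 4 * m + ladderSize post

variable {k a b : ℕ} {LC : List Node} {pI pO post : List (ℕ × ℕ)}

theorem verts_tailNodes (k b : ℕ) (pI pO post : List (ℕ × ℕ)) (q : Fin 4 → Perm (Fin m)) :
    (nodeVerts (tailNodes k b pI pO post q) : Multiset ℕ) =
      (Finset.Ioc k (totalSize k pI pO post m)).val := by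
  unfold tailNodes totalSize
  rw [nodeVerts_append, nodeVerts_append, nodeVerts_append, ← Multiset.coe_add, ← Multiset.coe_add,
    ← Multiset.coe_add, verts_inLadder, verts_outLadder, verts_zone, verts_inLadder,
    Ioc_val_add (by omega) (by omega), Ioc_val_add (by omega) (by omega),
    Ioc_val_add (by omega) (by omega)]

/-- The balance `hw` says that after the in-tails and the out-tails the string has weight one, as
the zigzag requires. -/
theorem FullStair.goodNodes_tailNodes (h : FullStair b k a LC) (hI : TailsOK pI) (hO : TailsOK pO)
    (hP : TailsOK post) (hw : b + (pI.map Prod.fst).sum = 1 + (pO.map Prod.fst).sum)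
    (q : Fin 4 → Perm (Fin m)) :
    GoodNodes (totalSize k pI pO post m) a (LC ++ tailNodes k b pI pO post q) := by
  refine ⟨?_, ?_, by simp [h.ne_nil]⟩
  · set r := totalSize k pI pO post m with hr
    unfold totalSize at hr
    -- the four parts, from the last one to the first one
    have v4 : ∀ p, 1 ≤ p → p ≤ k + ladderSize pI + ladderSize pO + 4 * m →
        ValidNodes r p 1 (inLadder (k + ladderSize pI + ladderSize pO + 4 * m) 1 post) := by
      intro p h1 h2
      have := valid_inLadder (r := r) (L' := []) hP odd_one h1 h2 (fun p h3 h4 => ⟨?_, by omega⟩)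
        (by show _ < r + 1; omega)
      · rwa [List.append_nil] at this
      · have h6 : ∀ l : List (ℕ × ℕ), TailsOK l → Odd (1 + (l.map Prod.fst).sum) := by
          intro l
          induction l with
          | nil => intro _; simp
          | cons g l ih =>
            intro hl
            rw [List.map_cons, List.sum_cons, add_left_comm, add_comm]
            exact (ih fun g' h' => hl g' (by simp [h'])).add_even (hl g (by simp)).1
        exact h6 post hP
    have n4 : k + ladderSize pI + ladderSize pO + 4 * m <
        nextPos r (inLadder (k + ladderSize pI + ladderSize pO + 4 * m) 1 post) := by
      have := inLadder_next r (k + ladderSize pI + ladderSize pO + 4 * m) 1 post [] le_rfl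
        (by show _ < r + 1; omega)
      rwa [List.append_nil] at this
    have v3 : ∀ p, 1 ≤ p → p ≤ k + ladderSize pI + ladderSize pO → ValidNodes r p 1
        (zone (k + ladderSize pI + ladderSize pO) q (List.finRange m) ++
          inLadder (k + ladderSize pI + ladderSize pO + 4 * m) 1 post) := fun p h1 h2 =>
      valid_zone (fun p h1 h2 => v4 p h1 (by omega)) (by omega) h1 (by omega)
    have n3 : k + ladderSize pI + ladderSize pO < nextPos r
        (zone (k + ladderSize pI + ladderSize pO) q (List.finRange m) ++
          inLadder (k + ladderSize pI + ladderSize pO + 4 * m) 1 post) := by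
      cases List.finRange m with
      | nil => exact lt_of_le_of_lt (by omega) n4
      | cons i l =>
        show _ < k + ladderSize pI + ladderSize pO + 2 * m + q 2 i + 1
        omega
    have n2 := outLadder_next r 1 (k + ladderSize pI) pO _ le_rfl n3
    refine h.valid (fun p h1 h2 => valid_inLadder hI h.odd h1 h2 (fun p h1 h2 => ?_) n2)
      (inLadder_next r k b pI _ le_rfl n2)
    rw [hw]
    exact valid_outLadder hO odd_one h1 h2 v3 n3
  · rw [nodeVerts_append, ← Multiset.coe_add, h.verts, verts_tailNodes]
    have h1 : ∀ N, Finset.Icc 1 N = Finset.Ioc 0 N := fun N => by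
      ext x
      rw [Finset.mem_Icc, Finset.mem_Ioc]
      omega
    rw [h1, h1]
    exact Ioc_val_add (Nat.zero_le _) (by unfold totalSize; omega)

theorem FullStair.lastWt_tailNodes (h : FullStair b k a LC)
    (hw : b + (pI.map Prod.fst).sum = 1 + (pO.map Prod.fst).sum) (q : Fin 4 → Perm (Fin m)) :
    lastWt a (LC ++ tailNodes k b pI pO post q) = 1 + (post.map Prod.fst).sum := by
  unfold tailNodes
  rw [lastWt_append, lastWt_append, lastWt_append, lastWt_append, h.lastWt_eq, lastWt_inLadder, hw,
    lastWt_outLadder, lastWt_zone, lastWt_inLadder]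

theorem endsOf_tailNodes_false (k b : ℕ) (pI pO post : List (ℕ × ℕ)) (q : Fin 4 → Perm (Fin m)) :
    endsOf false (tailNodes k b pI pO post q) =
      ladderEnds pI + Multiset.replicate (2 * m) 1 + ladderEnds post := by
  unfold tailNodes
  simp [endsOf_append, endsOf_inLadder, endsOf_outLadder, endsOf_zone, add_assoc]

theorem endsOf_tailNodes_true (k b : ℕ) (pI pO post : List (ℕ × ℕ)) (q : Fin 4 → Perm (Fin m)) :
    endsOf true (tailNodes k b pI pO post q) = ladderEnds pO + Multiset.replicate (2 * m) 1 := by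
  unfold tailNodes
  simp [endsOf_append, endsOf_inLadder, endsOf_outLadder, endsOf_zone]

theorem cycles_tailNodes (k b : ℕ) (pI pO post : List (ℕ × ℕ)) (q : Fin 4 → Perm (Fin m)) :
    ((tailNodes k b pI pO post q).map fun nd => nd.inner.length / 2).sum =
      (pI.map fun g => g.2 / 2).sum + (pO.map fun g => g.2 / 2).sum +
        (post.map fun g => g.2 / 2).sum := by
  unfold tailNodes
  simp [cycles_inLadder, cycles_outLadder, cycles_zone, add_assoc]

/-- A tail with its attachment has one vertex for each end and two for each symmetric cycle. With
the two ends of the string this is the number r of branch points. -/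
theorem length_nodeVerts : ∀ L : List Node, (nodeVerts L).length =
    (endsOf false L).card + (endsOf true L).card + 2 * (L.map fun nd => nd.inner.length / 2).sum
  | [] => rfl
  | nd :: L => by
    have h := Nat.even_or_odd nd.inner.length
    rw [nodeVerts_cons, endsOf_cons, endsOf_cons, List.length_cons, List.length_append,
      length_nodeVerts L, List.map_cons, List.sum_cons, Multiset.card_add, Multiset.card_add]
    have h1 : (if nd.out = false then nd.ends else 0).card +
        (if nd.out = true then nd.ends else 0).card = nd.ends.card := by
      cases nd.out <;> simp
    have h2 : nd.ends.card + 2 * (nd.inner.length / 2) = nd.inner.length + 1 := by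
      unfold Node.ends
      rcases h with h | h
      · rw [if_pos h, Multiset.card_singleton]
        have := Nat.two_mul_div_two_of_even h
        omega
      · rw [if_neg (Nat.not_even_iff_odd.2 h), Multiset.card_pair]
        have := Nat.two_mul_div_two_add_one_of_odd h
        omega
    omega

end Assembly


/-! ### Different permutations give different covers. -/

section Injective

theorem exists_cover_append (r : ℕ) : ∀ (u w : ℕ) (L : List Node),
    ∃ A, ∀ L', cover r u w (L ++ L') = A + cover r (lastPos u L) (lastWt w L) L'
  | u, w, [] => ⟨0, fun L' => by rw [zero_add]; rfl⟩
  | u, w, nd :: L => by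
    obtain ⟨A, hA⟩ := exists_cover_append r nd.pos nd.wt L
    exact ⟨_, fun L' => by rw [List.cons_append, cover_cons, hA, ← add_assoc]; rfl⟩

theorem cover_cons' (r u w : ℕ) (nd : Node) (L : List Node) : cover r u w (nd :: L) =
    {seg u nd.pos w} + (tailEdges (nd.far r) nd.tw nd.pos nd.inner + cover r nd.pos nd.wt L) := by
  rw [cover_cons, add_assoc]

theorem seg_injective {u x x' w : ℕ} (h : seg u x w = seg u x' w) : x = x' := by
  unfold seg at h
  rw [Edge.mk.injEq] at h
  omega

variable {r : ℕ}

/-- In the rest of the cover the next string edge is the only edge at `u`, so it can be read off. -/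
theorem nextPos_eq_of_cover_eq {u w : ℕ} {L L' : List Node} (hu : 1 ≤ u ∧ u ≤ r)
    (hL' : u ∉ nodeVerts L') (h : cover r u w L = cover r u w L') :
    nextPos r L = nextPos r L' := by
  obtain ⟨R, hR, -⟩ := cover_eq_cons r u w L
  obtain ⟨R', hR', hR''⟩ := cover_eq_cons r u w L'
  have h1 : seg u (nextPos r L) w ∈ cover r u w L' := by rw [← h, hR]; simp
  rw [hR', Multiset.mem_cons] at h1
  rcases h1 with h1 | h1
  · exact seg_injective h1
  · rcases hR'' _ h1 u (incident_seg.2 (Or.inl rfl)) with h2 | h2 | h2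
    · omega
    · omega
    · exact absurd h2 hL'

/-- The first edge of the tail is recognized by its weight, which differs from that of the string
edge and from that of the fork. -/
theorem inner_eq_of_cover_eq {p x x' far w w' : ℕ} {L L' : List Node} (hp : 1 ≤ p ∧ p ≤ r)
    (hww : w ≠ w') (hw0 : w ≠ 0) (hL' : p ∉ nodeVerts L')
    (h : tailEdges far w p [x] + cover r p w' L = tailEdges far w p [x'] + cover r p w' L') :
    x = x' := by
  obtain ⟨R', hR', hR''⟩ := cover_eq_cons r p w' L'
  have h1 : seg p x w ∈ tailEdges far w p [x'] + cover r p w' L' := by rw [← h]; simp [tailEdges]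
  rw [hR', Multiset.mem_add, Multiset.mem_cons] at h1
  have hne : ∀ a b, seg p x w ≠ seg a b (w / 2) := fun a b h2 => by
    have h3 := congrArg Edge.weight h2
    change w = w / 2 at h3
    omega
  rcases h1 with h1 | h1 | h1
  · simp only [tailEdges, Multiset.insert_eq_cons, Multiset.mem_cons, Multiset.mem_singleton, hne,
      or_false] at h1
    exact seg_injective h1
  · exact absurd (congrArg Edge.weight h1) hww
  · rcases hR'' _ h1 p (incident_seg.2 (Or.inl rfl)) with h2 | h2 | h2
    · omega
    · omega
    · exact absurd h2 hL'

/-- The permutations can be recovered from the cover. -/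
theorem zone_injective {m T : ℕ} {q q' : Fin 4 → Perm (Fin m)} {L' : List Node} :
    ∀ {l : List (Fin m)} {u : ℕ}, 1 ≤ u → u ≤ r →
      (∀ x ∈ nodeVerts (zone T q' l ++ L'), 1 ≤ x ∧ x ≤ r) →
      (u :: nodeVerts (zone T q' l ++ L')).Nodup →
      cover r u 1 (zone T q l ++ L') = cover r u 1 (zone T q' l ++ L') →
      ∀ i ∈ l, ∀ c, q c i = q' c i
  | [], _, _, _, _, _, _ => by simp
  | i :: l, u, h1, h2, hb, hn, h => by
    rw [zone_cons, List.cons_append, List.cons_append, nodeVerts_cons, nodeVerts_cons] at hb hn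
    rw [zone_cons, zone_cons, List.cons_append, List.cons_append, List.cons_append,
      List.cons_append] at h
    simp only [List.cons_append, List.nil_append, List.nodup_cons, List.mem_cons, not_or] at hb hn
    obtain ⟨⟨n1, n2, n3, n4, n5⟩, ⟨n6, n7, n8, n9⟩, ⟨n10, n11, n12⟩, ⟨n13, n14⟩, n15, n16⟩ := hn
    -- Following the string one reads off the out-bend, its fork, the in-bend and its fork; the
    -- edges already identified are cancelled each time.
    have e1 := nextPos_eq_of_cover_eq ⟨h1, h2⟩ (by
      simp only [nodeVerts_cons, List.mem_cons, List.cons_append, List.nil_append, not_or]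
      exact ⟨n1, n2, n3, n4, n5⟩) h
    have e1' : T + 2 * m + q 2 i + 1 = T + 2 * m + q' 2 i + 1 := e1
    rw [cover_cons' r u, cover_cons' r u] at h
    dsimp only at h
    rw [e1'] at h
    replace h := add_left_cancel h
    have hp := hb (T + 2 * m + q' 2 i + 1) (Or.inl rfl)
    have e2 := inner_eq_of_cover_eq hp (by norm_num) (by norm_num) (by
      simp only [nodeVerts_cons, List.mem_cons, List.cons_append, List.nil_append, not_or]
      exact ⟨n7, n8, n9⟩) h
    rw [e2] at h
    replace h := add_left_cancel h
    have e3 := nextPos_eq_of_cover_eq hp (by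
      simp only [nodeVerts_cons, List.mem_cons, List.cons_append, List.nil_append, not_or]
      exact ⟨n7, n8, n9⟩) h
    have e3' : T + m + q 1 i + 1 = T + m + q' 1 i + 1 := e3
    rw [cover_cons' r (T + 2 * m + q' 2 i + 1), cover_cons' r (T + 2 * m + q' 2 i + 1)] at h
    dsimp only at h
    rw [e3'] at h
    replace h := add_left_cancel h
    have hp' := hb (T + m + q' 1 i + 1) (Or.inr (Or.inr (Or.inl rfl)))
    have e4 := inner_eq_of_cover_eq hp' (by norm_num) (by norm_num) n14 h
    rw [e4] at h
    replace h := add_left_cancel h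
    have ih := zone_injective hp'.1 hp'.2 (fun x hx => hb x (by simp [hx]))
      (List.nodup_cons.2 ⟨n14, n16⟩) h
    intro j hj c
    rcases List.mem_cons.1 hj with rfl | hj
    · have a0 : q 0 j = q' 0 j := Fin.ext (by omega)
      have a1 : q 1 j = q' 1 j := Fin.ext (by omega)
      have a2 : q 2 j = q' 2 j := Fin.ext (by omega)
      have a3 : q 3 j = q' 3 j := Fin.ext (by omega)
      fin_cases c
      · exact a0
      · exact a1
      · exact a2
      · exact a3
    · exact ih j hj c

theorem FullStair.cover_injective {k a b m : ℕ} {LC : List Node} {pI pO post : List (ℕ × ℕ)}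
    (h : FullStair b k a LC) (hI : TailsOK pI) (hO : TailsOK pO)
    (hP : TailsOK post) (hw : b + (pI.map Prod.fst).sum = 1 + (pO.map Prod.fst).sum) :
    Function.Injective fun q : Fin 4 → Perm (Fin m) =>
      cover (totalSize k pI pO post m) 0 a (LC ++ tailNodes k b pI pO post q) := by
  intro q q' hqq
  set r := totalSize k pI pO post m with hr
  have hg := h.goodNodes_tailNodes hI hO hP hw q'
  rw [← hr] at hg
  have happ : ∀ q : Fin 4 → Perm (Fin m), LC ++ tailNodes k b pI pO post q =
      (LC ++ inLadder k b pI ++ outLadder 1 (k + ladderSize pI) pO) ++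
        (zone (k + ladderSize pI + ladderSize pO) q (List.finRange m) ++
          inLadder (k + ladderSize pI + ladderSize pO + 4 * m) 1 post) := fun q => by
    simp [tailNodes]
  dsimp only at hqq
  rw [happ, happ] at hqq
  rw [happ] at hg
  obtain ⟨A, hA⟩ := exists_cover_append r 0 a (LC ++ inLadder k b pI ++
    outLadder 1 (k + ladderSize pI) pO)
  rw [hA, hA, lastWt_append, lastWt_append, h.lastWt_eq, lastWt_inLadder, hw, lastWt_outLadder] at hqq
  have hne : LC ++ inLadder k b pI ++ outLadder 1 (k + ladderSize pI) pO ≠ [] := by simp [h.ne_nil]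
  have hmem := lastPos_mem (u := 0) hne
  have hu := (hg.mem_verts (lastPos 0 (LC ++ inLadder k b pI ++
    outLadder 1 (k + ladderSize pI) pO))).1 (by
      rw [nodeVerts_append]; exact List.mem_append_left _ hmem)
  have hn := hg.nodup
  rw [nodeVerts_append, List.nodup_append] at hn
  have := zone_injective hu.1 hu.2 (fun x hx => (hg.mem_verts x).1 (by
    rw [nodeVerts_append]; exact List.mem_append_right _ hx))
    (List.nodup_cons.2 ⟨fun hx => hn.2.2 _ hmem _ hx rfl, hn.2.1⟩) (add_left_cancel hqq)
  funext c
  exact Equiv.ext fun i => this i (List.mem_finRange i) c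

end Injective

/-! ### Bounds for the zigzag number by sums of multiplicities. -/

section Zigzag

variable {g n : ℕ} {lam mu : n.Partition} {k : ℕ}

theorem exists_of_mixedMultiplicity_ne_zero {M : Multiset Edge}
    (h : mixedMultiplicity g lam mu k M ≠ 0) (s : Fin (numBranch g lam mu) → ℤˣ) :
    ∃ T : RealTuple n (numBranch g lam mu), (T.realCover s).map Prod.fst = M := by
  have h1 : mixedMultiplicityAt g lam mu k M s ≠ 0 := fun h0 =>
    h (Nat.eq_zero_of_le_zero (h0 ▸ ciInf_le (OrderBot.bddBelow _) s))
  obtain ⟨⟨T, -, R, hR, -, hTR⟩⟩ := (Nat.card_ne_zero.1 h1).1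
  exact ⟨T, by rw [hTR, hR.forget]⟩

/-- A cover with nonzero multiplicity is produced by one of the finitely many tuples. Without
finiteness the sum in the zigzag number would be zero by default. -/
theorem finite_support_mixedMultiplicity : (Function.support fun M : {M : Multiset Edge //
    IsCoverOfType g lam mu M ∧ IsMixedZigzag (numBranch g lam mu) k M} =>
      mixedMultiplicity g lam mu k M.1).Finite := by
  refine Set.Finite.of_finite_image (f := Subtype.val) (Set.Finite.subset (Set.finite_range
    fun T : RealTuple n (numBranch g lam mu) => (T.realCover fun _ => 1).map Prod.fst) ?_)
    Subtype.val_injective.injOn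
  rintro _ ⟨M, hM, rfl⟩
  exact exists_of_mixedMultiplicity_ne_zero hM _

theorem le_mixedZigzagNumber {ι : Type*} [Fintype ι] (f : ι → Multiset Edge)
    (hf : Function.Injective f) (hM : ∀ i, IsCoverOfType g lam mu (f i))
    (hZ : ∀ i, IsMixedZigzag (numBranch g lam mu) k (f i)) {c : ℕ}
    (hc : ∀ i, c ≤ mixedMultiplicity g lam mu k (f i) * n) :
    Fintype.card ι * c ≤ mixedZigzagNumber g lam mu k * n := by
  classical
  let F : ι → {M : Multiset Edge // IsCoverOfType g lam mu M ∧
    IsMixedZigzag (numBranch g lam mu) k M} := fun i => ⟨f i, hM i, hZ i⟩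
  have hF : Function.Injective F := fun i j hij => hf (Subtype.ext_iff.1 hij)
  rw [mixedZigzagNumber, finsum_eq_sum_of_support_subset (s :=
    finite_support_mixedMultiplicity.toFinset ∪ Finset.univ.image F) _ (fun M hM => by
      simp only [Finset.coe_union, Set.Finite.coe_toFinset]
      exact Or.inl hM)]
  calc Fintype.card ι * c = ∑ i : ι, c := by simp
    _ ≤ ∑ i : ι, mixedMultiplicity g lam mu k (F i).1 * n := Finset.sum_le_sum fun i _ => hc i
    _ = (∑ M ∈ Finset.univ.image F, mixedMultiplicity g lam mu k M.1) * n := by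
      rw [Finset.sum_image hF.injOn, Finset.sum_mul]
    _ ≤ _ := Nat.mul_le_mul_right _ (Finset.sum_le_sum_of_subset Finset.subset_union_right)

/-- The minimum is at most the value at `s`, and for fixed signs a factorization determines its
cover, so different covers have disjoint sets of factorizations. -/
theorem mixedZigzagNumber_le (s : Fin (numBranch g lam mu) → ℤˣ) :
    mixedZigzagNumber g lam mu k ≤ realMixedHurwitzAt g lam mu k s := by
  classical
  rw [mixedZigzagNumber, finsum_eq_sum _ finite_support_mixedMultiplicity]
  set U := (finite_support_mixedMultiplicity (g := g) (lam := lam) (mu := mu) (k := k)).toFinset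
  calc ∑ M ∈ U, mixedMultiplicity g lam mu k M.1
      ≤ ∑ M ∈ U, mixedMultiplicityAt g lam mu k M.1 s :=
        Finset.sum_le_sum fun M _ => ciInf_le (OrderBot.bddBelow _) s
    _ = ∑ M : U, mixedMultiplicityAt g lam mu k M.1.1 s := (Finset.sum_coe_sort U
        fun M => mixedMultiplicityAt g lam mu k M.1 s).symm
    _ = Nat.card (Σ M : U, {T : RealTuple n (numBranch g lam mu) //
          IsRealMixedFactorization g lam mu k s T ∧ ∃ R, IsColouring (numBranch g lam mu) M.1.1 R ∧
            HasSplitting R s ∧ T.realCover s = R}) := by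
      rw [Nat.card_sigma]
      rfl
    _ ≤ realMixedHurwitzAt g lam mu k s := by
      refine Nat.card_le_card_of_injective (fun x => ⟨x.2.1, x.2.2.1⟩) ?_
      rintro ⟨⟨⟨M, hM⟩, hMU⟩, ⟨T, hT, R, hR, hs, hTR⟩⟩ ⟨⟨⟨M', hM'⟩, hMU'⟩, ⟨T', hT', R', hR', hs', hTR'⟩⟩ h
      have h1 : T = T' := Subtype.mk.inj h
      subst h1
      have h2 : M = M' := hR.forget.symm.trans (Eq.trans (by rw [← hTR, ← hTR']) hR'.forget)
      subst h2
      rfl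

theorem mixedZigzagNumber_le_realMixedHurwitz :
    mixedZigzagNumber g lam mu k ≤ realMixedHurwitz g lam mu k :=
  le_ciInf mixedZigzagNumber_le

end Zigzag


/-! ### The tail decomposition of a partition. -/

section Partitions

theorem count_evenPart (s : Multiset ℕ) (x : ℕ) :
    (evenPart s).count x = if Even x then s.count x else 0 :=
  Multiset.count_filter

theorem count_oddPart (s : Multiset ℕ) (x : ℕ) :
    (oddPart s).count x = if Odd x ∧ Odd (s.count x) then 1 else 0 := by
  rw [oddPart, Multiset.count_eq_of_nodup (Finset.nodup _)]
  refine if_congr ?_ rfl rfl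
  rw [Finset.mem_val, Finset.mem_filter, Multiset.mem_toFinset, and_iff_right_iff_imp]
  intro h
  exact Multiset.count_pos.1 h.2.pos

theorem count_pairPart (s : Multiset ℕ) (x : ℕ) :
    (pairPart s).count x = if Odd x then s.count x / 2 else 0 := by
  rw [pairPart, Multiset.count_sum']
  simp only [Multiset.count_replicate]
  rw [Finset.sum_ite_eq']
  by_cases hx : x ∈ s
  · simp [hx]
  · simp [hx]

theorem eq_evenPart_add (s : Multiset ℕ) :
    s = evenPart s + oddPart s + pairPart s + pairPart s := by
  ext x
  rw [Multiset.count_add, Multiset.count_add, Multiset.count_add, count_evenPart, count_oddPart,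
    count_pairPart]
  by_cases hx : Even x
  · have hx' : ¬ Odd x := Nat.not_odd_iff_even.2 hx
    simp [hx, hx']
  · have hx' : Odd x := Nat.not_even_iff_odd.1 hx
    rcases Nat.even_or_odd (s.count x) with h | h
    · have h' : ¬ Odd (s.count x) := Nat.not_odd_iff_even.2 h
      have := Nat.two_mul_div_two_of_even h
      simp only [hx, hx', h', if_false, if_true, and_false]
      omega
    · have := Nat.two_mul_div_two_add_one_of_odd h
      simp only [hx, hx', h, if_false, if_true, and_self]
      omega

theorem mem_pairPart {s : Multiset ℕ} {x : ℕ} (h : x ∈ pairPart s) : Odd x := by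
  have h1 := Multiset.count_pos.2 h
  rw [count_pairPart] at h1
  by_contra h2
  simp [h2] at h1

theorem mem_oddPart {s : Multiset ℕ} {x : ℕ} (h : x ∈ oddPart s) : Odd x := by
  have h1 := Multiset.count_pos.2 h
  rw [count_oddPart] at h1
  by_contra h2
  simp [h2] at h1

theorem sup_mem {s : Multiset ℕ} (h : s ≠ 0) : s.sup ∈ s := by
  induction s using Multiset.induction_on with
  | empty => exact absurd rfl h
  | cons x s ih =>
    rw [Multiset.sup_cons, Multiset.mem_cons]
    rcases eq_or_ne s 0 with rfl | hs
    · left; simp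
    · rcases le_total x s.sup with h1 | h1
      · right; rw [sup_eq_right.2 h1]; exact ih hs
      · left; exact sup_eq_left.2 h1

end Partitions

/-! ### Lists of tails with prescribed ends. -/

section TailLists

/-- Tails for the even parts in `E` and the pairs of odd parts in `O`. -/
noncomputable def tailList (E O : Multiset ℕ) : List (ℕ × ℕ) :=
  (E.toList.map fun x => (x, 0)) ++ O.toList.map fun x => (2 * x, 1)

theorem tailsOK_tailList {E O : Multiset ℕ} (hE : ∀ x ∈ E, Even x ∧ 0 < x) (hO : ∀ x ∈ O, Odd x) :
    TailsOK (tailList E O) := by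
  intro g hg
  rcases List.mem_append.1 hg with hg | hg
  · obtain ⟨x, hx, rfl⟩ := List.mem_map.1 hg
    have := hE x (Multiset.mem_toList.1 hx)
    exact ⟨this.1, this.2, by simp⟩
  · obtain ⟨x, hx, rfl⟩ := List.mem_map.1 hg
    have := hO x (Multiset.mem_toList.1 hx)
    exact ⟨even_two_mul x, Nat.mul_pos two_pos this.pos, fun _ => by simpa using this⟩

theorem ladderEnds_append (l l' : List (ℕ × ℕ)) :
    ladderEnds (l ++ l') = ladderEnds l + ladderEnds l' := by
  simp [ladderEnds]

theorem ladderEnds_tailList (E O : Multiset ℕ) : ladderEnds (tailList E O) = E + (O + O) := by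
  have h1 : ∀ l : List ℕ, ladderEnds (l.map fun x => (x, 0)) = l := by
    intro l
    induction l with
    | nil => rfl
    | cons x l ih =>
      rw [List.map_cons, ← List.singleton_append, ladderEnds_append, ih]
      rfl
  have h2 : ∀ l : List ℕ, ladderEnds (l.map fun x => (2 * x, 1)) = (l : Multiset ℕ) + l := by
    intro l
    induction l with
    | nil => rfl
    | cons x l ih =>
      have h3 : ladderEnds [(2 * x, 1)] = {x, x} := by simp [ladderEnds]
      rw [List.map_cons, ← List.singleton_append, ladderEnds_append, ih, h3, ← Multiset.cons_coe,
        ← Multiset.singleton_add, Multiset.insert_eq_cons, ← Multiset.singleton_add]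
      abel
  rw [tailList, ladderEnds_append, h1, h2, Multiset.coe_toList, Multiset.coe_toList]

theorem sum_tailList (E O : Multiset ℕ) :
    ((tailList E O).map Prod.fst).sum = E.sum + 2 * O.sum := by
  rw [tailList, List.map_append, List.sum_append, List.map_map, List.map_map]
  have h1 : ((Prod.fst : ℕ × ℕ → ℕ) ∘ fun x : ℕ => (x, 0)) = id := rfl
  have h2 : ((Prod.fst : ℕ × ℕ → ℕ) ∘ fun x : ℕ => (2 * x, 1)) = fun x => 2 * x := rfl
  rw [h1, h2, List.map_id, List.sum_map_mul_left, List.map_id', Multiset.sum_toList,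
    Multiset.sum_toList]

theorem cycles_tailList (E O : Multiset ℕ) :
    ((tailList E O).map fun g => g.2 / 2).sum = 0 := by
  rw [tailList, List.map_append, List.sum_append, List.map_map, List.map_map]
  simp [Function.comp_def]

end TailLists

/-! ### The lower bound for the zigzag number. -/

section LowerBound

/-- The contribution of the covers with given monotone part. -/
theorem factorial_le_mixedZigzagNumber {g d k a b e h m : ℕ} {lam mu : d.Partition}
    {LC : List Node} {X Y E₁ E₂ O₁ O₂ : Multiset ℕ} (hLC : FullStair b k a LC)
    (hX : endsOf false LC = X) (hY : endsOf true LC = Y) (hE₁ : ∀ x ∈ E₁, Even x ∧ 0 < x)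
    (hE₂ : ∀ x ∈ E₂, Even x ∧ 0 < x) (hO₁ : ∀ x ∈ O₁, Odd x) (hO₂ : ∀ x ∈ O₂, Odd x)
    (hlam : lam.parts = a ::ₘ (X + E₁ + O₁ + O₁)) (hmu : mu.parts = e ::ₘ (Y + E₂ + O₂ + O₂))
    (he : e = 2 * h + 1) (hXY : a + X.sum = b + Y.sum) [NeZero (d + 2 * (m + 1 + h))] :
    (m.factorial ^ 4) * (d + 2 * (m + 1 + h) - 2 * k).factorial ≤
      mixedZigzagNumber g (addOnes lam (2 * (m + 1 + h))) (addOnes mu (2 * (m + 1 + h))) k *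
        (d + 2 * (m + 1 + h)) := by
  -- The remaining parts become tails, pairs of odd parts becoming forks. The out-tail `(2, 2 * g +
  -- 1)` carries the genus, with g symmetric cycles and a final fork, and the pair of ones in `pI`
  -- compensates its weight. The h forks in `post` raise the string from weight one to e = 2h + 1,
  -- and h out-forks compensate them. Besides the 2m ones of the zigzag, this uses 2 + 2h ones on
  -- each side.
  set pI := tailList E₁ (1 ::ₘ O₁) with hpI
  set pO := (2, 2 * g + 1) :: tailList E₂ (O₂ + Multiset.replicate h 1) with hpO
  set post := tailList 0 (Multiset.replicate h 1) with hpost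
  have hone : ∀ x ∈ Multiset.replicate h 1, Odd x := fun x hx => by
    rw [Multiset.eq_of_mem_replicate hx]; exact odd_one
  have hI : TailsOK pI := tailsOK_tailList hE₁ fun x hx => by
    rcases Multiset.mem_cons.1 hx with rfl | hx
    · exact odd_one
    · exact hO₁ x hx
  have hO : TailsOK pO := by
    intro g' hg'
    rcases List.mem_cons.1 hg' with rfl | hg'
    · exact ⟨even_two, two_pos, fun _ => by norm_num⟩
    · refine tailsOK_tailList hE₂ (fun x hx => ?_) g' hg'
      rcases Multiset.mem_add.1 hx with hx | hx
      · exact hO₂ x hx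
      · exact hone x hx
  have hP : TailsOK post := tailsOK_tailList (by simp) hone
  have hd1 := congrArg Multiset.sum hlam
  have hd2 := congrArg Multiset.sum hmu
  rw [lam.parts_sum] at hd1
  rw [mu.parts_sum] at hd2
  simp only [Multiset.sum_cons, Multiset.sum_add] at hd1 hd2
  have hw : b + (pI.map Prod.fst).sum = 1 + (pO.map Prod.fst).sum := by
    rw [hpI, hpO, List.map_cons, List.sum_cons, sum_tailList, sum_tailList, Multiset.sum_cons,
      Multiset.sum_add, Multiset.sum_replicate, smul_eq_mul, mul_one]
    omega
  have hpw : 1 + (post.map Prod.fst).sum = e := by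
    rw [hpost, sum_tailList, Multiset.sum_replicate, he]
    simp
    omega
  have hgood := fun q : Fin 4 → Perm (Fin m) => hLC.goodNodes_tailNodes hI hO hP hw q
  have hA : ∀ (p : d.Partition) (j : ℕ), (addOnes p j).parts = p.parts + Multiset.replicate j 1 :=
    fun _ _ => rfl
  have hleft : ∀ q : Fin 4 → Perm (Fin m), a ::ₘ endsOf false (LC ++ tailNodes k b pI pO post q) =
      (addOnes lam (2 * (m + 1 + h))).parts := by
    intro q
    rw [endsOf_append, endsOf_tailNodes_false, hX, hA, hlam, hpI, hpost, ladderEnds_tailList,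
      ladderEnds_tailList, show 2 * (m + 1 + h) = 2 * m + 1 + 1 + h + h by ring,
      Multiset.replicate_add, Multiset.replicate_add, Multiset.replicate_add, Multiset.replicate_add,
      Multiset.replicate_one]
    simp only [← Multiset.singleton_add]
    abel
  have hright : ∀ q : Fin 4 → Perm (Fin m), lastWt a (LC ++ tailNodes k b pI pO post q) ::ₘ
      endsOf true (LC ++ tailNodes k b pI pO post q) = (addOnes mu (2 * (m + 1 + h))).parts := by
    intro q
    have h2 : ladderEnds pO = {1} + {1} + (E₂ + (O₂ + Multiset.replicate h 1 +
        (O₂ + Multiset.replicate h 1))) := by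
      rw [hpO, ← List.singleton_append, ladderEnds_append, ladderEnds_tailList]
      congr 1
      have h3 : ¬ Even (2 * g + 1) := Nat.not_even_iff_odd.2 (odd_two_mul_add_one g)
      simp [ladderEnds, h3]
    rw [hLC.lastWt_tailNodes hw, hpw, endsOf_append, endsOf_tailNodes_true, hY, hA, hmu, h2,
      show 2 * (m + 1 + h) = 2 * m + 1 + 1 + h + h by ring,
      Multiset.replicate_add, Multiset.replicate_add, Multiset.replicate_add, Multiset.replicate_add,
      Multiset.replicate_one]
    simp only [← Multiset.singleton_add]
    abel
  have hgenus : ∀ q : Fin 4 → Perm (Fin m),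
      ((LC ++ tailNodes k b pI pO post q).map fun nd => nd.inner.length / 2).sum = g := by
    intro q
    have h1 : (LC.map fun nd => nd.inner.length / 2).sum = 0 := by
      rw [List.sum_eq_zero_iff]
      intro x hx
      obtain ⟨nd, hnd, rfl⟩ := List.mem_map.1 hx
      rw [hLC.stairLike.inner_eq_nil hnd]
      rfl
    rw [List.map_append, List.sum_append, h1, cycles_tailNodes, hpI, hpO, hpost, List.map_cons,
      List.sum_cons, cycles_tailList, cycles_tailList, cycles_tailList]
    dsimp only
    omega
  have hr : ∀ q : Fin 4 → Perm (Fin m), numBranch g (addOnes lam (2 * (m + 1 + h)))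
      (addOnes mu (2 * (m + 1 + h))) = totalSize k pI pO post m := by
    intro q
    have h1 := congrArg Multiset.card (hgood q).verts
    rw [Multiset.coe_card, length_nodeVerts, hgenus, Finset.card_val, Nat.card_Icc] at h1
    rw [numBranch, ← hleft q, ← hright q, Multiset.card_cons, Multiset.card_cons]
    omega
  have hcover := fun q => (hgood q).isCoverOfType (hr q) (hleft q) (hright q) (hgenus q)
  have hinj := hLC.cover_injective (m := m) hI hO hP hw
  have hcard : Fintype.card (Fin 4 → Perm (Fin m)) = m.factorial ^ 4 := by
    rw [Fintype.card_fun, Fintype.card_fin, Fintype.card_perm, Fintype.card_fin]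
  rw [← hcard]
  refine le_mixedZigzagNumber _ hinj hcover (fun q => ?_) fun q => ?_
  · rw [hr q]
    refine (hgood q).isMixedZigzag hLC ?_ fun x hx => ?_
    · intro h0
      have h1 := congrArg Multiset.card (verts_tailNodes k b pI pO post q)
      rw [h0, Finset.card_val, Nat.card_Ioc, totalSize, hpO] at h1
      simp [nodeVerts, ladderSize] at h1
      omega
    · have h1 := Multiset.mem_coe.2 hx
      rw [verts_tailNodes, Finset.mem_val, Finset.mem_Ioc] at h1
      exact h1.1
  · refine (hgood q).factorial_le_mixedMultiplicity (hr q) (hcover q) ?_ fun v h1 h2 =>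
      hLC.active h1 h2
    unfold totalSize
    omega

/-- The even parts of λ and μ split into those used by the staircase and the rest; the shift `c`
accounts for the ones that are spent on the genus and on the last string edge. -/
theorem exists_factorial_le {g d d' k : ℕ} {lam mu : d.Partition} {lam' mu' : d'.Partition}
    (hlam : (oddPart lam.parts).card = 1) (hmu : (oddPart mu.parts).card = 1)
    (hlam'_odd : oddPart lam'.parts = oddPart lam.parts)
    (hlam'_sub : lam'.parts - oddPart lam'.parts ≤ evenPart lam.parts)
    (hmu'_sub : mu'.parts - oddPart mu'.parts ≤ evenPart mu.parts)
    (hlam'_pair : pairPart lam'.parts = 0) (hmu'_pair : pairPart mu'.parts = 0)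
    (hmu'_card : (oddPart mu'.parts).card = 1)
    (hk : lam'.parts.card + mu'.parts.card = k + 2)
    (hmu'_two : ∀ a b : ℕ, {a, b} ≤ evenPart mu'.parts →
      max (oddPart lam.parts).sup (evenPart lam'.parts).sup < a + b)
    (hmax : (oddPart mu'.parts).sup < (evenPart lam'.parts).sup) :
    ∃ c, ∀ m, (m.factorial ^ 4) * (d + 2 * (m + c) - 2 * k).factorial ≤
      mixedZigzagNumber g (addOnes lam (2 * (m + c))) (addOnes mu (2 * (m + c))) k *
        (d + 2 * (m + c)) := by
  obtain ⟨a, ha⟩ := Multiset.card_eq_one.1 hlam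
  obtain ⟨e, he⟩ := Multiset.card_eq_one.1 hmu
  obtain ⟨b, hb⟩ := Multiset.card_eq_one.1 hmu'_card
  have hao : Odd a := mem_oddPart (s := lam.parts) (by rw [ha]; simp)
  have heo : Odd e := mem_oddPart (s := mu.parts) (by rw [he]; simp)
  have hbo : Odd b := mem_oddPart (s := mu'.parts) (by rw [hb]; simp)
  have dlam := eq_evenPart_add lam.parts
  have dmu := eq_evenPart_add mu.parts
  have dlam' := eq_evenPart_add lam'.parts
  have dmu' := eq_evenPart_add mu'.parts
  rw [ha] at dlam hlam'_odd hmu'_two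
  rw [he] at dmu
  rw [hlam'_odd, hlam'_pair, add_zero, add_zero] at dlam'
  rw [hb, hmu'_pair, add_zero, add_zero] at dmu'
  rw [hb] at hmax hmu'_sub
  rw [hlam'_odd, dlam', add_tsub_cancel_right] at hlam'_sub
  rw [dmu', add_tsub_cancel_right] at hmu'_sub
  have hpos : ∀ {n : ℕ} (p : n.Partition), ∀ x ∈ evenPart p.parts, Even x ∧ 0 < x :=
    fun p x hx => ⟨(Multiset.mem_filter.1 hx).2, p.parts_pos (Multiset.mem_filter.1 hx).1⟩
  have hposL := hpos lam
  have hposM := hpos mu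
  have hposL' := hpos lam'
  have hposM' := hpos mu'
  have cL := congrArg Multiset.card dlam'
  have cM := congrArg Multiset.card dmu'
  have sL := congrArg Multiset.sum dlam'
  have sM := congrArg Multiset.sum dmu'
  rw [lam'.parts_sum] at sL
  rw [mu'.parts_sum] at sM
  generalize evenPart lam'.parts = EL' at *
  generalize evenPart mu'.parts = EM' at *
  generalize evenPart lam.parts = EL at *
  generalize evenPart mu.parts = EM at *
  obtain ⟨E₁, rfl⟩ := Multiset.le_iff_exists_add.1 hlam'_sub
  obtain ⟨E₂, rfl⟩ := Multiset.le_iff_exists_add.1 hmu'_sub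
  -- The supremum of the empty multiset is 0, which is not larger than the odd part of μ'.
  have hne : EL' ≠ 0 := by
    rintro rfl
    simp at hmax
  have hmem := sup_mem hne
  have hlemax : ∀ x ∈ EL', x ≤ EL'.sup := fun x hx => Multiset.le_sup hx
  generalize EL'.sup = X₀ at *
  obtain ⟨X, rfl⟩ := Multiset.exists_cons_of_mem hmem
  rw [Multiset.sup_singleton] at hmax hmu'_two
  rw [Multiset.card_add, Multiset.card_singleton] at cL cM
  rw [Multiset.sum_add, Multiset.sum_singleton] at sL sM
  rw [Multiset.sum_cons] at sL
  rw [Multiset.card_cons] at cL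
  -- The bound `max a X₀` dominates both the first string weight and all in-weights; the hypothesis
  -- on pairs of parts of μ' is stated for exactly this number.
  obtain ⟨LC, hLC, hX, hY⟩ := exists_fullStair (M := max a X₀) (X := X) (Y := EM') hao hbo
    (le_max_left _ _) hmax (le_max_right _ _)
    (fun x hx => ⟨(hposL' x (by simp [hx])).1, (hposL' x (by simp [hx])).2,
      (hlemax x (by simp [hx])).trans (le_max_right _ _)⟩) hposM' hmu'_two (by omega)
  rw [show X.card + 1 + EM'.card = k by omega] at hLC
  obtain ⟨h, hh⟩ := heo
  refine ⟨1 + h, fun m => ?_⟩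
  rw [← add_assoc]
  have : NeZero (d + 2 * (m + 1 + h)) := ⟨by omega⟩
  refine factorial_le_mixedZigzagNumber (E₁ := E₁) (E₂ := E₂) (O₁ := pairPart lam.parts)
    (O₂ := pairPart mu.parts) (e := e) hLC hX hY (fun x hx => hposL x (by simp [hx]))
    (fun x hx => hposM x (by simp [hx])) (fun x hx => mem_pairPart hx) (fun x hx => mem_pairPart hx)
    ?_ ?_ hh (by rw [Multiset.sum_cons]; omega)
  · conv_lhs => rw [dlam]
    rw [← Multiset.singleton_add a]
    abel
  · conv_lhs => rw [dmu]
    rw [← Multiset.singleton_add e]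
    abel

end LowerBound


/-! ### Growth rates on the scale m log m. -/

section Asymptotics

open Filter Topology

/-- `u m` grows like `κ m log m`. -/
def HasRate (u : ℕ → ℝ) (κ : ℝ) : Prop :=
  Tendsto (fun m : ℕ => u m / (m * Real.log m)) atTop (𝓝 κ)

/-- `N m` differs from `p m` by a bounded amount. -/
def NearLinear (N : ℕ → ℕ) (p : ℕ) : Prop :=
  0 < p ∧ ∃ c, ∀ᶠ m in atTop, p * m ≤ N m + c ∧ N m ≤ p * m + c

variable {u v w : ℕ → ℝ} {κ κ' : ℝ} {N : ℕ → ℕ} {p : ℕ}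

theorem HasRate.add (hu : HasRate u κ) (hv : HasRate v κ') :
    HasRate (fun m => u m + v m) (κ + κ') :=
  (Tendsto.add hu hv).congr fun _ => (add_div _ _ _).symm

theorem HasRate.sub (hu : HasRate u κ) (hv : HasRate v κ') :
    HasRate (fun m => u m - v m) (κ - κ') :=
  (Tendsto.sub hu hv).congr fun _ => (sub_div _ _ _).symm

theorem HasRate.const_mul (c : ℝ) (hu : HasRate u κ) : HasRate (fun m => c * u m) (c * κ) :=
  (Tendsto.const_mul c hu).congr fun _ => (mul_div_assoc _ _ _).symm

theorem tendsto_log_natCast : Tendsto (fun m : ℕ => Real.log m) atTop atTop :=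
  Real.tendsto_log_atTop.comp tendsto_natCast_atTop_atTop

theorem eventually_mul_log_pos : ∀ᶠ m : ℕ in atTop, 0 < (m : ℝ) * Real.log m := by
  filter_upwards [tendsto_log_natCast.eventually_gt_atTop 0, eventually_gt_atTop 0] with m h1 h2
  positivity

theorem HasRate.squeeze (hu : HasRate u κ) (hw : HasRate w κ) (h1 : ∀ᶠ m in atTop, u m ≤ v m)
    (h2 : ∀ᶠ m in atTop, v m ≤ w m) : HasRate v κ := by
  refine tendsto_of_tendsto_of_tendsto_of_le_of_le' hu hw ?_ ?_
  · filter_upwards [h1, eventually_mul_log_pos] with m h h'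
    gcongr
  · filter_upwards [h2, eventually_mul_log_pos] with m h h'
    gcongr

theorem HasRate.isEquivalent (hu : HasRate u κ) (hv : HasRate v κ) (hκ : κ ≠ 0) :
    Asymptotics.IsEquivalent atTop u v := by
  refine Asymptotics.isEquivalent_of_tendsto_one ?_
  have h := Tendsto.div hu hv hκ
  rw [div_self hκ] at h
  refine h.congr' ?_
  filter_upwards [eventually_mul_log_pos] with m hm
  exact div_div_div_cancel_right₀ hm.ne' _ _

theorem hasRate_mul_log (c : ℝ) : HasRate (fun m => c * m * Real.log m) c := by
  refine tendsto_const_nhds.congr' ?_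
  filter_upwards [eventually_mul_log_pos] with m hm
  rw [mul_assoc, mul_div_cancel_right₀ _ hm.ne']

theorem NearLinear.tendsto_div (hN : NearLinear N p) :
    Tendsto (fun m : ℕ => (N m : ℝ) / m) atTop (𝓝 p) := by
  obtain ⟨-, c, hc⟩ := hN
  have h0 : Tendsto (fun m : ℕ => (c : ℝ) / m) atTop (𝓝 0) := tendsto_const_div_atTop_nhds_zero_nat _
  have h1 := (tendsto_const_nhds (x := (p : ℝ))).sub h0
  have h2 := (tendsto_const_nhds (x := (p : ℝ))).add h0
  rw [sub_zero] at h1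
  rw [add_zero] at h2
  refine tendsto_of_tendsto_of_tendsto_of_le_of_le' h1 h2 ?_ ?_
  · filter_upwards [hc, eventually_gt_atTop 0] with m hm h
    have h' : (0 : ℝ) < m := by exact_mod_cast h
    have h3 : (p * m : ℝ) ≤ N m + c := by exact_mod_cast hm.1
    rw [sub_le_iff_le_add, ← add_div, le_div_iff₀ h']
    exact h3
  · filter_upwards [hc, eventually_gt_atTop 0] with m hm h
    have h' : (0 : ℝ) < m := by exact_mod_cast h
    have h3 : (N m : ℝ) ≤ p * m + c := by exact_mod_cast hm.2
    rw [div_le_iff₀ h', add_mul, div_mul_cancel₀ _ h'.ne']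
    exact h3

theorem NearLinear.eventually_pos (hN : NearLinear N p) : ∀ᶠ m in atTop, 0 < N m := by
  obtain ⟨hp, c, hc⟩ := hN
  filter_upwards [hc, eventually_gt_atTop c] with m hm h
  have := Nat.le_mul_of_pos_left m hp
  omega

theorem NearLinear.tendsto_log_div (hN : NearLinear N p) :
    Tendsto (fun m : ℕ => Real.log (N m) / Real.log m) atTop (𝓝 1) := by
  have hp : (p : ℝ) ≠ 0 := by exact_mod_cast hN.1.ne'
  have h1 := ((hN.tendsto_div.log hp).div_atTop tendsto_log_natCast).add_const 1
  rw [zero_add] at h1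
  refine h1.congr' ?_
  filter_upwards [hN.eventually_pos, tendsto_log_natCast.eventually_gt_atTop 0,
    eventually_gt_atTop 0] with m h2 h3 h4
  rw [Real.log_div (by positivity) (by positivity), sub_div, div_self h3.ne', sub_add_cancel]

/-- The quotient is the product of N/m, which tends to p, and log N / log m, which tends to one. -/
theorem NearLinear.hasRate_mul_log (hN : NearLinear N p) :
    HasRate (fun m => N m * Real.log (N m)) p := by
  have h := hN.tendsto_div.mul hN.tendsto_log_div
  rw [mul_one] at h
  exact h.congr fun m => div_mul_div_comm _ _ _ _

theorem NearLinear.hasRate_self (hN : NearLinear N p) : HasRate (fun m => (N m : ℝ)) 0 := by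
  exact (hN.tendsto_div.div_atTop tendsto_log_natCast).congr fun m => div_div _ _ _

theorem NearLinear.hasRate_log (hN : NearLinear N p) : HasRate (fun m => Real.log (N m)) 0 := by
  refine (hN.tendsto_log_div.div_atTop tendsto_natCast_atTop_atTop).congr fun m => ?_
  rw [div_div, mul_comm]

theorem mul_log_sub_le_log_factorial (n : ℕ) :
    n * Real.log n - n ≤ Real.log (n.factorial : ℝ) := by
  rcases Nat.eq_zero_or_pos n with rfl | hn
  · simp
  have h := Real.pow_div_factorial_le_exp (n : ℝ) (Nat.cast_nonneg n) n
  have h1 := Real.log_le_log (by positivity) h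
  rw [Real.log_exp, Real.log_div (by positivity) (by positivity), Real.log_pow] at h1
  linarith

theorem log_factorial_le (n : ℕ) : Real.log (n.factorial : ℝ) ≤ n * Real.log n := by
  rw [← Real.log_pow]
  exact Real.log_le_log (by positivity) (by exact_mod_cast Nat.factorial_le_pow n)

/-- The crude bounds n log n - n ≤ log n! ≤ n log n suffice, since a linear term has rate zero. -/
theorem NearLinear.hasRate_log_factorial (hN : NearLinear N p) :
    HasRate (fun m => Real.log ((N m).factorial : ℝ)) p := by
  have h := hN.hasRate_mul_log.sub hN.hasRate_self
  rw [sub_zero] at h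
  exact h.squeeze hN.hasRate_mul_log (.of_forall fun m => mul_log_sub_le_log_factorial _)
    (.of_forall fun m => log_factorial_le _)

/-- The upper bound for the complex double Hurwitz numbers has the rate `6`. -/
theorem hasRate_upper {R n t : ℕ → ℕ} (hR : NearLinear R 4) (hn : NearLinear n 2)
    (ht : NearLinear t 2) (G : ℕ) :
    HasRate (fun m => Real.log (2 ^ R m * (n m : ℝ) ^ (2 * n m) *
      (34 ^ R m * (t m).factorial * (n m : ℝ) ^ (2 * G)) * n m)) 6 := by
  -- The rates are 2 · 2 from the power n^(2n) and 2 from the factorial; exponentials and fixed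
  -- powers of n contribute zero.
  have h := ((((hR.hasRate_self.const_mul (Real.log 2)).add (hn.hasRate_mul_log.const_mul 2)).add
    (((hR.hasRate_self.const_mul (Real.log 34)).add ht.hasRate_log_factorial).add
      (hn.hasRate_log.const_mul (2 * G)))).add hn.hasRate_log)
  norm_num at h
  refine Tendsto.congr' ?_ h
  filter_upwards [hn.eventually_pos] with m hm
  congr 1
  rw [Real.log_mul (by positivity) (by positivity), Real.log_mul (by positivity) (by positivity),
    Real.log_mul (by positivity) (by positivity), Real.log_mul (by positivity) (by positivity),
    Real.log_mul (by positivity) (by positivity), Real.log_pow, Real.log_pow, Real.log_pow,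
    Real.log_pow]
  push_cast
  ring

/-- The lower bound for the zigzag numbers has the rate `6`. -/
theorem hasRate_lower {q t n : ℕ → ℕ} (hq : NearLinear q 1) (ht : NearLinear t 2)
    (hn : NearLinear n 2) :
    HasRate (fun m => Real.log (((q m).factorial ^ 4 * (t m).factorial : ℕ) : ℝ) -
      2 * Real.log (n m)) 6 := by
  have h := ((hq.hasRate_log_factorial.const_mul 4).add ht.hasRate_log_factorial).sub
    (hn.hasRate_log.const_mul 2)
  norm_num at h
  refine h.congr fun m => ?_
  congr 2
  push_cast
  rw [Real.log_mul (by positivity) (by positivity), Real.log_pow]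
  norm_num

theorem nearLinear_of_le {c : ℕ} (hp : 0 < p)
    (h : ∀ m, c ≤ m → p * m ≤ N m + c ∧ N m ≤ p * m + c) : NearLinear N p :=
  ⟨hp, c, (eventually_ge_atTop c).mono fun m hm => h m hm⟩

theorem card_parts_pos {n : ℕ} {lam : n.Partition} (h : (oddPart lam.parts).card = 1) :
    0 < lam.parts.card ∧ 0 < n := by
  have h1 : lam.parts ≠ 0 := by
    intro h0
    rw [h0] at h
    simp [oddPart] at h
  refine ⟨Multiset.card_pos.2 h1, ?_⟩
  obtain ⟨x, hx⟩ := Multiset.exists_mem_of_ne_zero h1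
  have h2 := Multiset.single_le_sum (fun _ _ => Nat.zero_le _) x hx
  rw [lam.parts_sum] at h2
  exact (lam.parts_pos hx).trans_le h2

/-- With ρ = 2d + r swaps in degree d + 2m, the value `lam.parts.card + mu.parts.card + 2 * g` of
`G` makes ρ + 2 = 2n + G. Nonempty partitions keep the truncated subtractions exact. The factor n on
both sides leaves room for the real structures. -/
theorem complexHurwitz_mul_le (g : ℕ) {d : ℕ} {lam mu : d.Partition} (hd : 0 < d)
    (hl : 0 < lam.parts.card) (hm : 0 < mu.parts.card) (m : ℕ) :
    (complexHurwitz g (addOnes lam (2 * m)) (addOnes mu (2 * m)) * (d + 2 * m : ℕ) : ℝ) ≤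
      2 ^ (4 * m + (2 * d + (lam.parts.card + mu.parts.card + 2 * g - 2))) *
        ((d + 2 * m : ℕ) : ℝ) ^ (2 * (d + 2 * m)) *
        (34 ^ (4 * m + (2 * d + (lam.parts.card + mu.parts.card + 2 * g - 2))) *
          (2 * m + (d + (lam.parts.card + mu.parts.card + 2 * g - 1))).factorial *
          ((d + 2 * m : ℕ) : ℝ) ^ (2 * (lam.parts.card + mu.parts.card + 2 * g))) *
        (d + 2 * m : ℕ) := by
  classical
  have : NeZero (d + 2 * m) := ⟨by omega⟩
  have : Nonempty (Fin (d + 2 * m)) := ⟨0⟩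
  refine mul_le_mul_of_nonneg_right ?_ (Nat.cast_nonneg _)
  have h1 := complexHurwitz_le g lam mu (j := 2 * m)
  have hc : ∀ p : d.Partition, (addOnes p (2 * m)).parts.card = p.parts.card + 2 * m := fun p => by
    rw [show (addOnes p (2 * m)).parts = p.parts + Multiset.replicate (2 * m) 1 from rfl]
    simp
  have hR : d + numBranch g (addOnes lam (2 * m)) (addOnes mu (2 * m)) + d =
      4 * m + (2 * d + (lam.parts.card + mu.parts.card + 2 * g - 2)) := by
    rw [numBranch, hc, hc]
    omega
  rw [hR, Nat.card_eq_fintype_card, Fintype.card_subtype] at h1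
  have h2 := card_seq_le (α := Fin (d + 2 * m))
    (ρ := 4 * m + (2 * d + (lam.parts.card + mu.parts.card + 2 * g - 2)))
    (G := lam.parts.card + mu.parts.card + 2 * g) (by rw [Fintype.card_fin]; omega)
  rw [Fintype.card_fin, show 4 * m + (2 * d + (lam.parts.card + mu.parts.card + 2 * g - 2)) + 1 -
    (d + 2 * m) = 2 * m + (d + (lam.parts.card + mu.parts.card + 2 * g - 1)) by omega] at h2
  refine le_trans ?_ h2
  exact_mod_cast h1

theorem realMixedHurwitz_le {g n : ℕ} {lam mu : n.Partition} {k : ℕ}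
    (s : Fin (numBranch g lam mu) → ℤˣ) :
    realMixedHurwitz g lam mu k ≤ realMixedHurwitzAt g lam mu k s :=
  ciInf_le (OrderBot.bddBelow _) s

end Asymptotics

end MixedHurwitz

open MixedHurwitz in
theorem mainTheorem6 (g d d' k : ℕ) (lam mu : d.Partition) (lam' mu' : d'.Partition)
    (hlam : (oddPart lam.parts).card = 1) (hmu : (oddPart mu.parts).card = 1)
    (hd : d' ≤ d)
    (hlam'_odd : oddPart lam'.parts = oddPart lam.parts)
    (hlam'_sub : lam'.parts - oddPart lam'.parts ≤ evenPart lam.parts)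
    (hmu'_sub : mu'.parts - oddPart mu'.parts ≤ evenPart mu.parts)
    (hlam'_pair : pairPart lam'.parts = 0) (hmu'_pair : pairPart mu'.parts = 0)
    (hlam'_card : (oddPart lam'.parts).card = 1) (hmu'_card : (oddPart mu'.parts).card = 1)
    (hk : lam'.parts.card + mu'.parts.card = k + 2)
    (hmu'_two : ∀ a b : ℕ, {a, b} ≤ evenPart mu'.parts →
      max (oddPart lam.parts).sup (evenPart lam'.parts).sup < a + b)
    (hmax : (oddPart mu'.parts).sup < (evenPart lam'.parts).sup) :
    Asymptotics.IsEquivalent Filter.atTop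
        (fun m : ℕ => Real.log
          (mixedZigzagNumber g (addOnes lam (2 * m)) (addOnes mu (2 * m)) k))
        (fun m : ℕ => 6 * (m : ℝ) * Real.log m) ∧
      Asymptotics.IsEquivalent Filter.atTop
        (fun m : ℕ => 6 * (m : ℝ) * Real.log m)
        (fun m : ℕ => Real.log
          (complexHurwitz g (addOnes lam (2 * m)) (addOnes mu (2 * m)))) ∧
      Asymptotics.IsEquivalent Filter.atTop
        (fun m : ℕ => Real.log
          (realMixedHurwitz g (addOnes lam (2 * m)) (addOnes mu (2 * m)) k))
        (fun m : ℕ => Real.log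
          (complexHurwitz g (addOnes lam (2 * m)) (addOnes mu (2 * m)))) ∧
      ∀ s : (m : ℕ) →
          Fin (numBranch g (addOnes lam (2 * m)) (addOnes mu (2 * m))) → ℤˣ,
        Asymptotics.IsEquivalent Filter.atTop
          (fun m : ℕ => Real.log
            (realMixedHurwitzAt g (addOnes lam (2 * m)) (addOnes mu (2 * m)) k (s m)))
          (fun m : ℕ => Real.log
            (complexHurwitz g (addOnes lam (2 * m)) (addOnes mu (2 * m)))) := by
  obtain ⟨c, hc⟩ := exists_factorial_le (g := g) hlam hmu hlam'_odd hlam'_sub hmu'_sub hlam'_pair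
    hmu'_pair hmu'_card hk hmu'_two hmax
  obtain ⟨hl, hd0⟩ := card_parts_pos hlam
  obtain ⟨hm, -⟩ := card_parts_pos hmu
  have hU := complexHurwitz_mul_le g hd0 hl hm
  set H := fun m : ℕ => complexHurwitz g (addOnes lam (2 * m)) (addOnes mu (2 * m)) with hH
  set Z := fun m : ℕ => mixedZigzagNumber g (addOnes lam (2 * m)) (addOnes mu (2 * m)) k with hZ
  set n := fun m : ℕ => d + 2 * m with hn
  have hn0 : ∀ m, 0 < n m := fun m => by simp only [hn]; omega
  have hnl : NearLinear n 2 := nearLinear_of_le (c := d) two_pos fun m _ => by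
    simp only [hn]; omega
  -- One squeeze serves all four sequences: the zigzag numbers, the complex numbers, the minima and
  -- the real numbers for given signs.
  have hrate : ∀ u : ℕ → ℕ, (∀ m, Z m ≤ u m * n m) → (∀ m, u m ≤ H m * n m) →
      HasRate (fun m => Real.log (u m)) 6 := by
    intro u h1 h2
    -- The lower bound is used at m - c, as 2c ones are not available for the zigzag. One of the two
    -- factors n comes from the multiplicities, the other from the comparison of `Z` with `u`.
    have hlo : HasRate _ 6 := hasRate_lower (q := fun m => m - c) (t := fun m => d + 2 * m - 2 * k)
      (n := n) (nearLinear_of_le (c := c) one_pos fun m _ => by omega)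
      (nearLinear_of_le (c := d + 2 * k) two_pos fun m _ => by omega) hnl
    have hup := hasRate_upper (R := fun m => 4 * m +
        (2 * d + (lam.parts.card + mu.parts.card + 2 * g - 2))) (n := n)
      (t := fun m => 2 * m + (d + (lam.parts.card + mu.parts.card + 2 * g - 1)))
      (nearLinear_of_le (c := 2 * d + (lam.parts.card + mu.parts.card + 2 * g - 2)) four_pos
        fun m _ => by omega) hnl
      (nearLinear_of_le (c := d + (lam.parts.card + mu.parts.card + 2 * g - 1)) two_pos
        fun m _ => by omega) (lam.parts.card + mu.parts.card + 2 * g)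
    have hkey : ∀ m, c ≤ m → (m - c).factorial ^ 4 * (d + 2 * m - 2 * k).factorial ≤
        u m * n m ^ 2 := by
      intro m hm
      have h3 := hc (m - c)
      rw [Nat.sub_add_cancel hm] at h3
      refine h3.trans ((Nat.mul_le_mul_right _ (h1 m)).trans (le_of_eq ?_))
      simp only [hn]
      ring
    have hpos : ∀ m, c ≤ m → 0 < u m := by
      intro m hm
      have h3 : 0 < (m - c).factorial ^ 4 * (d + 2 * m - 2 * k).factorial := by positivity
      exact Nat.pos_of_mul_pos_right (h3.trans_le (hkey m hm))
    refine hlo.squeeze hup ?_ ?_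
    · filter_upwards [Filter.eventually_ge_atTop c] with m hm
      have h3 := hpos m hm
      have h4 := hn0 m
      have h5 : ((((m - c).factorial ^ 4 * (d + 2 * m - 2 * k).factorial : ℕ)) : ℝ) ≤
        u m * (n m : ℝ) ^ 2 := by exact_mod_cast hkey m hm
      have h6 := Real.log_le_log (by positivity) h5
      rw [Real.log_mul (by positivity) (by positivity), Real.log_pow] at h6
      push_cast at h6 ⊢
      linarith
    · filter_upwards [Filter.eventually_ge_atTop c] with m hm
      have h3 := hpos m hm
      refine Real.log_le_log (by positivity) (le_trans ?_ (hU m))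
      exact_mod_cast h2 m
  have hself : ∀ (m x : ℕ), x ≤ x * n m := fun m x => Nat.le_mul_of_pos_right x (hn0 m)
  have hAt : ∀ m (s : Fin (numBranch g (addOnes lam (2 * m)) (addOnes mu (2 * m))) → ℤˣ),
      realMixedHurwitzAt g (addOnes lam (2 * m)) (addOnes mu (2 * m)) k s ≤ H m * n m := fun m s =>
    have : NeZero (d + 2 * m) := ⟨(hn0 m).ne'⟩
    realMixedHurwitzAt_le g _ _ k s
  have hZH : ∀ m, Z m ≤ H m * n m := fun m => (mixedZigzagNumber_le fun _ => 1).trans (hAt m _)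
  have rZ := hrate Z (fun m => hself m _) hZH
  have rH := hrate H hZH fun m => hself m _
  have rmin := hrate (fun m => realMixedHurwitz g (addOnes lam (2 * m)) (addOnes mu (2 * m)) k)
    (fun m => mixedZigzagNumber_le_realMixedHurwitz.trans (hself m _))
    fun m => (realMixedHurwitz_le fun _ => 1).trans (hAt m _)
  have six : (6 : ℝ) ≠ 0 := by norm_num
  exact ⟨rZ.isEquivalent (hasRate_mul_log 6) six, (hasRate_mul_log 6).isEquivalent rH six,
    rmin.isEquivalent rH six, fun s => (hrate (fun m => realMixedHurwitzAt g (addOnes lam (2 * m))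
      (addOnes mu (2 * m)) k (s m)) (fun m => (mixedZigzagNumber_le _).trans (hself m _))
      fun m => hAt m _).isEquivalent rH six⟩
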